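/- \textbf{Setting.} For every security parameter $n$ let $G=G_n=\langle g\rangle$ be a group of prime order $q=q_n$, with elements encoded injectively by bit strings of polynomial length, and with multiplication and the membership test computable in polynomial time from the public parameters. $Z_q^*=\{1,\dots,q-1\}$. The functions $h$ (with $n$-bit values, read as integers) and $H_K$ (with values in $\{0,1\}^{k(n)}$, $k$ polynomially bounded) are independent random oracles. Algorithms are uniform probabilistic algorithms with a polynomial time limit. The \emph{CDH assumption} says that every such algorithm, given the public parameters and $g^x,g^y$ with $x,y$ uniform in $\{0,\dots,q-1\}$, outputs $g^{xy}$ with negligible probability only. \textbf{Protocols.} A player $\hat A$ has a secret key $a\in_R Z_q^*$ and the public key $A=g^a$. The initiator $\hat A$ sends $X=g^x$, $x\in_R Z_q^*$; the responder $\hat B$ sends $Y=g^y$, $y\in_R Z_q^*$; each checks that the received element lies in $G\setminus\{1\}$. The session key is $$H_K\bigl(B^{dx}Y^{ca+ex}\bigr)=H_K\bigl(A^{cy}X^{db+ey}\bigr),$$ computed by $\hat A$ by the left and by $\hat B$ by the right expression. In the public-key-free variants, $c=h(\hat A,Y)$, $d=h(\hat B,X)$, $e=h(X,Y)$ for OAKE,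 and $c=d=1$, $e=h(\hat A,\hat B,X,Y)$ for sOAKE. \textbf{Experiment (Canetti--Krawczyk framework, pre-specified peers).} The adversary has access to $h$ and $H_K$, has honest players set up, registers further players with arbitrary public keys in $G\setminus\{1\}$, and controls all communication. It can let an honest player precompute a DH-component offline (which it learns at once), and activate the player with it, as initiator or as responder, towards any registered peer, possibly the player itself. It can make state-reveal queries against incomplete sessions, and against precomputed values before the session that uses them; these return the owner's DH-component, DH-exponent, and DH-secret $(X,x,B^{dx})$, or $(Y,y,A^{cy})$ for a responder. It can make session-key queries against complete sessions and corrupt honest players. A complete session of owner $\hat A$ with peer $\hat B$, own DH-component $X$ and received DH-component $Y$ has the identifier $(\hat A,\hat B,X,Y)$; sessions $(\hat A,\hat B,X,Y)$ and $(\hat B,\hat A,Y,X)$ match. A session is \emph{unexposed} if, during the whole run, neither it nor a session matching it was subject to a state-reveal query (before or after activation) or to a session-key query, and no player of it was corrupted. Once, the adversary may choose a complete test session of the form $(\hat A,\hat A,X,X)$, i.e. with identical peer and identical DH-component; according to a random bit $\beta$ it then gets either its session key or an independent random key, continues, and finally outputs a guess of $\beta$. If there is no test session, or it is not unexposed at the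 end, the outcome is decided by a fair coin. \textbf{Statement.} Under the CDH assumption, in the random oracle model, the public-key-free variants of OAKE and of sOAKE, with offline precomputed and exposable DH-components, DH-exponents and DH-secrets of one's DH-component and the peer's public key, are SK-secure with respect to test sessions with identical peer and identical DH-component ($\hat A=\hat B$, $X=Y$): for every probabilistic polynomial-time adversary, (1) the probability that some complete session $(\hat A,\hat A,X,X)$ and a session matching it have different session keys is negligible; (2) the adversary guesses $\beta$ with probability $1/2$ up to a negligible function. -/

import Mathlib

noncomputable section

namespace OAKE

/-! ### Data, programs, and running time -/

/-- The values programs work on: finite binary trees with natural numbers at the leaves. -/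
inductive Data : Type
  | num (m : ℕ) : Data
  | cons (a b : Data) : Data
  deriving DecidableEq

namespace Data

/-- Bit size of a value. -/
def size : Data → ℕ
  | num m => Nat.size m + 1
  | cons a b => size a + size b + 1

/-- Tuples as right-nested trees. -/
def tuple : List Data → Data
  | [] => num 0
  | a :: l => cons a (tuple l)

/-- Truth values: `0` is false, `1` is true. -/
def ofBool (b : Bool) : Data := num (if b then 1 else 0)

end Data

open Data

/-- Elementary operations. Binary ones take a tree `cons a b`; an operation applied to a value of
the wrong shape returns `num 0`. Each is computable in time polynomial in the size of its argument,
and (up to an additive constant) its value is no larger than its argument. -/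
inductive Prim : Type
  | fst | snd | isCons | eq | size | add | sub | mul | div | mod

/-- Semantics of the elementary operations. -/
def Prim.apply : Prim → Data → Data
  | .fst, cons a _ => a
  | .snd, cons _ b => b
  | .isCons, cons _ _ => num 1
  | .eq, cons a b => ofBool (decide (a = b))
  | .size, a => num a.size
  | .add, cons (num a) (num b) => num (a + b)
  | .sub, cons (num a) (num b) => num (a - b)
  | .mul, cons (num a) (num b) => num (a * b)
  | .div, cons (num a) (num b) => num (a / b)
  | .mod, cons (num a) (num b) => num (a % b)
  | _, _ => num 0

/-- Probabilistic, interactive programs (finite syntax trees, hence uniform algorithms). A program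
maps a value to a value:
`comp g f` is composition, `pair f g` evaluates both and pairs the results,
`cond t f g` runs `f` if `t` gives a value other than `num 0`, and `g` otherwise,
`loop t f` iterates `f` as long as `t` gives a value other than `num 0`,
`rnd` maps `num m` to a uniformly random number in `{0, …, m}`,
`query` sends its argument to the environment and returns the reply. -/
inductive Code : Type
  | id : Code
  | const (d : Data) : Code
  | prim (p : Prim) : Code
  | comp (g f : Code) : Code
  | pair (f g : Code) : Code
  | cond (t f g : Code) : Code
  | loop (t f : Code) : Code
  | rnd : Code
  | query : Code

/-- The behaviour of a time-limited program, as a tree of its random choices and of its queries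
to the environment; `timeout` means that the time limit was exceeded. -/
inductive Comp (α : Type) : Type
  | ret (a : α) : Comp α
  | timeout : Comp α
  | rnd (m : ℕ) (k : ℕ → Comp α) : Comp α
  | query (d : Data) (k : Data → Comp α) : Comp α

namespace Comp

/-- Sequencing. -/
def bind {α β : Type} : Comp α → (α → Comp β) → Comp β
  | ret a, f => f a
  | timeout, _ => timeout
  | rnd m k, f => rnd m fun i => (k i).bind f
  | query d k, f => query d fun r => (k r).bind f

/-- Whatever the random choices and the replies are, there is no timeout and the result
satisfies `post`. -/
def Ensures {α : Type} (post : α → Prop) : Comp α → Prop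
  | ret a => post a
  | timeout => False
  | rnd m k => ∀ i ≤ m, (k i).Ensures post
  | query _ k => ∀ r, (k r).Ensures post

end Comp

/-- `while`-loops. `t`, `f` take a value and a remaining time, and return a value and the time
that remains then. The first argument bounds the number of iterations; started with more than the
remaining time, that bound is never what ends a loop, since each iteration consumes time. -/
def loopAux (t f : Data → ℕ → Comp (Data × ℕ)) : ℕ → Data → ℕ → Comp (Data × ℕ)
  | 0, _, _ => .timeout
  | k + 1, x, b => (t x b).bind fun r =>
      if r.1 = num 0 then .ret (x, r.2)
      else (f x r.2).bind fun s => loopAux t f k s.1 s.2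

/-- Execution of a program on `x` with `b` units of time left; returns the result together with
the time left at the end. Every node of the program that is executed costs `1` plus the bit size of
the value it is applied to (the logarithmic cost criterion). -/
def Code.eval : Code → Data → ℕ → Comp (Data × ℕ)
  | .id, x, b => if b < 1 + x.size then .timeout else .ret (x, b - (1 + x.size))
  | .const d, x, b => if b < 1 + x.size then .timeout else .ret (d, b - (1 + x.size))
  | .prim p, x, b => if b < 1 + x.size then .timeout else .ret (p.apply x, b - (1 + x.size))
  | .comp g f, x, b => if b < 1 + x.size then .timeout else
      (f.eval x (b - (1 + x.size))).bind fun r => g.eval r.1 r.2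
  | .pair f g, x, b => if b < 1 + x.size then .timeout else
      (f.eval x (b - (1 + x.size))).bind fun r =>
        (g.eval x r.2).bind fun s => .ret (cons r.1 s.1, s.2)
  | .cond t f g, x, b => if b < 1 + x.size then .timeout else
      (t.eval x (b - (1 + x.size))).bind fun r =>
        if r.1 = num 0 then g.eval x r.2 else f.eval x r.2
  | .loop t f, x, b => if b < 1 + x.size then .timeout else
      loopAux (fun y c => t.eval y c) (fun y c => f.eval y c)
        (b - (1 + x.size) + 1) x (b - (1 + x.size))
  | .rnd, x, b => if b < 1 + x.size then .timeout else
      match x with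
      | num m => .rnd m fun i => .ret (num i, b - (1 + x.size))
      | cons _ _ => .ret (num 0, b - (1 + x.size))
  | .query, x, b => if b < 1 + x.size then .timeout else
      .query x fun r => .ret (r, b - (1 + x.size))

/-- The program `c` computes the value `y` on input `x` within time `b`. -/
def Code.Computes (c : Code) (x : Data) (b : ℕ) (y : Data) : Prop :=
  (c.eval x b).Ensures fun r => r.1 = y

/-- A probabilistic polynomial-time algorithm: a program together with a polynomial time limit in
the security parameter. It is stopped as soon as its running time would exceed the limit. -/
structure PPT : Type where
  code : Code
  time : Polynomial ℕ

/-- Behaviour of the algorithm for security parameter `n` on input `x`. -/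
def PPT.start (A : PPT) (n : ℕ) (x : Data) : Comp (Data × ℕ) :=
  A.code.eval x (A.time.eval n)

/-! ### Probabilities -/

/-- The uniform distribution on `{0, …, m}`. -/
def uniformUpTo (m : ℕ) : PMF ℕ :=
  PMF.uniformOfFinset (Finset.range (m + 1)) ⟨0, by simp⟩

/-- Probability of an event, as a real number. -/
def prob {α : Type} (μ : PMF α) (E : Set α) : ℝ := (μ.toOuterMeasure E).toReal

/-- Negligible functions: they vanish faster than any inverse polynomial. -/
def Negligible (f : ℕ → ℝ) : Prop :=
  Asymptotics.SuperpolynomialDecay Filter.atTop (fun n : ℕ => (n : ℝ)) f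

/-- Running a computation against a stateful probabilistic environment; the result is `none` after
a timeout. -/
def Comp.run {α σ : Type} (env : Data → StateT σ PMF Data) :
    Comp α → σ → PMF (Option α × σ)
  | .ret a, s => PMF.pure (some a, s)
  | .timeout, s => PMF.pure (none, s)
  | .rnd m k, s => (uniformUpTo m).bind fun i => (k i).run env s
  | .query d k, s => (env d s).bind fun r => (k r.1).run env r.2

/-! ### The group and the CDH assumption -/

/-- System parameters: for every security parameter `n` a group `G n` of prime order `q n` with
generator `g n`, whose elements are encoded by numbers; `keyLen n` is the bit length of session
keys; `desc n` is any further public description of the group. -/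
structure Params where
  G : ℕ → Type
  [group : ∀ n, CommGroup (G n)]
  q : ℕ → ℕ
  prime : ∀ n, (q n).Prime
  card : ∀ n, Nat.card (G n) = q n
  g : ∀ n, G n
  generates : ∀ n, ∀ a : G n, a ∈ Subgroup.zpowers (g n)
  enc : ∀ n, G n → ℕ
  enc_injective : ∀ n, Function.Injective (enc n)
  keyLen : ℕ → ℕ
  desc : ℕ → Data

attribute [instance] Params.group

namespace Params

variable (S : Params)

/-- A group element as a value. -/
def elem (n : ℕ) (a : S.G n) : Data := num (S.enc n a)

/-- The public parameters, known to every party and every algorithm. -/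
def pub (n : ℕ) : Data :=
  tuple [num n, num (S.q n), S.elem n (S.g n), num (S.keyLen n), S.desc n]

open Classical in
/-- The group can be used in practice: parameters and elements have polynomial length,
multiplication and the membership test run in polynomial time. -/
structure Efficient : Prop where
  size_le : ∃ T : Polynomial ℕ, ∀ n,
    S.keyLen n ≤ T.eval n ∧ (S.desc n).size ≤ T.eval n ∧
      ∀ a : S.G n, (S.elem n a).size ≤ T.eval n
  mul : ∃ (c : Code) (T : Polynomial ℕ), ∀ n, ∀ a b : S.G n,
    c.Computes (tuple [S.pub n, S.elem n a, S.elem n b]) (T.eval n) (S.elem n (a * b))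
  mem : ∃ (c : Code) (T : Polynomial ℕ), ∀ n m : ℕ,
    c.Computes (tuple [S.pub n, num m]) (T.eval (n + Nat.size m))
      (ofBool (decide (m ∈ Set.range (S.enc n))))

/-- The environment of an algorithm that interacts with nobody. -/
def noEnv (_ : Data) : StateT Unit PMF Data := fun s => PMF.pure (num 0, s)

/-- The CDH experiment: does the algorithm, given `g ^ x` and `g ^ y` for uniformly random
`x`, `y` in `{0, …, q - 1}`, output `g ^ (x * y)`? -/
def cdhExperiment (A : PPT) (n : ℕ) : PMF Prop :=
  (uniformUpTo (S.q n - 1)).bind fun x =>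
  (uniformUpTo (S.q n - 1)).bind fun y =>
  ((A.start n (tuple [S.pub n, S.elem n (S.g n ^ x), S.elem n (S.g n ^ y)])).run noEnv ()).map
    fun r => r.1.map Prod.fst = some (S.elem n (S.g n ^ (x * y)))

/-- The CDH assumption: every PPT algorithm succeeds with negligible probability only. -/
def CDH : Prop :=
  ∀ A : PPT, Negligible fun n => prob (S.cdhExperiment A n) {p | p}

end Params

/-! ### The protocols and the Canetti–Krawczyk experiment -/

/-- The two protocols. -/
inductive Protocol : Type
  | oake | soake

/-- A registered player: its public key, its secret key (`none` if the key was registered by the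
adversary) and whether it is under the control of the adversary. -/
structure Player (G : Type) : Type where
  pk : G
  sk : Option ℕ
  corrupted : Bool

/-- Progress of a session: DH-component computed offline but not used yet; activated as initiator
towards a peer and waiting for the answer; completed with a peer, the peer's DH-component and the
session key. -/
inductive Phase (G : Type) : Type
  | precomputed : Phase G
  | opened (peer : ℕ) : Phase G
  | complete (peer : ℕ) (incoming : G) (key : ℕ) : Phase G

/-- A session: its owner, the owner's DH-exponent and DH-component, and what was exposed. -/
structure Session (G : Type) : Type where
  owner : ℕ
  exponent : ℕ
  component : G
  phase : Phase G
  stateExposed : Bool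
  keyExposed : Bool

/-- The identifier `(Â, B̂, X, Y)` of a complete session: owner, peer, the owner's DH-component,
the peer's DH-component. -/
def Session.ident {G : Type} (s : Session G) : Option (ℕ × ℕ × G × G) :=
  match s.phase with
  | .complete peer Y _ => some (s.owner, peer, s.component, Y)
  | _ => none

/-- The session key of a complete session. -/
def Session.key {G : Type} (s : Session G) : Option ℕ :=
  match s.phase with
  | .complete _ _ k => some k
  | _ => none

/-- `(Â, B̂, X, Y)` and `(B̂, Â, Y, X)` are matching. -/
def Session.Matching {G : Type} (s t : Session G) : Prop :=
  ∃ A B X Y, s.ident = some (A, B, X, Y) ∧ t.ident = some (B, A, Y, X)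

/-- Complete sessions `(Â, Â, X, X)`: identical peer and identical DH-component. -/
def Session.Reflected {G : Type} (s : Session G) : Prop :=
  ∃ A X, s.ident = some (A, A, X, X)

/-- The state of the experiment: the tables of the random oracles `h` and `H_K` (sampled lazily),
the registered players, the sessions of the honest players (under handles that the adversary
chooses), and the handle of the test session. -/
structure GameState (G : Type) : Type where
  hTable : Data → Option ℕ
  keyTable : Data → Option ℕ
  players : ℕ → Option (Player G)
  sessions : ℕ → Option (Session G)
  tested : Option ℕ

/-- The initial state. -/
def GameState.init (G : Type) : GameState G :=
  ⟨fun _ => none, fun _ => none, fun _ => none, fun _ => none, none⟩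

/-- The player with identity `A` is controlled by the adversary. -/
def GameState.Corrupted {G : Type} (st : GameState G) (A : ℕ) : Prop :=
  ∃ P, st.players A = some P ∧ P.corrupted = true

/-- The session was subject to a state-reveal query (before or after its activation) or to a
session-key query, or its owner or peer was corrupted. -/
def GameState.Hit {G : Type} (st : GameState G) (s : Session G) : Prop :=
  s.stateExposed = true ∨ s.keyExposed = true ∨ st.Corrupted s.owner ∨
    ∃ A B X Y, s.ident = some (A, B, X, Y) ∧ st.Corrupted B

/-- There is a test session, and neither it nor any session matching it was hit. -/
def GameState.Fresh {G : Type} (st : GameState G) : Prop :=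
  ∃ i s, st.tested = some i ∧ st.sessions i = some s ∧ ¬ st.Hit s ∧
    ∀ j t, st.sessions j = some t → s.Matching t → ¬ st.Hit t

/-- Two matching sessions of the form `(Â, Â, X, X)` are complete with different keys. -/
def GameState.Mismatch {G : Type} (st : GameState G) : Prop :=
  ∃ i j s t, st.sessions i = some s ∧ st.sessions j = some t ∧ s.Reflected ∧ s.Matching t ∧
    s.key ≠ t.key

/-- What the adversary can do. `i` is a session handle, `A` an identity. -/
inductive Query : Type
  /-- Random-oracle queries. -/
  | hash (d : Data)
  | keyHash (d : Data)
  /-- Set up an honest player with a fresh key pair, and get its public key. -/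
  | newPlayer (A : ℕ)
  /-- Register an adversarial player with an arbitrary public key in `G ∖ {1}`. -/
  | register (A : ℕ) (pk : ℕ)
  /-- Corrupt an honest player. This gives its secret key; the rest of its memory (session states
  and session keys) can then be had through the next queries. -/
  | corrupt (A : ℕ)
  /-- Let an honest player compute a fresh DH-component offline, and get this DH-component. -/
  | precompute (i : ℕ) (A : ℕ)
  /-- State-reveal query against an incomplete session, or against values computed offline and
  not used yet (then with respect to the peer `B`). -/
  | revealState (i : ℕ) (B : ℕ)
  /-- Session-key query against a complete session. -/
  | revealKey (i : ℕ)
  /-- Activations. -/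
  | initiate (i : ℕ) (B : ℕ)
  | respond (i : ℕ) (B : ℕ) (Y : ℕ)
  | complete (i : ℕ) (Y : ℕ)
  /-- The test query. -/
  | test (i : ℕ)

/-- How the queries are written as values. -/
def Query.ofData : Data → Option Query
  | cons (num 0) d => some (.hash d)
  | cons (num 1) d => some (.keyHash d)
  | cons (num 2) (num A) => some (.newPlayer A)
  | cons (num 3) (cons (num A) (num pk)) => some (.register A pk)
  | cons (num 4) (num A) => some (.corrupt A)
  | cons (num 5) (cons (num i) (num A)) => some (.precompute i A)
  | cons (num 6) (cons (num i) (num B)) => some (.revealState i B)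
  | cons (num 7) (num i) => some (.revealKey i)
  | cons (num 8) (cons (num i) (num B)) => some (.initiate i B)
  | cons (num 9) (cons (num i) (cons (num B) (num Y))) => some (.respond i B Y)
  | cons (num 10) (cons (num i) (num Y)) => some (.complete i Y)
  | cons (num 11) (num i) => some (.test i)
  | _ => none

namespace Params

variable (S : Params) (n : ℕ)

/-- Probabilistic computations on the state of the experiment. -/
abbrev Game : Type → Type := StateT (GameState (S.G n)) PMF

/-- Draw from a distribution. -/
def draw {α : Type} (μ : PMF α) : S.Game n α := fun st => μ.map fun a => (a, st)

open Classical in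
/-- The element of `G ∖ {1}` encoded by a number, if there is one. -/
def decode (m : ℕ) : Option (S.G n) :=
  if h : ∃ a, S.enc n a = m ∧ a ≠ 1 then some h.choose else none

/-- A uniformly random exponent in `{1, …, q - 1}`. -/
def exponent : PMF ℕ := (uniformUpTo (S.q n - 2)).map (· + 1)

/-- The random oracle `h`, with `n`-bit values. -/
def h (d : Data) : S.Game n ℕ := fun st =>
  match st.hTable d with
  | some v => PMF.pure (v, st)
  | none => (uniformUpTo (2 ^ n - 1)).map fun v =>
      (v, { st with hTable := Function.update st.hTable d (some v) })

/-- The random oracle `H_K`, with `keyLen`-bit values. -/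
def hK (d : Data) : S.Game n ℕ := fun st =>
  match st.keyTable d with
  | some v => PMF.pure (v, st)
  | none => (uniformUpTo (2 ^ S.keyLen n - 1)).map fun v =>
      (v, { st with keyTable := Function.update st.keyTable d (some v) })

/-- The exponents `c = h(Â, Y)` and `d = h(B̂, X)` of OAKE, for an identity and a DH-component;
they are `1` for sOAKE. -/
def cd (pr : Protocol) (A : ℕ) (Y : S.G n) : S.Game n ℕ :=
  match pr with
  | .oake => S.h n (tuple [num A, S.elem n Y])
  | .soake => pure 1

/-- The exponent `e`, which is `h(X, Y)` for OAKE and `h(Â, B̂, X, Y)` for sOAKE, where `A` and `X`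
belong to the initiator, `B` and `Y` to the responder. -/
def e (pr : Protocol) (A B : ℕ) (X Y : S.G n) : S.Game n ℕ :=
  match pr with
  | .oake => S.h n (tuple [S.elem n X, S.elem n Y])
  | .soake => S.h n (tuple [num A, num B, S.elem n X, S.elem n Y])

/-- The session key `H_K(B ^ (d x) * Y ^ (c a + e x))` of the initiator `A`, with secret key `a` and
DH-exponent `x`, for the responder `B` with public key `pkB` and DH-component `Y`. -/
def initiatorKey (pr : Protocol) (A B a x : ℕ) (pkB Y : S.G n) : S.Game n ℕ := do
  let X := S.g n ^ x
  let c ← S.cd n pr A Y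
  let d ← S.cd n pr B X
  let e ← S.e n pr A B X Y
  S.hK n (S.elem n (pkB ^ (d * x) * Y ^ (c * a + e * x)))

/-- The session key `H_K(A ^ (c y) * X ^ (d b + e y))` of the responder `B`, with secret key `b` and
DH-exponent `y`, for the initiator `A` with public key `pkA` and DH-component `X`. -/
def responderKey (pr : Protocol) (A B b y : ℕ) (pkA X : S.G n) : S.Game n ℕ := do
  let Y := S.g n ^ y
  let c ← S.cd n pr A Y
  let d ← S.cd n pr B X
  let e ← S.e n pr A B X Y
  S.hK n (S.elem n (pkA ^ (c * y) * X ^ (d * b + e * y)))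

/-- Store a player. -/
def setPlayer (A : ℕ) (P : Player (S.G n)) : S.Game n Unit :=
  modify fun st => { st with players := Function.update st.players A (some P) }

/-- Store a session. -/
def setSession (i : ℕ) (s : Session (S.G n)) : S.Game n Unit :=
  modify fun st => { st with sessions := Function.update st.sessions i (some s) }

/-- A negative reply. -/
def refuse : S.Game n Data := pure (num 0)

/-- A positive reply. -/
def accept (d : Data) : S.Game n Data := pure (cons (num 1) d)

open Classical in
/-- How the experiment reacts to the adversary's queries. The bit `β` says whether the test query
is answered by the session key or by an independent random key. -/
def answer (pr : Protocol) (β : Bool) : Query → S.Game n Data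
  | .hash d => do
      S.accept n (num (← S.h n d))
  | .keyHash d => do
      S.accept n (num (← S.hK n d))
  | .newPlayer A => do
      match (← get).players A with
      | some _ => S.refuse n
      | none =>
          let a ← S.draw n (S.exponent n)
          S.setPlayer n A ⟨S.g n ^ a, some a, false⟩
          S.accept n (S.elem n (S.g n ^ a))
  | .register A pk => do
      match (← get).players A, S.decode n pk with
      | none, some P =>
          S.setPlayer n A ⟨P, none, true⟩
          S.accept n (num 0)
      | _, _ => S.refuse n
  | .corrupt A => do
      match (← get).players A with
      | some ⟨P, some a, _⟩ =>
          S.setPlayer n A ⟨P, some a, true⟩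
          S.accept n (num a)
      | _ => S.refuse n
  | .precompute i A => do
      match (← get).sessions i, (← get).players A with
      | none, some ⟨_, some _, _⟩ =>
          let x ← S.draw n (S.exponent n)
          S.setSession n i ⟨A, x, S.g n ^ x, .precomputed, false, false⟩
          S.accept n (S.elem n (S.g n ^ x))
      | _, _ => S.refuse n
  | .revealState i B => do
      match (← get).sessions i with
      | none => S.refuse n
      | some s =>
          let peer : Option ℕ :=
            match s.phase with
            | .precomputed => some B
            | .opened C => some C
            | .complete _ _ _ => none
          match peer with
          | none => S.refuse n
          | some C =>
              match (← get).players C with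
              | none => S.refuse n
              | some P =>
                  let d ← S.cd n pr C s.component
                  S.setSession n i { s with stateExposed := true }
                  S.accept n (tuple [S.elem n s.component, num s.exponent,
                    S.elem n (P.pk ^ (d * s.exponent))])
  | .revealKey i => do
      match (← get).sessions i with
      | none => S.refuse n
      | some s =>
          match s.key with
          | none => S.refuse n
          | some k =>
              S.setSession n i { s with keyExposed := true }
              S.accept n (num k)
  | .initiate i B => do
      match (← get).sessions i, (← get).players B with
      | some s, some _ =>
          match s.phase with
          | .precomputed =>
              S.setSession n i { s with phase := .opened B }
              S.accept n (S.elem n s.component)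
          | _ => S.refuse n
      | _, _ => S.refuse n
  | .respond i B m => do
      match (← get).sessions i, (← get).players B, S.decode n m with
      | some s, some P, some X =>
          match s.phase, (← get).players s.owner with
          | .precomputed, some ⟨_, some b, _⟩ =>
              let k ← S.responderKey n pr B s.owner b s.exponent P.pk X
              S.setSession n i { s with phase := .complete B X k }
              S.accept n (S.elem n s.component)
          | _, _ => S.refuse n
      | _, _, _ => S.refuse n
  | .complete i m => do
      match (← get).sessions i, S.decode n m with
      | some s, some Y =>
          match s.phase with
          | .opened B =>
              match (← get).players B, (← get).players s.owner with
              | some P, some ⟨_, some a, _⟩ =>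
                  let k ← S.initiatorKey n pr s.owner B a s.exponent P.pk Y
                  S.setSession n i { s with phase := .complete B Y k }
                  S.accept n (num 0)
              | _, _ => S.refuse n
          | _ => S.refuse n
      | _, _ => S.refuse n
  | .test i => do
      match (← get).tested, (← get).sessions i with
      | none, some s =>
          match s.key with
          | none => S.refuse n
          | some k =>
              if s.Reflected then
                modify fun st => { st with tested := some i }
                let k' ← S.draw n (uniformUpTo (2 ^ S.keyLen n - 1))
                S.accept n (num (if β then k else k'))
              else S.refuse n
      | _, _ => S.refuse n

/-- The environment of the adversary. -/
def challenger (pr : Protocol) (β : Bool) (d : Data) : S.Game n Data :=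
  match Query.ofData d with
  | some Q => S.answer n pr β Q
  | none => S.refuse n

/-- A run of the adversary, for the challenge bit `β`: its output and the final state. -/
def attack (pr : Protocol) (A : PPT) (β : Bool) : PMF (Option Data × GameState (S.G n)) :=
  ((A.start n (S.pub n)).run (S.challenger n pr β) (GameState.init (S.G n))).map fun r =>
    (r.1.map Prod.fst, r.2)

/-- A run with a random challenge bit. -/
def experiment (pr : Protocol) (A : PPT) :
    PMF (Bool × Option Data × GameState (S.G n)) :=
  (PMF.uniformOfFintype Bool).bind fun β => (S.attack n pr A β).map fun r => (β, r)

open Classical in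
/-- Does the adversary guess the challenge bit (by output `num 1` for `true`, anything else for
`false`)? Runs without an unexposed test session are decided by a fair coin. -/
def guess (pr : Protocol) (A : PPT) : PMF Bool :=
  (S.experiment n pr A).bind fun r =>
    if r.2.2.Fresh then PMF.pure (decide (r.2.1 = some (num 1)) == r.1)
    else PMF.uniformOfFintype Bool

/-- SK-security with respect to test sessions `(Â, Â, X, X)`, in the random oracle model: for every
PPT adversary, except with negligible probability matching sessions have the same key, and its
advantage in telling the key of an unexposed test session from a random key is negligible. -/
def SKSecure (pr : Protocol) : Prop :=
  ∀ A : PPT,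
    (Negligible fun n => prob (S.experiment n pr A) {r | r.2.2.Mismatch}) ∧
    (Negligible fun n => |prob (S.guess n pr A) {true} - 1 / 2|)

end Params

end OAKE

end

/-!
# Sessions with identical peer and identical DH-component

In a session `(A, A, X, X)` with `X = g ^ x`, secret key `a` and hash values `c` (equal to `d`)
and `e`, both parties compute the same key `H_K(Z)` with `Z = g ^ (2 c a x + e x²)`. Hence the
correctness part holds with probability `1`: by the invariant `Inv`, the key of each such session
is the value of `H_K` at this point, and matching sessions agree on all the data in it
(`prob_mismatch`).

For secrecy, the experiment is compared with a simulator `Sim.env`. It chooses the secret keys of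
all honest players, but uses a given group element `U = g ^ u` as the DH-component of the session
created by query number `κ`, the *special* session, without knowledge of `u`. It neither has to
know the key of that session: a complete special session `(A, A, U, U)` does not ask `H_K` for it,
and the reply to the test query is a number `k` drawn in advance. The simulator gives up when the
special session can no longer become an unexposed test session (`Doomed`). Otherwise its run is
coupled with the run of the experiment (`Coupled.attack`) until `H_K` is asked for the key of the
special session (`Bad`). In the experiment, the DH-exponent and either the session key or the
random key of the test query may be drawn in advance as well (`run_tracked_eq_planned`), so that
for both values of the challenge bit the experiment is coupled with the same simulation
(`planned_freshAt_le`). The advantage of the adversary is therefore bounded by the probabilities of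
`Bad`, summed over `κ` (`advantage_le`).

If `Bad` happens, `Z` is among the queries to `H_K`, and `g ^ (u²) = (Z * U ^ (-2 c a)) ^ (1 / e)`
(`extract_eq`). Here `a`, `c` and `e` are known, and `e` is invertible modulo `q` unless a value of
`h` is divisible by `q`, which is unlikely (`hashZero_le`). Guessing `κ` and the query, one gets an
algorithm for the square Diffie-Hellman problem (`squareSolver`). Since
`4 x y = (x + y)² - (x - y)²`, two calls of it with the inputs `g ^ x * g ^ y` and `g ^ x / g ^ y`,
which are independent and uniformly distributed if `q` is odd (`sum_mul_div`), solve the CDH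
problem. So its probability of success, being the square root of a negligible function at most, is
negligible (`Params.CDH.negligible_squareProb`). That `1 / q` is negligible follows from the CDH
assumption too, since the constant output `1` is correct for `x = 0`.

The reductions have to be programs of the given machine model. Polynomial-time computability is
handled by the predicates `Eff`, `EffD`, `EffN` and `EffM` and their closure properties; the
decisive one is `Eff.simulate`, by which the interaction of a time-limited program with an efficient
environment can be carried out by a single program.
-/

noncomputable section

namespace OAKE

open Data

/-! ### Distributions of computations, and running time -/

theorem bind_congr_support {α β : Type} (p : PMF α) {f g : α → PMF β}
    (h : ∀ a ∈ p.support, f a = g a) : p.bind f = p.bind g := by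
  ext b
  simp only [PMF.bind_apply]
  refine tsum_congr fun a => ?_
  by_cases ha : p a = 0
  · simp [ha]
  · rw [h a ha]

theorem mem_support_uniformUpTo {m i : ℕ} : i ∈ (uniformUpTo m).support ↔ i ≤ m := by
  refine (PMF.mem_support_uniformOfFinset_iff ⟨0, by simp⟩ _).trans ?_
  rw [Finset.mem_range, Nat.lt_succ_iff]

namespace Comp

/-- Distribution of the result of a computation that interacts with nobody; `none` is a timeout. -/
def dist {α : Type} : Comp α → PMF (Option α)
  | ret a => PMF.pure (some a)
  | timeout => PMF.pure none
  | rnd m k => (uniformUpTo m).bind fun i => (k i).dist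
  | query _ k => (k (num 0)).dist

theorem run_noEnv {α : Type} (m : Comp α) :
    m.run Params.noEnv () = m.dist.map fun o => (o, ()) := by
  induction m with
  | ret a => simp [run, dist, PMF.pure_map]
  | timeout => simp [run, dist, PMF.pure_map]
  | rnd m k ih => simp only [run, dist, ih, PMF.map_bind]
  | query d k ih => simp only [run, dist, Params.noEnv, PMF.pure_bind, ih]

theorem dist_bind {α β : Type} (m : Comp α) (f : α → Comp β) :
    (m.bind f).dist = m.dist.bind fun o => o.elim (PMF.pure none) fun a => (f a).dist := by
  induction m with
  | ret a => simp [bind, dist]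
  | timeout => simp [bind, dist]
  | rnd m k ih => simp only [bind, dist, ih, PMF.bind_bind]
  | query d k ih => simp only [bind, dist, ih]

theorem run_bind {α β σ : Type} (env : Data → StateT σ PMF Data) (m : Comp α) (f : α → Comp β)
    (s : σ) : (m.bind f).run env s =
      (m.run env s).bind fun r => r.1.elim (PMF.pure (none, r.2)) fun a => (f a).run env r.2 := by
  induction m generalizing s with
  | ret a => simp [bind, run]
  | timeout => simp [bind, run]
  | rnd m k ih => simp only [bind, run, ih, PMF.bind_bind]
  | query d k ih => simp only [bind, run, ih, PMF.bind_bind]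

end Comp

/-- Given a time budget of at least `t`, the computation does not time out, consumes at most `t`,
and its result has distribution `μ`. -/
def Timed (m : ℕ → Comp (Data × ℕ)) (t : ℕ) (μ : PMF Data) : Prop :=
  ∀ b, ∃ ν : PMF (Data × ℕ), (m (t + b)).dist = ν.map some ∧ ν.map Prod.fst = μ ∧
    ∀ r ∈ ν.support, b ≤ r.2

namespace Timed

theorem mono {m : ℕ → Comp (Data × ℕ)} {t t' : ℕ} {μ : PMF Data} (h : Timed m t μ)
    (htt : t ≤ t') : Timed m t' μ := by
  intro b
  obtain ⟨ν, h1, h2, h3⟩ := h (t' - t + b)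
  refine ⟨ν, ?_, h2, fun r hr => le_trans (by omega) (h3 r hr)⟩
  rw [← h1]
  congr 2
  omega

theorem ret (y : Data) : Timed (fun b => .ret (y, b)) 0 (PMF.pure y) := fun b =>
  ⟨PMF.pure (y, b), by simp [Comp.dist, PMF.pure_map], by simp [PMF.pure_map], by simp⟩

theorem rnd (m : ℕ) :
    Timed (fun b => .rnd m fun i => .ret (num i, b)) 0 ((uniformUpTo m).map num) := by
  intro b
  refine ⟨(uniformUpTo m).map fun i => (num i, b), ?_, ?_, ?_⟩
  · simp [Comp.dist, PMF.map, Function.comp_def]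
  · simp [PMF.map_comp, Function.comp_def]
  · simp

theorem charge {m : ℕ → Comp (Data × ℕ)} {t w : ℕ} {μ : PMF Data} (h : Timed m t μ) :
    Timed (fun b => if b < w then .timeout else m (b - w)) (w + t) μ := by
  intro b
  obtain ⟨ν, h1, h2, h3⟩ := h b
  refine ⟨ν, ?_, h2, h3⟩
  simp only [← h1]
  rw [if_neg (by omega), show w + t + b - w = t + b by omega]

theorem bind {m : ℕ → Comp (Data × ℕ)} {k : Data → ℕ → Comp (Data × ℕ)} {t₁ t₂ : ℕ}
    {μ : PMF Data} {κ : Data → PMF Data} (hm : Timed m t₁ μ)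
    (hk : ∀ y ∈ μ.support, Timed (k y) t₂ (κ y)) :
    Timed (fun b => (m b).bind fun r => k r.1 r.2) (t₁ + t₂) (μ.bind κ) := by
  intro b
  obtain ⟨ν, h1, h2, h3⟩ := hm (t₂ + b)
  have hsup : ∀ r ∈ ν.support, r.1 ∈ μ.support := fun r hr => by
    rw [← h2, PMF.support_map]
    exact ⟨r, hr, rfl⟩
  have key : ∀ r : Data × ℕ, ∃ ν' : PMF (Data × ℕ), r ∈ ν.support →
      (k r.1 r.2).dist = ν'.map some ∧ ν'.map Prod.fst = κ r.1 ∧ ∀ r ∈ ν'.support, b ≤ r.2 := by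
    intro r
    by_cases hr : r ∈ ν.support
    · obtain ⟨ν', h1', h2', h3'⟩ := hk r.1 (hsup r hr) (r.2 - t₂)
      have := h3 r hr
      refine ⟨ν', fun _ => ⟨?_, h2', fun r' hr' => le_trans (by omega) (h3' r' hr')⟩⟩
      rw [← h1']
      congr 2
      omega
    · exact ⟨PMF.pure r, fun h => absurd h hr⟩
  choose F hF using key
  refine ⟨ν.bind F, ?_, ?_, ?_⟩
  · rw [Comp.dist_bind, add_assoc, h1, PMF.bind_map, PMF.map_bind]
    exact bind_congr_support ν fun r hr => (hF r hr).1
  · rw [PMF.map_bind, ← h2, PMF.bind_map]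
    exact bind_congr_support ν fun r hr => (hF r hr).2.1
  · intro r hr
    obtain ⟨a, ha, ha'⟩ := (PMF.mem_support_bind_iff _ _ _).1 hr
    exact (hF a ha).2.2 r ha'

end Timed

/-- On input `x` and within time `t`, the program `c` samples from `μ`, and the values in the
support of `μ` have size at most `t`. -/
def Impl (c : Code) (x : Data) (t : ℕ) (μ : PMF Data) : Prop :=
  Timed (c.eval x) t μ ∧ ∀ y ∈ μ.support, y.size ≤ t

namespace Impl

theorem mono {c : Code} {x : Data} {t t' : ℕ} {μ : PMF Data} (h : Impl c x t μ)
    (htt : t ≤ t') : Impl c x t' μ :=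
  ⟨h.1.mono htt, fun y hy => (h.2 y hy).trans htt⟩

theorem const (d x : Data) : Impl (.const d) x (1 + x.size + d.size) (PMF.pure d) := by
  refine ⟨Timed.mono (t := 1 + x.size) ?_ (by omega), by simp⟩
  simpa [Code.eval] using (Timed.ret d).charge (w := 1 + x.size)

theorem prim (p : Prim) (x : Data) :
    Impl (.prim p) x (1 + x.size + (p.apply x).size) (PMF.pure (p.apply x)) := by
  refine ⟨Timed.mono (t := 1 + x.size) ?_ (by omega), by simp⟩
  simpa [Code.eval] using (Timed.ret (p.apply x)).charge (w := 1 + x.size)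

theorem rnd (m : ℕ) :
    Impl .rnd (num m) (1 + (num m).size) ((uniformUpTo m).map num) := by
  refine ⟨?_, ?_⟩
  · simpa [Code.eval] using (Timed.rnd m).charge (w := 1 + (num m).size)
  · intro y hy
    obtain ⟨i, hi, rfl⟩ := (PMF.mem_support_map_iff _ _ _).1 hy
    have := Nat.size_le_size (mem_support_uniformUpTo.1 hi)
    simp only [Data.size]
    omega

theorem comp {f g : Code} {x : Data} {t₁ t₂ : ℕ} {μ : PMF Data} {κ : Data → PMF Data}
    (hf : Impl f x t₁ μ) (hg : ∀ y ∈ μ.support, Impl g y t₂ (κ y)) :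
    Impl (.comp g f) x (1 + x.size + (t₁ + t₂)) (μ.bind κ) := by
  refine ⟨?_, fun z hz => ?_⟩
  · simpa [Code.eval] using (hf.1.bind fun y hy => (hg y hy).1).charge (w := 1 + x.size)
  · obtain ⟨y, hy, hz⟩ := (PMF.mem_support_bind_iff _ _ _).1 hz
    have := (hg y hy).2 z hz
    omega

theorem pair {f g : Code} {x : Data} {t₁ t₂ : ℕ} {μ ν : PMF Data}
    (hf : Impl f x t₁ μ) (hg : Impl g x t₂ ν) :
    Impl (.pair f g) x (1 + x.size + (t₁ + t₂)) (μ.bind fun y => ν.map fun z => cons y z) := by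
  refine ⟨?_, fun z hz => ?_⟩
  · have := (hf.1.bind (k := fun y b => (g.eval x b).bind fun s => .ret (cons y s.1, s.2))
      (t₂ := t₂ + 0) (κ := fun y => ν.bind fun z => PMF.pure (cons y z)) fun y _ =>
        hg.1.bind fun z _ => Timed.ret (cons y z)).charge (w := 1 + x.size)
    simpa [Code.eval, PMF.map, Function.comp_def] using this
  · obtain ⟨y, hy, hz⟩ := (PMF.mem_support_bind_iff _ _ _).1 hz
    obtain ⟨z', hz', rfl⟩ := (PMF.mem_support_map_iff _ _ _).1 hz
    have := hf.2 y hy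
    have := hg.2 z' hz'
    simp only [Data.size]
    omega

theorem cond {t f g : Code} {x : Data} {t₁ t₂ : ℕ} {y : Data} {μ : PMF Data}
    (ht : Impl t x t₁ (PMF.pure y)) (hf : y ≠ num 0 → Impl f x t₂ μ)
    (hg : y = num 0 → Impl g x t₂ μ) :
    Impl (.cond t f g) x (1 + x.size + (t₁ + t₂)) μ := by
  refine ⟨?_, fun z hz => ?_⟩
  · have := (ht.1.bind (k := fun y b => if y = num 0 then g.eval x b else f.eval x b)
      (t₂ := t₂) (κ := fun _ => μ) fun z hz => by
        obtain rfl : z = y := by simpa using hz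
        by_cases h : z = num 0
        · simpa [h] using (hg h).1
        · simpa [h] using (hf h).1).charge (w := 1 + x.size)
    simpa [Code.eval] using this
  · by_cases h : y = num 0
    · have := (hg h).2 z hz
      omega
    · have := (hf h).2 z hz
      omega

end Impl

/-- `k`-fold iteration of a random function. -/
def iter (f : Data → PMF Data) : ℕ → Data → PMF Data
  | 0, z => PMF.pure z
  | k + 1, z => (f z).bind (iter f k)

/-- A loop that counts down to zero, and keeps some value `p` unchanged. The body takes time `M`,
the values that occur have size at most `M`, and `I k` holds for the current value when `k`
iterations remain. -/
theorem loopAux_countdown {c : Code} {p : Data} {f : Data → PMF Data} {M : ℕ} (I : ℕ → Data → Prop)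
    (hI : ∀ k z, I (k + 1) z → ∀ z' ∈ (f z).support, I k z')
    (hsize : ∀ k z, I k z → (cons (num k) (cons p z)).size ≤ M)
    (hc : ∀ k z, I (k + 1) z → Impl c (cons (num (k + 1)) (cons p z)) M
      ((f z).map fun z' => cons (num k) (cons p z'))) :
    ∀ k fuel z, I k z → k + 1 ≤ fuel →
      Timed (fun b => loopAux (fun y b => (Code.prim .fst).eval y b) (fun y b => c.eval y b) fuel
        (cons (num k) (cons p z)) b) ((k + 1) * (3 * M + 3))
        ((iter f k z).map fun z' => cons (num 0) (cons p z')) := by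
  have hfst : ∀ k z, I k z →
      Timed ((Code.prim .fst).eval (cons (num k) (cons p z))) (2 * M + 2) (PMF.pure (num k)) := by
    intro k z h
    have h1 := hsize k z h
    have := (Impl.prim .fst (cons (num k) (cons p z))).1
    simp only [Prim.apply] at this
    refine this.mono ?_
    simp only [Data.size] at h1 ⊢
    omega
  intro k
  induction k with
  | zero =>
    rintro (_ | fuel) z hz hfuel
    · omega
    have := (hfst 0 z hz).bind (t₂ := 0)
      (k := fun y b => if y = num 0 then .ret (cons (num 0) (cons p z), b) else
        (c.eval (cons (num 0) (cons p z)) b).bind fun s => loopAux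
          (fun y b => (Code.prim .fst).eval y b) (fun y b => c.eval y b) fuel s.1 s.2)
      (κ := fun _ => PMF.pure (cons (num 0) (cons p z))) (fun y hy => by
        obtain rfl : y = num 0 := by simpa using hy
        simpa using Timed.ret _)
    refine Timed.mono (t := 2 * M + 2 + 0) ?_ (by omega)
    simpa [loopAux, iter, PMF.pure_map] using this
  | succ k ih =>
    rintro (_ | fuel) z hz hfuel
    · omega
    have := (hfst (k + 1) z hz).bind (t₂ := M + (k + 1) * (3 * M + 3))
      (k := fun y b => if y = num 0 then .ret (cons (num (k + 1)) (cons p z), b) else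
        (c.eval (cons (num (k + 1)) (cons p z)) b).bind fun s => loopAux
          (fun y b => (Code.prim .fst).eval y b) (fun y b => c.eval y b) fuel s.1 s.2)
      (κ := fun _ => ((f z).map fun z' => cons (num k) (cons p z')).bind fun w =>
        (iter f k (match w with | cons _ (cons _ z') => z' | w => w)).map
          fun z' => cons (num 0) (cons p z')) (fun y hy => by
        obtain rfl : y = num (k + 1) := by simpa using hy
        simp only [num.injEq, Nat.add_eq_zero_iff, one_ne_zero, and_false, if_false]
        refine (hc k z hz).1.bind (k := fun s b => loopAux
          (fun y b => (Code.prim .fst).eval y b) (fun y b => c.eval y b) fuel s b) fun w hw => ?_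
        obtain ⟨z', hz', rfl⟩ := (PMF.mem_support_map_iff _ _ _).1 hw
        exact ih fuel z' (hI k z hz z' hz') (by omega))
    have hκ : (PMF.pure (num (k + 1))).bind (fun _ : Data =>
        ((f z).map fun z' => cons (num k) (cons p z')).bind fun w =>
        (iter f k (match w with | cons _ (cons _ z') => z' | w => w)).map
          fun z' => cons (num 0) (cons p z')) =
        (iter f (k + 1) z).map fun z' => cons (num 0) (cons p z') := by
      simp only [PMF.pure_bind, PMF.bind_map, Function.comp_def, iter, PMF.map_bind]
    rw [hκ] at this
    refine Timed.mono (t := 2 * M + 2 + (M + (k + 1) * (3 * M + 3))) ?_ (by ring_nf; omega)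
    simpa only [loopAux] using this

/-- Running time of a `loop` that applies `f` as often as the counter says. The fuel of `loopAux`
is no obstacle, since it exceeds the time that is left. -/
theorem Impl.loop_countdown {c : Code} {p : Data} {f : Data → PMF Data} {M : ℕ}
    (I : ℕ → Data → Prop) (hI : ∀ k z, I (k + 1) z → ∀ z' ∈ (f z).support, I k z')
    (hsize : ∀ k z, I k z → (cons (num k) (cons p z)).size ≤ M)
    (hc : ∀ k z, I (k + 1) z → Impl c (cons (num (k + 1)) (cons p z)) M
      ((f z).map fun z' => cons (num k) (cons p z'))) (k : ℕ) (z : Data) (hz : I k z) :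
    Impl (.loop (.prim .fst) c) (cons (num k) (cons p z)) (1 + M + (k + 1) * (3 * M + 3))
      ((iter f k z).map fun z' => cons (num 0) (cons p z')) := by
  have hs := hsize k z hz
  refine ⟨Timed.mono (t := 1 + (cons (num k) (cons p z)).size + (k + 1) * (3 * M + 3)) ?_
    (by omega), fun y hy => ?_⟩
  · intro b
    obtain ⟨ν, h1, h2⟩ := loopAux_countdown I hI hsize hc k
      ((k + 1) * (3 * M + 3) + b + 1) z hz (by nlinarith) b
    refine ⟨ν, ?_, h2⟩
    rw [← h1, Code.eval, if_neg (by omega)]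
    congr 2 <;> omega
  · obtain ⟨z', hz', rfl⟩ := (PMF.mem_support_map_iff _ _ _).1 hy
    have : ∀ k z, I k z → ∀ z' ∈ (iter f k z).support, I 0 z' := by
      intro k
      induction k with
      | zero => intro z hz z' hz'; simp only [iter, PMF.mem_support_pure_iff] at hz'; exact hz' ▸ hz
      | succ k ih =>
        intro z hz z' hz'
        obtain ⟨w, hw, hw'⟩ := (PMF.mem_support_bind_iff _ _ _).1 hz'
        exact ih w (hI k z hz w hw) z' hw'
    have := hsize 0 z' (this k z hz z' hz')
    omega

/-! ### More time does not hurt -/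

/-- `m'` behaves as `m` does, with `k` more units of time left, as long as `m` does not time out. -/
inductive Comp.Slack (k : ℕ) : Comp (Data × ℕ) → Comp (Data × ℕ) → Prop
  | timeout (m) : Slack k .timeout m
  | ret (y b) : Slack k (.ret (y, b)) (.ret (y, b + k))
  | rnd (m f f') (h : ∀ i, Slack k (f i) (f' i)) : Slack k (.rnd m f) (.rnd m f')
  | query (d f f') (h : ∀ r, Slack k (f r) (f' r)) : Slack k (.query d f) (.query d f')

theorem Comp.Slack.bind {k : ℕ} {m m' : Comp (Data × ℕ)} {f f' : Data × ℕ → Comp (Data × ℕ)}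
    (h : Slack k m m') (hf : ∀ y b, Slack k (f (y, b)) (f' (y, b + k))) :
    Slack k (m.bind f) (m'.bind f') := by
  induction h with
  | timeout m => exact .timeout _
  | ret y b => exact hf y b
  | rnd m f f' h ih => exact .rnd _ _ _ ih
  | query d f f' h ih => exact .query _ _ _ ih

theorem Comp.Slack.charge {k b w : ℕ} {m m' : ℕ → Comp (Data × ℕ)}
    (h : ∀ b, Slack k (m b) (m' (b + k))) :
    Slack k (if b < w then .timeout else m (b - w))
      (if b + k < w then .timeout else m' (b + k - w)) := by
  by_cases hb : b < w
  · rw [if_pos hb]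
    exact .timeout _
  · rw [if_neg hb, if_neg (by omega), show b + k - w = b - w + k by omega]
    exact h _

theorem loopAux_slack {t f : Data → ℕ → Comp (Data × ℕ)} {k : ℕ}
    (ht : ∀ x b, Comp.Slack k (t x b) (t x (b + k)))
    (hf : ∀ x b, Comp.Slack k (f x b) (f x (b + k))) :
    ∀ n n', n ≤ n' → ∀ x b, Comp.Slack k (loopAux t f n x b) (loopAux t f n' x (b + k)) := by
  intro n
  induction n with
  | zero => intro n' _ x b; exact .timeout _
  | succ n ih =>
    rintro (_ | n') hn x b
    · omega
    simp only [loopAux]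
    refine (ht x b).bind fun y b => ?_
    by_cases hy : y = num 0
    · simpa [hy] using Comp.Slack.ret _ _
    · simpa [hy] using (hf x b).bind fun y b => ih n' (by omega) y b

/-- A program that does not time out behaves in the same way if it has more time. So a time limit
that suffices on an input may be replaced by any larger one. -/
theorem Code.eval_slack (c : Code) (k : ℕ) :
    ∀ x b, Comp.Slack k (c.eval x b) (c.eval x (b + k)) := by
  induction c with
  | id =>
    intro x b
    simp only [Code.eval]
    exact .charge (m := fun b => .ret (x, b)) (m' := fun b => .ret (x, b)) fun b => .ret _ _
  | const d =>
    intro x b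
    simp only [Code.eval]
    exact .charge (m := fun b => .ret (d, b)) (m' := fun b => .ret (d, b)) fun b => .ret _ _
  | prim p =>
    intro x b
    simp only [Code.eval]
    exact .charge (m := fun b => .ret (p.apply x, b)) (m' := fun b => .ret (p.apply x, b))
      fun b => .ret _ _
  | comp g f ihg ihf =>
    intro x b
    simp only [Code.eval]
    exact .charge (m := fun b => (f.eval x b).bind fun r => g.eval r.1 r.2)
      (m' := fun b => (f.eval x b).bind fun r => g.eval r.1 r.2)
      fun b => (ihf x b).bind fun y b => ihg y b
  | pair f g ihf ihg =>
    intro x b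
    simp only [Code.eval]
    exact .charge
      (m := fun b => (f.eval x b).bind fun r => (g.eval x r.2).bind fun s =>
        .ret (cons r.1 s.1, s.2))
      (m' := fun b => (f.eval x b).bind fun r => (g.eval x r.2).bind fun s =>
        .ret (cons r.1 s.1, s.2))
      fun b => (ihf x b).bind fun y b => (ihg x b).bind fun z b => .ret _ _
  | cond t f g iht ihf ihg =>
    intro x b
    simp only [Code.eval]
    refine .charge
      (m := fun b => (t.eval x b).bind fun r => if r.1 = num 0 then g.eval x r.2 else f.eval x r.2)
      (m' := fun b => (t.eval x b).bind fun r => if r.1 = num 0 then g.eval x r.2 else f.eval x r.2)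
      fun b => (iht x b).bind fun y b => ?_
    by_cases hy : y = num 0
    · simpa [hy] using ihg x b
    · simpa [hy] using ihf x b
  | loop t f iht ihf =>
    intro x b
    simp only [Code.eval]
    exact .charge
      (m := fun b => loopAux (fun y c => t.eval y c) (fun y c => f.eval y c) (b + 1) x b)
      (m' := fun b => loopAux (fun y c => t.eval y c) (fun y c => f.eval y c) (b + 1) x b)
      fun b => loopAux_slack iht ihf _ _ (by omega) x b
  | rnd =>
    intro x b
    simp only [Code.eval]
    cases x with
    | num m =>
      exact .charge (m := fun b => .rnd m fun i => .ret (num i, b))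
        (m' := fun b => .rnd m fun i => .ret (num i, b)) fun b => .rnd _ _ _ fun i => .ret _ _
    | cons y z =>
      exact .charge (m := fun b => .ret (num 0, b)) (m' := fun b => .ret (num 0, b))
        fun b => .ret _ _
  | query =>
    intro x b
    simp only [Code.eval]
    exact .charge (m := fun b => .query x fun r => .ret (r, b))
      (m' := fun b => .query x fun r => .ret (r, b)) fun b => .query _ _ _ fun i => .ret _ _

theorem Comp.Slack.dist_of_ensures {k : ℕ} {m m' : Comp (Data × ℕ)} {y : Data}
    (h : Slack k m m') (hm : m.Ensures fun r => r.1 = y) :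
    ∃ ν : PMF (Data × ℕ), m'.dist = ν.map some ∧ ν.map Prod.fst = PMF.pure y ∧
      ∀ r ∈ ν.support, k ≤ r.2 := by
  induction h with
  | timeout m => exact hm.elim
  | ret z b =>
    obtain rfl : z = y := hm
    exact ⟨PMF.pure (z, b + k), by simp [dist, PMF.pure_map], by simp [PMF.pure_map], by simp⟩
  | rnd m f f' h ih =>
    have : ∀ i, ∃ ν : PMF (Data × ℕ), i ≤ m → (f' i).dist = ν.map some ∧
        ν.map Prod.fst = PMF.pure y ∧ ∀ r ∈ ν.support, k ≤ r.2 := fun i => by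
      by_cases hi : i ≤ m
      · obtain ⟨ν, hν⟩ := ih i (hm i hi)
        exact ⟨ν, fun _ => hν⟩
      · exact ⟨PMF.pure (num 0, 0), fun h => absurd h hi⟩
    choose F hF using this
    refine ⟨(uniformUpTo m).bind F, ?_, ?_, ?_⟩
    · rw [dist, PMF.map_bind]
      exact bind_congr_support _ fun i hi => (hF i (mem_support_uniformUpTo.1 hi)).1
    · rw [PMF.map_bind]
      refine (bind_congr_support _ fun i hi => (hF i (mem_support_uniformUpTo.1 hi)).2.1).trans ?_
      exact PMF.bind_const _ _
    · intro r hr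
      obtain ⟨i, hi, hi'⟩ := (PMF.mem_support_bind_iff _ _ _).1 hr
      exact (hF i (mem_support_uniformUpTo.1 hi)).2.2 r hi'
  | query d f f' h ih => exact ih _ (hm _)

theorem Code.Computes.impl {c : Code} {x y : Data} {t : ℕ} (h : c.Computes x t y) :
    Impl c x (t + y.size) (PMF.pure y) :=
  ⟨Timed.mono (t := t) (fun b => (c.eval_slack b x t).dist_of_ensures h) (by omega), by simp⟩

end OAKE

end

noncomputable section

namespace OAKE

open Data

/-! ### Functions computable in polynomial time -/

namespace Data

/-- First component of a pair; `num 0` for a number. -/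
def left : Data → Data
  | num _ => num 0
  | cons a _ => a

/-- Second component of a pair; `num 0` for a number. -/
def right : Data → Data
  | num _ => num 0
  | cons _ b => b

/-- Value of a number; `0` for a pair. -/
def toNat : Data → ℕ
  | num m => m
  | cons _ _ => 0

theorem size_cons (a b : Data) : (cons a b).size = a.size + b.size + 1 := rfl

@[simp] theorem left_cons (a b : Data) : (cons a b).left = a := rfl
@[simp] theorem right_cons (a b : Data) : (cons a b).right = b := rfl
@[simp] theorem left_num (m : ℕ) : (num m).left = num 0 := rfl
@[simp] theorem right_num (m : ℕ) : (num m).right = num 0 := rfl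
@[simp] theorem toNat_num (m : ℕ) : (num m).toNat = m := rfl

theorem one_le_size (d : Data) : 1 ≤ d.size := by
  cases d <;> simp [size]

theorem left_size_le (d : Data) : d.left.size ≤ d.size := by
  cases d with
  | num m => simp [left, size]
  | cons a b => simp only [left, size]; omega

theorem right_size_le (d : Data) : d.right.size ≤ d.size := by
  cases d with
  | num m => simp [right, size]
  | cons a b => simp only [right, size]; omega

end Data

theorem poly_mono (P : Polynomial ℕ) {a b : ℕ} (h : a ≤ b) : P.eval a ≤ P.eval b := by
  induction P using Polynomial.induction_on' with
  | add p q hp hq => simpa using add_le_add hp hq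
  | monomial n c => simpa using Nat.mul_le_mul_left c (Nat.pow_le_pow_left h n)

/-- The size of an input together with the public parameters and the security parameter. -/
def Params.len (S : Params) (n : ℕ) (x : Data) : ℕ := n + (cons (S.pub n) x).size

variable {S : Params}

theorem Params.len_mono {n : ℕ} {x y : Data} (h : x.size ≤ y.size) : S.len n x ≤ S.len n y := by
  simp only [Params.len, Data.size]
  omega

theorem Params.size_lt_len (n : ℕ) (x : Data) : x.size < S.len n x := by
  simp only [Params.len, Data.size]
  omega

/-- The random function `f` (depending on the security parameter) is computable in polynomial time
from the public parameters and the argument. -/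
def Eff (S : Params) (f : ℕ → Data → PMF Data) : Prop :=
  ∃ (c : Code) (P : Polynomial ℕ), ∀ n x,
    Impl c (cons (S.pub n) x) (P.eval (S.len n x)) (f n x)

/-- Polynomial-time computability of a deterministic function. -/
def EffD (S : Params) (f : ℕ → Data → Data) : Prop := Eff S fun n x => PMF.pure (f n x)

/-- Polynomial-time computability of a function with values in the natural numbers. -/
def EffN (S : Params) (f : ℕ → Data → ℕ) : Prop := EffD S fun n x => num (f n x)

/-- Sequential composition. The second function gets the original input `z` too, in the second
component of its argument. -/
theorem Eff.bind {f : ℕ → Data → PMF Data} {g : ℕ → Data → Data → PMF Data} (hf : Eff S f)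
    (hg : Eff S fun n p => g n p.right p.left) : Eff S fun n z => (f n z).bind (g n z) := by
  obtain ⟨c, P, hf⟩ := hf
  obtain ⟨d, Q, hg⟩ := hg
  refine ⟨.comp d (.pair (.prim .fst) (.pair c (.prim .snd))),
    10 * Polynomial.X + 10 + P + Q.comp (Polynomial.X + P + 1), fun n z => ?_⟩
  have h1 := Impl.pair (.prim .fst (cons (S.pub n) z))
    (.pair (hf n z) (.prim .snd (cons (S.pub n) z)))
  have h := Impl.comp h1 (g := d) (κ := fun w => g n w.right.right w.right.left)
    (t₂ := Q.eval (S.len n z + P.eval (S.len n z) + 1)) fun w hw => by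
      simp only [Prim.apply, PMF.pure_bind, PMF.pure_map, PMF.mem_support_map_iff,
        PMF.mem_support_bind_iff, PMF.mem_support_pure_iff] at hw
      obtain ⟨_, ⟨y, hy, rfl⟩, rfl⟩ := hw
      refine (hg n (cons y z)).mono (poly_mono Q ?_)
      have := (hf n z).2 y hy
      simp only [Params.len, Data.size] at this ⊢
      omega
  have h := h.mono (t' := (10 * Polynomial.X + 10 + P +
      Q.comp (Polynomial.X + P + 1)).eval (S.len n z)) (by
    simp only [Polynomial.eval_add, Polynomial.eval_mul, Polynomial.eval_ofNat, Polynomial.eval_X,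
      Polynomial.eval_comp, Polynomial.eval_one, Prim.apply]
    simp only [Params.len, Data.size]
    omega)
  simpa only [Prim.apply, PMF.pure_bind, PMF.pure_map, PMF.bind_bind, PMF.map_bind,
      right_cons, left_cons] using h

theorem Eff.id : EffD S fun _ z => z :=
  ⟨.prim .snd, 2 * Polynomial.X + 1, fun n z => (Impl.prim .snd _).mono (by
    simp [Prim.apply, Params.len, Data.size]; omega)⟩

theorem EffD.pub : EffD S fun n _ => S.pub n :=
  ⟨.prim .fst, 2 * Polynomial.X + 1, fun n z => (Impl.prim .fst _).mono (by
    simp [Prim.apply, Params.len, Data.size]; omega)⟩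

theorem EffD.const (d : Data) : EffD S fun _ _ => d :=
  ⟨.const d, Polynomial.X + 1 + Polynomial.C d.size, fun n z => (Impl.const d _).mono (by
    simp [Params.len]; omega)⟩

theorem Prim.size_apply_le (p : Prim) (x : Data) : (p.apply x).size ≤ x.size + 1 := by
  have hb : ∀ b : Bool, (ofBool b).size ≤ 2 := by decide
  have hmono : ∀ {a b : ℕ}, a ≤ b → a.size ≤ b.size := fun h => Nat.size_le_size h
  rcases x with m | ⟨a, b⟩
  · cases p <;> simp only [Prim.apply, Data.size, Nat.size_zero] <;> try omega
    rcases Nat.eq_zero_or_pos m with rfl | hm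
    · simp
    · have := hmono (Nat.size_le.2 (Nat.lt_two_pow_self (n := m.size + 1)))
      have h2 : (m.size + 1).size ≤ m.size + 1 := Nat.size_le.2 (Nat.lt_two_pow_self)
      omega
  · cases p
    case fst => simp only [Prim.apply, Data.size]; omega
    case snd => simp only [Prim.apply, Data.size]; omega
    case isCons => simp [Prim.apply, Data.size]
    case eq =>
      have := hb (decide (a = b))
      have := one_le_size a
      simp only [Prim.apply, Data.size]
      omega
    case size =>
      have h2 : ((cons a b).size).size ≤ (cons a b).size := Nat.size_le.2 (Nat.lt_two_pow_self)
      simp only [Prim.apply]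
      rw [Data.size]
      omega
    all_goals
      rcases a with a | ⟨a, a'⟩ <;> rcases b with b | ⟨b, b'⟩ <;>
        simp only [Prim.apply, Data.size, Nat.size_zero] <;> try omega
    · have : (a + b).size ≤ a.size + b.size + 1 := Nat.size_le.2 <| by
        have h1 := Nat.lt_size_self a
        have h2 := Nat.lt_size_self b
        have h3 : 2 ^ a.size ≤ 2 ^ (a.size + b.size) := Nat.pow_le_pow_right (by omega) (by omega)
        have h4 : 2 ^ b.size ≤ 2 ^ (a.size + b.size) := Nat.pow_le_pow_right (by omega) (by omega)
        rw [pow_succ]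
        omega
      omega
    · have := hmono (Nat.sub_le a b)
      omega
    · have : (a * b).size ≤ a.size + b.size := Nat.size_le.2 <| by
        rw [pow_add]
        exact Nat.mul_lt_mul'' (Nat.lt_size_self a) (Nat.lt_size_self b)
      omega
    · have := hmono (Nat.div_le_self a b)
      omega
    · have := hmono (Nat.mod_le a b)
      omega

theorem EffD.prim (p : Prim) {f : ℕ → Data → Data} (hf : EffD S f) :
    EffD S fun n z => p.apply (f n z) := by
  obtain ⟨c, P, hf⟩ := hf
  refine ⟨.comp (.prim p) c, 2 * Polynomial.X + 10 + 4 * P, fun n z => ?_⟩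
  have h := Impl.comp (hf n z) (g := .prim p) (κ := fun y => PMF.pure (p.apply y))
    (t₂ := 3 + 2 * P.eval (S.len n z)) fun y hy => (Impl.prim p y).mono (by
      have := (hf n z).2 y hy
      have := p.size_apply_le y
      omega)
  simp only [PMF.pure_bind] at h
  refine h.mono ?_
  simp only [Polynomial.eval_add, Polynomial.eval_mul, Polynomial.eval_ofNat, Polynomial.eval_X]
  simp only [Params.len]
  omega

theorem EffD.cons {f g : ℕ → Data → Data} (hf : EffD S f) (hg : EffD S g) :
    EffD S fun n z => Data.cons (f n z) (g n z) := by
  obtain ⟨c, P, hf⟩ := hf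
  obtain ⟨d, Q, hg⟩ := hg
  refine ⟨.pair c d, Polynomial.X + 1 + P + Q, fun n z => ?_⟩
  have h := Impl.pair (hf n z) (hg n z)
  simp only [PMF.pure_bind, PMF.pure_map] at h
  refine h.mono ?_
  simp only [Polynomial.eval_add, Polynomial.eval_one, Polynomial.eval_X]
  simp only [Params.len]
  omega

theorem EffD.left {f : ℕ → Data → Data} (hf : EffD S f) : EffD S fun n z => (f n z).left := by
  convert hf.prim .fst using 4 with n z
  cases f n z <;> rfl

theorem EffD.right {f : ℕ → Data → Data} (hf : EffD S f) : EffD S fun n z => (f n z).right := by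
  convert hf.prim .snd using 4 with n z
  cases f n z <;> rfl

theorem Eff.ite_zero {t : ℕ → Data → Data} {f g : ℕ → Data → PMF Data} (ht : EffD S t)
    (hf : Eff S f) (hg : Eff S g) :
    Eff S fun n z => if t n z = num 0 then g n z else f n z := by
  obtain ⟨c, P, ht⟩ := ht
  obtain ⟨d, Q, hf⟩ := hf
  obtain ⟨e, R, hg⟩ := hg
  refine ⟨.cond c d e, Polynomial.X + 1 + P + Q + R, fun n z => ?_⟩
  have h := Impl.cond (ht n z) (f := d) (g := e) (t₂ := Q.eval (S.len n z) + R.eval (S.len n z))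
    (μ := if t n z = num 0 then g n z else f n z)
    (fun h => by simpa [h] using (hf n z).mono (by omega))
    (fun h => by simpa [h] using (hg n z).mono (by omega))
  refine h.mono ?_
  simp only [Polynomial.eval_add, Polynomial.eval_one, Polynomial.eval_X]
  simp only [Params.len]
  omega

theorem Eff.ite_eq {a b : ℕ → Data → Data} {f g : ℕ → Data → PMF Data} (ha : EffD S a)
    (hb : EffD S b) (hf : Eff S f) (hg : Eff S g) :
    Eff S fun n z => if a n z = b n z then f n z else g n z := by
  convert Eff.ite_zero ((ha.cons hb).prim .eq) hf hg using 3 with n z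
  by_cases h : a n z = b n z <;> simp [Prim.apply, h, ofBool]

theorem EffD.ite_eq {a b : ℕ → Data → Data} {f g : ℕ → Data → Data} (ha : EffD S a)
    (hb : EffD S b) (hf : EffD S f) (hg : EffD S g) :
    EffD S fun n z => if a n z = b n z then f n z else g n z := by
  unfold EffD
  convert Eff.ite_eq ha hb hf hg using 3 with n z
  split_ifs with h <;> simp [h]

theorem EffD.comp {f : ℕ → Data → Data} {g : ℕ → Data → Data} (hg : EffD S g) (hf : EffD S f) :
    EffD S fun n z => g n (f n z) := by
  obtain ⟨c, P, hf⟩ := hf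
  obtain ⟨d, Q, hg⟩ := hg
  refine ⟨.comp d (.pair (.prim .fst) c),
    10 * Polynomial.X + 10 + P + Q.comp (Polynomial.X + P + 1), fun n z => ?_⟩
  have h1 := Impl.pair (.prim .fst (Data.cons (S.pub n) z)) (hf n z)
  simp only [Prim.apply, PMF.pure_bind, PMF.pure_map] at h1
  have h2 := Impl.comp h1 (g := d) (κ := fun _ => PMF.pure (g n (f n z)))
    (t₂ := Q.eval (S.len n z + P.eval (S.len n z) + 1)) fun w hw => by
      obtain rfl : w = Data.cons (S.pub n) (f n z) := by simpa using hw
      refine (hg n (f n z)).mono (poly_mono Q ?_)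
      have := (hf n z).2 (f n z) (by simp)
      simp only [Params.len, Data.size] at this ⊢
      omega
  simp only [PMF.pure_bind] at h2
  refine h2.mono ?_
  simp only [Polynomial.eval_add, Polynomial.eval_mul, Polynomial.eval_ofNat, Polynomial.eval_X,
    Polynomial.eval_comp, Polynomial.eval_one]
  simp only [Params.len, Data.size]
  omega

/-- Substitution into a random function. -/
theorem Eff.comp {f : ℕ → Data → Data} {g : ℕ → Data → PMF Data} (hg : Eff S g) (hf : EffD S f) :
    Eff S fun n z => g n (f n z) := by
  have h : Eff S fun n p => g n p.left := by
    obtain ⟨d, Q, hg⟩ := hg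
    refine ⟨.comp d (.pair (.prim .fst) (.comp (.prim .fst) (.prim .snd))),
      20 * Polynomial.X + 10 + Q, fun n z => ?_⟩
    have h1 := Impl.pair (.prim .fst (Data.cons (S.pub n) z))
      (Impl.comp (.prim .snd (Data.cons (S.pub n) z)) (g := .prim .fst)
        (κ := fun y => PMF.pure (y.left)) (t₂ := 1 + z.size + z.size) fun y hy => by
        obtain rfl : y = z := by simpa [Prim.apply] using hy
        have := (Impl.prim .fst y).mono (t' := 1 + y.size + y.size)
        cases y with
        | num m => simpa [Prim.apply, Data.size] using this
        | cons a b => exact this (by simp [Prim.apply, Data.size]; omega))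
    simp only [Prim.apply, PMF.pure_bind, PMF.pure_map] at h1
    have h2 := Impl.comp h1 (g := d) (κ := fun _ => g n z.left)
      (t₂ := Q.eval (S.len n z)) fun w hw => by
        obtain rfl : w = Data.cons (S.pub n) z.left := by simpa using hw
        exact (hg n z.left).mono (poly_mono Q (Params.len_mono z.left_size_le))
    simp only [PMF.pure_bind] at h2
    refine h2.mono ?_
    simp only [Polynomial.eval_add, Polynomial.eval_mul, Polynomial.eval_ofNat, Polynomial.eval_X]
    simp only [Params.len, Data.size]
    omega
  have := Eff.bind (g := fun n z y => g n y) hf h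
  simpa only [PMF.pure_bind] using this

theorem Eff.map {f : ℕ → Data → PMF Data} {g : ℕ → Data → Data → Data} (hf : Eff S f)
    (hg : EffD S fun n p => g n p.right p.left) : Eff S fun n z => (f n z).map (g n z) :=
  Eff.bind (g := fun n z y => PMF.pure (g n z y)) hf hg

/-- Local definitions. -/
theorem EffD.let {f : ℕ → Data → Data} {g : ℕ → Data → Data → Data} (hf : EffD S f)
    (hg : EffD S fun n p => g n p.right p.left) : EffD S fun n z => g n z (f n z) := by
  unfold EffD
  simpa only [PMF.pure_bind] using
    Eff.bind (g := fun n z y => PMF.pure (g n z y)) hf hg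

theorem EffD.polynomial_size {f : ℕ → Data → Data} (hf : EffD S f) :
    ∃ P : Polynomial ℕ, ∀ n z, (f n z).size ≤ P.eval (S.len n z) := by
  obtain ⟨c, P, hf⟩ := hf
  exact ⟨P, fun n z => (hf n z).2 _ (by simp)⟩

theorem EffN.const (k : ℕ) : EffN S fun _ _ => k := EffD.const (num k)

theorem EffN.add {f g : ℕ → Data → ℕ} (hf : EffN S f) (hg : EffN S g) :
    EffN S fun n z => f n z + g n z := (EffD.cons hf hg).prim .add

theorem EffN.sub {f g : ℕ → Data → ℕ} (hf : EffN S f) (hg : EffN S g) :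
    EffN S fun n z => f n z - g n z := (EffD.cons hf hg).prim .sub

theorem EffN.mul {f g : ℕ → Data → ℕ} (hf : EffN S f) (hg : EffN S g) :
    EffN S fun n z => f n z * g n z := (EffD.cons hf hg).prim .mul

theorem EffN.div {f g : ℕ → Data → ℕ} (hf : EffN S f) (hg : EffN S g) :
    EffN S fun n z => f n z / g n z := (EffD.cons hf hg).prim .div

theorem EffN.mod {f g : ℕ → Data → ℕ} (hf : EffN S f) (hg : EffN S g) :
    EffN S fun n z => f n z % g n z := (EffD.cons hf hg).prim .mod

theorem EffN.size {f : ℕ → Data → Data} (hf : EffD S f) : EffN S fun n z => (f n z).size := by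
  have := hf.prim .size
  unfold EffN
  convert this using 4 with n z
  simp only []
  cases f n z <;> rfl

theorem EffN.toNat {f : ℕ → Data → Data} (hf : EffD S f) : EffN S fun n z => (f n z).toNat := by
  have := (hf.cons (EffD.const (num 0))).prim .add
  unfold EffN
  convert this using 4 with n z
  simp only []
  cases f n z <;> rfl

theorem EffN.polynomial (T : Polynomial ℕ) {f : ℕ → Data → ℕ} (hf : EffN S f) :
    EffN S fun n z => T.eval (f n z) := by
  induction T using Polynomial.induction_on with
  | C a => simpa using EffN.const a
  | add p q hp hq => simpa using hp.add hq
  | monomial k a h =>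
    simp only [Polynomial.eval_mul, Polynomial.eval_C, Polynomial.eval_pow, Polynomial.eval_X,
      pow_succ, ← mul_assoc] at h ⊢
    exact h.mul hf

theorem EffN.ite_le {a b f g : ℕ → Data → ℕ} (ha : EffN S a) (hb : EffN S b) (hf : EffN S f)
    (hg : EffN S g) : EffN S fun n z => if a n z ≤ b n z then f n z else g n z := by
  have := EffD.ite_eq (EffN.sub ha hb) (EffN.const 0) hf hg
  unfold EffN
  convert this using 4 with n z
  by_cases h : a n z ≤ b n z
  · simp [h]
  · simp [h, Nat.sub_eq_zero_iff_le]

theorem EffD.ite_le {a b : ℕ → Data → ℕ} {f g : ℕ → Data → Data} (ha : EffN S a) (hb : EffN S b)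
    (hf : EffD S f) (hg : EffD S g) :
    EffD S fun n z => if a n z ≤ b n z then f n z else g n z := by
  have := EffD.ite_eq (EffN.sub ha hb) (EffN.const 0) hf hg
  convert this using 4 with n z
  by_cases h : a n z ≤ b n z
  · simp [h]
  · simp [h, Nat.sub_eq_zero_iff_le]

theorem Eff.ite_le {a b : ℕ → Data → ℕ} {f g : ℕ → Data → PMF Data} (ha : EffN S a)
    (hb : EffN S b) (hf : Eff S f) (hg : Eff S g) :
    Eff S fun n z => if a n z ≤ b n z then f n z else g n z := by
  have := Eff.ite_eq (EffN.sub ha hb) (EffN.const 0) hf hg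
  convert this using 4 with n z
  simp [Nat.sub_eq_zero_iff_le]

theorem EffN.min {a b : ℕ → Data → ℕ} (ha : EffN S a) (hb : EffN S b) :
    EffN S fun n z => Min.min (a n z) (b n z) := by
  simpa only [min_def] using EffN.ite_le ha hb ha hb

theorem Eff.uniform {f : ℕ → Data → ℕ} (hf : EffN S f) :
    Eff S fun n z => (uniformUpTo (f n z)).map num := by
  obtain ⟨c, P, hf⟩ := hf
  refine ⟨.comp .rnd c, 2 * Polynomial.X + 10 + 4 * P, fun n z => ?_⟩
  have h := Impl.comp (hf n z) (g := .rnd) (κ := fun y => (uniformUpTo (f n z)).map num)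
    (t₂ := 1 + P.eval (S.len n z)) fun y hy => by
      have := (hf n z).2 y hy
      obtain rfl : y = num (f n z) := by simpa using hy
      exact (Impl.rnd _).mono (by omega)
  simp only [PMF.pure_bind] at h
  refine h.mono ?_
  simp only [Polynomial.eval_add, Polynomial.eval_mul, Polynomial.eval_ofNat, Polynomial.eval_X]
  simp only [Params.len]
  omega

theorem iter_succ' (f : Data → PMF Data) (k : ℕ) (z : Data) :
    iter f (k + 1) z = (iter f k z).bind f := by
  induction k generalizing z with
  | zero => simp [iter, PMF.pure_bind, PMF.bind_pure]
  | succ k ih =>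
    rw [iter, iter, PMF.bind_bind]
    congr 1
    funext w
    exact ih w

/-- Iteration of a function a polynomial number of times, provided that the sizes of the
intermediate values remain polynomially bounded. Polynomial running time of a single step alone
would not do, since the sizes might double at each step. -/
theorem Eff.iter {f : ℕ → Data → PMF Data} {N : ℕ → Data → ℕ} {init : ℕ → Data → Data}
    (hf : Eff S f) (hN : EffN S N) (hinit : EffD S init) (R : Polynomial ℕ)
    (hNR : ∀ n z, N n z ≤ R.eval (S.len n z))
    (hR : ∀ n z k, k ≤ N n z → ∀ w ∈ (iter (f n) k (init n z)).support,
      w.size ≤ R.eval (S.len n z)) :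
    Eff S fun n z => OAKE.iter (f n) (N n z) (init n z) := by
  obtain ⟨c, P, hf⟩ := hf
  obtain ⟨cN, PN, hN⟩ := hN
  obtain ⟨ci, Pi, hinit⟩ := hinit
  let body : Code := .pair (.comp (.prim .sub) (.pair (.prim .fst) (.const (num 1))))
    (.pair (.comp (.prim .fst) (.prim .snd)) (.comp c (.prim .snd)))
  let A : Polynomial ℕ := PN + Polynomial.X + R + 10
  let M : Polynomial ℕ := 40 * A + P.comp (Polynomial.X + R)
  refine ⟨.comp (.comp (.prim .snd) (.prim .snd)) (.comp (.loop (.prim .fst) body)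
    (.pair cN (.pair (.prim .fst) ci))),
    20 * Polynomial.X + 20 + PN + Pi + (1 + M + (R + 1) * (3 * M + 3)) + 20 * A, fun n z => ?_⟩
  set L := S.len n z with hL
  have hAe : A.eval L = PN.eval L + L + R.eval L + 10 := by simp [A]
  have hMe : M.eval L = 40 * A.eval L + P.eval (L + R.eval L) := by simp [M]
  have hpub : n + (S.pub n).size + 2 ≤ L := by
    simp only [hL, Params.len, Data.size]
    have := one_le_size z
    omega
  have hNs : ∀ k, k ≤ N n z → (num k).size ≤ PN.eval L := fun k hk => by
    have := (hN n z).2 _ ((PMF.mem_support_pure_iff _ _).2 rfl)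
    have h2 := Nat.size_le_size hk
    simp only [Data.size, ← hL] at this ⊢
    omega
  let I : ℕ → Data → Prop := fun k w => ∃ j, j + k = N n z ∧
    w ∈ (OAKE.iter (f n) j (init n z)).support
  have hIs : ∀ k w, I k w → w.size ≤ R.eval L := fun k w ⟨j, hj, hw⟩ =>
    hR n z j (by omega) w hw
  have hInum : ∀ k w, I k w → (num k).size ≤ PN.eval L := fun k w ⟨j, hj, _⟩ => hNs k (by omega)
  have hsz : ∀ k w, I k w → (Data.cons (num k) (Data.cons (S.pub n) w)).size ≤ A.eval L := by
    intro k w h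
    have h1 := hIs k w h
    have h2 := hInum k w h
    rw [hAe, size_cons, size_cons]
    omega
  have hbody : ∀ k w, I (k + 1) w → Impl body (Data.cons (num (k + 1)) (Data.cons (S.pub n) w))
      (M.eval L) ((f n w).map fun z' => Data.cons (num k) (Data.cons (S.pub n) z')) := by
    intro k w h
    have hw := hIs _ w h
    have hs := hsz _ w h
    have hk := hInum _ w h
    have hf' := (hf n w).mono (t' := P.eval (L + R.eval L)) (poly_mono P (by
      simp only [Params.len, Data.size]
      omega))
    have hpw : (Data.cons (S.pub n) w).size ≤ A.eval L := by
      simp only [Data.size] at hs ⊢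
      omega
    set x := Data.cons (num (k + 1)) (Data.cons (S.pub n) w) with hx
    have h1 : Impl (.pair (.prim .fst) (.const (num 1))) x (8 * A.eval L)
        (PMF.pure (Data.cons (num (k + 1)) (num 1))) := by
      have := Impl.pair (.prim .fst x) (.const (num 1) x)
      simp only [hx, Prim.apply, PMF.pure_bind, PMF.pure_map] at this
      refine this.mono ?_
      rw [← hx]
      have : (num 1).size = 2 := rfl
      omega
    have h2 : Impl (.comp (.prim .sub) (.pair (.prim .fst) (.const (num 1)))) x (12 * A.eval L)
        (PMF.pure (num k)) := by
      have := Impl.comp h1 (g := .prim .sub) (κ := fun _ => PMF.pure (num k))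
        (t₂ := 2 * A.eval L) (fun y hy => by
          obtain rfl : y = Data.cons (num (k + 1)) (num 1) := by simpa using hy
          have := Impl.prim .sub (Data.cons (num (k + 1)) (num 1))
          simp only [Prim.apply, Nat.add_sub_cancel] at this
          refine this.mono ?_
          have h1 : (num k).size ≤ (num (k + 1)).size := by
            simp only [Data.size]
            have := Nat.size_le_size (Nat.le_add_right k 1)
            omega
          have h2 : (num 1).size = 2 := rfl
          have h3 : (num (k + 1)).size ≤ PN.eval L := hInum _ w h
          rw [size_cons]
          omega)
      simp only [PMF.pure_bind] at this
      refine this.mono ?_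
      omega
    have h3 : Impl (.comp (.prim .fst) (.prim .snd)) x (8 * A.eval L) (PMF.pure (S.pub n)) := by
      have := Impl.comp (.prim .snd x) (g := .prim .fst) (κ := fun _ => PMF.pure (S.pub n))
        (t₂ := 3 * A.eval L) (fun y hy => by
          obtain rfl : y = Data.cons (S.pub n) w := by simpa [Prim.apply, hx] using hy
          refine (Impl.prim .fst (Data.cons (S.pub n) w)).mono ?_
          simp only [Prim.apply]
          omega)
      simp only [hx, Prim.apply, PMF.pure_bind] at this
      refine this.mono ?_
      rw [← hx]
      omega
    have h4 : Impl (.comp c (.prim .snd)) x (4 * A.eval L + P.eval (L + R.eval L)) (f n w) := by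
      have := Impl.comp (.prim .snd x) (g := c) (κ := fun _ => f n w)
        (t₂ := P.eval (L + R.eval L)) (fun y hy => by
          obtain rfl : y = Data.cons (S.pub n) w := by simpa [Prim.apply, hx] using hy
          exact hf')
      simp only [hx, Prim.apply, PMF.pure_bind] at this
      refine this.mono ?_
      rw [← hx]
      omega
    have := Impl.pair h2 (Impl.pair h3 h4)
    simp only [PMF.pure_bind, PMF.map_comp, Function.comp_def] at this
    refine this.mono ?_
    omega
  have hloop := Impl.loop_countdown (p := S.pub n) (f := f n) (M := M.eval L) I
    (fun k w ⟨j, hj, hw⟩ w' hw' => ⟨j + 1, by omega, by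
      rw [iter_succ']
      exact (PMF.mem_support_bind_iff _ _ _).2 ⟨w, hw, hw'⟩⟩)
    (fun k w h => (hsz k w h).trans (by omega)) hbody (N n z) (init n z)
    ⟨0, by omega, by simp [OAKE.iter]⟩
  have h0 : Impl (.pair cN (.pair (.prim .fst) ci)) (Data.cons (S.pub n) z)
      (6 * L + 6 + PN.eval L + Pi.eval L)
      (PMF.pure (Data.cons (num (N n z)) (Data.cons (S.pub n) (init n z)))) := by
    have := Impl.pair (hN n z) (Impl.pair (.prim .fst (Data.cons (S.pub n) z)) (hinit n z))
    simp only [Prim.apply, PMF.pure_bind, PMF.pure_map] at this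
    refine this.mono ?_
    have : (Data.cons (S.pub n) z).size ≤ L := by simp only [hL, Params.len]; omega
    rw [← hL]
    omega
  have h1 := Impl.comp h0 (g := .loop (.prim .fst) body)
    (κ := fun _ => (OAKE.iter (f n) (N n z) (init n z)).map
      fun z' => Data.cons (num 0) (Data.cons (S.pub n) z'))
    (t₂ := 1 + M.eval L + (N n z + 1) * (3 * M.eval L + 3)) (fun y hy => by
      obtain rfl : y = Data.cons (num (N n z)) (Data.cons (S.pub n) (init n z)) := by simpa using hy
      exact hloop)
  simp only [PMF.pure_bind] at h1
  have h2 := Impl.comp h1 (g := .comp (.prim .snd) (.prim .snd))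
    (κ := fun w => PMF.pure w.right.right) (t₂ := 10 * A.eval L) (fun y hy => by
      obtain ⟨w, hw, rfl⟩ := (PMF.mem_support_map_iff _ _ _).1 hy
      have hw' := hsz 0 w ⟨N n z, by omega, hw⟩
      have := Impl.comp (.prim .snd (Data.cons (num 0) (Data.cons (S.pub n) w))) (g := .prim .snd)
        (κ := fun y => PMF.pure y.right) (t₂ := 3 * A.eval L) (fun y hy => by
          obtain rfl : y = Data.cons (S.pub n) w := by simpa [Prim.apply] using hy
          refine (Impl.prim .snd _).mono ?_
          simp only [Prim.apply]
          simp only [Data.size] at hw' ⊢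
          omega)
      simp only [Prim.apply, PMF.pure_bind, right_cons] at this ⊢
      refine this.mono ?_
      have : (num 0).size = 1 := rfl
      simp only [Data.size] at hw' ⊢
      omega)
  simp only [PMF.bind_map, Function.comp_def, right_cons, PMF.bind_pure] at h2
  refine h2.mono ?_
  simp only [Polynomial.eval_add, Polynomial.eval_mul, Polynomial.eval_ofNat, Polynomial.eval_X,
    Polynomial.eval_one]
  have : (Data.cons (S.pub n) z).size ≤ L := by simp only [hL, Params.len]; omega
  have hle : (N n z + 1) * (3 * M.eval L + 3) ≤ (R.eval L + 1) * (3 * M.eval L + 3) :=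
    Nat.mul_le_mul_right _ (by have := hNR n z; rw [← hL] at this; omega)
  omega

/-- Deterministic iteration. -/
theorem EffD.iterate {f : ℕ → Data → Data} {N : ℕ → Data → ℕ} {init : ℕ → Data → Data}
    (hf : EffD S f) (hN : EffN S N) (hinit : EffD S init) (R : Polynomial ℕ)
    (hNR : ∀ n z, N n z ≤ R.eval (S.len n z))
    (hR : ∀ n z k, k ≤ N n z → ((f n)^[k] (init n z)).size ≤ R.eval (S.len n z)) :
    EffD S fun n z => (f n)^[N n z] (init n z) := by
  have key : ∀ n k z, OAKE.iter (fun z => PMF.pure (f n z)) k z = PMF.pure ((f n)^[k] z) := by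
    intro n k
    induction k with
    | zero => intro z; rfl
    | succ k ih => intro z; simp [OAKE.iter, ih]
  have := Eff.iter hf hN hinit R hNR fun n z k hk w hw => by
    rw [key, PMF.mem_support_pure_iff] at hw
    exact hw ▸ hR n z k hk
  unfold EffD
  simpa only [key] using this

theorem EffN.two_pow {f : ℕ → Data → ℕ} (hf : EffN S f) (R : Polynomial ℕ)
    (hR : ∀ n z, f n z ≤ R.eval (S.len n z)) : EffN S fun n z => 2 ^ f n z := by
  have key : ∀ k : ℕ, (fun z : Data => num (z.toNat + z.toNat))^[k] (num 1) = num (2 ^ k) := by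
    intro k
    induction k with
    | zero => rfl
    | succ k ih =>
      rw [Function.iterate_succ_apply', ih]
      simp only [toNat_num, pow_succ]
      congr 1
      omega
  have := EffD.iterate (f := fun _ z => num (z.toNat + z.toNat)) (init := fun _ _ => num 1)
    ((EffN.toNat Eff.id).add (EffN.toNat Eff.id)) hf (EffD.const (num 1)) (R + 2)
    (fun n z => by simpa using (hR n z).trans (by omega)) (fun n z k hk => by
      rw [key, Data.size, Nat.size_pow]
      have := hR n z
      simp only [Polynomial.eval_add, Polynomial.eval_ofNat]
      omega)
  unfold EffN
  simpa only [key] using this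

end OAKE

end

noncomputable section

namespace OAKE

open Data

variable {S : Params}

/-! ### Arithmetic in the group -/

/-- A code for inputs of a special form yields an efficient function. -/
theorem Eff.of_impl {h : ℕ → Data → Data} {F : ℕ → Data → PMF Data} (hh : EffD S h) (c : Code)
    (P : Polynomial ℕ)
    (hc : ∀ n z, Impl c (cons (S.pub n) (h n z)) (P.eval (S.len n z)) (F n z)) : Eff S F := by
  obtain ⟨d, Q, hd⟩ := hh
  refine ⟨.comp c (.pair (.prim .fst) d), 10 * Polynomial.X + 10 + Q + P, fun n z => ?_⟩
  have h1 := Impl.pair (.prim .fst (cons (S.pub n) z)) (hd n z)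
  simp only [Prim.apply, PMF.pure_bind, PMF.pure_map] at h1
  have h2 := Impl.comp h1 (g := c) (κ := fun _ => F n z) (t₂ := P.eval (S.len n z)) (fun y hy => by
    obtain rfl : y = cons (S.pub n) (h n z) := by simpa using hy
    exact hc n z)
  simp only [PMF.pure_bind] at h2
  refine h2.mono ?_
  simp only [Polynomial.eval_add, Polynomial.eval_mul, Polynomial.eval_ofNat, Polynomial.eval_X]
  simp only [Params.len, Data.size]
  omega

theorem EffN.security : EffN S fun n _ => n := by
  have := EffN.toNat (EffD.left (EffD.pub (S := S)))
  simpa [Params.pub, tuple] using this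

theorem EffN.order : EffN S fun n _ => S.q n := by
  have := EffN.toNat (EffD.left (EffD.right (EffD.pub (S := S))))
  simpa [Params.pub, tuple] using this

theorem EffD.generator : EffD S fun n _ => S.elem n (S.g n) := by
  have := EffD.left (EffD.right (EffD.right (EffD.pub (S := S))))
  simpa [Params.pub, tuple] using this

theorem EffN.keyLen : EffN S fun n _ => S.keyLen n := by
  have := EffN.toNat (EffD.left (EffD.right (EffD.right (EffD.right (EffD.pub (S := S))))))
  simpa [Params.pub, tuple] using this

namespace Params

open Classical in
/-- The group element encoded by a value, if there is one. -/
def dec (S : Params) (n : ℕ) (x : Data) : Option (S.G n) :=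
  if h : ∃ a, S.elem n a = x then some h.choose else none

theorem elem_injective (n : ℕ) : Function.Injective (S.elem n) := fun a b h => by
  simp only [elem, num.injEq] at h
  exact S.enc_injective n h

@[simp] theorem elem_inj {n : ℕ} {a b : S.G n} : S.elem n a = S.elem n b ↔ a = b :=
  (elem_injective n).eq_iff

@[simp] theorem dec_elem (n : ℕ) (a : S.G n) : S.dec n (S.elem n a) = some a := by
  have h : ∃ b, S.elem n b = S.elem n a := ⟨a, rfl⟩
  rw [dec, dif_pos h, elem_injective n h.choose_spec]

theorem dec_eq_some {n : ℕ} {x : Data} {a : S.G n} : S.dec n x = some a ↔ x = S.elem n a := by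
  constructor
  · intro h
    by_cases hx : ∃ b, S.elem n b = x
    · obtain ⟨b, rfl⟩ := hx
      rw [dec_elem, Option.some.injEq] at h
      rw [h]
    · simp [dec, hx] at h
  · rintro rfl
    exact dec_elem n a

/-- Product of two encoded group elements; `num 0` for values that encode no group elements. -/
def mulD (S : Params) (n : ℕ) (x y : Data) : Data :=
  match S.dec n x, S.dec n y with
  | some a, some b => S.elem n (a * b)
  | _, _ => num 0

@[simp] theorem mulD_elem (n : ℕ) (a b : S.G n) :
    S.mulD n (S.elem n a) (S.elem n b) = S.elem n (a * b) := by
  simp [mulD]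

/-- Does a value encode a group element? -/
def memD (S : Params) (n : ℕ) (x : Data) : Data := ofBool (S.dec n x).isSome

theorem memD_eq_one {n : ℕ} {x : Data} : S.memD n x = num 1 ↔ ∃ a, x = S.elem n a := by
  simp only [← dec_eq_some, memD]
  cases S.dec n x <;> simp [ofBool]

theorem q_pos (n : ℕ) : 0 < S.q n := (S.prime n).pos

theorem pow_q (n : ℕ) (a : S.G n) : a ^ S.q n = 1 := by
  rw [← S.card n]
  exact pow_card_eq_one'

theorem pow_eq_pow_of_cast {n : ℕ} (a : S.G n) {i j : ℕ} (h : (i : ZMod (S.q n)) = j) :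
    a ^ i = a ^ j := by
  rw [ZMod.natCast_eq_natCast_iff] at h
  rw [pow_eq_pow_iff_modEq]
  exact h.of_dvd (orderOf_dvd_of_pow_eq_one (pow_q n a))

theorem orderOf_g (n : ℕ) : orderOf (S.g n) = S.q n := by
  rw [orderOf_eq_card_of_forall_mem_zpowers (S.generates n), S.card]

theorem g_pow_eq_iff {n i j : ℕ} : S.g n ^ i = S.g n ^ j ↔ (i : ZMod (S.q n)) = j := by
  rw [ZMod.natCast_eq_natCast_iff, pow_eq_pow_iff_modEq, orderOf_g]

theorem exists_pow (n : ℕ) (a : S.G n) : ∃ i, a = S.g n ^ i := by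
  classical
  have : Finite (S.G n) := Nat.finite_of_card_ne_zero (by rw [S.card]; exact (q_pos n).ne')
  obtain ⟨i, -, hi⟩ := (isOfFinOrder_of_finite (S.g n)).mem_zpowers_iff_mem_range_orderOf.1
    (S.generates n a) |> Finset.mem_image.1
  exact ⟨i, hi.symm⟩

/-- A polynomial bound for the sizes of group elements, of the group order, of the security
parameter and of session keys. -/
theorem Efficient.exists_bound (hS : S.Efficient) : ∃ L : Polynomial ℕ, ∀ n,
    (∀ a : S.G n, (S.elem n a).size ≤ L.eval n) ∧ Nat.size (S.q n) + 1 ≤ L.eval n ∧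
      S.keyLen n + 1 ≤ L.eval n ∧ (S.pub n).size ≤ L.eval n ∧ n + 1 ≤ L.eval n := by
  obtain ⟨T, hT⟩ := hS.size_le
  refine ⟨4 * T + 2 * Polynomial.X + 20, fun n => ?_⟩
  obtain ⟨h1, h2, h3⟩ := hT n
  simp only [Polynomial.eval_add, Polynomial.eval_mul, Polynomial.eval_ofNat, Polynomial.eval_X]
  have hq : S.q n ≤ 2 ^ T.eval n := by
    have hlt : ∀ a : S.G n, S.enc n a < 2 ^ T.eval n := fun a => by
      have := h3 a
      simp only [elem, Data.size] at this
      exact Nat.size_le.1 (by omega)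
    have : Function.Injective (fun a : S.G n => (⟨S.enc n a, hlt a⟩ : Fin (2 ^ T.eval n))) :=
      fun a b h => S.enc_injective n (by simpa using h)
    have := Nat.card_le_card_of_injective _ this
    rwa [S.card, Nat.card_eq_fintype_card, Fintype.card_fin] at this
  have hq' : Nat.size (S.q n) ≤ T.eval n + 1 := Nat.size_le.2 (by
    have := Nat.two_pow_pos (T.eval n)
    rw [pow_succ]
    omega)
  have hn : Nat.size n ≤ n := Nat.size_le.2 (Nat.lt_two_pow_self)
  have hk : Nat.size (S.keyLen n) ≤ S.keyLen n := Nat.size_le.2 (Nat.lt_two_pow_self)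
  have hg := h3 (S.g n)
  refine ⟨fun a => (h3 a).trans (by omega), by omega, by omega, ?_, by omega⟩
  simp only [pub, tuple, Data.size, Nat.size_zero]
  omega

end Params

/-- The membership test is specified for numbers only, and pairs never encode group elements. -/
theorem EffD.memD (hS : S.Efficient) {f : ℕ → Data → Data} (hf : EffD S f) :
    EffD S fun n z => S.memD n (f n z) := by
  obtain ⟨c, T, hc⟩ := hS.mem
  have h1 : EffD S fun n z => S.memD n (num z.toNat) := by
    refine Eff.of_impl (h := fun _ z => Data.cons (num z.toNat) (num 0))
      ((EffN.toNat Eff.id).cons (EffD.const _)) c (T + 2) fun n z => ?_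
    have := (hc n z.toNat).impl
    classical
    have hmem : ofBool (decide (z.toNat ∈ Set.range (S.enc n))) = S.memD n (num z.toNat) := by
      have : z.toNat ∈ Set.range (S.enc n) ↔ (S.dec n (num z.toNat)).isSome = true := by
        simp only [Option.isSome_iff_exists, Params.dec_eq_some, Params.elem, num.injEq]
        exact ⟨fun ⟨a, h⟩ => ⟨a, h.symm⟩, fun ⟨a, h⟩ => ⟨a, h.symm⟩⟩
      rw [Params.memD]
      congr 1
      rw [Bool.eq_iff_iff, decide_eq_true_iff]
      exact this
    rw [hmem] at this
    refine this.mono ?_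
    have hz : (S.memD n (num z.toNat)).size ≤ 2 := by
      unfold Params.memD
      cases (S.dec n (num z.toNat)).isSome <;> decide
    have hT : T.eval (n + Nat.size z.toNat) ≤ T.eval (S.len n z) := poly_mono T (by
      have : Nat.size z.toNat ≤ z.size := by cases z <;> simp [Data.toNat, Data.size]
      simp only [Params.len, Data.size]
      omega)
    simp only [Polynomial.eval_add, Polynomial.eval_ofNat]
    omega
  have h2 : EffD S fun n z => S.memD n z := by
    convert EffD.ite_eq Eff.id (EffN.toNat Eff.id) h1 (EffD.const (num 0)) using 4 with n z
    cases z with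
    | num m => simp
    | cons a b => simp [Params.memD, Params.dec, Params.elem, ofBool]
  exact h2.comp hf

/-- The multiplication program is specified for encodings of group elements only, so other
arguments are replaced by the generator before it is called. -/
theorem EffD.mulD (hS : S.Efficient) {f g : ℕ → Data → Data} (hf : EffD S f) (hg : EffD S g) :
    EffD S fun n z => S.mulD n (f n z) (g n z) := by
  obtain ⟨c, T, hc⟩ := hS.mul
  obtain ⟨L, hL⟩ := hS.exists_bound
  let x : ℕ → Data → Data := fun n z => if S.memD n z.left = num 1 then z.left else S.elem n (S.g n)
  let y : ℕ → Data → Data := fun n z => if S.memD n z.right = num 1 then z.right else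
    S.elem n (S.g n)
  have hx : EffD S x := EffD.ite_eq (EffD.memD hS (EffD.left Eff.id)) (EffD.const _)
    (EffD.left Eff.id) EffD.generator
  have hy : EffD S y := EffD.ite_eq (EffD.memD hS (EffD.right Eff.id)) (EffD.const _)
    (EffD.right Eff.id) EffD.generator
  have hxe : ∀ n z, ∃ a, x n z = S.elem n a := fun n z => by
    by_cases h : S.memD n z.left = num 1
    · simpa only [x, h, if_true] using Params.memD_eq_one.1 h
    · exact ⟨S.g n, by simp [x, h]⟩
  have hye : ∀ n z, ∃ a, y n z = S.elem n a := fun n z => by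
    by_cases h : S.memD n z.right = num 1
    · simpa only [y, h, if_true] using Params.memD_eq_one.1 h
    · exact ⟨S.g n, by simp [y, h]⟩
  have h1 : EffD S fun n z => S.mulD n (x n z) (y n z) := by
    refine Eff.of_impl (h := fun n z => Data.cons (x n z) (Data.cons (y n z) (num 0)))
      (hx.cons (hy.cons (EffD.const _))) c (T + L) fun n z => ?_
    obtain ⟨a, ha⟩ := hxe n z
    obtain ⟨b, hb⟩ := hye n z
    simp only [ha, hb, Params.mulD_elem]
    refine (hc n a b).impl.mono ?_
    have hl : n ≤ S.len n z := by simp [Params.len]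
    have h2 := (hL n).1 (a * b)
    have h3 := poly_mono T hl
    have h4 := poly_mono L hl
    simp only [Polynomial.eval_add]
    omega
  have h2 : EffD S fun n z => S.mulD n z.left z.right := by
    convert EffD.ite_eq (EffD.memD hS (EffD.left Eff.id)) (EffD.const (num 1))
      (EffD.ite_eq (EffD.memD hS (EffD.right Eff.id)) (EffD.const (num 1)) h1
        (EffD.const (num 0))) (EffD.const (num 0)) using 4 with n z
    by_cases h : S.memD n z.left = num 1
    · by_cases h' : S.memD n z.right = num 1
      · simp [x, y, h, h']
      · simp only [h, h', if_true, if_false]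
        have : S.dec n z.right = none := by
          simp only [Params.memD, ofBool] at h'
          cases hd : S.dec n z.right <;> simp_all
        simp only [Params.mulD, this]
        split <;> simp_all
    · simp only [h, if_false]
      have : S.dec n z.left = none := by
        simp only [Params.memD, ofBool] at h
        cases hd : S.dec n z.left <;> simp_all
      simp only [Params.mulD, this]
  simpa using h2.comp (hf.cons hg)

/-- One step of fast exponentiation; the state consists of the base, the exponent and the
accumulator. -/
def powStep (op : Data → Data → Data) (w : Data) : Data :=
  cons (op w.left w.left) (cons (num (w.right.left.toNat / 2))
    (if num (w.right.left.toNat % 2) = num 0 then w.right.right else op w.right.right w.left))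

/-- Fast exponentiation for the operation `op`, with an initial value `acc`. -/
def powOp (op : Data → Data → Data) (acc base : Data) (k : ℕ) : Data :=
  ((powStep op)^[(num k).size] (cons base (cons (num k) acc))).right.right

theorem powOp_eq {M : Type} [Monoid M] {φ : M → Data} {op : Data → Data → Data}
    (hop : ∀ a b, op (φ a) (φ b) = φ (a * b)) (c a : M) (k : ℕ) :
    powOp op (φ c) (φ a) k = φ (c * a ^ k) := by
  have key : ∀ j, (powStep op)^[j] (cons (φ a) (cons (num k) (φ c))) =
      cons (φ (a ^ 2 ^ j)) (cons (num (k / 2 ^ j)) (φ (c * a ^ (k % 2 ^ j)))) := by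
    intro j
    induction j with
    | zero => simp [Nat.mod_one]
    | succ j ih =>
      rw [Function.iterate_succ_apply', ih]
      simp only [powStep, left_cons, right_cons, toNat_num, hop, Nat.div_div_eq_div_mul,
        ← pow_succ, Nat.mod_pow_succ, num.injEq]
      have h1 : a ^ 2 ^ j * a ^ 2 ^ j = a ^ 2 ^ (j + 1) := by rw [← pow_add, pow_succ, mul_two]
      rw [h1]
      congr 2
      rcases Nat.mod_two_eq_zero_or_one (k / 2 ^ j) with h | h
      · simp [h]
      · simp [h, pow_add, mul_assoc]
  have hk : k < 2 ^ (num k).size :=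
    (Nat.lt_size_self k).trans_le (Nat.pow_le_pow_right (by omega) (by simp [Data.size]))
  rw [powOp, key, right_cons, right_cons, Nat.mod_eq_of_lt hk]

/-- Fast exponentiation is efficient if the values of `op` have polynomial size. -/
theorem EffD.powOp {op : ℕ → Data → Data → Data} (hop : EffD S fun n z => op n z.left z.right)
    (B : Polynomial ℕ) (hB : ∀ n x y, (op n x y).size ≤ B.eval n) {c a : ℕ → Data → Data}
    {k : ℕ → Data → ℕ} (hc : EffD S c) (ha : EffD S a) (hk : EffN S k) :
    EffD S fun n z => OAKE.powOp (op n) (c n z) (a n z) (k n z) := by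
  have hop' : ∀ {f g : ℕ → Data → Data}, EffD S f → EffD S g →
      EffD S fun n z => op n (f n z) (g n z) := fun hf hg => by
    simpa using hop.comp (hf.cons hg)
  have hw : EffD S fun _ w => w := Eff.id
  have hstep : EffD S fun n w => powStep (op n) w :=
    (hop' hw.left hw.left).cons (((EffN.toNat hw.right.left).div (EffN.const 2)).cons
      (EffD.ite_eq ((EffN.toNat hw.right.left).mod (EffN.const 2)) (EffD.const _) hw.right.right
        (hop' hw.right.right hw.left)))
  obtain ⟨P, hP⟩ := ha.polynomial_size
  obtain ⟨Q, hQ⟩ := hc.polynomial_size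
  obtain ⟨R, hR⟩ := EffD.polynomial_size (f := fun n z => num (k n z)) hk
  have key : ∀ n z j, ∃ x i y, (powStep (op n))^[j] (Data.cons (a n z)
      (Data.cons (num (k n z)) (c n z))) = Data.cons x (Data.cons (num i) y) ∧
      x.size ≤ P.eval (S.len n z) + B.eval n ∧ i ≤ k n z ∧
      y.size ≤ Q.eval (S.len n z) + B.eval n := by
    intro n z j
    induction j with
    | zero => exact ⟨_, _, _, rfl, (hP n z).trans (by omega), le_rfl, (hQ n z).trans (by omega)⟩
    | succ j ih =>
      obtain ⟨x, i, y, h, hx, hi, hy⟩ := ih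
      rw [Function.iterate_succ_apply', h]
      refine ⟨op n x x, i / 2, if num (i % 2) = num 0 then y else op n y x, rfl,
        (hB n _ _).trans (by omega), by omega, ?_⟩
      · split_ifs
        · exact hy
        · exact (hB n _ _).trans (by omega)
  have hit : EffD S fun n z => (powStep (op n))^[(num (k n z)).size]
      (Data.cons (a n z) (Data.cons (num (k n z)) (c n z))) := by
    refine EffD.iterate (N := fun n z => (num (k n z)).size) hstep (EffN.size hk)
      (ha.cons (EffD.cons hk hc)) (P + Q + R + 2 * B + 3) (fun n z => ?_) (fun n z j _ => ?_)
    · refine (hR n z).trans ?_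
      simp only [Polynomial.eval_add]
      omega
    · obtain ⟨x, i, y, h, hx, hi, hy⟩ := key n z j
      rw [h]
      have h1 := hR n z
      have h2 := Nat.size_le_size hi
      have h3 : B.eval n ≤ B.eval (S.len n z) := poly_mono B (by simp [Params.len])
      simp only [Data.size, Polynomial.eval_add, Polynomial.eval_mul, Polynomial.eval_ofNat]
        at h1 ⊢
      omega
  exact hit.right.right

namespace Params

/-- Exponentiation of an encoded group element. The exponent is increased by the group order, so
that the accumulator can start with the element itself instead of the neutral element. -/
def powD (S : Params) (n : ℕ) (x : Data) (k : ℕ) : Data :=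
  powOp (S.mulD n) x x (k + (S.q n - 1))

@[simp] theorem powD_elem (n : ℕ) (a : S.G n) (k : ℕ) :
    S.powD n (S.elem n a) k = S.elem n (a ^ k) := by
  rw [powD, powOp_eq (φ := S.elem n) (mulD_elem n), ← pow_succ', add_assoc,
    Nat.sub_add_cancel (q_pos n), pow_add, pow_q, mul_one]

/-- Multiplication modulo the group order. -/
def modMul (S : Params) (n : ℕ) (x y : Data) : Data := num (x.toNat * y.toNat % S.q n)

/-- Inverse modulo the group order, by Fermat's theorem. -/
def invN (S : Params) (n e : ℕ) : ℕ :=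
  (powOp (S.modMul n) (num (e % S.q n)) (num (e % S.q n)) (S.q n - 3)).toNat

theorem invN_mul {n e : ℕ} (hq : 3 ≤ S.q n) (he : ¬ S.q n ∣ e) :
    ((S.invN n e * e : ℕ) : ZMod (S.q n)) = 1 := by
  have : Fact (S.q n).Prime := ⟨S.prime n⟩
  have h1 : num (e % S.q n) = num (e : ZMod (S.q n)).val := by rw [ZMod.val_natCast]
  have h2 := powOp_eq (M := ZMod (S.q n)) (φ := fun a => num a.val) (op := S.modMul n)
    (fun a b => by simp [modMul, ZMod.val_mul]) (e : ZMod (S.q n)) (e : ZMod (S.q n)) (S.q n - 3)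
  have he' : (e : ZMod (S.q n)) ≠ 0 := by rwa [Ne, ZMod.natCast_eq_zero_iff]
  rw [Nat.cast_mul, invN, h1, h2]
  simp only [toNat_num, ZMod.natCast_val, ZMod.cast_id', _root_.id]
  rw [← pow_succ', ← pow_succ, show S.q n - 3 + 1 + 1 = S.q n - 1 by omega]
  exact ZMod.pow_card_sub_one_eq_one he'

end Params

theorem EffD.powD (hS : S.Efficient) {f : ℕ → Data → Data} {k : ℕ → Data → ℕ} (hf : EffD S f)
    (hk : EffN S k) : EffD S fun n z => S.powD n (f n z) (k n z) := by
  obtain ⟨L, hL⟩ := hS.exists_bound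
  refine EffD.powOp (op := S.mulD) (EffD.mulD hS (EffD.left Eff.id) (EffD.right Eff.id)) (L + 1)
    (fun n x y => ?_) hf hf (hk.add (EffN.sub EffN.order (EffN.const 1)))
  rw [Polynomial.eval_add, Polynomial.eval_one, Params.mulD]
  split
  · exact ((hL n).1 _).trans (by omega)
  · simp [Data.size]

theorem EffN.invN (hS : S.Efficient) {k : ℕ → Data → ℕ} (hk : EffN S k) :
    EffN S fun n z => S.invN n (k n z) := by
  obtain ⟨L, hL⟩ := hS.exists_bound
  have hb := EffN.mod hk EffN.order
  refine EffN.toNat (EffD.powOp (op := S.modMul) (EffN.mod ((EffN.toNat (EffD.left Eff.id)).mul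
    (EffN.toNat (EffD.right Eff.id))) EffN.order) (L + 1) (fun n x y => ?_) hb hb
    (EffN.sub EffN.order (EffN.const 3)))
  have h1 := Nat.size_le_size (Nat.mod_lt (x.toNat * y.toNat) (Params.q_pos (S := S) n)).le
  have h2 := (hL n).2.1
  simp only [Polynomial.eval_add, Polynomial.eval_one, Params.modMul, Data.size]
  omega

/-! ### Association lists -/

/-- Value stored under the key `k` in an association list; `num 0` if there is none. -/
def lookup : Data → Data → Data
  | num _, _ => num 0
  | cons p s, k => if p.left = k then p.right else lookup s k

@[simp] theorem lookup_num (m : ℕ) (k : Data) : lookup (num m) k = num 0 := rfl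

@[simp] theorem lookup_cons (k' v s k : Data) :
    lookup (cons (cons k' v) s) k = if k' = k then v else lookup s k := rfl

/-- The lookup loop removes entries from the head of the list until the key is found. -/
theorem EffD.lookup {f g : ℕ → Data → Data} (hf : EffD S f) (hg : EffD S g) :
    EffD S fun n z => OAKE.lookup (f n z) (g n z) := by
  let step : Data → Data := fun w =>
    if w.left.left.left = w.right then w else Data.cons w.left.right w.right
  have hw : EffD S fun _ w => w := Eff.id
  have hstep : EffD S fun _ w => step w :=
    EffD.ite_eq hw.left.left.left hw.right hw (hw.left.right.cons hw.right)
  have hsz : ∀ w j, (step^[j] w).size ≤ 2 * w.size + 1 ∧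
      (step^[j] w).left.size ≤ w.left.size ∧ (step^[j] w).right = w.right := by
    intro w j
    induction j with
    | zero => simp; omega
    | succ j ih =>
      rw [Function.iterate_succ_apply']
      set v := step^[j] w
      simp only [step]
      split_ifs
      · exact ih
      · obtain ⟨h1, h2, h3⟩ := ih
        have h4 := v.left.right_size_le
        have h5 := w.left_size_le
        have h6 := w.right_size_le
        simp only [left_cons, right_cons, h3, size_cons]
        refine ⟨?_, by omega, trivial⟩
        omega
  have hval : ∀ s k j, s.size ≤ j →
      (if (step^[j] (Data.cons s k)).left.left.left = k
        then (step^[j] (Data.cons s k)).left.left.right else num 0) = OAKE.lookup s k := by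
    intro s k j
    have hfix : ∀ w : Data, w.left.left.left = w.right → ∀ j, step^[j] w = w := by
      intro w hw j
      exact Function.iterate_fixed (by simp [step, hw]) j
    induction s generalizing j with
    | num m =>
      intro _
      have : ∀ j, (step^[j] (Data.cons (num m) k)).left.left.right = num 0 := by
        intro j
        have : ∃ i, (step^[j] (Data.cons (num m) k)).left = num i := by
          induction j with
          | zero => exact ⟨m, rfl⟩
          | succ j ih =>
            obtain ⟨i, hi⟩ := ih
            rw [Function.iterate_succ_apply']
            set v := step^[j] (Data.cons (num m) k)
            simp only [step]
            split_ifs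
            · exact ⟨i, hi⟩
            · exact ⟨0, by simp [hi]⟩
        obtain ⟨i, hi⟩ := this
        simp [hi]
      simp [this]
    | cons p s _ ih =>
      intro hj
      rw [OAKE.lookup]
      by_cases hp : p.left = k
      · rw [hfix _ (by simpa using hp)]
        simp [hp]
      · obtain ⟨j, rfl⟩ : ∃ i, j = i + 1 := ⟨j - 1, by
          simp only [Data.size] at hj
          omega⟩
        rw [Function.iterate_succ_apply, if_neg hp]
        have : step (Data.cons (Data.cons p s) k) = Data.cons s k := by simp [step, hp]
        rw [this]
        exact ih j (by simp only [Data.size] at hj; omega)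
  have hit : EffD S fun _ z => step^[z.size] z := by
    refine EffD.iterate (f := fun _ => step) (N := fun _ z => z.size) (init := fun _ z => z) hstep
      (EffN.size hw) hw (2 * Polynomial.X + 1) (fun n z => ?_) (fun n z j _ => ?_)
    · have := S.size_lt_len n z
      simp
      omega
    · have := S.size_lt_len n z
      have := (hsz z j).1
      simp
      omega
  have h2 := EffD.let hit (g := fun _ z w =>
    if w.left.left.left = z.right then w.left.left.right else num 0)
    (EffD.ite_eq hw.left.left.left.left hw.right.right hw.left.left.left.right
      (EffD.const (num 0)))
  convert h2.comp (hf.cons hg) using 4 with n z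
  exact (hval _ _ _ (by simp only [Data.size]; omega)).symm

theorem EffD.tails {f : ℕ → Data → Data} {k : ℕ → Data → ℕ} (hf : EffD S f) (hk : EffN S k)
    (R : Polynomial ℕ) (hR : ∀ n z, k n z ≤ R.eval (S.len n z)) :
    EffD S fun n z => Data.right^[k n z] (f n z) := by
  obtain ⟨P, hP⟩ := hf.polynomial_size
  refine EffD.iterate (f := fun _ => Data.right) (EffD.right Eff.id) hk hf (P + R)
    (fun n z => (hR n z).trans (by simp)) fun n z j _ => ?_
  have : ∀ (j : ℕ) (d : Data), (Data.right^[j] d).size ≤ d.size := fun j d => by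
    induction j with
    | zero => rfl
    | succ j ih =>
      rw [Function.iterate_succ_apply']
      exact (right_size_le _).trans ih
  exact (this _ _).trans ((hP n z).trans (by simp))

end OAKE

end

noncomputable section

namespace OAKE

open Data

variable {S : Params}

/-! ### Budgets -/

/-- The computation `m` has at most `b` units of time at its disposal: the queries, of size `d`,
cost `1 + d` each, and as long as the replies satisfy `ok`, a result `(y, b')` satisfies `b' ≤ b`
and `post`. -/
def Comp.Budget (ok : Data → Prop) (post : Data × ℕ → Prop) : Comp (Data × ℕ) → ℕ → Prop
  | ret r, b => r.2 ≤ b ∧ post r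
  | timeout, _ => True
  | rnd m k, b => ∀ i ≤ m, (k i).Budget ok post b
  | query d k, b => 1 + d.size ≤ b ∧ ∀ r, ok r → (k r).Budget ok post (b - (1 + d.size))

namespace Comp.Budget

variable {ok : Data → Prop} {post post' : Data × ℕ → Prop} {m : Comp (Data × ℕ)} {b b' : ℕ}

theorem mono (h : m.Budget ok post b) (hb : b ≤ b') (hp : ∀ r, post r → post' r) :
    m.Budget ok post' b' := by
  induction m generalizing b b' with
  | ret r => exact ⟨h.1.trans hb, hp r h.2⟩
  | timeout => trivial
  | rnd m k ih => exact fun i hi => ih i (h i hi) hb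
  | query d k ih => exact ⟨h.1.trans hb, fun r hr => ih r (h.2 r hr) (by omega)⟩

theorem bind {f : Data × ℕ → Comp (Data × ℕ)} (h : m.Budget ok post b)
    (hf : ∀ r, r.2 ≤ b → post r → (f r).Budget ok post' r.2) : (m.bind f).Budget ok post' b := by
  induction m generalizing b with
  | ret r => exact (hf r h.1 h.2).mono h.1 fun _ h => h
  | timeout => trivial
  | rnd m k ih => exact fun i hi => ih i (h i hi) hf
  | query d k ih => exact ⟨h.1, fun r hr => ih r (h.2 r hr) fun r hr => hf r (by omega)⟩

/-- A potential `J` that the environment lowers by at least the cost of each query. -/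
theorem run {σ : Type} {env : Data → StateT σ PMF Data} (J : ℕ → σ → Prop)
    (hJ : ∀ b b' s, J b s → b' ≤ b → J b' s)
    (henv : ∀ b d s, J b s → 1 + d.size ≤ b →
      ∀ r ∈ (env d s).support, ok r.1 ∧ J (b - (1 + d.size)) r.2)
    (h : m.Budget ok post b) {s : σ} (hs : J b s) {r : Option (Data × ℕ) × σ}
    (hr : r ∈ (m.run env s).support) :
    J 0 r.2 ∧ ∀ y, r.1 = some y → y.2 ≤ b ∧ post y ∧ J y.2 r.2 := by
  induction m generalizing b s with
  | ret a =>
    obtain rfl : r = (some a, s) := by simpa [Comp.run] using hr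
    refine ⟨hJ _ _ _ hs (Nat.zero_le _), ?_⟩
    rintro _ ⟨⟩
    exact ⟨h.1, h.2, hJ _ _ _ hs h.1⟩
  | timeout =>
    obtain rfl : r = (none, s) := by simpa [Comp.run] using hr
    exact ⟨hJ _ _ _ hs (Nat.zero_le _), by simp⟩
  | rnd m k ih =>
    obtain ⟨i, hi, hr⟩ := (PMF.mem_support_bind_iff _ _ _).1 hr
    exact ih i (h i (mem_support_uniformUpTo.1 hi)) hs hr
  | query d k ih =>
    obtain ⟨a, ha, hr⟩ := (PMF.mem_support_bind_iff _ _ _).1 hr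
    obtain ⟨h1, h2⟩ := henv b d s hs h.1 a ha
    obtain ⟨h3, h4⟩ := ih a.1 (h.2 a.1 h1) h2 hr
    exact ⟨h3, fun y hy => ⟨(h4 y hy).1.trans (Nat.sub_le _ _), (h4 y hy).2⟩⟩

end Comp.Budget

/-- A bound for the sizes of the constants of a program. -/
def Code.constBound : Code → ℕ
  | .const d => d.size
  | .comp g f => g.constBound + f.constBound
  | .pair f g => f.constBound + g.constBound
  | .cond t f g => t.constBound + f.constBound + g.constBound
  | .loop t f => t.constBound + f.constBound
  | _ => 0

/-- Programs do not exceed their budget, and the values that they compute are not much larger than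
the time used. Here `μ` is a lower bound for the size of values; `μ = 0` is of use when nothing is
known about the replies. -/
theorem Code.eval_budget {ok : Data → Prop} {μ : Data → ℕ} {W : ℕ} (hμ : ∀ d, μ d ≤ d.size)
    (hcons : ∀ a b, μ (cons a b) ≤ μ a + μ b + 1) (hok : ∀ r, ok r → μ r ≤ W) (hW : 1 ≤ W)
    (c : Code) (hc : c.constBound ≤ W) :
    ∀ x b, (c.eval x b).Budget ok (fun r => r.2 < b ∧ μ r.1 + W * r.2 ≤ W * b) b := by
  have charge : ∀ (x : Data) (b : ℕ) (m : ℕ → Comp (Data × ℕ)),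
      (∀ b', b = b' + (1 + x.size) →
        (m b').Budget ok (fun r => r.2 ≤ b' ∧ μ r.1 + W * r.2 ≤ W * b) b') →
      (if b < 1 + x.size then Comp.timeout else m (b - (1 + x.size))).Budget ok
        (fun r => r.2 < b ∧ μ r.1 + W * r.2 ≤ W * b) b := by
    intro x b m h
    split_ifs with hb
    · trivial
    · exact (h (b - (1 + x.size)) (by omega)).mono (by omega) fun r hr => ⟨by omega, hr.2⟩
  have aux : ∀ (x : Data) (b b' w : ℕ), b = b' + (1 + x.size) → w ≤ W * (1 + x.size) →
      w + W * b' ≤ W * b := by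
    rintro x b b' w rfl h
    rw [mul_add]
    omega
  have hx : ∀ x : Data, x.size + 1 ≤ W * (1 + x.size) := fun x => by nlinarith
  have hWx : ∀ x : Data, W ≤ W * (1 + x.size) := fun x => by nlinarith
  induction c with
  | id => exact fun x b => charge x b (fun b => .ret (x, b)) fun b' hb =>
      ⟨le_rfl, le_rfl, aux x b b' _ hb (by have := hμ x; have := hx x; show μ x ≤ _; omega)⟩
  | const d => exact fun x b => charge x b (fun b => .ret (d, b)) fun b' hb =>
      ⟨le_rfl, le_rfl, aux x b b' _ hb (((hμ d).trans hc).trans (hWx x))⟩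
  | prim p => exact fun x b => charge x b (fun b => .ret (p.apply x, b)) fun b' hb =>
      ⟨le_rfl, le_rfl, aux x b b' _ hb (by
        have := hμ (p.apply x)
        have := p.size_apply_le x
        have := hx x
        show μ (p.apply x) ≤ _
        omega)⟩
  | comp g f ihg ihf =>
    simp only [Code.constBound] at hc
    exact fun x b => charge x b (fun b => (f.eval x b).bind fun r => g.eval r.1 r.2) fun b' hb =>
      (ihf (by omega) x b').bind fun r hr hr' => (ihg (by omega) r.1 r.2).mono le_rfl
        fun r' h => ⟨by omega, by have := aux x b b' 0 hb (Nat.zero_le _); omega⟩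
  | pair f g ihf ihg =>
    simp only [Code.constBound] at hc
    exact fun x b => charge x b (fun b => (f.eval x b).bind fun r =>
        (g.eval x r.2).bind fun s => .ret (cons r.1 s.1, s.2)) fun b' hb =>
      (ihf (by omega) x b').bind fun r hr hr' => (ihg (by omega) x r.2).bind
        fun s hs hs' => ⟨le_rfl, by simp only; omega, by
          have h1 := aux x b b' 1 hb (by have := hx x; omega)
          have h2 := hcons r.1 s.1
          simp only at hr' hs' ⊢
          omega⟩
  | cond t f g iht ihf ihg =>
    simp only [Code.constBound] at hc
    refine fun x b => charge x b (fun b => (t.eval x b).bind fun r =>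
      if r.1 = num 0 then g.eval x r.2 else f.eval x r.2) fun b' hb =>
      (iht (by omega) x b').bind fun r hr hr' => ?_
    have h1 := aux x b b' 0 hb (Nat.zero_le _)
    split_ifs
    · exact (ihg (by omega) x r.2).mono le_rfl fun s hs => ⟨by omega, by omega⟩
    · exact (ihf (by omega) x r.2).mono le_rfl fun s hs => ⟨by omega, by omega⟩
  | loop t f iht ihf =>
    simp only [Code.constBound] at hc
    have key : ∀ C k x b, μ x + W * b ≤ C →
        (loopAux (fun y c => t.eval y c) (fun y c => f.eval y c) k x b).Budget ok
          (fun r => r.2 ≤ b ∧ μ r.1 + W * r.2 ≤ C) b := by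
      intro C k
      induction k with
      | zero => intro x b _; trivial
      | succ k ih =>
        intro x b hC
        refine (iht (by omega) x b).bind fun r hr hr' => ?_
        split_ifs
        · exact ⟨le_rfl, hr, by simp only; omega⟩
        · exact (ihf (by omega) x r.2).bind fun s hs hs' =>
            (ih s.1 s.2 (by omega)).mono le_rfl fun u hu => ⟨by omega, hu.2⟩
    exact fun x b => charge x b (fun b => loopAux (fun y c => t.eval y c) (fun y c => f.eval y c)
      (b + 1) x b) fun b' hb => key (W * b) (b' + 1) x b'
        (aux x b b' _ hb (by have := hμ x; have := hx x; omega))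
  | rnd =>
    intro x b
    cases x with
    | num m =>
      refine charge (num m) b (fun b => .rnd m fun i => .ret (num i, b)) fun b' hb i hi => ?_
      refine ⟨le_rfl, le_rfl, aux _ b b' _ hb ?_⟩
      have h1 := hμ (num i)
      have h2 := hx (num m)
      have h3 := Nat.size_le_size hi
      show μ (num i) ≤ _
      simp only [Data.size] at h1 h2 ⊢
      omega
    | cons y z => exact charge (cons y z) b (fun b => .ret (num 0, b)) fun b' hb =>
        ⟨le_rfl, le_rfl, aux _ b b' _ hb (by
          have := hμ (num 0)
          have := hx (cons y z)
          have : (num 0).size = 1 := rfl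
          show μ (num 0) ≤ _
          omega)⟩
  | query =>
    intro x b
    simp only [Code.eval]
    split_ifs with hb
    · trivial
    · refine ⟨by omega, fun r hr => ⟨le_rfl, by have := one_le_size x; simp only; omega, ?_⟩⟩
      have h1 := aux x b (b - (1 + x.size)) (μ r) (by omega) ((hok r hr).trans (hWx x))
      exact h1

/-! ### Simulation of a program together with its environment -/

/-- Outcome of a run as a value: result, remaining time, and state of the environment. Results
without remaining time are identified with timeouts. -/
def collapse (r : Option (Data × ℕ) × Data) : Data :=
  match r.1 with
  | some (y, b) => if b = 0 then cons (num 0) (cons (num 0) r.2) else cons y (cons (num b) r.2)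
  | none => cons (num 0) (cons (num 0) r.2)

/-- The run of the computations `m x b`, for `x`, `b` and the state of the environment taken from a
value, with a cut-off of the budget at `T`. -/
def simulate (env : Data → StateT Data PMF Data) (T : ℕ) (m : Data → ℕ → Comp (Data × ℕ))
    (z : Data) : PMF Data :=
  ((m z.left (min z.right.left.toNat T)).run env z.right.right).map collapse

/-- Without any time left, the computation does nothing. -/
def Idle (m : Data → ℕ → Comp (Data × ℕ)) : Prop :=
  ∀ (env : Data → StateT Data PMF Data) (y s : Data),
    ((m y 0).run env s).map collapse = PMF.pure (cons (num 0) (cons (num 0) s))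

theorem Idle.of_timeout {m : Data → ℕ → Comp (Data × ℕ)} (h : ∀ y, m y 0 = .timeout) : Idle m :=
  fun env y s => by simp [h, Comp.run, PMF.pure_map, collapse]

theorem Idle.ret (f : Data → Data) : Idle fun x b => .ret (f x, b) :=
  fun env y s => by simp [Comp.run, PMF.pure_map, collapse]

theorem Code.eval_zero (c : Code) (x : Data) : c.eval x 0 = .timeout := by
  cases c <;> simp [Code.eval]

theorem Code.idle (c : Code) : Idle c.eval := .of_timeout c.eval_zero

theorem Code.idle_bind (c : Code) (f : Data → Data) (k : Data → Data × ℕ → Comp (Data × ℕ)) :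
    Idle fun x b => (c.eval (f x) b).bind (k x) :=
  .of_timeout fun y => by simp [Code.eval_zero, Comp.bind]

theorem Code.budget_lt (c : Code) (x : Data) (b : ℕ) :
    (c.eval x b).Budget (fun _ => True) (fun r => r.2 < b) b :=
  (c.eval_budget (μ := fun _ => 0) (W := c.constBound + 1) (by simp) (by simp) (by simp) (by omega)
    (by omega) x b).mono le_rfl fun _ h => h.1

theorem Code.lt_of_mem_run {c : Code} {x : Data} {b : ℕ} {σ : Type}
    {env : Data → StateT σ PMF Data} {s : σ} {r : Option (Data × ℕ) × σ}
    (hr : r ∈ ((c.eval x b).run env s).support) {y : Data × ℕ} (hy : r.1 = some y) : y.2 < b :=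
  (((c.budget_lt x b).run (fun _ _ => True) (by simp) (by simp) trivial hr).2 y hy).2.1

/-- Paying for an operation, in terms of the simulation. -/
theorem simulate_charge {env : Data → StateT Data PMF Data} {T : ℕ}
    {m : Data → ℕ → Comp (Data × ℕ)} (hm : Idle m) (z : Data) :
    simulate env T (fun x b => if b < 1 + x.size then .timeout else m x (b - (1 + x.size))) z =
      simulate env T m (if 1 + z.left.size ≤ min z.right.left.toNat T
        then cons z.left (cons (num (min z.right.left.toNat T - (1 + z.left.size))) z.right.right)
        else cons (num 0) (cons (num 0) z.right.right)) := by
  by_cases h : 1 + z.left.size ≤ min z.right.left.toNat T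
  · simp only [simulate, if_pos h, if_neg (not_lt.2 h), left_cons, right_cons, toNat_num]
    rw [min_eq_left ((Nat.sub_le _ _).trans (min_le_right _ _))]
  · simp only [simulate, if_neg h, if_pos (not_le.1 h), left_cons, right_cons, toNat_num]
    rw [Nat.zero_min, hm]
    simp [Comp.run, PMF.pure_map, collapse]

/-- Simulations of consecutive computations are composed like the computations themselves. -/
theorem simulate_bind {env : Data → StateT Data PMF Data} {T : ℕ} {z : Data}
    {m : Data → ℕ → Comp (Data × ℕ)} {k : Data → ℕ → Comp (Data × ℕ)} (hk : Idle k)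
    (hm : ∀ r ∈ ((m z.left (min z.right.left.toNat T)).run env z.right.right).support,
      ∀ y, r.1 = some y → y.2 ≤ T) :
    simulate env T (fun x b => (m x b).bind fun r => k r.1 r.2) z =
      (simulate env T m z).bind (simulate env T k) := by
  simp only [simulate, Comp.run_bind, PMF.map_bind, PMF.bind_map, Function.comp_def]
  refine bind_congr_support _ ?_
  rintro ⟨_ | ⟨y, b⟩, s⟩ hr
  · simp only [Option.elim, collapse, left_cons, right_cons, toNat_num]
    rw [Nat.zero_min, hk]
    simp [PMF.pure_map, collapse]
  · simp only [Option.elim, collapse]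
    have := hm _ hr _ rfl
    by_cases hb : b = 0
    · subst hb
      simp only [if_true, left_cons, right_cons, toNat_num]
      rw [Nat.zero_min, hk, hk]
    · simp only [if_neg hb, left_cons, right_cons, toNat_num]
      rw [min_eq_left this]

/-- One iteration of a simulated loop; the first component tells whether the loop is over. -/
def loopStep (G H : Data → PMF Data) (w : Data) : PMF Data :=
  if w.left = num 0 then
    (G w.right).bind fun r =>
      if r.left = num 0 then PMF.pure (cons (num 1)
        (if r.right.left = num 0 then cons (num 0) (cons (num 0) r.right.right)
          else cons w.right.left r.right))
      else (H (cons w.right.left r.right)).map (cons (num 0))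
  else PMF.pure w

theorem iter_loopStep_done (G H : Data → PMF Data) (k : ℕ) (w : Data) :
    iter (loopStep G H) k (cons (num 1) w) = PMF.pure (cons (num 1) w) := by
  induction k with
  | zero => rfl
  | succ k ih => simp [iter, loopStep, ih]

/-- The simulated loop agrees with `loopAux`: as each iteration consumes time, `N` iterations
suffice if less than `N` units of time are left. -/
theorem iter_loopStep {env : Data → StateT Data PMF Data} {T : ℕ} (t f : Code) (N : ℕ) :
    ∀ (fuel : ℕ) (x : Data) (b : ℕ) (s : Data), b < N → b < fuel → b ≤ T →
      iter (loopStep (simulate env T t.eval) (simulate env T f.eval)) N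
        (cons (num 0) (cons x (cons (num b) s))) =
      ((loopAux (fun y c => t.eval y c) (fun y c => f.eval y c) fuel x b).run env s).map
        fun r => cons (num 1) (collapse r) := by
  induction N with
  | zero => intro _ _ _ _ h; omega
  | succ N ih =>
    rintro (_ | fuel) x b s hN hfuel hT
    · omega
    simp only [iter, loopStep, loopAux, Comp.run_bind, PMF.map_bind, left_cons, right_cons,
      if_true, PMF.bind_bind]
    rw [show simulate env T t.eval (cons x (cons (num b) s)) =
      ((t.eval x b).run env s).map collapse by simp [simulate, min_eq_left hT], PMF.bind_map]
    refine bind_congr_support _ ?_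
    rintro ⟨_ | ⟨y, b'⟩, s'⟩ hr
    · simp [collapse, Option.elim, iter_loopStep_done, PMF.pure_map]
    · have hb' : b' < b := Code.lt_of_mem_run hr rfl
      simp only [Function.comp_def, Option.elim, collapse]
      by_cases hb0 : b' = 0
      · subst hb0
        simp only [if_true, left_cons, right_cons, PMF.pure_bind, iter_loopStep_done]
        by_cases hy : y = num 0
        · simp [hy, Comp.run, PMF.pure_map]
        · simp [hy, Code.eval_zero, Comp.bind, Comp.run, PMF.pure_map]
      · simp only [if_neg hb0, left_cons, right_cons]
        by_cases hy : y = num 0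
        · simp [hy, Comp.run, PMF.pure_map, PMF.pure_bind, iter_loopStep_done, hb0]
        · simp only [if_neg hy, Comp.run_bind, PMF.map_bind, PMF.bind_map]
          rw [show simulate env T f.eval (cons x (cons (num b') s')) =
            ((f.eval x b').run env s').map collapse by
              simp [simulate, min_eq_left (hb'.le.trans hT)], PMF.bind_map]
          refine bind_congr_support _ ?_
          rintro ⟨_ | ⟨y2, b2⟩, s2⟩ hr2
          · simp only [Function.comp_def, Option.elim, collapse]
            rw [ih 1 _ 0 _ (by omega) (by omega) (by omega)]
            simp [loopAux, Code.eval_zero, Comp.bind, Comp.run, PMF.pure_map, collapse]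
          · have hb2 : b2 < b' := Code.lt_of_mem_run hr2 rfl
            simp only [Function.comp_def, Option.elim, collapse]
            by_cases hb20 : b2 = 0
            · subst hb20
              simp only [if_true]
              rw [ih fuel _ 0 _ (by omega) (by omega) (by omega)]
              obtain ⟨fuel, rfl⟩ : ∃ i, fuel = i + 1 := ⟨fuel - 1, by omega⟩
              simp [loopAux, Code.eval_zero, Comp.bind, Comp.run, PMF.pure_map, collapse]
            · simp only [if_neg hb20]
              exact ih fuel _ b2 _ (by omega) (by omega) (by omega)

end OAKE

end

noncomputable section

namespace OAKE

open Data

variable {S : Params}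

/-- Sizes of the intermediate values of a simulation, for an environment that enlarges its state by
at most `q` per query, and whose replies have size at most `ρ` as long as its state has size at
most `M`. -/
theorem size_of_mem_simulate {env : Data → StateT Data PMF Data} {T q M ρ : ℕ}
    (hgrow : ∀ d s, ∀ r ∈ (env d s).support, r.2.size ≤ s.size + q)
    (hrep : ∀ d s, d.size ≤ T → s.size ≤ M → ∀ r ∈ (env d s).support, r.1.size ≤ ρ)
    (c : Code) {x s : Data} {b : ℕ} (hb : b ≤ T) (hs : s.size + q * b ≤ M) {w : Data}
    (hw : w ∈ (simulate env T c.eval (cons x (cons (num b) s))).support) :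
    ∃ y b' s', w = cons y (cons (num b') s') ∧ y.size ≤ (c.constBound + ρ + 1) * T + 1 ∧ b' ≤ T ∧
      s'.size + q * b' ≤ s.size + q * b := by
  simp only [simulate, left_cons, right_cons, toNat_num, min_eq_left hb] at hw
  obtain ⟨r, hr, rfl⟩ := (PMF.mem_support_map_iff _ _ _).1 hw
  have hbud := c.eval_budget (ok := fun r => r.size ≤ ρ) (μ := Data.size)
    (W := c.constBound + ρ + 1) (fun _ => le_rfl) (fun _ _ => le_rfl) (fun r hr => by omega)
    (by omega) (by omega) x b
  obtain ⟨h1, h2⟩ := hbud.run (fun b' s' => b' ≤ T ∧ s'.size + q * b' ≤ s.size + q * b)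
    (fun b1 b2 s' h hb => ⟨hb.trans h.1, by have := Nat.mul_le_mul_left q hb; omega⟩)
    (fun b1 d s' h hd r hr => by
      refine ⟨hrep d s' (by omega) (by omega) r hr, by omega, ?_⟩
      have h3 := hgrow d s' r hr
      have h4 : q * (b1 - (1 + d.size)) + q ≤ q * b1 := by
        obtain ⟨j, rfl⟩ : ∃ j, b1 = j + (1 + d.size) := ⟨b1 - (1 + d.size), by omega⟩
        rw [Nat.add_sub_cancel, mul_add, mul_add]
        omega
      omega) (s := s) ⟨hb, le_rfl⟩ hr
  have hz : (num 0).size = 1 := rfl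
  obtain ⟨_ | ⟨y, b'⟩, s'⟩ := r
  · exact ⟨_, 0, s', rfl, by omega, by omega, h1.2⟩
  · obtain ⟨h3, h4, h5⟩ := h2 _ rfl
    by_cases hb' : b' = 0
    · exact ⟨num 0, 0, s', by simp [collapse, hb'], by omega, by omega, h1.2⟩
    · refine ⟨y, b', s', by simp [collapse, hb'], ?_, h5.1, h5.2⟩
      have := Nat.mul_le_mul_left (c.constBound + ρ + 1) hb
      simp only at h4
      omega

set_option maxHeartbeats 1000000 in
/-- The interaction of a time-limited program with an efficient environment can be simulated
efficiently, if the state of the environment does not grow too fast. -/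
theorem Eff.simulate {env : ℕ → Data → StateT Data PMF Data}
    (henv : Eff S fun n z => (env n z.left z.right).map fun r => cons r.1 r.2)
    (q : Polynomial ℕ) (hgrow : ∀ n d s, ∀ r ∈ (env n d s).support, r.2.size ≤ s.size + q.eval n)
    (T : Polynomial ℕ) (c : Code) :
    Eff S fun n z => OAKE.simulate (env n) (T.eval n) c.eval z := by
  have hz : EffD S fun _ z => z := Eff.id
  have hB : EffN S fun n z => min z.right.left.toNat (T.eval n) :=
    EffN.min (EffN.toNat hz.right.left) (EffN.polynomial T EffN.security)
  have hw : EffN S fun _ z => 1 + z.left.size := (EffN.const 1).add (EffN.size hz.left)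
  have hout : EffD S fun _ z => Data.cons (num 0) (Data.cons (num 0) z.right.right) :=
    (EffD.const _).cons ((EffD.const _).cons hz.right.right)
  have hchg : EffD S fun n z => if 1 + z.left.size ≤ min z.right.left.toNat (T.eval n)
      then cons z.left (cons (num (min z.right.left.toNat (T.eval n) - (1 + z.left.size)))
        z.right.right)
      else cons (num 0) (cons (num 0) z.right.right) :=
    EffD.ite_le hw hB (hz.left.cons (EffD.cons (EffN.sub hB hw) hz.right.right)) hout
  have charge : ∀ m : Data → ℕ → Comp (Data × ℕ), Idle m →
      (Eff S fun n z => OAKE.simulate (env n) (T.eval n) m z) →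
      Eff S fun n z => OAKE.simulate (env n) (T.eval n)
        (fun x b => if b < 1 + x.size then .timeout else m x (b - (1 + x.size))) z := by
    intro m hm h
    simp only [simulate_charge hm]
    exact h.comp hchg
  have hsimret : ∀ (f : Data → Data) n z, OAKE.simulate (env n) (T.eval n)
      (fun x b => .ret (f x, b)) z =
      PMF.pure (if num (min z.right.left.toNat (T.eval n)) = num 0 then
        Data.cons (num 0) (Data.cons (num 0) z.right.right) else
        Data.cons (f z.left) (Data.cons (num (min z.right.left.toNat (T.eval n))) z.right.right)) :=
    fun f n z => by simp [OAKE.simulate, Comp.run, PMF.pure_map, collapse]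
  have hret : ∀ f : Data → Data, (EffD S fun _ z => f z) →
      Eff S fun n z => OAKE.simulate (env n) (T.eval n) (fun x b => .ret (f x, b)) z := by
    intro f hf
    simp only [hsimret]
    exact EffD.ite_eq hB (EffD.const _) hout
      ((hf.comp hz.left).cons (EffD.cons hB hz.right.right))
  have hle : ∀ (c : Code) (n : ℕ) (z : Data), ∀ r ∈ ((c.eval z.left
      (min z.right.left.toNat (T.eval n))).run (env n) z.right.right).support,
      ∀ y, r.1 = some y → y.2 ≤ T.eval n := fun c n z r hr y hy =>
    ((Code.lt_of_mem_run hr hy).le).trans (min_le_right _ _)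
  induction c with
  | id => simpa only [Code.eval] using charge _ (Idle.ret _) (hret (fun x => x) hz)
  | const d => simpa only [Code.eval] using charge _ (Idle.ret _) (hret (fun _ => d) (EffD.const d))
  | prim p => simpa only [Code.eval] using charge _ (Idle.ret _) (hret _ (hz.prim p))
  | comp g f ihg ihf =>
    refine charge (fun x b => (f.eval x b).bind fun r => g.eval r.1 r.2)
      (f.idle_bind _root_.id _) ?_
    simp only [simulate_bind g.idle (hle f _ _)]
    exact ihf.bind (g := fun n z y => OAKE.simulate (env n) (T.eval n) g.eval y)
      (ihg.comp hz.left)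
  | pair f g ihf ihg =>
    refine charge (fun x b => (f.eval x b).bind fun r =>
        (g.eval x r.2).bind fun s => .ret (cons r.1 s.1, s.2)) (f.idle_bind _root_.id _) ?_
    let out : ℕ → Data → Data → Data := fun n y s =>
      if num (min s.right.left.toNat (T.eval n)) = num 0 then
        cons (num 0) (cons (num 0) s.right.right) else cons (cons y s.left)
          (cons (num (min s.right.left.toNat (T.eval n))) s.right.right)
    have hout' : EffD S fun n p => out n p.right.left.left p.left := by
      have hB' : EffN S fun n z => min z.left.right.left.toNat (T.eval n) :=
        EffN.min (EffN.toNat hz.left.right.left) (EffN.polynomial T EffN.security)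
      exact EffD.ite_eq hB' (EffD.const _) ((EffD.const _).cons ((EffD.const _).cons
        hz.left.right.right)) ((hz.right.left.left.cons hz.left.left).cons
          (EffD.cons hB' hz.left.right.right))
    have hret' : ∀ n y s, OAKE.simulate (env n) (T.eval n) (fun z b => .ret (cons y z, b)) s =
        PMF.pure (out n y s) := fun n y s => hsimret (fun z => cons y z) n s
    clear_value out
    have h1 : ∀ n z, OAKE.simulate (env n) (T.eval n) (fun x b => (f.eval x b).bind fun r =>
        (g.eval x r.2).bind fun s => .ret (cons r.1 s.1, s.2)) z =
      (OAKE.simulate (env n) (T.eval n) f.eval z).bind fun r =>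
        (OAKE.simulate (env n) (T.eval n) g.eval (cons z.left r.right)).map (out n r.left) := by
      intro n z
      refine (simulate_bind (m := f.eval) (k := fun y b => (g.eval z.left b).bind fun s =>
        .ret (cons y s.1, s.2)) (g.idle_bind (fun _ => z.left) _) (hle f n z)).trans ?_
      congr 1
      funext r
      refine (simulate_bind (z := cons z.left r.right) (m := g.eval)
        (k := fun y b => .ret (cons r.left y, b)) (Idle.ret _) (hle g n _)).trans ?_
      exact congrArg (PMF.bind _) (funext fun s => hret' n r.left s)
    simp only [h1]
    exact ihf.bind (g := fun n z r => (OAKE.simulate (env n) (T.eval n) g.eval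
      (cons z.left r.right)).map (out n r.left))
      ((ihg.comp (hz.right.left.cons hz.left.right)).map (g := fun n p s => out n p.left.left s)
        hout')
  | cond t f g iht ihf ihg =>
    refine charge (fun x b => (t.eval x b).bind fun r =>
        if r.1 = num 0 then g.eval x r.2 else f.eval x r.2) (t.idle_bind _root_.id _) ?_
    have h1 : ∀ n z, OAKE.simulate (env n) (T.eval n) (fun x b => (t.eval x b).bind fun r =>
        if r.1 = num 0 then g.eval x r.2 else f.eval x r.2) z =
      (OAKE.simulate (env n) (T.eval n) t.eval z).bind fun r => if r.left = num 0 then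
        OAKE.simulate (env n) (T.eval n) g.eval (cons z.left r.right) else
        OAKE.simulate (env n) (T.eval n) f.eval (cons z.left r.right) := by
      intro n z
      refine (simulate_bind (m := t.eval) (k := fun y b => if y = num 0 then g.eval z.left b else
        f.eval z.left b) (.of_timeout fun y => by simp [Code.eval_zero]) (hle t n z)).trans ?_
      congr 1
      funext r
      by_cases hr : r.left = num 0 <;> simp [OAKE.simulate, hr]
    simp only [h1]
    refine iht.bind (g := fun n z r => if r.left = num 0 then
        OAKE.simulate (env n) (T.eval n) g.eval (cons z.left r.right) else
        OAKE.simulate (env n) (T.eval n) f.eval (cons z.left r.right)) ?_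
    exact Eff.ite_eq hz.left.left (EffD.const _) (ihg.comp (hz.right.left.cons hz.left.right))
      (ihf.comp (hz.right.left.cons hz.left.right))
  | loop t f iht ihf =>
    refine charge (fun x b => loopAux (fun y c => t.eval y c) (fun y c => f.eval y c) (b + 1) x b)
      (.of_timeout fun y => by simp [loopAux, Code.eval_zero, Comp.bind]) ?_
    have hstep : Eff S fun n w => loopStep (OAKE.simulate (env n) (T.eval n) t.eval)
        (OAKE.simulate (env n) (T.eval n) f.eval) w := by
      refine Eff.ite_eq hz.left (EffD.const _) ?_ hz
      refine (iht.comp hz.right).bind (g := fun n w r => if r.left = num 0 then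
        PMF.pure (cons (num 1) (if r.right.left = num 0 then cons (num 0) (cons (num 0)
          r.right.right) else cons w.right.left r.right))
        else (OAKE.simulate (env n) (T.eval n) f.eval (cons w.right.left r.right)).map
          (cons (num 0))) ?_
      refine Eff.ite_eq hz.left.left (EffD.const _) ?_ ?_
      · exact (EffD.const _).cons (EffD.ite_eq hz.left.right.left (EffD.const _)
          ((EffD.const _).cons ((EffD.const _).cons hz.left.right.right))
          (hz.right.right.left.cons hz.left.right))
      · exact (ihf.comp (hz.right.right.left.cons hz.left.right)).map
          (g := fun _ _ s => Data.cons (num 0) s) ((EffD.const _).cons hz.left)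
    have hinit : EffD S fun n z => Data.cons (num 0) (Data.cons z.left
        (Data.cons (num (min z.right.left.toNat (T.eval n))) z.right.right)) :=
      (EffD.const _).cons (hz.left.cons (EffD.cons hB hz.right.right))
    have hit : Eff S fun n z => OAKE.iter (loopStep (OAKE.simulate (env n) (T.eval n) t.eval)
        (OAKE.simulate (env n) (T.eval n) f.eval)) (T.eval n + 1) (Data.cons (num 0)
          (Data.cons z.left
            (Data.cons (num (min z.right.left.toNat (T.eval n))) z.right.right))) := by
      obtain ⟨ce, P, hP⟩ := henv
      let M : Polynomial ℕ := Polynomial.X + q * T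
      let ρ : Polynomial ℕ := P.comp (2 * Polynomial.X + T + M + 2)
      let R : Polynomial ℕ := Polynomial.X + 8 + M + T +
        (Polynomial.C f.constBound + ρ + 1) * T
      refine Eff.iter (N := fun n _ => T.eval n + 1) hstep
        ((EffN.polynomial T EffN.security).add (EffN.const 1)) hinit R (fun n z => ?_) ?_
      · have := poly_mono T (a := n) (b := S.len n z) (by simp [Params.len])
        simp only [R, Polynomial.eval_add, Polynomial.eval_ofNat]
        omega
      · intro n z k hk w hwk
        set L := S.len n z with hL
        have hnL : n ≤ L := by simp [hL, Params.len]
        have hTL := poly_mono T hnL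
        have hqL := poly_mono q hnL
        have hM : M.eval L = L + q.eval L * T.eval L := by simp [M]
        have hρ : ρ.eval L = P.eval (2 * L + T.eval L + M.eval L + 2) := by simp [ρ]
        have hrep : ∀ d s, d.size ≤ T.eval n → s.size ≤ M.eval L →
            ∀ r ∈ (env n d s).support, r.1.size ≤ ρ.eval L := by
          intro d s hd hs r hr
          have h1 := (hP n (cons d s)).2 (cons r.1 r.2) (by
            simp only [left_cons, right_cons]
            exact (PMF.mem_support_map_iff _ _ _).2 ⟨r, hr, rfl⟩)
          have h2 : P.eval (S.len n (cons d s)) ≤ ρ.eval L := by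
            rw [hρ]
            refine poly_mono P ?_
            have : n + (S.pub n).size ≤ L := by simp only [hL, Params.len, size_cons]; omega
            simp only [Params.len, size_cons]
            omega
          rw [size_cons] at h1
          omega
        have hzl := z.left_size_le
        have hzr := (right_size_le z.right).trans z.right_size_le
        have hzL : z.size < L := S.size_lt_len n z
        -- invariant of the loop
        have inv : ∀ k, ∀ w ∈ (OAKE.iter (loopStep (OAKE.simulate (env n) (T.eval n) t.eval)
            (OAKE.simulate (env n) (T.eval n) f.eval)) k (Data.cons (num 0) (Data.cons z.left
              (Data.cons (num (min z.right.left.toNat (T.eval n))) z.right.right)))).support,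
            ∃ fl x b s, w = Data.cons (num fl) (Data.cons x (Data.cons (num b) s)) ∧ fl ≤ 1 ∧
              x.size ≤ L + (f.constBound + ρ.eval L + 1) * T.eval L + 1 ∧ b ≤ T.eval n ∧
              s.size + q.eval n * b ≤ M.eval L := by
          intro k
          induction k with
          | zero =>
            intro w hw
            simp only [OAKE.iter, PMF.mem_support_pure_iff] at hw
            refine ⟨0, _, _, _, hw, by omega, by omega, min_le_right _ _, ?_⟩
            have := Nat.mul_le_mul hqL ((min_le_right z.right.left.toNat (T.eval n)).trans hTL)
            rw [hM]
            omega
          | succ k ih =>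
            intro w hw
            rw [iter_succ'] at hw
            obtain ⟨v, hv, hw⟩ := (PMF.mem_support_bind_iff _ _ _).1 hw
            obtain ⟨fl, x, b, s, rfl, hfl, hx, hb, hs⟩ := ih v hv
            rw [loopStep] at hw
            split_ifs at hw
            · obtain ⟨r, hr, hw⟩ := (PMF.mem_support_bind_iff _ _ _).1 hw
              obtain ⟨y, b', s', rfl, hy, hb', hs'⟩ :=
                size_of_mem_simulate (hgrow n) hrep t hb hs hr
              replace hw : w ∈ (if y = num 0 then PMF.pure (Data.cons (num 1)
                  (if num b' = num 0 then Data.cons (num 0) (Data.cons (num 0) s')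
                    else Data.cons x (Data.cons (num b') s')))
                else (OAKE.simulate (env n) (T.eval n) f.eval (Data.cons x (Data.cons (num b')
                  s'))).map (Data.cons (num 0))).support := hw
              by_cases h1 : y = num 0
              · rw [if_pos h1, PMF.mem_support_pure_iff] at hw
                by_cases h2 : num b' = num 0
                · rw [if_pos h2] at hw
                  refine ⟨1, num 0, 0, s', hw, by omega, ?_, by omega, by omega⟩
                  have : (num 0).size = 1 := rfl
                  omega
                · rw [if_neg h2] at hw
                  exact ⟨1, x, b', s', hw, by omega, hx, by omega, by omega⟩
              · rw [if_neg h1] at hw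
                obtain ⟨w', hw', rfl⟩ := (PMF.mem_support_map_iff _ _ _).1 hw
                obtain ⟨y2, b2, s2, rfl, hy2, hb2, hs2⟩ := size_of_mem_simulate (hgrow n) hrep f hb'
                  (by omega) hw'
                refine ⟨0, y2, b2, s2, rfl, by omega, ?_, by omega, by omega⟩
                have := Nat.mul_le_mul_left (f.constBound + ρ.eval L + 1) hTL
                omega
            · rw [PMF.mem_support_pure_iff] at hw
              exact ⟨fl, x, b, s, hw, hfl, hx, hb, hs⟩
        obtain ⟨fl, x, b, s, rfl, hfl, hx, hb, hs⟩ := inv k w hwk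
        have h1 := Nat.size_le_size hfl
        have h2 : Nat.size b ≤ T.eval L :=
          (Nat.size_le.2 (Nat.lt_two_pow_self)).trans (hb.trans hTL)
        have h3 : Nat.size 1 = 1 := by decide
        simp only [R, Polynomial.eval_add, Polynomial.eval_mul, Polynomial.eval_ofNat,
          Polynomial.eval_X, Polynomial.eval_C, Polynomial.eval_one, Data.size]
        omega
    have h1 : ∀ n z, OAKE.simulate (env n) (T.eval n) (fun x b => loopAux (fun y c => t.eval y c)
        (fun y c => f.eval y c) (b + 1) x b) z =
        (OAKE.iter (loopStep (OAKE.simulate (env n) (T.eval n) t.eval)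
        (OAKE.simulate (env n) (T.eval n) f.eval)) (T.eval n + 1) (Data.cons (num 0)
          (Data.cons z.left
            (Data.cons (num (min z.right.left.toNat (T.eval n))) z.right.right)))).map right := by
      intro n z
      rw [iter_loopStep t f (T.eval n + 1) (min z.right.left.toNat (T.eval n) + 1) _ _ _
        (Nat.lt_succ_of_le (min_le_right _ _)) (by omega) (min_le_right _ _), PMF.map_comp]
      rfl
    simp only [h1]
    exact hit.map (g := fun _ _ w => w.right) hz.left.right
  | rnd =>
    have h : Eff S fun n z => (if z.left = num z.left.toNat then
        (uniformUpTo z.left.toNat).map num else PMF.pure (num 0)).map fun y =>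
        if num (min z.right.left.toNat (T.eval n)) = num 0 then
          Data.cons (num 0) (Data.cons (num 0) z.right.right) else
          Data.cons y (Data.cons (num (min z.right.left.toNat (T.eval n))) z.right.right) :=
      (Eff.ite_eq hz.left (EffN.toNat hz.left) (Eff.uniform (EffN.toNat hz.left))
        (EffD.const _)).map (g := fun n z y => if num (min z.right.left.toNat (T.eval n)) = num 0
          then Data.cons (num 0) (Data.cons (num 0) z.right.right) else
          Data.cons y (Data.cons (num (min z.right.left.toNat (T.eval n))) z.right.right))
        (EffD.ite_eq (hB.comp hz.right) (EffD.const _) (hout.comp hz.right)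
          (hz.left.cons (EffD.cons (hB.comp hz.right) hz.right.right.right)))
    let m : Data → ℕ → Comp (Data × ℕ) := fun x b => match x with
      | num m => .rnd m fun i => .ret (num i, b)
      | cons _ _ => .ret (num 0, b)
    have h2 := charge m (fun env y s => by
      cases y <;> simp [m, Comp.run, PMF.pure_map, collapse, PMF.map_bind]) (by
      convert h using 3 with n z
      obtain ⟨x, z, rfl⟩ | hzn : (∃ x z', z = cons x z') ∨ ∃ i, z = num i := by
        cases z <;> simp
      · cases x with
        | num i =>
          simp only [m, OAKE.simulate, Comp.run, PMF.map_comp, Function.comp_def,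
            left_cons, right_cons, toNat_num, if_true]
          rw [PMF.map_bind, PMF.map]
          refine congrArg _ (funext fun a => ?_)
          simp only [PMF.pure_map, collapse, Function.comp_def]
          simp only [num.injEq]
        | cons u v => simp [m, OAKE.simulate, Comp.run, collapse, PMF.pure_map]
      · obtain ⟨i, rfl⟩ := hzn
        have h0 : min (num i).right.left.toNat (T.eval n) = 0 := by simp
        have h3 : ∀ f : Data → PMF Data, f = (fun _ => PMF.pure (Data.cons (num 0)
            (Data.cons (num 0) (num 0)))) → ∀ μ : PMF Data, μ.bind f =
            PMF.pure (Data.cons (num 0) (Data.cons (num 0) (num 0))) := by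
          rintro f rfl μ
          exact PMF.bind_const _ _
        rw [h0, PMF.map]
        refine Eq.trans ?_ (h3 _ (funext fun a => ?_) _).symm
        · simp [m, OAKE.simulate, Comp.run, collapse, PMF.map_bind, PMF.pure_map, PMF.bind_const]
        · simp)
    convert h2 using 5 with n z x b
    cases x <;> rfl
  | query =>
    have h : Eff S fun n z => if 1 + z.left.size ≤ min z.right.left.toNat (T.eval n) then
        (env n z.left z.right.right).map fun r => if num (min z.right.left.toNat (T.eval n) -
            (1 + z.left.size)) = num 0 then Data.cons (num 0) (Data.cons (num 0) r.2) else
          Data.cons r.1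
            (Data.cons (num (min z.right.left.toNat (T.eval n) - (1 + z.left.size))) r.2)
        else PMF.pure (Data.cons (num 0) (Data.cons (num 0) z.right.right)) := by
      refine Eff.ite_le hw hB ?_ hout
      have := (henv.comp (hz.left.cons hz.right.right)).map (g := fun n z r =>
        if num (min z.right.left.toNat (T.eval n) -
            (1 + z.left.size)) = num 0 then Data.cons (num 0) (Data.cons (num 0) r.right) else
          Data.cons r.left (Data.cons (num (min z.right.left.toNat (T.eval n) - (1 + z.left.size)))
            r.right)) (EffD.ite_eq ((EffN.sub hB hw).comp hz.right) (EffD.const _)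
              ((EffD.const _).cons ((EffD.const _).cons hz.left.right))
              (hz.left.left.cons (EffD.cons ((EffN.sub hB hw).comp hz.right) hz.left.right)))
      simpa only [PMF.map_comp, Function.comp_def, left_cons, right_cons] using this
    convert h using 3 with n z
    by_cases hb : 1 + z.left.size ≤ min z.right.left.toNat (T.eval n)
    · simp only [OAKE.simulate, Code.eval, if_neg (not_lt.2 hb), if_pos hb, Comp.run,
        PMF.map_bind, PMF.pure_map, collapse, num.injEq]
      rfl
    · simp only [OAKE.simulate, Code.eval, if_pos (not_le.1 hb), if_neg hb, Comp.run,
        PMF.pure_map, collapse]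

end OAKE

end

noncomputable section

namespace OAKE

open Data

variable {S : Params}

/-! ### Programs with an append-only store -/

/-- Probabilistic programs with a store. The store is an association list; entries are added at
its head and never changed. The value `num 0` stands for a missing entry. -/
abbrev Sim : Type → Type := StateT Data PMF

namespace Sim

/-- Read the entry for the key `k`. -/
def look (k : Data) : Sim Data := fun s => PMF.pure (lookup s k, s)

/-- Add an entry, unless there is one for the key `k` already. The size limit `m` makes sure that
stores stay small whatever the inputs are. -/
def add (m : ℕ) (k v : Data) : Sim Data := fun s =>
  PMF.pure (num 0, if lookup s k = num 0 then
    if k.size + v.size ≤ m then cons (cons k v) s else s else s)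

/-- Draw a number from `{0, …, m}`. -/
def draw (m : ℕ) : Sim Data := fun s => ((uniformUpTo m).map num).map fun v => (v, s)

/-- The random oracle with name `tag` and values in `{0, …, r}`, sampled lazily. -/
def oracle (m : ℕ) (tag : Data) (r : ℕ) (d : Data) : Sim Data := do
  let v ← look (cons tag d)
  if v = num 0 then do
    let w ← draw r
    let _ ← add m (cons tag d) (cons w (num 0))
    pure w
  else pure v.left

end Sim

/-- Polynomial-time computability of a program with a store. -/
def EffM (S : Params) (m : ℕ → Data → Sim Data) : Prop :=
  Eff S fun n z => (m n z.left z.right).map fun r => cons r.1 r.2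

namespace EffM

theorem of_eq {m : ℕ → Data → Sim Data} {F : ℕ → Data → PMF Data} (h : Eff S F)
    (hF : ∀ n x s, (m n x s).map (fun r => cons r.1 r.2) = F n (cons x s))
    (hF' : ∀ n i, F n (num i) = F n (cons (num 0) (num 0))) : EffM S m := by
  unfold EffM
  convert h using 3 with n z
  cases z with
  | num i => exact (hF n _ _).trans (hF' n i).symm
  | cons x s => exact hF n x s

theorem bind {m : ℕ → Data → Sim Data} {k : ℕ → Data → Data → Sim Data} (hm : EffM S m)
    (hk : EffM S fun n p => k n p.right p.left) : EffM S fun n z => m n z >>= k n z := by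
  have hz : EffD S fun _ z => z := Eff.id
  have h := Eff.bind (g := fun n z r => (k n z.left r.left r.right).map fun r => cons r.1 r.2) hm
    (by
      simpa only [left_cons, right_cons] using
        hk.comp ((hz.left.left.cons hz.right.left).cons hz.left.right))
  refine of_eq h (fun n x s => ?_) fun n i => rfl
  change ((m n x s).bind fun r => k n x r.1 r.2).map _ = _
  simp only [PMF.map_bind, PMF.bind_map, Function.comp_def, left_cons, right_cons]

theorem pure {f : ℕ → Data → Data} (hf : EffD S f) :
    EffM S fun n z => (Pure.pure (f n z) : Sim Data) := by
  have hz : EffD S fun _ z => z := Eff.id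
  have h := (hf.comp hz.left).cons hz.right
  exact of_eq h (fun n x s => PMF.pure_map _ _) fun n i => rfl

theorem ite_eq {a b : ℕ → Data → Data} {f g : ℕ → Data → Sim Data} (ha : EffD S a)
    (hb : EffD S b) (hf : EffM S f) (hg : EffM S g) :
    EffM S fun n z => if a n z = b n z then f n z else g n z := by
  have hz : EffD S fun _ z => z := Eff.id
  have h := Eff.ite_eq (ha.comp hz.left) (hb.comp hz.left) hf hg
  refine of_eq h (fun n x s => ?_) fun n i => rfl
  by_cases hab : a n x = b n x <;> simp [hab]

theorem look {f : ℕ → Data → Data} (hf : EffD S f) : EffM S fun n z => Sim.look (f n z) := by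
  have hz : EffD S fun _ z => z := Eff.id
  have h := (EffD.lookup hz.right (hf.comp hz.left)).cons hz.right
  exact of_eq h (fun n x s => PMF.pure_map _ _) fun n i => rfl

theorem add {f g : ℕ → Data → Data} {m : ℕ → ℕ} (hm : EffN S fun n _ => m n) (hf : EffD S f)
    (hg : EffD S g) : EffM S fun n z => Sim.add (m n) (f n z) (g n z) := by
  have hz : EffD S fun _ z => z := Eff.id
  have hf := hf.comp hz.left
  have hg := hg.comp hz.left
  have h := (EffD.const (S := S) (num 0)).cons (EffD.ite_eq (EffD.lookup hz.right hf)
    (EffD.const (num 0)) (EffD.ite_le ((EffN.size hf).add (EffN.size hg)) hm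
      ((hf.cons hg).cons hz.right) hz.right) hz.right)
  exact of_eq h (fun n x s => PMF.pure_map _ _) fun n i => rfl

theorem draw {r : ℕ → ℕ} (hr : EffN S fun n _ => r n) : EffM S fun n _ => Sim.draw (r n) := by
  have hz : EffD S fun _ z => z := Eff.id
  have h := (Eff.uniform hr).map (g := fun n z v => cons v z.right) (hz.left.cons hz.right.right)
  refine of_eq h (fun n x s => ?_) fun n i => rfl
  simp only [Sim.draw, PMF.map_comp]
  rfl

theorem oracle {f : ℕ → Data → Data} {m r : ℕ → ℕ} (tag : Data) (hm : EffN S fun n _ => m n)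
    (hr : EffN S fun n _ => r n) (hf : EffD S f) :
    EffM S fun n z => Sim.oracle (m n) tag (r n) (f n z) := by
  have hz : EffD S fun _ z => z := Eff.id
  unfold Sim.oracle
  refine bind (look ((EffD.const _).cons hf)) (ite_eq hz.left (EffD.const _) ?_ (pure hz.left.left))
  exact bind (draw hr) (bind (add hm ((EffD.const _).cons (hf.comp hz.right.right))
    (hz.left.cons (EffD.const _))) (pure hz.right.left))

end EffM

/-- Some value of the oracle with name `num 0` is divisible by `q`. -/
def Degenerate (q : ℕ) (s : Data) : Prop :=
  ∃ d v, lookup s (cons (num 0) d) = cons (num v) (num 0) ∧ q ∣ v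

/-- The store `s'` extends `s` by at most `b` in size. -/
def Extends (b : ℕ) (s s' : Data) : Prop :=
  s'.size ≤ s.size + b ∧ ∀ k, lookup s k ≠ num 0 → lookup s' k = lookup s k

theorem Extends.trans {b c : ℕ} {s t u : Data} (h : Extends b s t) (h' : Extends c t u) :
    Extends (b + c) s u :=
  ⟨by have := h.1; have := h'.1; omega, fun k hk => by
    rw [h'.2 k (by rw [h.2 k hk]; exact hk), h.2 k hk]⟩

/-- The program consists of at most `j` elementary steps, each of which adds at most `m + 2` to the
size of the store, and at most `δ` to the probability that the store is degenerate. -/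
def Sim.Tame (q m : ℕ) (δ : ENNReal) (j : ℕ) (p : Sim Data) : Prop :=
  ∀ s, (∀ r ∈ (p s).support, Extends (j * (m + 2)) s r.2) ∧
    (¬ Degenerate q s → (p s).toOuterMeasure {r | Degenerate q r.2} ≤ j * δ)

/-- If a first step ends in `A` with probability at most `a`, and outside of `A` the second step
ends in `B` with probability at most `b`, then `B` has probability at most `a + b`. -/
theorem toOuterMeasure_bind_le {α β : Type} {μ : PMF α} {f : α → PMF β} {A : Set α} {B : Set β}
    {a b : ENNReal} (h1 : μ.toOuterMeasure A ≤ a)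
    (h2 : ∀ x ∈ μ.support, x ∉ A → (f x).toOuterMeasure B ≤ b) :
    (μ.bind f).toOuterMeasure B ≤ a + b := by
  classical
  rw [PMF.toOuterMeasure_bind_apply]
  calc ∑' x, μ x * (f x).toOuterMeasure B
      ≤ ∑' x, (A.indicator μ x + μ x * b) := by
        refine ENNReal.tsum_le_tsum fun x => ?_
        by_cases hx : x ∈ A
        · rw [Set.indicator_of_mem hx]
          refine le_add_right ?_
          calc μ x * (f x).toOuterMeasure B ≤ μ x * 1 := by
                gcongr
                exact (PMF.toOuterMeasure_apply _ _).trans_le ((ENNReal.tsum_le_tsum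
                  fun y => Set.indicator_le_self' (by simp) y).trans (f x).tsum_coe.le)
            _ = μ x := mul_one _
        · rw [Set.indicator_of_notMem hx, zero_add]
          by_cases hs : x ∈ μ.support
          · gcongr
            exact h2 x hs hx
          · rw [(PMF.apply_eq_zero_iff _ _).2 hs]
            simp
    _ = μ.toOuterMeasure A + b := by
        rw [ENNReal.tsum_add, ENNReal.tsum_mul_right, μ.tsum_coe, one_mul,
          PMF.toOuterMeasure_apply]
    _ ≤ a + b := by gcongr

namespace Sim.Tame

variable {q m j : ℕ} {δ : ENNReal} {p : Sim Data}

theorem of_idle_at {s : Data} (h : ∀ r ∈ (p s).support, r.2 = s) :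
    (∀ r ∈ (p s).support, Extends (j * (m + 2)) s r.2) ∧
      (¬ Degenerate q s → (p s).toOuterMeasure {r | Degenerate q r.2} ≤ j * δ) := by
  refine ⟨fun r hr => ?_, fun hs => ?_⟩
  · rw [h r hr]
    exact ⟨Nat.le_add_right _ _, fun _ _ => rfl⟩
  · refine le_of_eq_of_le ?_ (zero_le)
    rw [PMF.toOuterMeasure_apply_eq_zero_iff, Set.disjoint_left]
    intro r hr hr'
    rw [Set.mem_ofPred_eq, h r hr] at hr'
    exact hs hr'

theorem of_idle (h : ∀ s, ∀ r ∈ (p s).support, r.2 = s) : p.Tame q m δ j :=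
  fun s => of_idle_at (h s)

theorem pure (d : Data) : (Pure.pure d : Sim Data).Tame q m δ j :=
  of_idle fun s r hr => by
    obtain rfl : r = (d, s) := (PMF.mem_support_pure_iff _ _).1 hr
    rfl

theorem look (k : Data) : (Sim.look k).Tame q m δ j :=
  of_idle fun s r hr => by
    rw [(PMF.mem_support_pure_iff _ _).1 hr]

theorem bind {k : Data → Sim Data} (hp : p.Tame q m δ 1) (hk : ∀ d, (k d).Tame q m δ j) :
    (p >>= k).Tame q m δ (j + 1) := by
  refine fun s => ⟨fun r hr => ?_, fun hs => ?_⟩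
  · obtain ⟨t, ht, hr⟩ := (PMF.mem_support_bind_iff _ _ _).1 hr
    convert ((hp s).1 t ht).trans ((hk t.1 t.2).1 r hr) using 1
    ring
  · rw [Nat.cast_add, add_comm, add_mul]
    exact toOuterMeasure_bind_le ((hp s).2 hs) fun t _ ht => (hk t.1 t.2).2 ht

theorem ite {c : Prop} [Decidable c] {p' : Sim Data} (h : p.Tame q m δ j) (h' : p'.Tame q m δ j) :
    (if c then p else p').Tame q m δ j := by
  split_ifs
  exacts [h, h']

theorem add {k : Data} (hk : ∀ d, k ≠ cons (num 0) d) (v : Data) :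
    (Sim.add m k v).Tame q m δ (j + 1) := by
  intro s
  have h : ∀ r ∈ (Sim.add m k v s).support, r.2 = s ∨
      lookup s k = num 0 ∧ k.size + v.size ≤ m ∧ r.2 = cons (cons k v) s := by
    intro r hr
    rw [(PMF.mem_support_pure_iff _ _).1 hr]
    simp only
    split_ifs with h1 h2
    exacts [.inr ⟨h1, h2, rfl⟩, .inl rfl, .inl rfl]
  refine ⟨fun r hr => ?_, fun hs => ?_⟩
  · obtain h | ⟨h1, h2, h3⟩ := h r hr
    · rw [h]
      exact ⟨Nat.le_add_right _ _, fun _ _ => rfl⟩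
    · rw [h3]
      refine ⟨by simp only [size_cons]; nlinarith, fun k' hk' => ?_⟩
      rw [lookup_cons, if_neg]
      rintro rfl
      exact hk' h1
  · refine le_of_eq_of_le ?_ (zero_le)
    rw [PMF.toOuterMeasure_apply_eq_zero_iff, Set.disjoint_left]
    rintro r hr ⟨d, w, hd, hw⟩
    refine hs ⟨d, w, ?_, hw⟩
    obtain h | ⟨h1, h2, h3⟩ := h r hr
    · rwa [h] at hd
    · rwa [h3, lookup_cons, if_neg (hk d)] at hd

/-- A new value of the oracle makes the store degenerate only if the oracle is `h` and the value is
divisible by `q`. -/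
theorem oracle {tag : Data} {r : ℕ} (d : Data) (hδ : tag = num 0 →
    (uniformUpTo r).toOuterMeasure {v | q ∣ v} ≤ δ) :
    (Sim.oracle m tag r d).Tame q m δ (j + 1) := by
  intro s
  set s' : ℕ → Data := fun v => if lookup s (cons tag d) = num 0 then
    if (cons tag d).size + (cons (num v) (num 0)).size ≤ m then
      cons (cons (cons tag d) (cons (num v) (num 0))) s else s else s with hs'
  by_cases h0 : lookup s (cons tag d) = num 0
  · have heq : Sim.oracle m tag r d s = (uniformUpTo r).map fun v => (num v, s' v) := by
      change (PMF.pure (lookup s (cons tag d), s)).bind _ = _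
      rw [PMF.pure_bind]
      simp only [if_pos h0]
      change ((((uniformUpTo r).map num).map fun v => (v, s))).bind _ = _
      rw [PMF.bind_map, PMF.bind_map, PMF.map]
      refine congrArg _ (funext fun v => ?_)
      simp only [Function.comp_def]
      change (PMF.pure (num 0, s' v)).bind _ = _
      rw [PMF.pure_bind]
      rfl
    rw [heq]
    refine ⟨fun t ht => ?_, fun hs => ?_⟩
    · obtain ⟨v, -, rfl⟩ := (PMF.mem_support_map_iff _ _ _).1 ht
      simp only [hs', if_pos h0]
      split_ifs with h1
      · refine ⟨by simp only [size_cons] at h1 ⊢; nlinarith, fun k' hk' => ?_⟩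
        rw [lookup_cons, if_neg]
        rintro rfl
        exact hk' h0
      · exact ⟨Nat.le_add_right _ _, fun _ _ => rfl⟩
    · rw [PMF.toOuterMeasure_map_apply]
      have h1 : ∀ v, Degenerate q (s' v) → tag = num 0 ∧ q ∣ v := by
        rintro v ⟨d', w, hd', hw⟩
        by_contra hv
        refine hs ⟨d', w, ?_, hw⟩
        simp only [hs', if_pos h0] at hd'
        split_ifs at hd' with h2
        · rw [lookup_cons] at hd'
          split_ifs at hd' with h3
          · simp only [cons.injEq, num.injEq, and_true] at h3 hd'
            exact absurd ⟨h3.1, hd' ▸ hw⟩ hv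
          · exact hd'
        · exact hd'
      by_cases ht : tag = num 0
      · refine (MeasureTheory.measure_mono fun v hv => (h1 v hv).2).trans ((hδ ht).trans ?_)
        push_cast
        exact le_mul_of_one_le_left' (by simp)
      · refine le_of_eq_of_le ?_ (zero_le)
        rw [PMF.toOuterMeasure_apply_eq_zero_iff, Set.disjoint_left]
        exact fun v _ hv => ht (h1 v hv).1
  · refine of_idle_at fun t ht => ?_
    have heq : Sim.oracle m tag r d s = PMF.pure ((lookup s (cons tag d)).left, s) := by
      change (PMF.pure (lookup s (cons tag d), s)).bind _ = _
      rw [PMF.pure_bind]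
      simp only [if_neg h0]
      rfl
    rw [heq, PMF.mem_support_pure_iff] at ht
    rw [ht]

end Sim.Tame

end OAKE

end

noncomputable section

namespace OAKE

open Data

variable {S : Params}

/-! ### The simulated experiment

The store of the simulator has the following entries: `(0, d)` and `(1, d)` for the values of the
oracles `h` and `H_K` at `d`; `(2, A)` for the public key and (for honest players) the secret key of
`A`, and `(5, A)` if `A` is corrupted; `(3, i)` for the owner, the DH-component and the DH-exponent
of session `i`, `(7, i)` for its peer, `(8, i)` for the incoming DH-component and the session key,
`(6, i)` and `(9, i)` if its state or its key was exposed; `2` for the owner of the special session,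
`3` for the test session, `4` if the simulation is dead. The DH-exponent and the session key of the
special session are missing. -/

namespace Sim

variable (S) (n : ℕ) (pr : Protocol) (m : ℕ)

/-- The oracle `h`. -/
def hash (d : Data) : Sim Data := oracle m (num 0) (2 ^ n - 1) d

/-- The oracle `H_K`. -/
def keyHash (d : Data) : Sim Data := oracle m (num 1) (2 ^ S.keyLen n - 1) d

/-- A negative reply. -/
def refuse : Sim Data := pure (num 0)

/-- A positive reply. -/
def accept (d : Data) : Sim Data := pure (cons (num 1) d)

/-- Give up, since the special session will not be an unexposed test session. -/
def die : Sim Data := do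
  let _ ← add m (num 4) (num 1)
  refuse

/-- A random exponent in `{1, …, q - 1}`. -/
def exponent : Sim Data := do
  let x ← draw (S.q n - 2)
  pure (num (x.toNat + 1))

/-- The exponents `c` and `d` of the protocol. -/
def cd (A Y : Data) : Sim Data :=
  match pr with
  | .oake => hash n m (cons A (cons Y (num 0)))
  | .soake => pure (num 1)

/-- The exponent `e` of the protocol. -/
def e (A B X Y : Data) : Sim Data :=
  match pr with
  | .oake => hash n m (cons X (cons Y (num 0)))
  | .soake => hash n m (cons A (cons B (cons X (cons Y (num 0)))))

/-- The session key of the initiator. -/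
def initiatorKey (A B a x X pkB Y : Data) : Sim Data := do
  let c ← cd n pr m A Y
  let d ← cd n pr m B X
  let e ← e n pr m A B X Y
  keyHash S n m (S.mulD n (S.powD n pkB (d.toNat * x.toNat))
    (S.powD n Y (c.toNat * a.toNat + e.toNat * x.toNat)))

/-- The session key of the responder. -/
def responderKey (A B b y Y pkA X : Data) : Sim Data := do
  let c ← cd n pr m A Y
  let d ← cd n pr m B X
  let e ← e n pr m A B X Y
  keyHash S n m (S.mulD n (S.powD n pkA (c.toNat * y.toNat))
    (S.powD n X (d.toNat * b.toNat + e.toNat * y.toNat)))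

/-- The oracle queries for the key of the special session; the key itself is not computed. -/
def reflectedHash (A X : Data) : Sim Data := do
  let _ ← cd n pr m A X
  let _ ← cd n pr m A X
  e n pr m A A X X

/-- Set up an honest player. -/
def newPlayer (A : Data) : Sim Data := do
  let P ← look (cons (num 2) A)
  if P = num 0 then do
    let a ← exponent S n
    let _ ← add m (cons (num 2) A) (cons (S.powD n (S.elem n (S.g n)) a.toNat) (cons a (num 0)))
    accept (S.powD n (S.elem n (S.g n)) a.toNat)
  else refuse

/-- Continue if `x` encodes an element of `G ∖ {1}`. -/
def ifValid (x : Data) (p : Sim Data) : Sim Data :=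
  if S.memD n x = num 1 then
    if x = S.powD n (S.elem n (S.g n)) 0 then refuse else p
  else refuse

/-- Register an adversarial player. -/
def register (A pk : Data) : Sim Data := do
  let P ← look (cons (num 2) A)
  if P = num 0 then
    ifValid S n pk do
      let _ ← add m (cons (num 2) A) (cons pk (num 0))
      let _ ← add m (cons (num 5) A) (num 1)
      accept (num 0)
  else refuse

/-- Corrupt an honest player. -/
def corrupt (A : Data) : Sim Data := do
  let P ← look (cons (num 2) A)
  if P.right = num 0 then refuse
  else do
    let _ ← add m (cons (num 5) A) (num 1)
    accept P.right.left

/-- Offline computation of a DH-component. For `t = num 1`, this is the special session, and `U` is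
used as its DH-component. -/
def precompute (U t i A : Data) : Sim Data := do
  let s ← look (cons (num 3) i)
  if s = num 0 then do
    let P ← look (cons (num 2) A)
    if P.right = num 0 then refuse
    else if t = num 1 then do
      let _ ← add m (num 2) (cons A (num 0))
      let _ ← add m (cons (num 3) i) (cons A (cons U (num 0)))
      accept U
    else do
      let x ← exponent S n
      let _ ← add m (cons (num 3) i)
        (cons A (cons (S.powD n (S.elem n (S.g n)) x.toNat) (cons x (num 0))))
      accept (S.powD n (S.elem n (S.g n)) x.toNat)
  else refuse

/-- State-reveal query. -/
def revealState (i B : Data) : Sim Data := do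
  let s ← look (cons (num 3) i)
  if s = num 0 then refuse
  else do
    let r ← look (cons (num 8) i)
    if r = num 0 then do
      let p ← look (cons (num 7) i)
      let C ← (if p = num 0 then pure B else pure p.left)
      let P ← look (cons (num 2) C)
      if P = num 0 then refuse
      else if s.right.right = num 0 then die m
      else do
        let d ← cd n pr m C s.right.left
        let _ ← add m (cons (num 6) i) (num 1)
        accept (cons s.right.left (cons s.right.right.left
          (cons (S.powD n P.left (d.toNat * s.right.right.left.toNat)) (num 0))))
    else refuse

/-- Session-key query. -/
def revealKey (i : Data) : Sim Data := do
  let r ← look (cons (num 8) i)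
  if r = num 0 then refuse
  else if r.right = num 0 then die m
  else do
    let _ ← add m (cons (num 9) i) (num 1)
    accept r.right.left

/-- Activation as initiator. -/
def initiate (i B : Data) : Sim Data := do
  let s ← look (cons (num 3) i)
  if s = num 0 then refuse
  else do
    let P ← look (cons (num 2) B)
    if P = num 0 then refuse
    else do
      let p ← look (cons (num 7) i)
      if p = num 0 then do
        let _ ← add m (cons (num 7) i) (cons B (num 0))
        accept s.right.left
      else refuse

/-- Activation as responder. -/
def respond (U i B X : Data) : Sim Data := do
  let s ← look (cons (num 3) i)
  if s = num 0 then refuse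
  else do
    let P ← look (cons (num 2) B)
    if P = num 0 then refuse
    else ifValid S n X do
      let p ← look (cons (num 7) i)
      if p = num 0 then do
        let Q ← look (cons (num 2) s.left)
        if Q.right = num 0 then refuse
        else if s.right.right = num 0 then
          if s.left = B then
            if X = U then do
              let _ ← reflectedHash n pr m B X
              let _ ← add m (cons (num 7) i) (cons B (num 0))
              let _ ← add m (cons (num 8) i) (cons X (num 0))
              accept s.right.left
            else die m
          else die m
        else do
          let k ← responderKey S n pr m B s.left Q.right.left s.right.right.left s.right.left
            P.left X
          let _ ← add m (cons (num 7) i) (cons B (num 0))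
          let _ ← add m (cons (num 8) i) (cons X (cons k (num 0)))
          accept s.right.left
      else refuse

/-- Completion of a session opened as initiator. -/
def complete (U i Y : Data) : Sim Data := do
  let s ← look (cons (num 3) i)
  if s = num 0 then refuse
  else ifValid S n Y do
    let p ← look (cons (num 7) i)
    if p = num 0 then refuse
    else do
      let r ← look (cons (num 8) i)
      if r = num 0 then do
        let P ← look (cons (num 2) p.left)
        if P = num 0 then refuse
        else do
          let Q ← look (cons (num 2) s.left)
          if Q.right = num 0 then refuse
          else if s.right.right = num 0 then
            if s.left = p.left then
              if Y = U then do
                let _ ← reflectedHash n pr m s.left Y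
                let _ ← add m (cons (num 8) i) (cons Y (num 0))
                accept (num 0)
              else die m
            else die m
          else do
            let k ← initiatorKey S n pr m s.left p.left Q.right.left s.right.right.left
              s.right.left P.left Y
            let _ ← add m (cons (num 8) i) (cons Y (cons k (num 0)))
            accept (num 0)
      else refuse

/-- Test query; `k` is the reply if the special session is tested. -/
def test (k i : Data) : Sim Data := do
  let t ← look (num 3)
  if t = num 0 then do
    let s ← look (cons (num 3) i)
    let p ← look (cons (num 7) i)
    let r ← look (cons (num 8) i)
    if r = num 0 then refuse
    else if s.left = p.left then
      if s.right.left = r.left then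
        if s.right.right = num 0 then do
          let _ ← add m (num 3) (cons i (num 0))
          accept k
        else die m
      else refuse
    else refuse
  else refuse

/-- Reaction of the simulator to the query `d`. Here `U` is the DH-component of the special session,
which is the one created by the present query if `t = num 1`, and `k` is its session key. -/
def answer (U k t d : Data) : Sim Data :=
  if d = cons (num 0) d.right then do
    let v ← hash n m d.right
    accept v
  else if d = cons (num 1) d.right then do
    let v ← keyHash S n m d.right
    accept v
  else if d = cons (num 2) (num d.right.toNat) then newPlayer S n m d.right
  else if d = cons (num 3) (cons (num d.right.left.toNat) (num d.right.right.toNat)) then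
    register S n m d.right.left d.right.right
  else if d = cons (num 4) (num d.right.toNat) then corrupt m d.right
  else if d = cons (num 5) (cons (num d.right.left.toNat) (num d.right.right.toNat)) then
    precompute S n m U t d.right.left d.right.right
  else if d = cons (num 6) (cons (num d.right.left.toNat) (num d.right.right.toNat)) then
    revealState S n pr m d.right.left d.right.right
  else if d = cons (num 7) (num d.right.toNat) then revealKey m d.right
  else if d = cons (num 8) (cons (num d.right.left.toNat) (num d.right.right.toNat)) then
    initiate m d.right.left d.right.right
  else if d = cons (num 9) (cons (num d.right.left.toNat)
      (cons (num d.right.right.left.toNat) (num d.right.right.right.toNat))) then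
    respond S n pr m U d.right.left d.right.right.left d.right.right.right
  else if d = cons (num 10) (cons (num d.right.left.toNat) (num d.right.right.toNat)) then
    complete S n pr m U d.right.left d.right.right
  else if d = cons (num 11) (num d.right.toNat) then test m k d.right
  else refuse

/-- The simulator as an environment. Its state consists of the DH-component and the key of the
special session, a countdown for the query that creates the special session, and the store. -/
def env (d : Data) : StateT Data PMF Data := fun z =>
  (answer S n pr m z.left z.right.left z.right.right.left d z.right.right.right).map fun r =>
    (r.1, cons z.left (cons z.right.left (cons (num (z.right.right.left.toNat - 1)) r.2)))

end Sim

/-- The probability that a value of `h` is divisible by `q`. -/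
def hashZero (S : Params) (n : ℕ) : ENNReal :=
  (uniformUpTo (2 ^ n - 1)).toOuterMeasure {v | S.q n ∣ v}

namespace Sim.Tame

variable {q m j : ℕ} {δ : ENNReal} {n : ℕ} {pr : Protocol}

theorem mono {p : Sim Data} {i : ℕ} (hp : p.Tame q m δ i) (hij : i ≤ j) : p.Tame q m δ j :=
  fun s => ⟨fun r hr => ⟨((hp s).1 r hr).1.trans (by gcongr), ((hp s).1 r hr).2⟩,
    fun hs => ((hp s).2 hs).trans (by gcongr)⟩

theorem hash (d : Data) : (Sim.hash n m d).Tame (S.q n) m (hashZero S n) (j + 1) :=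
  oracle d fun _ => le_rfl

theorem keyHash (d : Data) : (Sim.keyHash S n m d).Tame q m δ (j + 1) :=
  oracle d (by simp)

theorem exponent : (Sim.exponent S n).Tame q m δ j :=
  of_idle fun s r hr => by
    obtain ⟨t, ht, hr⟩ := (PMF.mem_support_bind_iff _ _ _).1 hr
    obtain ⟨v, -, rfl⟩ := (PMF.mem_support_map_iff _ _ _).1 ht
    rw [(PMF.mem_support_pure_iff _ _).1 hr]

theorem cd (A Y : Data) : (Sim.cd n pr m A Y).Tame (S.q n) m (hashZero S n) (j + 1) := by
  cases pr
  exacts [hash _, pure _]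

theorem e (A B X Y : Data) : (Sim.e n pr m A B X Y).Tame (S.q n) m (hashZero S n) (j + 1) := by
  cases pr
  exacts [hash _, hash _]

theorem ifValid {x : Data} {p : Sim Data} (h : p.Tame q m δ j) :
    (Sim.ifValid S n x p).Tame q m δ j :=
  .ite (.ite (.pure _) h) (.pure _)

theorem answer (U k t d : Data) :
    (Sim.answer S n pr m U k t d).Tame (S.q n) m (hashZero S n) 20 := by
  unfold Sim.answer Sim.newPlayer Sim.register Sim.corrupt Sim.precompute Sim.revealState
    Sim.revealKey Sim.initiate Sim.respond Sim.complete Sim.test Sim.initiatorKey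
    Sim.responderKey Sim.reflectedHash Sim.die Sim.accept Sim.refuse
  simp only [bind_assoc]
  repeat' first
    | with_reducible exact pure _
    | with_reducible exact look _
    | with_reducible exact hash _
    | with_reducible exact keyHash _
    | with_reducible exact exponent
    | with_reducible exact cd _ _
    | with_reducible exact e _ _ _ _
    | with_reducible exact add (by simp) _
    | with_reducible refine ite ?_ ?_
    | with_reducible refine ifValid ?_
    | with_reducible refine bind ?_ fun _ => ?_

end Sim.Tame

namespace EffM

variable {n : ℕ} {pr : Protocol} {m : ℕ → ℕ}

theorem hash (hm : EffN S fun n _ => m n) {f : ℕ → Data → Data} (hf : EffD S f) :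
    EffM S fun n z => Sim.hash n (m n) (f n z) :=
  oracle _ hm ((EffN.two_pow EffN.security Polynomial.X
    fun n z => by simp [Params.len]).sub (EffN.const 1)) hf

theorem keyHash (hS : S.Efficient) (hm : EffN S fun n _ => m n) {f : ℕ → Data → Data}
    (hf : EffD S f) : EffM S fun n z => Sim.keyHash S n (m n) (f n z) := by
  obtain ⟨L, hL⟩ := hS.exists_bound
  refine oracle _ hm ((EffN.two_pow EffN.keyLen L fun n z => ?_).sub (EffN.const 1)) hf
  have h1 := (hL n).2.2.1
  have h2 := poly_mono L (a := n) (b := S.len n z) (by simp [Params.len])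
  omega

theorem exponent : EffM S fun n _ => Sim.exponent S n :=
  bind (draw (EffN.order.sub (EffN.const 2)))
    (pure (EffN.add (EffN.toNat (EffD.left Eff.id)) (EffN.const 1)))

theorem cd (hm : EffN S fun n _ => m n) {A Y : ℕ → Data → Data} (hA : EffD S A) (hY : EffD S Y) :
    EffM S fun n z => Sim.cd n pr (m n) (A n z) (Y n z) := by
  cases pr
  exacts [hash hm (hA.cons (hY.cons (EffD.const _))), pure (EffD.const _)]

theorem e (hm : EffN S fun n _ => m n) {A B X Y : ℕ → Data → Data} (hA : EffD S A)
    (hB : EffD S B) (hX : EffD S X) (hY : EffD S Y) :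
    EffM S fun n z => Sim.e n pr (m n) (A n z) (B n z) (X n z) (Y n z) := by
  cases pr
  exacts [hash hm (hX.cons (hY.cons (EffD.const _))),
    hash hm (hA.cons (hB.cons (hX.cons (hY.cons (EffD.const _)))))]

theorem ifValid (hS : S.Efficient) {x : ℕ → Data → Data} {p : ℕ → Data → Sim Data}
    (hx : EffD S x) (hp : EffM S p) : EffM S fun n z => Sim.ifValid S n (x n z) (p n z) :=
  ite_eq (hx.memD hS) (EffD.const _) (ite_eq hx (EffD.powD hS EffD.generator (EffN.const 0))
    (pure (EffD.const _)) hp) (pure (EffD.const _))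

theorem num {f : ℕ → Data → ℕ} (hf : EffN S f) : EffD S fun n z => Data.num (f n z) := hf

theorem sim_answer (hS : S.Efficient) (hm : EffN S fun n _ => m n) :
    EffM S fun n z => Sim.answer S n pr (m n) z.left z.right.left z.right.right.left
      z.right.right.right := by
  have hz : EffD S fun _ z => z := Eff.id
  unfold Sim.answer Sim.newPlayer Sim.register Sim.corrupt Sim.precompute Sim.revealState
    Sim.revealKey Sim.initiate Sim.respond Sim.complete Sim.test Sim.initiatorKey
    Sim.responderKey Sim.reflectedHash Sim.die Sim.accept Sim.refuse
  repeat' first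
    | with_reducible exact EffD.const _
    | with_reducible exact hz
    | with_reducible apply EffM.ite_eq
    | with_reducible apply EffM.bind
    | with_reducible apply EffM.look
    | with_reducible apply EffM.add hm
    | with_reducible apply EffM.hash hm
    | with_reducible apply EffM.keyHash hS hm
    | with_reducible apply EffM.cd hm
    | with_reducible apply EffM.e hm
    | with_reducible apply EffM.ifValid hS
    | with_reducible exact EffM.exponent
    | with_reducible apply EffM.pure
    | with_reducible apply EffD.left
    | with_reducible apply EffD.right
    | with_reducible apply EffD.cons
    | with_reducible apply EffD.mulD hS
    | with_reducible apply EffD.powD hS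
    | with_reducible exact EffD.generator
    | with_reducible apply EffM.num
    | with_reducible apply EffN.add
    | with_reducible apply EffN.mul
    | with_reducible apply EffN.toNat

end EffM

/-- The simulator can be run in polynomial time. -/
theorem Eff.sim_env (hS : S.Efficient) (pr : Protocol) {m : ℕ → ℕ} (hm : EffN S fun n _ => m n) :
    Eff S fun n z => (Sim.env S n pr (m n) z.left z.right).map fun r => cons r.1 r.2 := by
  have hz : EffD S fun _ z => z := Eff.id
  have hs := hz.right.right.right.right
  have h := (EffM.sim_answer (pr := pr) hS hm).comp ((hz.right.left.cons (hz.right.right.left.cons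
    (hz.right.right.right.left.cons hz.left))).cons hs)
  have h' := h.map (g := fun n z r => cons r.left (cons z.right.left (cons z.right.right.left
    (cons (num (z.right.right.right.left.toNat - 1)) r.right))))
    (hz.left.left.cons (hz.right.right.left.cons (hz.right.right.right.left.cons
      (EffD.cons (EffN.sub (EffN.toNat hz.right.right.right.right.left) (EffN.const 1))
        hz.left.right))))
  unfold Eff at h' ⊢
  simpa only [Sim.env, PMF.map_comp, Function.comp_def, left_cons, right_cons] using h'

theorem Sim.env_size_le (n : ℕ) (pr : Protocol) (m : ℕ) (d z : Data) :
    ∀ r ∈ (env S n pr m d z).support, r.2.size ≤ z.size + (20 * (m + 2) + 10) := by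
  intro r hr
  obtain ⟨t, ht, rfl⟩ := (PMF.mem_support_map_iff _ _ _).1 hr
  have h1 := ((Tame.answer (S := S) (n := n) (pr := pr) (m := m) z.left z.right.left
    z.right.right.left d z.right.right.right).1 t ht).1
  have h2 : ∀ x : Data, (num (x.toNat - 1)).size ≤ x.size := by
    rintro (i | ⟨a, b⟩)
    · exact Nat.add_le_add_right (Nat.size_le_size (Nat.sub_le _ _)) 1
    · exact one_le_size _
  have h3 := h2 z.right.right.left
  have h4 : ∀ x : Data, x.left.size + x.right.size ≤ x.size + 1 := by
    rintro (i | ⟨a, b⟩)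
    · have := one_le_size (num i)
      simp [left, right, Data.size]
    · simp only [left, right, Data.size]
      omega
  have h5 := h4 z
  have h6 := h4 z.right
  have h7 := h4 z.right.right
  simp only [size_cons]
  omega

end OAKE

end

noncomputable section

namespace OAKE

open Data

namespace Params

variable (S : Params) (n : ℕ)

/-! ### The experiment with modified random choices -/

/-- The uniform distribution of session keys. -/
def keyDist : PMF ℕ := uniformUpTo (2 ^ S.keyLen n - 1)

/-- The random oracle `H_K`, with new values drawn from `kd`. -/
def hKFrom (kd : PMF ℕ) (d : Data) : S.Game n ℕ := fun st =>
  match st.keyTable d with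
  | some v => PMF.pure (v, st)
  | none => kd.map fun v =>
      (v, { st with keyTable := Function.update st.keyTable d (some v) })

/-- The session key of the initiator, with new values of `H_K` drawn from `kd`. -/
def initiatorKeyFrom (kd : PMF ℕ) (pr : Protocol) (A B a x : ℕ) (pkB Y : S.G n) :
    S.Game n ℕ := do
  let X := S.g n ^ x
  let c ← S.cd n pr A Y
  let d ← S.cd n pr B X
  let e ← S.e n pr A B X Y
  S.hKFrom n kd (S.elem n (pkB ^ (d * x) * Y ^ (c * a + e * x)))

/-- The session key of the responder, with new values of `H_K` drawn from `kd`. -/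
def responderKeyFrom (kd : PMF ℕ) (pr : Protocol) (A B b y : ℕ) (pkA X : S.G n) :
    S.Game n ℕ := do
  let Y := S.g n ^ y
  let c ← S.cd n pr A Y
  let d ← S.cd n pr B X
  let e ← S.e n pr A B X Y
  S.hKFrom n kd (S.elem n (pkA ^ (c * y) * X ^ (d * b + e * y)))

open Classical in
/-- The reactions of the experiment, with DH-exponents drawn from `ed`, the key of session `i` drawn
from `kd i` unless the value of `H_K` is known, and the random key of the test query drawn from
`td`. -/
def answerFrom (ed : PMF ℕ) (kd : ℕ → PMF ℕ) (td : PMF ℕ) (pr : Protocol) (β : Bool) :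
    Query → S.Game n Data
  | .precompute i A => do
      match (← get).sessions i, (← get).players A with
      | none, some ⟨_, some _, _⟩ =>
          let x ← S.draw n ed
          S.setSession n i ⟨A, x, S.g n ^ x, .precomputed, false, false⟩
          S.accept n (S.elem n (S.g n ^ x))
      | _, _ => S.refuse n
  | .respond i B m => do
      match (← get).sessions i, (← get).players B, S.decode n m with
      | some s, some P, some X =>
          match s.phase, (← get).players s.owner with
          | .precomputed, some ⟨_, some b, _⟩ =>
              let k ← S.responderKeyFrom n (kd i) pr B s.owner b s.exponent P.pk X
              S.setSession n i { s with phase := .complete B X k }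
              S.accept n (S.elem n s.component)
          | _, _ => S.refuse n
      | _, _, _ => S.refuse n
  | .complete i m => do
      match (← get).sessions i, S.decode n m with
      | some s, some Y =>
          match s.phase with
          | .opened B =>
              match (← get).players B, (← get).players s.owner with
              | some P, some ⟨_, some a, _⟩ =>
                  let k ← S.initiatorKeyFrom n (kd i) pr s.owner B a s.exponent P.pk Y
                  S.setSession n i { s with phase := .complete B Y k }
                  S.accept n (num 0)
              | _, _ => S.refuse n
          | _ => S.refuse n
      | _, _ => S.refuse n
  | .test i => do
      match (← get).tested, (← get).sessions i with
      | none, some s =>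
          match s.key with
          | none => S.refuse n
          | some k =>
              if s.Reflected then
                modify fun st => { st with tested := some i }
                let k' ← S.draw n td
                S.accept n (num (if β then k else k'))
              else S.refuse n
      | _, _ => S.refuse n
  | Q => S.answer n pr β Q

theorem answerFrom_eq (pr : Protocol) (β : Bool) (Q : Query) :
    S.answerFrom n (S.exponent n) (fun _ => S.keyDist n) (S.keyDist n) pr β Q =
      S.answer n pr β Q := by
  cases Q <;> rfl

end Params

variable {S : Params} {n : ℕ}

namespace Game

variable {α β : Type}

theorem get_bind (f : GameState (S.G n) → S.Game n α) (st : GameState (S.G n)) :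
    (get >>= f) st = f st st := PMF.pure_bind _ _

theorem pure_bind_apply (a : β) (f : β → S.Game n α) (st : GameState (S.G n)) :
    (pure a >>= f) st = f a st := PMF.pure_bind _ _

theorem bind_apply (m : S.Game n β) (f : β → S.Game n α) (st : GameState (S.G n)) :
    (m >>= f) st = (m st).bind fun r => f r.1 r.2 := rfl

theorem setSession_bind (i : ℕ) (s : Session (S.G n)) (f : PUnit → S.Game n α)
    (st : GameState (S.G n)) : (S.setSession n i s >>= f) st =
      f ⟨⟩ { st with sessions := Function.update st.sessions i (some s) } := PMF.pure_bind _ _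

theorem setPlayer_bind (A : ℕ) (P : Player (S.G n)) (f : PUnit → S.Game n α)
    (st : GameState (S.G n)) : (S.setPlayer n A P >>= f) st =
      f ⟨⟩ { st with players := Function.update st.players A (some P) } := PMF.pure_bind _ _

theorem modify_bind (g : GameState (S.G n) → GameState (S.G n)) (f : PUnit → S.Game n α)
    (st : GameState (S.G n)) : ((modify g : S.Game n PUnit) >>= f) st = f ⟨⟩ (g st) :=
  PMF.pure_bind _ _

theorem draw_bind (μ : PMF β) (f : β → S.Game n α) (st : GameState (S.G n)) :
    (S.draw n μ >>= f) st = μ.bind fun a => f a st := by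
  rw [bind_apply, Params.draw, PMF.bind_map]
  rfl

/-- Every outcome of `m` from `st` satisfies `Q`. -/
def Reach (st : GameState (S.G n)) (m : S.Game n α) (Q : α → GameState (S.G n) → Prop) : Prop :=
  ∀ r ∈ (m st).support, Q r.1 r.2

namespace Reach

variable {st : GameState (S.G n)} {Q : α → GameState (S.G n) → Prop}

theorem bind {m : S.Game n β} {f : β → S.Game n α}
    (h : Reach st m fun b st' => Reach st' (f b) Q) : Reach st (m >>= f) Q := by
  intro r hr
  obtain ⟨t, ht, hr⟩ := (PMF.mem_support_bind_iff _ _ _).1 hr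
  exact h t ht r hr

theorem pure {a : α} (h : Q a st) : Reach st (Pure.pure a : S.Game n α) Q := by
  intro r hr
  rw [(PMF.mem_support_pure_iff _ _).1 hr]
  exact h

theorem accept {Q : Data → GameState (S.G n) → Prop} {d : Data} (h : Q (cons (num 1) d) st) :
    Reach st (S.accept n d) Q := pure h

theorem refuse {Q : Data → GameState (S.G n) → Prop} (h : Q (num 0) st) :
    Reach st (S.refuse n) Q := pure h

theorem get {f : GameState (S.G n) → S.Game n α} (h : Reach st (f st) Q) :
    Reach st (MonadState.get >>= f) Q := by
  unfold Reach
  rw [get_bind]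
  exact h

theorem setSession {i : ℕ} {s : Session (S.G n)} {f : PUnit → S.Game n α}
    (h : Reach { st with sessions := Function.update st.sessions i (some s) } (f ⟨⟩) Q) :
    Reach st (S.setSession n i s >>= f) Q := by
  unfold Reach
  rw [setSession_bind]
  exact h

theorem setPlayer {A : ℕ} {P : Player (S.G n)} {f : PUnit → S.Game n α}
    (h : Reach { st with players := Function.update st.players A (some P) } (f ⟨⟩) Q) :
    Reach st (S.setPlayer n A P >>= f) Q := by
  unfold Reach
  rw [setPlayer_bind]
  exact h

theorem modify {g : GameState (S.G n) → GameState (S.G n)} {f : PUnit → S.Game n α}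
    (h : Reach (g st) (f ⟨⟩) Q) : Reach st ((_root_.modify g : S.Game n PUnit) >>= f) Q := by
  unfold Reach
  rw [modify_bind]
  exact h

theorem draw {μ : PMF α} (h : ∀ a, Q a st) : Reach st (S.draw n μ) Q := by
  intro r hr
  obtain ⟨a, -, rfl⟩ := (PMF.mem_support_map_iff _ _ _).1 hr
  exact h a

end Reach

end Game

/-- The state `st'` arises from `st` by new entries in the tables of the random oracles. -/
structure TableExt {G : Type} (st st' : GameState G) : Prop where
  hTable : ∀ d v, st.hTable d = some v → st'.hTable d = some v
  keyTable : ∀ d v, st.keyTable d = some v → st'.keyTable d = some v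
  players : st'.players = st.players
  sessions : st'.sessions = st.sessions
  tested : st'.tested = st.tested

theorem TableExt.refl {G : Type} (st : GameState G) : TableExt st st :=
  ⟨fun _ _ h => h, fun _ _ h => h, rfl, rfl, rfl⟩

theorem TableExt.trans {G : Type} {s t u : GameState G} (h : TableExt s t) (h' : TableExt t u) :
    TableExt s u :=
  ⟨fun d v hd => h'.1 d v (h.1 d v hd), fun d v hd => h'.2 d v (h.2 d v hd),
    h'.3.trans h.3, h'.4.trans h.4, h'.5.trans h.5⟩

open Game

theorem Game.Reach.h {st : GameState (S.G n)} {d : Data} {Q : ℕ → GameState (S.G n) → Prop}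
    (H : ∀ v st', TableExt st st' → st'.hTable d = some v → Q v st') : Reach st (S.h n d) Q := by
  intro r hr
  unfold Params.h at hr
  split at hr
  · rename_i v hv
    rw [(PMF.mem_support_pure_iff _ _).1 hr]
    exact H _ _ (.refl _) hv
  · rename_i hv
    obtain ⟨v, -, rfl⟩ := (PMF.mem_support_map_iff _ _ _).1 hr
    refine H _ _ ⟨fun d' v' h' => ?_, fun _ _ h' => h', rfl, rfl, rfl⟩ (by simp)
    have : d' ≠ d := by rintro rfl; simp [hv] at h'
    simpa [Function.update_of_ne this] using h'

theorem Game.Reach.hKFrom {st : GameState (S.G n)} {kd : PMF ℕ} {d : Data}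
    {Q : ℕ → GameState (S.G n) → Prop}
    (H : ∀ v st', TableExt st st' → st'.keyTable d = some v → Q v st') :
    Reach st (S.hKFrom n kd d) Q := by
  intro r hr
  unfold Params.hKFrom at hr
  split at hr
  · rename_i v hv
    rw [(PMF.mem_support_pure_iff _ _).1 hr]
    exact H _ _ (.refl _) hv
  · rename_i hv
    obtain ⟨v, -, rfl⟩ := (PMF.mem_support_map_iff _ _ _).1 hr
    refine H _ _ ⟨fun _ _ h' => h', fun d' v' h' => ?_, rfl, rfl, rfl⟩ (by simp)
    have : d' ≠ d := by rintro rfl; simp [hv] at h'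
    simpa [Function.update_of_ne this] using h'

/-- The value of `c` (or `d`) is known to be `c`. -/
def CDVal (S : Params) (n : ℕ) (pr : Protocol) (st : GameState (S.G n)) (A : ℕ) (Y : S.G n)
    (c : ℕ) : Prop :=
  match pr with
  | .oake => st.hTable (tuple [num A, S.elem n Y]) = some c
  | .soake => c = 1

/-- The argument of `h` for the exponent `e`. -/
def eArg (S : Params) (n : ℕ) (pr : Protocol) (A B : ℕ) (X Y : S.G n) : Data :=
  match pr with
  | .oake => tuple [S.elem n X, S.elem n Y]
  | .soake => tuple [num A, num B, S.elem n X, S.elem n Y]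

theorem CDVal.mono {pr : Protocol} {st st' : GameState (S.G n)} (h : TableExt st st') {A : ℕ}
    {Y : S.G n} {c : ℕ} (hc : CDVal S n pr st A Y c) : CDVal S n pr st' A Y c := by
  cases pr
  exacts [h.1 _ _ hc, hc]

theorem Game.Reach.cd {pr : Protocol} {st : GameState (S.G n)} {A : ℕ} {Y : S.G n}
    {Q : ℕ → GameState (S.G n) → Prop}
    (H : ∀ v st', TableExt st st' → CDVal S n pr st' A Y v → Q v st') :
    Reach st (S.cd n pr A Y) Q := by
  cases pr
  · exact .h H
  · exact .pure (H _ _ (.refl _) rfl)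

theorem Game.Reach.e {pr : Protocol} {st : GameState (S.G n)} {A B : ℕ} {X Y : S.G n}
    {Q : ℕ → GameState (S.G n) → Prop}
    (H : ∀ v st', TableExt st st' → st'.hTable (eArg S n pr A B X Y) = some v → Q v st') :
    Reach st (S.e n pr A B X Y) Q := by
  cases pr <;> exact .h H

theorem Game.Reach.responderKeyFrom {kd : PMF ℕ} {pr : Protocol} {st : GameState (S.G n)}
    {A B b y : ℕ} {pkA X : S.G n} {Q : ℕ → GameState (S.G n) → Prop}
    (H : ∀ k st' c d e, TableExt st st' → CDVal S n pr st' A (S.g n ^ y) c →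
      CDVal S n pr st' B X d → st'.hTable (eArg S n pr A B X (S.g n ^ y)) = some e →
      st'.keyTable (S.elem n (pkA ^ (c * y) * X ^ (d * b + e * y))) = some k → Q k st') :
    Reach st (S.responderKeyFrom n kd pr A B b y pkA X) Q := by
  refine .bind (.cd fun c s1 h1 hc => .bind (.cd fun d s2 h2 hd => .bind (.e fun e s3 h3 he =>
    .hKFrom fun k s4 h4 hk => H k s4 c d e ((h1.trans h2).trans (h3.trans h4))
      (hc.mono (h2.trans (h3.trans h4))) (hd.mono (h3.trans h4)) (h4.1 _ _ he) hk)))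

theorem Game.Reach.initiatorKeyFrom {kd : PMF ℕ} {pr : Protocol} {st : GameState (S.G n)}
    {A B a x : ℕ} {pkB Y : S.G n} {Q : ℕ → GameState (S.G n) → Prop}
    (H : ∀ k st' c d e, TableExt st st' → CDVal S n pr st' A Y c →
      CDVal S n pr st' B (S.g n ^ x) d → st'.hTable (eArg S n pr A B (S.g n ^ x) Y) = some e →
      st'.keyTable (S.elem n (pkB ^ (d * x) * Y ^ (c * a + e * x))) = some k → Q k st') :
    Reach st (S.initiatorKeyFrom n kd pr A B a x pkB Y) Q := by
  refine .bind (.cd fun c s1 h1 hc => .bind (.cd fun d s2 h2 hd => .bind (.e fun e s3 h3 he =>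
    .hKFrom fun k s4 h4 hk => H k s4 c d e ((h1.trans h2).trans (h3.trans h4))
      (hc.mono (h2.trans (h3.trans h4))) (hd.mono (h3.trans h4)) (h4.1 _ _ he) hk)))

/-! ### Invariants of the experiment -/

/-- How a session changes in the course of the experiment. -/
structure Session.Evolves {G : Type} (s s' : Session G) : Prop where
  owner : s'.owner = s.owner
  exponent : s'.exponent = s.exponent
  component : s'.component = s.component
  stateExposed : s.stateExposed = true → s'.stateExposed = true
  keyExposed : s.keyExposed = true → s'.keyExposed = true
  complete : ∀ B Y k, s.phase = .complete B Y k → s'.phase = .complete B Y k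

theorem Session.Evolves.refl {G : Type} (s : Session G) : s.Evolves s :=
  ⟨rfl, rfl, rfl, fun h => h, fun h => h, fun _ _ _ h => h⟩

/-- How the state changes in the course of the experiment. -/
structure Evolves {G : Type} (st st' : GameState G) : Prop where
  hTable : ∀ d v, st.hTable d = some v → st'.hTable d = some v
  keyTable : ∀ d v, st.keyTable d = some v → st'.keyTable d = some v
  players : ∀ A P, st.players A = some P →
    ∃ P', st'.players A = some P' ∧ P'.pk = P.pk ∧ P'.sk = P.sk
  sessions : ∀ i s, st.sessions i = some s → ∃ s', st'.sessions i = some s' ∧ s.Evolves s'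
  tested : ∀ i, st.tested = some i → st'.tested = some i

theorem TableExt.evolves {G : Type} {st st' : GameState G} (h : TableExt st st') :
    Evolves st st' :=
  ⟨h.1, h.2, fun A P hP => ⟨P, by rw [h.3, hP], rfl, rfl⟩,
    fun i s hs => ⟨s, by rw [h.4, hs], .refl s⟩, fun i hi => by rw [h.5, hi]⟩

theorem Evolves.refl {G : Type} (st : GameState G) : Evolves st st := (TableExt.refl st).evolves

theorem Evolves.setPlayer {G : Type} {st : GameState G} {A : ℕ} {P : Player G}
    (h : ∀ P', st.players A = some P' → P.pk = P'.pk ∧ P.sk = P'.sk) :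
    Evolves st { st with players := Function.update st.players A (some P) } := by
  refine ⟨fun _ _ h => h, fun _ _ h => h, fun A' P' hP' => ?_, fun i s hs => ⟨s, hs, .refl s⟩,
    fun _ h => h⟩
  by_cases hA : A' = A
  · subst hA
    exact ⟨P, by simp, h P' hP'⟩
  · exact ⟨P', by simp [Function.update_of_ne hA, hP'], rfl, rfl⟩

theorem Evolves.setSession {G : Type} {st st' : GameState G} {i : ℕ} {s : Session G}
    (hst : TableExt st st') (h : ∀ s', st.sessions i = some s' → s'.Evolves s) :
    Evolves st { st' with sessions := Function.update st'.sessions i (some s) } := by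
  refine ⟨hst.1, hst.2, fun A P hP => ⟨P, by simp [hst.3, hP], rfl, rfl⟩, fun j s' hs => ?_,
    fun i h => hst.5.trans h⟩
  by_cases hj : j = i
  · subst hj
    exact ⟨s, by simp, h s' hs⟩
  · exact ⟨s', by simp [Function.update_of_ne hj, hst.4, hs], .refl s'⟩

theorem CDVal.evolves {pr : Protocol} {st st' : GameState (S.G n)} (h : Evolves st st') {A : ℕ}
    {Y : S.G n} {c : ℕ} (hc : CDVal S n pr st A Y c) : CDVal S n pr st' A Y c := by
  cases pr
  exacts [h.1 _ _ hc, hc]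

/-- The key of a complete session `(A, A, X, X)` is the one given by the protocol. -/
def KeyOK (S : Params) (n : ℕ) (pr : Protocol) (st : GameState (S.G n)) (s : Session (S.G n)) :
    Prop :=
  ∀ k, s.phase = .complete s.owner s.component k → ∃ P a c e, st.players s.owner = some P ∧
    P.sk = some a ∧ CDVal S n pr st s.owner s.component c ∧
    st.hTable (eArg S n pr s.owner s.owner s.component s.component) = some e ∧
    st.keyTable (S.elem n (s.component ^ (c * a) * s.component ^ (c * a + e * s.exponent))) =
      some k

/-- The invariant of the experiment. -/
structure Inv (S : Params) (n : ℕ) (pr : Protocol) (st : GameState (S.G n)) : Prop where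
  pk : ∀ A P a, st.players A = some P → P.sk = some a → P.pk = S.g n ^ a
  component : ∀ i s, st.sessions i = some s → s.component = S.g n ^ s.exponent
  key : ∀ i s, st.sessions i = some s → KeyOK S n pr st s
  tested : ∀ i, st.tested = some i → ∃ s, st.sessions i = some s ∧ s.Reflected

theorem Session.Evolves.reflected {G : Type} {s s' : Session G} (h : s.Evolves s')
    (hs : s.Reflected) : s'.Reflected := by
  obtain ⟨A, X, hA⟩ := hs
  refine ⟨A, X, ?_⟩
  unfold Session.ident at hA ⊢
  split at hA
  · rename_i B Y k hp
    rw [h.complete B Y k hp, h.owner, h.component]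
    exact hA
  · simp at hA

theorem KeyOK.evolves {pr : Protocol} {st st' : GameState (S.G n)} {s s' : Session (S.G n)}
    (h : KeyOK S n pr st s) (hst : Evolves st st') (h1 : s'.owner = s.owner)
    (h2 : s'.component = s.component) (h3 : s'.exponent = s.exponent)
    (h4 : ∀ k, s'.phase = .complete s.owner s.component k →
      s.phase = .complete s.owner s.component k) : KeyOK S n pr st' s' := by
  intro k hk
  rw [h1, h2] at hk
  obtain ⟨P, a, c, e, hP, ha, hc, he, hk⟩ := h k (h4 k hk)
  obtain ⟨P', hP', -, hsk⟩ := hst.players _ _ hP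
  rw [h1, h2, h3]
  exact ⟨P', a, c, e, hP', hsk.trans ha, hc.evolves hst, hst.1 _ _ he, hst.2 _ _ hk⟩

theorem Inv.tableExt {pr : Protocol} {st st' : GameState (S.G n)} (h : Inv S n pr st)
    (hst : TableExt st st') : Inv S n pr st' :=
  ⟨by rw [hst.3]; exact h.1, by rw [hst.4]; exact h.2, fun i s hs =>
    (h.3 i s (by rwa [hst.4] at hs)).evolves hst.evolves rfl rfl rfl fun _ h => h,
    by rw [hst.5, hst.4]; exact h.4⟩

theorem Inv.setPlayer {pr : Protocol} {st : GameState (S.G n)} (h : Inv S n pr st)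
    {A : ℕ} {P : Player (S.G n)} (h1 : ∀ P', st.players A = some P' → P.pk = P'.pk ∧ P.sk = P'.sk)
    (h2 : ∀ a, P.sk = some a → P.pk = S.g n ^ a) :
    Inv S n pr { st with players := Function.update st.players A (some P) } := by
  refine ⟨fun A' P' a hP' ha => ?_, h.2, fun i s hs =>
    (h.3 i s hs).evolves (.setPlayer h1) rfl rfl rfl fun _ h => h, h.4⟩
  by_cases hA : A' = A
  · subst hA
    simp only [Function.update_self, Option.some.injEq] at hP'
    subst hP'
    exact h2 a ha
  · exact h.1 A' P' a (by simpa [Function.update_of_ne hA] using hP') ha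

theorem Inv.setSession {pr : Protocol} {st : GameState (S.G n)} (h : Inv S n pr st)
    {i : ℕ} {s : Session (S.G n)} (h1 : ∀ s', st.sessions i = some s' → s'.Evolves s)
    (h2 : s.component = S.g n ^ s.exponent) (h3 : KeyOK S n pr st s) :
    Inv S n pr { st with sessions := Function.update st.sessions i (some s) } := by
  have hev := Evolves.setSession (TableExt.refl st) h1
  refine ⟨h.1, fun j s' hs' => ?_, fun j s' hs' => ?_, fun j hj => ?_⟩
  case refine_3 =>
    obtain ⟨s', hs', hr⟩ := h.tested j hj
    obtain ⟨s'', hs'', hse⟩ := hev.sessions j s' hs'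
    exact ⟨s'', hs'', hse.reflected hr⟩
  all_goals by_cases hj : j = i
  · subst hj
    simp only [Function.update_self, Option.some.injEq] at hs'
    subst hs'
    exact h2
  · exact h.2 j s' (by simpa [Function.update_of_ne hj] using hs')
  · subst hj
    simp only [Function.update_self, Option.some.injEq] at hs'
    subst hs'
    exact h3.evolves hev rfl rfl rfl fun _ h => h
  · exact (h.3 j s' (by simpa [Function.update_of_ne hj] using hs')).evolves hev rfl rfl rfl
      fun _ h => h

/-- Every reaction of the experiment respects the invariant. -/
theorem answerFrom_reach {pr : Protocol} {st : GameState (S.G n)} (h : Inv S n pr st)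
    (ed : PMF ℕ) (kd : ℕ → PMF ℕ) (td : PMF ℕ) (β : Bool) (Q : Query) :
    Reach st (S.answerFrom n ed kd td pr β Q) fun _ st' => Evolves st st' ∧ Inv S n pr st' := by
  have hidle : Reach st (S.refuse n) fun _ st' => Evolves st st' ∧ Inv S n pr st' :=
    .refuse ⟨.refl st, h⟩
  cases Q with
  | hash d => exact .bind (.h fun v st' hst _ => .accept ⟨hst.evolves, h.tableExt hst⟩)
  | keyHash d =>
    exact .bind (.hKFrom (kd := S.keyDist n) fun v st' hst _ =>
      .accept ⟨hst.evolves, h.tableExt hst⟩)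
  | newPlayer A =>
    unfold Params.answerFrom Params.answer
    repeat with_reducible refine .get ?_
    cases hA : st.players A with
    | some P => exact hidle
    | none =>
      refine .bind (.draw fun a => ?_)
      refine .setPlayer ?_
      exact .accept ⟨.setPlayer (by simp [hA]), h.setPlayer (by simp [hA]) (by simp)⟩
  | register A pk =>
    unfold Params.answerFrom Params.answer
    repeat with_reducible refine .get ?_
    cases hA : st.players A with
    | some P => exact hidle
    | none =>
      cases S.decode n pk with
      | none => exact hidle
      | some P =>
        refine .setPlayer ?_
        exact .accept ⟨.setPlayer (by simp [hA]), h.setPlayer (by simp [hA]) (by simp)⟩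
  | corrupt A =>
    unfold Params.answerFrom Params.answer
    repeat with_reducible refine .get ?_
    cases hA : st.players A with
    | none => exact hidle
    | some P =>
      obtain ⟨P, _ | a, cor⟩ := P
      · exact hidle
      · refine .setPlayer ?_
        have := h.pk A _ a hA rfl
        exact .accept ⟨.setPlayer (by simp [hA]),
          h.setPlayer (by simp [hA]) (by rintro b ⟨⟩; exact this)⟩
  | precompute i A =>
    unfold Params.answerFrom
    repeat with_reducible refine .get ?_
    cases hi : st.sessions i with
    | some s => exact hidle
    | none =>
      cases hA : st.players A with
      | none => exact hidle
      | some P =>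
        obtain ⟨P, _ | a, cor⟩ := P
        · exact hidle
        · refine .bind (.draw fun a => ?_)
          refine .setSession ?_
          exact .accept ⟨.setSession (.refl st) (by simp [hi]),
            h.setSession (by simp [hi]) rfl (by simp [KeyOK])⟩
  | revealState i B =>
    unfold Params.answerFrom Params.answer
    repeat with_reducible refine .get ?_
    cases hi : st.sessions i with
    | none => exact hidle
    | some s =>
      have key : ∀ P C ph, s.phase = ph → Reach st (do
          let d ← S.cd n pr C s.component
          S.setSession n i { s with phase := ph, stateExposed := true }
          S.accept n (tuple [S.elem n s.component, num s.exponent,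
            S.elem n (P ^ (d * s.exponent))])) fun _ st' => Evolves st st' ∧ Inv S n pr st' := by
        rintro P C _ rfl
        refine .bind (.cd fun d st' hst _ => ?_)
        refine .setSession ?_
        refine .accept ⟨.setSession hst ?_, (h.tableExt hst).setSession ?_ ?_ ?_⟩
        · rw [hi]
          rintro _ ⟨⟩
          exact ⟨rfl, rfl, rfl, fun _ => rfl, fun h => h, fun _ _ _ h => h⟩
        · rw [hst.4, hi]
          rintro _ ⟨⟩
          exact ⟨rfl, rfl, rfl, fun _ => rfl, fun h => h, fun _ _ _ h => h⟩
        · exact h.component i s hi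
        · exact (h.key i s hi).evolves hst.evolves rfl rfl rfl fun _ h => h
      dsimp only
      cases hp : s.phase with
      | precomputed =>
        dsimp only
        repeat with_reducible refine .get ?_
        cases st.players B with
        | none => exact hidle
        | some P => exact key _ _ _ hp
      | opened C =>
        dsimp only
        repeat with_reducible refine .get ?_
        cases st.players C with
        | none => exact hidle
        | some P => exact key _ _ _ hp
      | complete C Y k => exact hidle
  | revealKey i =>
    unfold Params.answerFrom Params.answer
    repeat with_reducible refine .get ?_
    cases hi : st.sessions i with
    | none => exact hidle
    | some s =>
      dsimp only
      cases hk : s.key with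
      | none => exact hidle
      | some k =>
        refine .setSession ?_
        refine .accept ⟨.setSession (.refl st) ?_, h.setSession ?_ ?_ ?_⟩
        · rw [hi]
          rintro _ ⟨⟩
          exact ⟨rfl, rfl, rfl, fun h => h, fun _ => rfl, fun _ _ _ h => h⟩
        · rw [hi]
          rintro _ ⟨⟩
          exact ⟨rfl, rfl, rfl, fun h => h, fun _ => rfl, fun _ _ _ h => h⟩
        · exact h.component i s hi
        · exact (h.key i s hi).evolves (.refl st) rfl rfl rfl fun _ h => h
  | initiate i B =>
    unfold Params.answerFrom Params.answer
    repeat with_reducible refine .get ?_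
    cases hi : st.sessions i with
    | none => exact hidle
    | some s =>
      cases st.players B with
      | none => exact hidle
      | some P =>
        dsimp only
        cases hp : s.phase with
        | opened C => exact hidle
        | complete C Y k => exact hidle
        | precomputed =>
          refine .setSession ?_
          refine .accept ⟨.setSession (.refl st) ?_, h.setSession ?_ ?_ ?_⟩
          · rw [hi]
            rintro _ ⟨⟩
            exact ⟨rfl, rfl, rfl, fun h => h, fun h => h, by simp [hp]⟩
          · rw [hi]
            rintro _ ⟨⟩
            exact ⟨rfl, rfl, rfl, fun h => h, fun h => h, by simp [hp]⟩
          · exact h.component i s hi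
          · simp [KeyOK]
  | respond i B m =>
    unfold Params.answerFrom
    repeat with_reducible refine .get ?_
    cases hi : st.sessions i with
    | none => exact hidle
    | some s =>
      cases hB : st.players B with
      | none => exact hidle
      | some P =>
        cases S.decode n m with
        | none => exact hidle
        | some X =>
          dsimp only
          repeat with_reducible refine .get ?_
          cases hp : s.phase with
          | opened C => exact hidle
          | complete C Y k => exact hidle
          | precomputed =>
            cases hQ : st.players s.owner with
            | none => exact hidle
            | some Q =>
              obtain ⟨Q, _ | b, cor⟩ := Q
              · exact hidle
              · refine .bind (.responderKeyFrom fun k st' c d e hst hc hd he hk => ?_)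
                refine .setSession ?_
                refine .accept ⟨.setSession hst ?_, (h.tableExt hst).setSession ?_ ?_ ?_⟩
                · rw [hi]
                  rintro _ ⟨⟩
                  exact ⟨rfl, rfl, rfl, fun h => h, fun h => h, by simp [hp]⟩
                · rw [hst.4, hi]
                  rintro _ ⟨⟩
                  exact ⟨rfl, rfl, rfl, fun h => h, fun h => h, by simp [hp]⟩
                · exact h.component i s hi
                · intro k' hk'
                  simp only [Phase.complete.injEq] at hk'
                  obtain ⟨rfl, rfl, rfl⟩ := hk'
                  obtain rfl : P = ⟨Q, some b, cor⟩ := by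
                    rw [hB] at hQ
                    exact Option.some.inj hQ
                  have hX := h.component i s hi
                  rw [← hX] at hc he
                  obtain rfl : c = d := by
                    cases pr
                    · exact Option.some.inj (hc.symm.trans hd)
                    · exact Eq.trans hc (Eq.symm hd)
                  refine ⟨_, b, c, e, by rw [hst.3]; exact hB, rfl, hc, he, ?_⟩
                  rw [← hk]
                  refine congrArg _ (congrArg _ ?_)
                  rw [h.pk _ _ b hB rfl, hX]
                  simp only [← pow_mul, ← pow_add]
                  congr 1
                  ring
  | complete i m =>
    unfold Params.answerFrom
    repeat with_reducible refine .get ?_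
    cases hi : st.sessions i with
    | none => exact hidle
    | some s =>
      cases S.decode n m with
      | none => exact hidle
      | some Y =>
        dsimp only
        cases hp : s.phase with
        | precomputed => exact hidle
        | complete C Y k => exact hidle
        | opened B =>
          dsimp only
          repeat with_reducible refine .get ?_
          cases hB : st.players B with
          | none => exact hidle
          | some P =>
            cases hQ : st.players s.owner with
            | none => exact hidle
            | some Q =>
              obtain ⟨Q, _ | b, cor⟩ := Q
              · exact hidle
              · refine .bind (.initiatorKeyFrom fun k st' c d e hst hc hd he hk => ?_)
                refine .setSession ?_
                refine .accept ⟨.setSession hst ?_, (h.tableExt hst).setSession ?_ ?_ ?_⟩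
                · rw [hi]
                  rintro _ ⟨⟩
                  exact ⟨rfl, rfl, rfl, fun h => h, fun h => h, by simp [hp]⟩
                · rw [hst.4, hi]
                  rintro _ ⟨⟩
                  exact ⟨rfl, rfl, rfl, fun h => h, fun h => h, by simp [hp]⟩
                · exact h.component i s hi
                · intro k' hk'
                  simp only [Phase.complete.injEq] at hk'
                  obtain ⟨rfl, rfl, rfl⟩ := hk'
                  obtain rfl : P = ⟨Q, some b, cor⟩ := by
                    rw [hB] at hQ
                    exact Option.some.inj hQ
                  have hX := h.component i s hi
                  rw [← hX] at hd he
                  obtain rfl : c = d := by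
                    cases pr
                    · exact Option.some.inj (hc.symm.trans hd)
                    · exact Eq.trans hc (Eq.symm hd)
                  refine ⟨_, b, c, e, by rw [hst.3]; exact hB, rfl, hc, he, ?_⟩
                  rw [← hk]
                  refine congrArg _ (congrArg _ ?_)
                  rw [h.pk _ _ b hB rfl, hX]
                  simp only [← pow_mul, ← pow_add]
                  congr 1
                  ring
  | test i =>
    unfold Params.answerFrom
    repeat with_reducible refine .get ?_
    cases ht : st.tested with
    | some j => exact hidle
    | none =>
      cases hi : st.sessions i with
      | none => exact hidle
      | some s =>
        dsimp only
        cases s.key with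
        | none => exact hidle
        | some k =>
          dsimp only
          by_cases hr : s.Reflected
          · rw [if_pos hr]
            refine .modify ?_
            refine .bind (.draw fun k' => .accept ⟨⟨fun _ _ h => h, fun _ _ h => h,
              fun A P hP => ⟨P, hP, rfl, rfl⟩, fun i s hs => ⟨s, hs, .refl s⟩, by simp [ht]⟩,
              h.pk, h.component, fun i s hs => h.key i s hs, ?_⟩)
            rintro _ ⟨⟩
            exact ⟨s, hi, hr⟩
          · rw [if_neg hr]
            exact hidle

/-- Matching sessions `(A, A, X, X)` have the same key. -/
theorem Inv.not_mismatch {pr : Protocol} {st : GameState (S.G n)} (h : Inv S n pr st) :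
    ¬ st.Mismatch := by
  rintro ⟨i, j, s, t, hs, ht, ⟨A, X, hr⟩, ⟨A', B', X', Y', h1, h2⟩, hne⟩
  refine hne ?_
  have hd : ∀ s : Session (S.G n), s.ident = some (A, A, X, X) →
      ∃ k, s.phase = .complete s.owner s.component k ∧ s.owner = A ∧ s.component = X ∧
        s.key = some k := by
    intro s hs
    unfold Session.ident at hs
    split at hs
    · rename_i B Y k hp
      simp only [Option.some.injEq, Prod.mk.injEq] at hs
      obtain ⟨rfl, rfl, rfl, rfl⟩ := hs
      exact ⟨k, hp, rfl, rfl, by simp [Session.key, hp]⟩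
    · simp at hs
  rw [hr] at h1
  simp only [Option.some.injEq, Prod.mk.injEq] at h1
  obtain ⟨rfl, rfl, rfl, rfl⟩ := h1
  obtain ⟨k, hk, ho, hc, hkey⟩ := hd s hr
  obtain ⟨k', hk', ho', hc', hkey'⟩ := hd t h2
  obtain ⟨P, a, c, e, hP, ha, hcv, he, hK⟩ := h.key i s hs k hk
  obtain ⟨P', a', c', e', hP', ha', hcv', he', hK'⟩ := h.key j t ht k' hk'
  have hx := h.component i s hs
  have hy := h.component j t ht
  rw [ho, hc] at *
  rw [ho', hc'] at *
  obtain rfl : P = P' := Option.some.inj (hP.symm.trans hP')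
  obtain rfl : a = a' := Option.some.inj (ha.symm.trans ha')
  obtain rfl : e = e' := Option.some.inj (he.symm.trans he')
  obtain rfl : c = c' := by
    cases pr
    · exact Option.some.inj (hcv.symm.trans hcv')
    · exact Eq.trans hcv (Eq.symm hcv')
  -- the exponents agree modulo the order of `g` only
  have hpow : X ^ s.exponent = X ^ t.exponent := by
    conv_lhs => rw [hy, pow_right_comm, ← hx]
  have : X ^ (e * s.exponent) = X ^ (e * t.exponent) := by
    rw [mul_comm, pow_mul, hpow, ← pow_mul, mul_comm]
  rw [hkey, hkey', ← hK, ← hK', pow_add, pow_add, this]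

end OAKE

end

noncomputable section

namespace OAKE

open Data

/-! ### Couplings -/

/-- There is a coupling of `μ` and `ν` whose outcomes are related by `R`. -/
def Coupled {α β : Type} (R : α → β → Prop) (μ : PMF α) (ν : PMF β) : Prop :=
  ∃ ρ : PMF (α × β), ρ.map Prod.fst = μ ∧ ρ.map Prod.snd = ν ∧ ∀ p ∈ ρ.support, R p.1 p.2

namespace Coupled

variable {α β γ δ : Type} {R R' : α → β → Prop} {μ : PMF α} {ν : PMF β}

theorem mono (h : Coupled R μ ν) (hR : ∀ a b, R a b → R' a b) : Coupled R' μ ν := by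
  obtain ⟨ρ, h1, h2, h3⟩ := h
  exact ⟨ρ, h1, h2, fun p hp => hR _ _ (h3 p hp)⟩

theorem pure {a : α} {b : β} (h : R a b) : Coupled R (PMF.pure a) (PMF.pure b) := by
  refine ⟨PMF.pure (a, b), PMF.pure_map _ _, PMF.pure_map _ _, fun p hp => ?_⟩
  rw [(PMF.mem_support_pure_iff _ _).1 hp]
  exact h

theorem of_forall (h : ∀ a ∈ μ.support, ∀ b ∈ ν.support, R a b) : Coupled R μ ν := by
  refine ⟨μ.bind fun a => ν.map fun b => (a, b), ?_, ?_, fun p hp => ?_⟩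
  · simp only [PMF.map_bind, PMF.map_comp, Function.comp_def]
    simp only [PMF.map, Function.comp_def, PMF.bind_const, PMF.bind_pure]
  · simp only [PMF.map_bind, PMF.map_comp, Function.comp_def]
    exact (PMF.bind_const _ _).trans (PMF.map_id ν)
  · obtain ⟨a, ha, hp⟩ := (PMF.mem_support_bind_iff _ _ _).1 hp
    obtain ⟨b, hb, rfl⟩ := (PMF.mem_support_map_iff _ _ _).1 hp
    exact h a ha b hb

theorem bind {R : γ → δ → Prop} {μ : PMF γ} {ν : PMF δ} {f : γ → PMF α} {g : δ → PMF β}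
    (h : Coupled R μ ν) (hf : ∀ a b, R a b → Coupled R' (f a) (g b)) :
    Coupled R' (μ.bind f) (ν.bind g) := by
  classical
  obtain ⟨ρ, rfl, rfl, h3⟩ := h
  choose K h1 h2 h4 using hf
  let L : γ × δ → PMF (α × β) := fun p => if h : R p.1 p.2 then K p.1 p.2 h else
    (f p.1).bind fun a => (g p.2).map fun b => (a, b)
  refine ⟨ρ.bind L, ?_, ?_, fun p hp => ?_⟩
  · rw [PMF.map_bind, PMF.bind_map]
    refine bind_congr_support _ fun p hp => ?_
    simp only [L, dif_pos (h3 p hp), h1, Function.comp_def]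
  · rw [PMF.map_bind, PMF.bind_map]
    refine bind_congr_support _ fun p hp => ?_
    simp only [L, dif_pos (h3 p hp), h2, Function.comp_def]
  · obtain ⟨r, hr, hp⟩ := (PMF.mem_support_bind_iff _ _ _).1 hp
    simp only [L, dif_pos (h3 r hr)] at hp
    exact h4 _ _ _ p hp

theorem map {f : γ → α} {g : δ → β} {μ : PMF γ} {ν : PMF δ}
    (h : Coupled (fun a b => R (f a) (g b)) μ ν) : Coupled R (μ.map f) (ν.map g) :=
  bind (f := fun a => PMF.pure (f a)) (g := fun b => PMF.pure (g b)) h fun _ _ h => pure h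

theorem refl {R : α → α → Prop} (h : ∀ a ∈ μ.support, R a a) : Coupled R μ μ := by
  refine ⟨μ.map fun a => (a, a), ?_, ?_, fun p hp => ?_⟩
  · rw [PMF.map_comp]
    exact PMF.map_id μ
  · rw [PMF.map_comp]
    exact PMF.map_id μ
  · obtain ⟨a, ha, rfl⟩ := (PMF.mem_support_map_iff _ _ _).1 hp
    exact h a ha

theorem bind_left {μ : PMF γ} {f : γ → PMF α} (h : ∀ a ∈ μ.support, Coupled R (f a) ν) :
    Coupled R (μ.bind f) ν := by
  have h1 : Coupled (fun a (_ : Unit) => a ∈ μ.support) μ (PMF.pure ()) :=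
    of_forall fun a ha _ _ => ha
  have := bind (g := fun _ => ν) h1 fun a b hab => h a hab
  rwa [PMF.pure_bind] at this

theorem toOuterMeasure_le (h : Coupled R μ ν) {A : Set α} {B C : Set β}
    (hA : ∀ a b, R a b → a ∈ A → b ∈ B ∨ b ∈ C) :
    μ.toOuterMeasure A ≤ ν.toOuterMeasure B + ν.toOuterMeasure C := by
  obtain ⟨ρ, rfl, rfl, h3⟩ := h
  refine le_trans ?_ (MeasureTheory.measure_union_le B C)
  rw [PMF.toOuterMeasure_map_apply, PMF.toOuterMeasure_map_apply]
  exact PMF.toOuterMeasure_mono _ fun p hp => hA _ _ (h3 p hp.2) hp.1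

theorem swap (h : Coupled R μ ν) : Coupled (fun b a => R a b) ν μ := by
  obtain ⟨ρ, rfl, rfl, h3⟩ := h
  refine ⟨ρ.map Prod.swap, ?_, ?_, fun p hp => ?_⟩
  · rw [PMF.map_comp]
    rfl
  · rw [PMF.map_comp]
    rfl
  · obtain ⟨r, hr, rfl⟩ := (PMF.mem_support_map_iff _ _ _).1 hp
    exact h3 r hr

/-- Runs of a program against two environments that react in the same way to queries of size at
most `T` as long as their states satisfy the relation `Q`; once the states satisfy `B`, the runs
need not agree any more. -/
theorem run {σ τ : Type} {env : Data → StateT σ PMF Data} {env' : Data → StateT τ PMF Data}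
    {T : ℕ} {Q B : σ → τ → Prop}
    (hstep : ∀ d, d.size ≤ T → ∀ s t, Q s t → Coupled (fun r r' =>
      (r.1 = r'.1 ∧ Q r.2 r'.2) ∨ B r.2 r'.2) (env d s) (env' d t))
    (hl : ∀ d s t, B s t → ∀ r ∈ (env d s).support, B r.2 t)
    (hr : ∀ d s t, B s t → ∀ r ∈ (env' d t).support, B s r.2)
    {c : Comp (Data × ℕ)} {post : Data × ℕ → Prop} {b : ℕ}
    (hc : c.Budget (fun _ => True) post b) (hb : b ≤ T) {s : σ} {t : τ} (hst : Q s t) :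
    Coupled (fun r r' => (r.1 = r'.1 ∧ Q r.2 r'.2) ∨ B r.2 r'.2) (c.run env s) (c.run env' t) := by
  have hl' : ∀ (c : Comp (Data × ℕ)) s t, B s t → ∀ r ∈ (c.run env s).support, B r.2 t := by
    intro c
    induction c with
    | ret a => intro s t h r hr; rw [(PMF.mem_support_pure_iff _ _).1 hr]; exact h
    | timeout => intro s t h r hr; rw [(PMF.mem_support_pure_iff _ _).1 hr]; exact h
    | rnd m k ih =>
      intro s t h r hr
      obtain ⟨i, -, hr⟩ := (PMF.mem_support_bind_iff _ _ _).1 hr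
      exact ih i s t h r hr
    | query d k ih =>
      intro s t h r hr
      obtain ⟨u, hu, hr⟩ := (PMF.mem_support_bind_iff _ _ _).1 hr
      exact ih _ _ _ (hl d s t h u hu) r hr
  have hr' : ∀ (c : Comp (Data × ℕ)) s t, B s t → ∀ r ∈ (c.run env' t).support, B s r.2 := by
    intro c
    induction c with
    | ret a => intro s t h r hr; rw [(PMF.mem_support_pure_iff _ _).1 hr]; exact h
    | timeout => intro s t h r hr; rw [(PMF.mem_support_pure_iff _ _).1 hr]; exact h
    | rnd m k ih =>
      intro s t h r hr
      obtain ⟨i, -, hr⟩ := (PMF.mem_support_bind_iff _ _ _).1 hr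
      exact ih i s t h r hr
    | query d k ih =>
      intro s t h r h'
      obtain ⟨u, hu, h'⟩ := (PMF.mem_support_bind_iff _ _ _).1 h'
      exact ih _ _ _ (hr d s t h u hu) r h'
  induction c generalizing b s t with
  | ret a => exact pure (.inl ⟨rfl, hst⟩)
  | timeout => exact pure (.inl ⟨rfl, hst⟩)
  | rnd m k ih =>
    refine bind (R := fun i j => i = j ∧ i ≤ m)
      (refl fun i hi => ⟨rfl, mem_support_uniformUpTo.1 hi⟩) ?_
    rintro i _ ⟨rfl, hi⟩
    exact ih i (hc i hi) hb hst
  | query d k ih =>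
    refine bind (hstep d (by have := hc.1; omega) s t hst) fun u v huv => ?_
    obtain ⟨h1, h2⟩ | h := huv
    · rw [h1]
      exact ih _ (hc.2 _ trivial) (by omega) h2
    · exact of_forall fun x hx y hy => .inr (hr' _ _ _ (hl' _ _ _ h x hx) y hy)

end Coupled

/-! ### Environments -/

theorem Comp.run_map {α σ τ : Type} {env : Data → StateT σ PMF Data}
    {env' : Data → StateT τ PMF Data} (π : σ → τ)
    (h : ∀ d s, (env d s).map (fun r => (r.1, π r.2)) = env' d (π s)) (c : Comp α) (s : σ) :
    (c.run env s).map (fun r => (r.1, π r.2)) = c.run env' (π s) := by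
  induction c generalizing s with
  | ret a => exact PMF.pure_map _ _
  | timeout => exact PMF.pure_map _ _
  | rnd m k ih =>
    simp only [Comp.run, PMF.map_bind, ih]
  | query d k ih =>
    simp only [Comp.run, PMF.map_bind, ih, ← h, PMF.bind_map, Function.comp_def]

/-- A value that is drawn from `μ` at most once during a run may as well be drawn in advance.
`Used s` says that it has been drawn, and `env' k` is the environment that uses `k` instead. -/
theorem Comp.run_presample {α σ : Type} {env : Data → StateT σ PMF Data}
    {env' : ℕ → Data → StateT σ PMF Data} {μ : PMF ℕ} (I Used : σ → Prop)
    (hI : ∀ d s, I s → ∀ r ∈ (env d s).support, I r.2)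
    (hI' : ∀ d s, I s → ∀ k, ∀ r ∈ (env' k d s).support, I r.2)
    (h1 : ∀ d s, I s → Used s → ∀ k, env' k d s = env d s)
    (h2 : ∀ d s, I s → Used s → ∀ r ∈ (env d s).support, Used r.2)
    (h3 : ∀ d s, I s → ¬ Used s → (∀ k, env' k d s = env d s) ∨
      (env d s = μ.bind fun k => env' k d s) ∧ ∀ k, ∀ r ∈ (env' k d s).support, Used r.2)
    (c : Comp α) {s : σ} (hs : I s) : c.run env s = μ.bind fun k => c.run (env' k) s := by
  have hused : ∀ (k : ℕ) (c : Comp α) s, I s → Used s → c.run (env' k) s = c.run env s := by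
    intro k c
    induction c with
    | ret a => intro s _ _; rfl
    | timeout => intro s _ _; rfl
    | rnd m f ih => intro s hs hu; simp only [Comp.run, ih _ _ hs hu]
    | query d f ih =>
      intro s hs hu
      simp only [Comp.run, h1 d s hs hu]
      exact bind_congr_support _ fun r hr => ih _ _ (hI d s hs r hr) (h2 d s hs hu r hr)
  induction c generalizing s with
  | ret a => simp only [Comp.run, PMF.bind_const]
  | timeout => simp only [Comp.run, PMF.bind_const]
  | rnd m f ih =>
    simp only [Comp.run, ih _ hs]
    rw [PMF.bind_comm]
  | query d f ih =>
    by_cases hu : Used s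
    · rw [show (fun k => (Comp.query d f).run (env' k) s) = fun _ => (Comp.query d f).run env s from
        funext fun k => hused k _ s hs hu, PMF.bind_const]
    · simp only [Comp.run]
      obtain h | ⟨h, h'⟩ := h3 d s hs hu
      · simp only [h]
        rw [← PMF.bind_comm]
        exact bind_congr_support _ fun r hr => ih _ (hI d s hs r hr)
      · rw [h, PMF.bind_bind]
        refine congrArg _ (funext fun k => ?_)
        exact bind_congr_support _ fun r hr => (hused k _ _ (hI' d s hs k r hr) (h' k r hr)).symm

end OAKE

end

noncomputable section

namespace OAKE

open Data Game

/-! ### Recording the queries that create sessions -/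

/-- A state of the experiment together with the number of queries so far, and for every session the
number of the query that created it. -/
structure Tracked (G : Type) : Type where
  base : GameState G
  count : ℕ
  birth : ℕ → Option ℕ

namespace Tracked

variable {G : Type}

/-- The initial state. -/
def init (G : Type) : Tracked G := ⟨.init G, 0, fun _ => none⟩

open Classical in
/-- The state after a query that leads to `st`. -/
def next (t : Tracked G) (st : GameState G) : Tracked G :=
  ⟨st, t.count + 1, fun i => if t.base.sessions i = none ∧ st.sessions i ≠ none then some t.count
    else t.birth i⟩

/-- Some session created by query `κ` is complete. -/
def Spent (κ : ℕ) (t : Tracked G) : Prop :=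
  ∃ i s B Y k, t.birth i = some κ ∧ t.base.sessions i = some s ∧ s.phase = .complete B Y k

/-- The test session was created by query `κ`. -/
def TestedAt (κ : ℕ) (t : Tracked G) : Prop :=
  ∃ i, t.base.tested = some i ∧ t.birth i = some κ

/-- Session creation is recorded correctly. -/
def Recorded (t : Tracked G) : Prop :=
  (∀ i s, t.base.sessions i = some s → ∃ κ, t.birth i = some κ) ∧
    ∀ i κ, t.birth i = some κ → κ < t.count

theorem Recorded.next {t : Tracked G} (h : t.Recorded) (st : GameState G) :
    (t.next st).Recorded := by
  refine ⟨fun i s hs => ?_, fun i κ hκ => ?_⟩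
  · simp only [Tracked.next] at hs ⊢
    split_ifs with hi
    · exact ⟨_, rfl⟩
    · rw [hs] at hi
      cases h' : t.base.sessions i with
      | none => simp [h'] at hi
      | some s' => exact h.1 i s' h'
  · simp only [Tracked.next] at hκ ⊢
    split_ifs at hκ with hi
    · simp only [Option.some.injEq] at hκ
      omega
    · exact (h.2 i κ hκ).trans (Nat.lt_succ_self _)

theorem next_birth {t : Tracked G} {st : GameState G} {i : ℕ} {s : Session G}
    (hs : t.base.sessions i = some s) : (t.next st).birth i = t.birth i := by
  simp [next, hs]

theorem Spent.next {κ : ℕ} {t : Tracked G} (h : t.Spent κ) {st : GameState G}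
    (hst : Evolves t.base st) : (t.next st).Spent κ := by
  obtain ⟨i, s, B, Y, k, h1, h2, h3⟩ := h
  obtain ⟨s', hs', hev⟩ := hst.sessions i s h2
  exact ⟨i, s', B, Y, k, by rw [next_birth h2, h1], hs', hev.complete _ _ _ h3⟩

end Tracked

namespace Params

variable (S : Params) (n : ℕ)

open Classical in
/-- The distribution of the key of session `i`, if it is drawn next: `kd` for the first key of a
session created by query `κ`. -/
def keySource (κ : ℕ) (kd : PMF ℕ) (t : Tracked (S.G n)) (i : ℕ) : PMF ℕ :=
  if t.birth i = some κ ∧ ¬ t.Spent κ then kd else S.keyDist n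

/-- The experiment with record of session creation. The DH-exponent of the session created by query
`κ` is drawn from `ed`, its key from `kd`, and the random key of the test query from `td`. -/
def tracked (κ : ℕ) (ed kd td : PMF ℕ) (pr : Protocol) (β : Bool) (d : Data) :
    StateT (Tracked (S.G n)) PMF Data := fun t =>
  match Query.ofData d with
  | some Q => (S.answerFrom n (if t.count = κ then ed else S.exponent n)
      (S.keySource n κ kd t) td pr β Q t.base).map
        fun r => (r.1, t.next r.2)
  | none => PMF.pure (num 0, t.next t.base)

/-- The experiment in which the DH-exponent `x` of the session created by query `κ` is given. Also
given is `k`, which for `β = true` is the key of that session unless the value of `H_K` is known,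
and for `β = false` is the random key of the test query. -/
def planned (κ : ℕ) (pr : Protocol) (β : Bool) (x k : ℕ) :
    Data → StateT (Tracked (S.G n)) PMF Data :=
  S.tracked n κ (PMF.pure x) (if β then PMF.pure k else S.keyDist n)
    (if β then S.keyDist n else PMF.pure k) pr β

end Params

variable {S : Params} {n : ℕ}

theorem tracked_map_base (κ : ℕ) (pr : Protocol) (β : Bool) (d : Data) (t : Tracked (S.G n)) :
    (S.tracked n κ (S.exponent n) (S.keyDist n) (S.keyDist n) pr β d t).map
      (fun r => (r.1, r.2.base)) = S.challenger n pr β d t.base := by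
  unfold Params.tracked Params.challenger
  cases Query.ofData d with
  | none => exact PMF.pure_map _ _
  | some Q =>
    have h : S.keySource n κ (S.keyDist n) t = fun _ => S.keyDist n :=
      funext fun i => ite_self _
    simp only [ite_self, PMF.map_comp, h, Params.answerFrom_eq]
    exact PMF.map_id _

theorem tracked_recorded {κ : ℕ} {ed kd td : PMF ℕ} {pr : Protocol} {β : Bool} (d : Data)
    {t : Tracked (S.G n)} (h : t.Recorded) :
    ∀ r ∈ (S.tracked n κ ed kd td pr β d t).support, r.2.Recorded ∧ r.2.count = t.count + 1 := by
  intro r hr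
  unfold Params.tracked at hr
  split at hr
  · obtain ⟨u, -, rfl⟩ := (PMF.mem_support_map_iff _ _ _).1 hr
    exact ⟨h.next _, rfl⟩
  · rw [(PMF.mem_support_pure_iff _ _).1 hr]
    exact ⟨h.next _, rfl⟩

theorem tracked_evolves {κ : ℕ} {ed kd td : PMF ℕ} {pr : Protocol} {β : Bool} (d : Data)
    {t : Tracked (S.G n)} (h : Inv S n pr t.base) :
    ∀ r ∈ (S.tracked n κ ed kd td pr β d t).support, Inv S n pr r.2.base ∧
      Evolves t.base r.2.base ∧ r.2 = t.next r.2.base := by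
  intro r hr
  unfold Params.tracked at hr
  split at hr
  · obtain ⟨u, hu, rfl⟩ := (PMF.mem_support_map_iff _ _ _).1 hr
    obtain ⟨h1, h2⟩ := answerFrom_reach h _ _ _ _ _ u hu
    exact ⟨h2, h1, rfl⟩
  · rw [(PMF.mem_support_pure_iff _ _).1 hr]
    exact ⟨h, .refl _, rfl⟩

theorem Inv.init (pr : Protocol) : Inv S n pr (.init (S.G n)) :=
  ⟨by simp [GameState.init], by simp [GameState.init], by simp [GameState.init],
    by simp [GameState.init]⟩

/-! ### Drawing in advance -/

theorem answerFrom_exponent (ed : PMF ℕ) (kd : ℕ → PMF ℕ) (td : PMF ℕ) (pr : Protocol) (β : Bool)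
    (Q : Query) (st : GameState (S.G n)) : S.answerFrom n ed kd td pr β Q st =
      ed.bind fun x => S.answerFrom n (PMF.pure x) kd td pr β Q st := by
  cases Q with
  | precompute i A =>
    unfold Params.answerFrom
    simp only [get_bind]
    rcases st.sessions i with _ | s
    · rcases st.players A with _ | ⟨P, _ | a, cor⟩
      · exact (PMF.bind_const _ _).symm
      · exact (PMF.bind_const _ _).symm
      · simp only [draw_bind, PMF.pure_bind]
    · exact (PMF.bind_const _ _).symm
  | _ => exact (PMF.bind_const _ _).symm

theorem hKFrom_bind (kd : PMF ℕ) (d : Data) (st : GameState (S.G n)) :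
    S.hKFrom n kd d st = kd.bind fun k => S.hKFrom n (PMF.pure k) d st := by
  unfold Params.hKFrom
  split
  · rw [PMF.bind_const]
  · simp only [PMF.pure_map]
    rfl

theorem Game.bind_comm {α β : Type} {μ : PMF ℕ} {m : S.Game n α} {f : α → S.Game n β}
    {f' : ℕ → α → S.Game n β} (h : ∀ a st, f a st = μ.bind fun k => f' k a st)
    (st : GameState (S.G n)) : (m >>= f) st = μ.bind fun k => (m >>= f' k) st := by
  simp only [bind_apply, h]
  rw [PMF.bind_comm]

theorem responderKeyFrom_bind (kd : PMF ℕ) (pr : Protocol) (A B b y : ℕ) (pkA X : S.G n)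
    (st : GameState (S.G n)) : S.responderKeyFrom n kd pr A B b y pkA X st =
      kd.bind fun k => S.responderKeyFrom n (PMF.pure k) pr A B b y pkA X st :=
  bind_comm (fun _ => bind_comm fun _ => bind_comm fun _ => hKFrom_bind _ _) st

theorem initiatorKeyFrom_bind (kd : PMF ℕ) (pr : Protocol) (A B a x : ℕ) (pkB Y : S.G n)
    (st : GameState (S.G n)) : S.initiatorKeyFrom n kd pr A B a x pkB Y st =
      kd.bind fun k => S.initiatorKeyFrom n (PMF.pure k) pr A B a x pkB Y st :=
  bind_comm (fun _ => bind_comm fun _ => bind_comm fun _ => hKFrom_bind _ _) st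

/-- Either `m` does not depend on the value that `m'` is given, or that value may as well be drawn
from `μ`, and the state satisfies `U` afterwards. -/
def Game.Presampled {α : Type} (μ : PMF ℕ) (U : GameState (S.G n) → Prop)
    (st : GameState (S.G n)) (m : S.Game n α) (m' : ℕ → S.Game n α) : Prop :=
  (∀ k, m' k st = m st) ∨
    (m st = μ.bind fun k => m' k st) ∧ ∀ k, Reach st (m' k) fun _ st' => U st'

theorem Game.Presampled.const {α : Type} {μ : PMF ℕ} {U : GameState (S.G n) → Prop}
    {st : GameState (S.G n)} (m : S.Game n α) : Presampled μ U st m fun _ => m :=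
  .inl fun _ => rfl

theorem Game.Presampled.get {α : Type} {μ : PMF ℕ} {U : GameState (S.G n) → Prop}
    {st : GameState (S.G n)} {f : GameState (S.G n) → S.Game n α}
    {f' : ℕ → GameState (S.G n) → S.Game n α}
    (h : Presampled μ U st (f st) fun k => f' k st) :
    Presampled μ U st (MonadState.get >>= f) fun k => MonadState.get >>= f' k := by
  simpa only [Presampled, Reach, get_bind] using h

/-- The key of session `i` may be drawn in advance. -/
theorem answerFrom_key (ed : PMF ℕ) (kd : PMF ℕ) (kf : ℕ → PMF ℕ) (p : ℕ → Prop)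
    [DecidablePred p] (td : PMF ℕ) (pr : Protocol) (β : Bool) (Q : Query)
    (st : GameState (S.G n)) :
    Presampled kd (fun st' => ∃ i s s' B Y k', p i ∧ st.sessions i = some s ∧
      st'.sessions i = some s' ∧ s'.phase = .complete B Y k') st
      (S.answerFrom n ed (fun i => if p i then kd else kf i) td pr β Q)
      fun k => S.answerFrom n ed (fun i => if p i then PMF.pure k else kf i) td pr β Q := by
  cases Q with
  | respond i B m =>
    unfold Params.answerFrom
    by_cases hi : p i
    · simp only [if_pos hi]
      repeat with_reducible refine .get ?_
      rcases hs : st.sessions i with _ | s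
      · exact .const (S.refuse n)
      rcases st.players B with _ | P
      · exact .const (S.refuse n)
      rcases S.decode n m with _ | X
      · exact .const (S.refuse n)
      dsimp only
      repeat with_reducible refine .get ?_
      rcases s.phase with _ | C | ⟨C, Y, k⟩
      · rcases st.players s.owner with _ | ⟨Q, _ | b, cor⟩
        · exact .const (S.refuse n)
        · exact .const (S.refuse n)
        · refine .inr ⟨?_, fun k => ?_⟩
          · simp only [bind_apply, responderKeyFrom_bind kd, PMF.bind_bind]
          · dsimp only
            refine Reach.bind fun u hu => ?_
            refine Reach.setSession (.accept ?_)
            exact ⟨i, s, _, _, _, _, hi, hs, by simp; rfl, rfl⟩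
      · exact .const (S.refuse n)
      · exact .const (S.refuse n)
    · simp only [if_neg hi]
      exact .const _
  | complete i m =>
    unfold Params.answerFrom
    by_cases hi : p i
    · simp only [if_pos hi]
      repeat with_reducible refine .get ?_
      rcases hs : st.sessions i with _ | s
      · exact .const (S.refuse n)
      rcases S.decode n m with _ | Y
      · exact .const (S.refuse n)
      dsimp only
      rcases s.phase with _ | B | ⟨C, Y, k⟩
      · exact .const (S.refuse n)
      · dsimp only
        repeat with_reducible refine .get ?_
        rcases st.players B with _ | P
        · exact .const (S.refuse n)
        rcases st.players s.owner with _ | ⟨Q, _ | a, cor⟩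
        · exact .const (S.refuse n)
        · exact .const (S.refuse n)
        · refine .inr ⟨?_, fun k => ?_⟩
          · simp only [bind_apply, initiatorKeyFrom_bind kd, PMF.bind_bind]
          · dsimp only
            refine Reach.bind fun u hu => ?_
            refine Reach.setSession (.accept ?_)
            exact ⟨i, s, _, _, _, _, hi, hs, by simp; rfl, rfl⟩
      · exact .const (S.refuse n)
    · simp only [if_neg hi]
      exact .const _
  | _ => exact .const _

/-- The random key of the test query may be drawn in advance. -/
theorem answerFrom_test (ed : PMF ℕ) (kf : ℕ → PMF ℕ) (td : PMF ℕ) (pr : Protocol) (β : Bool)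
    (Q : Query) (st : GameState (S.G n)) :
    (∀ k, S.answerFrom n ed kf (PMF.pure k) pr β Q st = S.answerFrom n ed kf td pr β Q st) ∨
      st.tested = none ∧ Presampled td (fun st' => st'.tested ≠ none) st
        (S.answerFrom n ed kf td pr β Q) fun k => S.answerFrom n ed kf (PMF.pure k) pr β Q := by
  cases Q with
  | test i =>
    cases ht : st.tested with
    | some j =>
      left
      intro k
      unfold Params.answerFrom
      simp only [get_bind, ht]
    | none =>
      refine .inr ⟨rfl, ?_⟩
      unfold Params.answerFrom
      repeat with_reducible refine .get ?_
      rw [ht]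
      rcases hs : st.sessions i with _ | s
      · exact .const (S.refuse n)
      dsimp only
      rcases hk : s.key with _ | k
      · exact .const (S.refuse n)
      dsimp only
      by_cases hr : s.Reflected
      · simp only [if_pos hr]
        refine .inr ⟨?_, fun k' => ?_⟩
        · simp only [modify_bind, draw_bind, PMF.pure_bind]
        · refine Reach.modify ?_
          refine .bind (.draw fun k'' => .accept ?_)
          simp
      · simp only [if_neg hr]
        exact .const _
  | _ => exact .inl fun _ => rfl

variable {α : Type}

/-- The DH-exponent of the session created by query `κ` may be drawn in advance: it is drawn during
that query, if at all. -/
theorem run_tracked_exponent (κ : ℕ) (kd td : PMF ℕ) (pr : Protocol) (β : Bool) (c : Comp α)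
    {t : Tracked (S.G n)} (ht : Inv S n pr t.base) :
    c.run (S.tracked n κ (S.exponent n) kd td pr β) t =
      (S.exponent n).bind fun x => c.run (S.tracked n κ (PMF.pure x) kd td pr β) t := by
  refine Comp.run_presample (fun t => Inv S n pr t.base) (fun t => κ < t.count)
    (fun d s hs r hr => (tracked_evolves d hs r hr).1)
    (fun d s hs k r hr => (tracked_evolves d hs r hr).1) (fun d s _ hs k => ?_)
    (fun d s hi hs r hr => ?_) (fun d s hi hs => ?_) c ht
  · unfold Params.tracked
    simp only [if_neg hs.ne']
  · rw [(tracked_evolves d hi r hr).2.2]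
    exact Nat.lt_succ_of_lt hs
  · by_cases h : s.count = κ
    · refine .inr ⟨?_, fun k r hr => ?_⟩
      · unfold Params.tracked
        simp only [if_pos h]
        cases Query.ofData d with
        | none => simp only [PMF.bind_const]
        | some Q =>
          simp only
          rw [answerFrom_exponent (S.exponent n), PMF.map_bind]
      · rw [(tracked_evolves d hi r hr).2.2, ← h]
        exact Nat.lt_succ_self _
    · refine .inl fun k => ?_
      unfold Params.tracked
      simp only [if_neg h]

/-- The key of the session created by query `κ` may be drawn in advance: from `kd` it is drawn only
if the session becomes complete, which happens once. -/
theorem run_tracked_key (κ : ℕ) (ed td : PMF ℕ) (pr : Protocol) (β : Bool) (c : Comp α)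
    {t : Tracked (S.G n)} (ht : Inv S n pr t.base) :
    c.run (S.tracked n κ ed (S.keyDist n) td pr β) t =
      (S.keyDist n).bind fun k => c.run (S.tracked n κ ed (PMF.pure k) td pr β) t := by
  classical
  refine Comp.run_presample (fun t => Inv S n pr t.base) (Tracked.Spent κ)
    (fun d s hs r hr => (tracked_evolves d hs r hr).1)
    (fun d s hs k r hr => (tracked_evolves d hs r hr).1) (fun d s _ hs k => ?_)
    (fun d s hi hs r hr => ?_) (fun d s hi hs => ?_) c ht
  · unfold Params.tracked Params.keySource
    simp only [hs, not_true, and_false, if_false]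
  · rw [(tracked_evolves d hi r hr).2.2]
    exact hs.next (tracked_evolves d hi r hr).2.1
  · unfold Params.tracked Params.keySource
    cases Query.ofData d with
    | none => exact .inl fun k => rfl
    | some Q =>
      obtain h | ⟨h, h'⟩ := answerFrom_key (if s.count = κ then ed else S.exponent n)
        (S.keyDist n) (fun _ => S.keyDist n) (fun i => s.birth i = some κ ∧ ¬ s.Spent κ) td pr β Q
        s.base
      · refine .inl fun k => ?_
        simp only
        exact congrArg _ (h k)
      · refine .inr ⟨?_, fun k r hr => ?_⟩
        · simp only
          refine (congrArg _ h).trans ?_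
          rw [PMF.map_bind]
        · obtain ⟨u, hu, rfl⟩ := (PMF.mem_support_map_iff _ _ _).1 hr
          obtain ⟨i, w, w', B, Y, k', h1, h2, h3, h4⟩ := h' k u hu
          exact ⟨i, w', B, Y, k', by rw [Tracked.next_birth h2]; exact h1.1, h3, h4⟩

/-- The random key of the test query may be drawn in advance: it is drawn when the test session is
chosen. -/
theorem run_tracked_test (κ : ℕ) (ed kd : PMF ℕ) (pr : Protocol) (β : Bool) (c : Comp α)
    {t : Tracked (S.G n)} (ht : Inv S n pr t.base) :
    c.run (S.tracked n κ ed kd (S.keyDist n) pr β) t =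
      (S.keyDist n).bind fun k => c.run (S.tracked n κ ed kd (PMF.pure k) pr β) t := by
  refine Comp.run_presample (fun t => Inv S n pr t.base) (fun t => t.base.tested ≠ none)
    (fun d s hs r hr => (tracked_evolves d hs r hr).1)
    (fun d s hs k r hr => (tracked_evolves d hs r hr).1) (fun d s _ hs k => ?_)
    (fun d s hi hs r hr => ?_) (fun d s hi hs => ?_) c ht
  · unfold Params.tracked
    cases Query.ofData d with
    | none => rfl
    | some Q =>
      obtain h | ⟨h, -⟩ := answerFrom_test (if s.count = κ then ed else S.exponent n)
        (S.keySource n κ kd s)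
        (S.keyDist n) pr β Q s.base
      · dsimp only
        rw [h k]
      · exact absurd h hs
  · obtain ⟨i, hi'⟩ := Option.ne_none_iff_exists'.1 hs
    rw [(tracked_evolves d hi r hr).2.1.tested i hi']
    simp
  · unfold Params.tracked
    cases Query.ofData d with
    | none => exact .inl fun k => rfl
    | some Q =>
      obtain h | ⟨-, h | ⟨h, h'⟩⟩ := answerFrom_test (if s.count = κ then ed else S.exponent n)
        (S.keySource n κ kd s)
        (S.keyDist n) pr β Q s.base
      · refine .inl fun k => ?_
        dsimp only
        rw [h k]
      · refine .inl fun k => ?_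
        dsimp only at h ⊢
        rw [h k]
      · refine .inr ⟨?_, fun k r hr => ?_⟩
        · simp only
          refine (congrArg _ h).trans ?_
          rw [PMF.map_bind]
        · obtain ⟨u, hu, rfl⟩ := (PMF.mem_support_map_iff _ _ _).1 hr
          exact h' k u hu

/-- The exponent and the key may be drawn at the beginning. -/
theorem run_tracked_eq_planned (κ : ℕ) (pr : Protocol) (β : Bool) (c : Comp α)
    {t : Tracked (S.G n)} (ht : Inv S n pr t.base) :
    c.run (S.tracked n κ (S.exponent n) (S.keyDist n) (S.keyDist n) pr β) t =
      (S.exponent n).bind fun x => (S.keyDist n).bind fun k =>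
        c.run (S.planned n κ pr β x k) t := by
  rw [run_tracked_exponent _ _ _ _ _ _ ht]
  refine congrArg _ (funext fun x => ?_)
  cases β
  · exact run_tracked_test _ _ _ _ _ _ ht
  · exact run_tracked_key _ _ _ _ _ _ ht

end OAKE

end

noncomputable section

namespace OAKE

open Data Game

/-! ### The relation between the experiment and its simulation -/

/-- An optional number as an entry of a store. -/
def entry : Option ℕ → Data
  | none => num 0
  | some v => cons (num v) (num 0)

/-- A truth value as an entry of a store. -/
def flag (b : Bool) : Data := if b then num 1 else num 0

@[simp] theorem entry_none : entry none = num 0 := rfl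
@[simp] theorem entry_some (v : ℕ) : entry (some v) = cons (num v) (num 0) := rfl
@[simp] theorem flag_true : flag true = num 1 := rfl
@[simp] theorem flag_false : flag false = num 0 := rfl

/-- What is fixed for a simulation: the protocol, the number `κ` of the query that creates the
special session, the exponent `x` of that session, the reply `k` to its test query, the challenge
bit, a bound `idSize` for the size of queries (hence of identities), and the size limit of new
entries of the store. -/
structure Plan : Type where
  pr : Protocol
  κ : ℕ
  x : ℕ
  k : ℕ
  β : Bool
  idSize : ℕ
  limit : ℕ

variable {S : Params} {n : ℕ}

/-- The entries for a player. -/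
def PlayerView (S : Params) (n : ℕ) : Option (Player (S.G n)) → Data → Data → Prop
  | none, p, c => p = num 0 ∧ c = num 0
  | some P, p, c => p = cons (S.elem n P.pk) (entry P.sk) ∧ c = flag P.corrupted

/-- The entries for the phase of a session; the session key is missing in the special session. -/
def PhaseView (S : Params) (n : ℕ) (special : Prop) : Phase (S.G n) → Data → Data → Prop
  | .precomputed, p, r => p = num 0 ∧ r = num 0
  | .opened B, p, r => p = cons (num B) (num 0) ∧ r = num 0
  | .complete B Y k, p, r => p = cons (num B) (num 0) ∧
      ((special ∧ r = cons (S.elem n Y) (num 0)) ∨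
        ¬ special ∧ r = cons (S.elem n Y) (cons (num k) (num 0)))

/-- The entries for a session; the DH-exponent is missing in the special session. -/
structure SessionView (S : Params) (n : ℕ) (special : Prop) (s : Session (S.G n))
    (d p r e e' : Data) : Prop where
  data : (special ∧ d = cons (num s.owner) (cons (S.elem n s.component) (num 0))) ∨
    ¬ special ∧ d = cons (num s.owner) (cons (S.elem n s.component)
      (cons (num s.exponent) (num 0)))
  phase : PhaseView S n special s.phase p r
  stateExposed : e = flag s.stateExposed
  keyExposed : e' = flag s.keyExposed

/-- The value of `c` (and `d`) for the identity `A` and the component `Y` is in the store. -/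
def CDEntry (S : Params) (n : ℕ) (pr : Protocol) (f : Data → Data) (A : ℕ) (Y : S.G n) (c : ℕ) :
    Prop :=
  match pr with
  | .oake => f (cons (num 0) (tuple [num A, S.elem n Y])) = cons (num c) (num 0)
  | .soake => c = 1

/-- The argument `d` of `H_K` in the special session `(A, A, X, X)` with `X = g ^ x`. -/
def Target (S : Params) (n : ℕ) (pr : Protocol) (x : ℕ) (f : Data → Data) (d : Data) : Prop :=
  ∃ A a c e p, f (num 2) = cons (num A) (num 0) ∧
    f (cons (num 2) (num A)) = cons p (cons (num a) (num 0)) ∧ CDEntry S n pr f A (S.g n ^ x) c ∧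
    f (cons (num 0) (eArg S n pr A A (S.g n ^ x) (S.g n ^ x))) = cons (num e) (num 0) ∧
    d = S.elem n (S.g n ^ (2 * (c * a) * x + e * (x * x)))

/-- The value of `H_K` for the special session was asked for. -/
def Bad (S : Params) (n : ℕ) (pr : Protocol) (x : ℕ) (s : Data) : Prop :=
  ∃ d, Target S n pr x (lookup s) d ∧ lookup s (cons (num 1) d) ≠ num 0

/-- The special session is complete. -/
def SpentAt (κ : ℕ) (birth : ℕ → Option ℕ) (st : GameState (S.G n)) : Prop :=
  ∃ i s B Y k, birth i = some κ ∧ st.sessions i = some s ∧ s.phase = .complete B Y k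

/-- The special session cannot become an unexposed test session any more. -/
def Doomed (κ : ℕ) (birth : ℕ → Option ℕ) (st : GameState (S.G n)) : Prop :=
  (∃ i s, birth i = some κ ∧ (∀ j, birth j = some κ → j = i) ∧ st.sessions i = some s ∧
    (s.stateExposed = true ∨ s.keyExposed = true ∨
      ∃ B Y k, s.phase = .complete B Y k ∧ ¬ (B = s.owner ∧ Y = s.component))) ∨
  ∃ i κ', st.tested = some i ∧ birth i = some κ' ∧ κ' ≠ κ

/-- The lookup function `f` of the simulator's store represents the state of the experiment.
Exceptions are the exponent and the key of the special session, and the value of `H_K` that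
belongs to it. -/
structure Rel (S : Params) (n : ℕ) (C : Plan) (birth : ℕ → Option ℕ) (st : GameState (S.G n))
    (f : Data → Data) : Prop where
  hash : ∀ d, f (cons (num 0) d) = entry (st.hTable d)
  key : ∀ d, f (cons (num 1) d) = entry (st.keyTable d) ∨
    SpentAt C.κ birth st ∧ Target S n C.pr C.x f d
  player : ∀ A, PlayerView S n (st.players A) (f (cons (num 2) (num A))) (f (cons (num 5) (num A)))
  noSession : ∀ i, st.sessions i = none → f (cons (num 3) (num i)) = num 0 ∧
    f (cons (num 7) (num i)) = num 0 ∧ f (cons (num 8) (num i)) = num 0 ∧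
    f (cons (num 6) (num i)) = num 0 ∧ f (cons (num 9) (num i)) = num 0
  session : ∀ i s, st.sessions i = some s → SessionView S n (birth i = some C.κ) s
    (f (cons (num 3) (num i))) (f (cons (num 7) (num i))) (f (cons (num 8) (num i)))
    (f (cons (num 6) (num i))) (f (cons (num 9) (num i)))
  tested : f (num 3) = entry st.tested
  alive : f (num 4) = num 0
  special : ∀ i s, st.sessions i = some s → birth i = some C.κ → s.exponent = C.x ∧
    s.component = S.g n ^ C.x ∧ f (num 2) = cons (num s.owner) (num 0) ∧
    ∀ B Y k, s.phase = .complete B Y k → B = s.owner ∧ Y = S.g n ^ C.x ∧ (C.β = true → k = C.k) ∧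
      ∃ d, Target S n C.pr C.x f d
  owner : (∀ i, birth i ≠ some C.κ) → f (num 2) = num 0
  recorded : ∀ i, st.sessions i = none ↔ birth i = none
  unique : ∀ i j, birth i = some C.κ → birth j = some C.κ → i = j
  testedSpecial : ∀ i, st.tested = some i → birth i = some C.κ
  small : ∀ i s, st.sessions i = some s → (num s.owner).size ≤ C.idSize ∧
    ∀ B, s.phase = .opened B → (num B).size ≤ C.idSize
  keySmall : ∀ d v, f (cons (num 1) d) = cons (num v) (num 0) → v < 2 ^ S.keyLen n

/-- The limits are large enough. -/
structure Plan.Wide (S : Params) (n : ℕ) (C : Plan) (l : ℕ) : Prop where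
  elem : ∀ a : S.G n, (S.elem n a).size ≤ l
  order : Nat.size (S.q n) + 1 ≤ l
  keyLen : S.keyLen n + 1 ≤ l
  security : n + 1 ≤ l
  limit : 10 * (C.idSize + l) + 50 ≤ C.limit

theorem Target.mono {pr : Protocol} {x : ℕ} {f f' : Data → Data} {d : Data}
    (hf : ∀ k, f k ≠ num 0 → f' k = f k) (h : Target S n pr x f d) : Target S n pr x f' d := by
  obtain ⟨A, a, c, e, p, h1, h2, h3, h4, h5⟩ := h
  refine ⟨A, a, c, e, p, ?_, ?_, ?_, ?_, h5⟩
  · rw [hf _ (by simp [h1]), h1]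
  · rw [hf _ (by simp [h2]), h2]
  · cases pr
    · exact (hf _ (by rw [show f _ = _ from h3]; simp)).trans h3
    · exact h3
  · rw [hf _ (by simp [h4]), h4]

theorem Bad.mono {pr : Protocol} {x : ℕ} {s s' : Data}
    (hs : ∀ k, lookup s k ≠ num 0 → lookup s' k = lookup s k) (h : Bad S n pr x s) :
    Bad S n pr x s' := by
  obtain ⟨d, h1, h2⟩ := h
  exact ⟨d, h1.mono hs, by rwa [hs _ h2]⟩

theorem update_mono {f : Data → Data} {k v : Data} (hk : f k = num 0) :
    ∀ k', f k' ≠ num 0 → Function.update f k v k' = f k' := by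
  intro k' hk'
  rw [Function.update_of_ne]
  rintro rfl
  exact hk' hk

namespace Rel

variable {C : Plan} {birth : ℕ → Option ℕ} {st : GameState (S.G n)} {f : Data → Data}

/-- A new value of `h`. -/
theorem setHash (h : Rel S n C birth st f) {d : Data} (hd : st.hTable d = none) (v : ℕ) :
    Rel S n C birth { st with hTable := Function.update st.hTable d (some v) }
      (Function.update f (cons (num 0) d) (cons (num v) (num 0))) := by
  have hm := update_mono (v := cons (num v) (num 0)) (show f (cons (num 0) d) = num 0 by
    rw [h.hash, hd]; rfl)
  refine ⟨fun d' => ?_, fun d' => ?_, by simpa using h.player, by simpa using h.noSession,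
    by simpa using h.session, by simpa using h.tested, by simpa using h.alive,
    fun i s hs hi => ?_, by simpa using h.owner, h.recorded, h.unique, h.testedSpecial, h.small,
    by simpa using h.keySmall⟩
  · by_cases hd' : d' = d
    · subst hd'
      simp
    · simp [hd', h.hash]
  · obtain h' | ⟨h1, h2⟩ := h.key d'
    · exact .inl (by simpa using h')
    · exact .inr ⟨h1, h2.mono hm⟩
  · obtain ⟨h1, h2, h3, h4⟩ := h.special i s hs hi
    refine ⟨h1, h2, by simpa using h3, fun B Y k hp => ?_⟩
    obtain ⟨h5, h6, h7, d', h8⟩ := h4 B Y k hp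
    exact ⟨h5, h6, h7, d', h8.mono hm⟩

/-- A new value of `H_K`, known to the simulator. -/
theorem setKey (h : Rel S n C birth st f) {d : Data} (hd : f (cons (num 1) d) = num 0)
    {v : ℕ} (hv : v < 2 ^ S.keyLen n) :
    Rel S n C birth { st with keyTable := Function.update st.keyTable d (some v) }
      (Function.update f (cons (num 1) d) (cons (num v) (num 0))) := by
  have hm := update_mono (v := cons (num v) (num 0)) hd
  refine ⟨by simpa using h.hash, fun d' => ?_, by simpa using h.player, by simpa using h.noSession,
    by simpa using h.session, by simpa using h.tested, by simpa using h.alive,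
    fun i s hs hi => ?_, by simpa using h.owner, h.recorded, h.unique, h.testedSpecial, h.small,
    fun d' w hw => ?_⟩
  · by_cases hd' : d' = d
    · subst hd'
      simp
    · obtain h' | ⟨h1, h2⟩ := h.key d'
      · exact .inl (by simpa [hd'] using h')
      · exact .inr ⟨h1, h2.mono hm⟩
  · obtain ⟨h1, h2, h3, h4⟩ := h.special i s hs hi
    refine ⟨h1, h2, by simpa using h3, fun B Y k hp => ?_⟩
    obtain ⟨h5, h6, h7, d', h8⟩ := h4 B Y k hp
    exact ⟨h5, h6, h7, d', h8.mono hm⟩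
  · by_cases hd' : d' = d
    · subst hd'
      simp only [Function.update_self, cons.injEq, num.injEq, and_true] at hw
      exact hw ▸ hv
    · exact h.keySmall d' w (by simpa [hd'] using hw)

/-- Changing the entries for a player. -/
theorem setPlayer (h : Rel S n C birth st f) {A : ℕ} {P : Player (S.G n)} {f' : Data → Data}
    (hf : ∀ k, k ≠ cons (num 2) (num A) → k ≠ cons (num 5) (num A) → f' k = f k)
    (hm : ∀ k, f k ≠ num 0 → k ≠ cons (num 5) (num A) → f' k = f k)
    (hP : PlayerView S n (some P) (f' (cons (num 2) (num A))) (f' (cons (num 5) (num A)))) :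
    Rel S n C birth { st with players := Function.update st.players A (some P) } f' := by
  have ht : ∀ d, Target S n C.pr C.x f d → Target S n C.pr C.x f' d := by
    rintro d ⟨A', a, c, e, p, h1, h2, h3, h4, h5⟩
    refine ⟨A', a, c, e, p, ?_, ?_, ?_, ?_, h5⟩
    · rw [hm _ (by simp [h1]) (by simp), h1]
    · rw [hm _ (by simp [h2]) (by simp), h2]
    · revert h3
      unfold CDEntry
      split
      · exact fun h3 => (hf _ (by simp) (by simp)).trans h3
      · exact fun h3 => h3
    · rw [hm _ (by simp [h4]) (by simp), h4]
  refine ⟨fun d => ?_, fun d => ?_, fun A' => ?_, fun i hi => ?_, fun i s hs => ?_, ?_, ?_,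
    fun i s hs hi => ?_, fun hb => ?_, h.recorded, h.unique, h.testedSpecial, h.small,
    fun d v hd => h.keySmall d v (by rwa [hf _ (by simp) (by simp)] at hd)⟩
  · rw [hf _ (by simp) (by simp)]
    exact h.hash d
  · rw [hf _ (by simp) (by simp)]
    exact (h.key d).imp (fun h => h) fun h => ⟨h.1, ht d h.2⟩
  · by_cases hA : A' = A
    · subst hA
      simpa using hP
    · rw [hf _ (by simp [hA]) (by simp), hf _ (by simp) (by simp [hA])]
      simpa [Function.update_of_ne hA] using h.player A'
  · simp only [hf _ (show cons (num 3) (num i) ≠ cons (num 2) (num A) by simp) (by simp),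
      hf _ (show cons (num 7) (num i) ≠ cons (num 2) (num A) by simp) (by simp),
      hf _ (show cons (num 8) (num i) ≠ cons (num 2) (num A) by simp) (by simp),
      hf _ (show cons (num 6) (num i) ≠ cons (num 2) (num A) by simp) (by simp),
      hf _ (show cons (num 9) (num i) ≠ cons (num 2) (num A) by simp) (by simp)]
    exact h.noSession i hi
  · simp only [hf _ (show cons (num 3) (num i) ≠ cons (num 2) (num A) by simp) (by simp),
      hf _ (show cons (num 7) (num i) ≠ cons (num 2) (num A) by simp) (by simp),
      hf _ (show cons (num 8) (num i) ≠ cons (num 2) (num A) by simp) (by simp),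
      hf _ (show cons (num 6) (num i) ≠ cons (num 2) (num A) by simp) (by simp),
      hf _ (show cons (num 9) (num i) ≠ cons (num 2) (num A) by simp) (by simp)]
    exact h.session i s hs
  · rw [hf _ (by simp) (by simp)]
    exact h.tested
  · rw [hf _ (by simp) (by simp)]
    exact h.alive
  · rw [hf _ (by simp) (by simp)]
    obtain ⟨h1, h2, h3, h4⟩ := h.special i s hs hi
    refine ⟨h1, h2, h3, fun B Y k hp => ?_⟩
    obtain ⟨h5, h6, h7, d', h8⟩ := h4 B Y k hp
    exact ⟨h5, h6, h7, d', ht _ h8⟩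
  · rw [hf _ (by simp) (by simp)]
    exact h.owner hb

/-- Changing the entries for an existing session. -/
theorem setSession (h : Rel S n C birth st f) {i : ℕ} {s₀ s : Session (S.G n)} {f' : Data → Data}
    (hs₀ : st.sessions i = some s₀)
    (hf : ∀ k, (∀ j ∈ [6, 7, 8, 9], k ≠ cons (num j) (num i)) → f' k = f k)
    (hspent : ∀ B Y k, s₀.phase = .complete B Y k → s.phase = .complete B Y k)
    (hview : SessionView S n (birth i = some C.κ) s
      (f (cons (num 3) (num i))) (f' (cons (num 7) (num i))) (f' (cons (num 8) (num i)))
      (f' (cons (num 6) (num i))) (f' (cons (num 9) (num i))))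
    (ho : s.owner = s₀.owner) (he : s.exponent = s₀.exponent) (hc : s.component = s₀.component)
    (hspecial : birth i = some C.κ → ∀ B Y k, s.phase = .complete B Y k → B = s.owner ∧
      Y = S.g n ^ C.x ∧ (C.β = true → k = C.k) ∧ ∃ d, Target S n C.pr C.x f d)
    (hsmall : ∀ B, s.phase = .opened B → (num B).size ≤ C.idSize) :
    Rel S n C birth { st with sessions := Function.update st.sessions i (some s) } f' := by
  have hf0 : ∀ d, f' (cons (num 0) d) = f (cons (num 0) d) := fun d => hf _ (by simp)
  have hf1 : ∀ d, f' (cons (num 1) d) = f (cons (num 1) d) := fun d => hf _ (by simp)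
  have hf2 : ∀ d, f' (cons (num 2) d) = f (cons (num 2) d) := fun d => hf _ (by simp)
  have hf3 : ∀ d, f' (cons (num 3) d) = f (cons (num 3) d) := fun d => hf _ (by simp)
  have hf5 : ∀ d, f' (cons (num 5) d) = f (cons (num 5) d) := fun d => hf _ (by simp)
  have hfn : ∀ j, f' (num j) = f (num j) := fun j => hf _ (by simp)
  have hfi : ∀ j, j ≠ i → ∀ a, f' (cons (num a) (num j)) = f (cons (num a) (num j)) :=
    fun j hj a => hf _ (by simp [hj])
  have ht : ∀ d, Target S n C.pr C.x f d → Target S n C.pr C.x f' d := by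
    rintro d ⟨A', a, c, e, p, h1, h2, h3, h4, h5⟩
    refine ⟨A', a, c, e, p, by rw [hfn, h1], by rw [hf2, h2], ?_, by rw [hf0, h4], h5⟩
    revert h3
    unfold CDEntry
    split
    · exact fun h3 => (hf0 _).trans h3
    · exact fun h3 => h3
  have hsome : ∀ j s', Function.update st.sessions i (some s) j = some s' →
      j = i ∧ s' = s ∨ j ≠ i ∧ st.sessions j = some s' := by
    intro j s' hs'
    by_cases hj : j = i
    · subst hj
      simp only [Function.update_self, Option.some.injEq] at hs'
      exact .inl ⟨rfl, hs'.symm⟩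
    · exact .inr ⟨hj, by simpa [Function.update_of_ne hj] using hs'⟩
  refine ⟨fun d => (hf0 d).trans (h.hash d), fun d => ?_, fun A => ?_, fun j hj => ?_,
    fun j s' hs' => ?_, (hfn 3).trans h.tested, (hfn 4).trans h.alive, fun j s' hs' hj => ?_,
    fun hb => (hfn 2).trans (h.owner hb), fun j => ?_, h.unique, h.testedSpecial,
    fun j s' hs' => ?_, fun d v hd => h.keySmall d v (by rwa [hf1] at hd)⟩
  · rw [hf1]
    refine (h.key d).imp (fun h => h) fun h' => ⟨?_, ht d h'.2⟩
    obtain ⟨j, s', B, Y, k, h1, h2, h3⟩ := h'.1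
    by_cases hj : j = i
    · subst hj
      rw [hs₀] at h2
      obtain rfl := Option.some.inj h2
      exact ⟨j, s, B, Y, k, h1, by simp, hspent _ _ _ h3⟩
    · exact ⟨j, s', B, Y, k, h1, by simpa [Function.update_of_ne hj] using h2, h3⟩
  · rw [hf2, hf5]
    exact h.player A
  · have hji : j ≠ i := by
      rintro rfl
      simp at hj
    simp only [hfi j hji]
    exact h.noSession j (by simpa [Function.update_of_ne hji] using hj)
  · obtain ⟨rfl, rfl⟩ | ⟨hj, hs'⟩ := hsome j s' hs'
    · rw [hf3]
      exact hview
    · simp only [hfi j hj]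
      exact h.session j s' hs'
  · rw [hfn]
    obtain ⟨rfl, rfl⟩ | ⟨hji, hs'⟩ := hsome j s' hs'
    · obtain ⟨h1, h2, h3, -⟩ := h.special j s₀ hs₀ hj
      refine ⟨he.trans h1, hc.trans h2, by rw [ho, h3], fun B Y k hp => ?_⟩
      obtain ⟨h5, h6, h7, d', h8⟩ := hspecial hj B Y k hp
      exact ⟨h5, h6, h7, d', ht _ h8⟩
    · obtain ⟨h1, h2, h3, h4⟩ := h.special j s' hs' hj
      refine ⟨h1, h2, h3, fun B Y k hp => ?_⟩
      obtain ⟨h5, h6, h7, d', h8⟩ := h4 B Y k hp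
      exact ⟨h5, h6, h7, d', ht _ h8⟩
  · by_cases hj : j = i
    · subst hj
      have := h.recorded j
      rw [hs₀] at this
      simpa using this
    · simpa [Function.update_of_ne hj] using h.recorded j
  · obtain ⟨rfl, rfl⟩ | ⟨hji, hs'⟩ := hsome j s' hs'
    · exact ⟨by rw [ho]; exact (h.small j s₀ hs₀).1, hsmall⟩
    · exact h.small j s' hs'

end Rel

end OAKE

end

noncomputable section

namespace OAKE

open Data Game

variable {S : Params} {n : ℕ}

namespace Rel

variable {C : Plan} {birth : ℕ → Option ℕ} {st : GameState (S.G n)} {f : Data → Data}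

/-- Adding a session; it is the special one if `c = C.κ`. -/
theorem newSession (h : Rel S n C birth st f) {i c : ℕ} {s : Session (S.G n)} {f' : Data → Data}
    (hi : st.sessions i = none) (hc : c = C.κ → ∀ j, birth j ≠ some C.κ)
    (hf : ∀ k, k ≠ cons (num 3) (num i) → (k = num 2 → c ≠ C.κ) → f' k = f k)
    (hdata : (c = C.κ ∧ f' (cons (num 3) (num i)) =
        cons (num s.owner) (cons (S.elem n s.component) (num 0))) ∨
      c ≠ C.κ ∧ f' (cons (num 3) (num i)) = cons (num s.owner) (cons (S.elem n s.component)
        (cons (num s.exponent) (num 0))))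
    (hphase : s.phase = .precomputed) (he : s.stateExposed = false) (he' : s.keyExposed = false)
    (hspecial : c = C.κ → s.exponent = C.x ∧ s.component = S.g n ^ C.x ∧
      f' (num 2) = cons (num s.owner) (num 0)) (hsmall : (num s.owner).size ≤ C.idSize) :
    Rel S n C (Function.update birth i (some c))
      { st with sessions := Function.update st.sessions i (some s) } f' := by
  have hbi : birth i = none := (h.recorded i).1 hi
  obtain ⟨h3, h7, h8, h6, h9⟩ := h.noSession i hi
  have hf' : ∀ a d, cons a d ≠ cons (num 3) (num i) → f' (cons a d) = f (cons a d) :=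
    fun a d had => hf _ had (by simp)
  have hf2 : c ≠ C.κ → f' (num 2) = f (num 2) := fun hc => hf _ (by simp) fun _ => hc
  have hfm : ∀ k, f k ≠ num 0 → f' k = f k := by
    intro k hk
    refine hf k ?_ ?_
    · rintro rfl
      exact hk h3
    · rintro rfl hcκ
      exact hk (h.owner (hc hcκ))
  have hne : ∀ {j}, j ≠ i → Function.update birth i (some c) j = birth j :=
    fun hj => Function.update_of_ne hj _ _
  have hsome : ∀ j s', Function.update st.sessions i (some s) j = some s' →
      j = i ∧ s' = s ∨ j ≠ i ∧ st.sessions j = some s' := by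
    intro j s' hs'
    by_cases hj : j = i
    · subst hj
      simp only [Function.update_self, Option.some.injEq] at hs'
      exact .inl ⟨rfl, hs'.symm⟩
    · exact .inr ⟨hj, by simpa [Function.update_of_ne hj] using hs'⟩
  refine ⟨fun d => (hf' _ _ (by simp)).trans (h.hash d), fun d => ?_, fun A => ?_, fun j hj => ?_,
    fun j s' hs' => ?_, (hf _ (by simp) (by simp)).trans h.tested,
    (hf _ (by simp) (by simp)).trans h.alive, fun j s' hs' hj => ?_,
    fun hb => ?_, fun j => ?_, fun j j' hj hj' => ?_, fun j hj => ?_, fun j s' hs' => ?_,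
    fun d v hd => h.keySmall d v (by rwa [hf' _ _ (by simp)] at hd)⟩
  · rw [hf' _ _ (by simp)]
    refine (h.key d).imp (fun h => h) fun h' => ⟨?_, h'.2.mono hfm⟩
    obtain ⟨j, s', B, Y, k, h1, h2, h3⟩ := h'.1
    have hj : j ≠ i := by
      rintro rfl
      rw [hi] at h2
      simp at h2
    exact ⟨j, s', B, Y, k, (hne hj).trans h1, by simpa [Function.update_of_ne hj] using h2, h3⟩
  · rw [hf' _ _ (by simp), hf' _ _ (by simp)]
    exact h.player A
  · have hji : j ≠ i := by
      rintro rfl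
      simp at hj
    rw [hf' _ _ (by simp [hji]), hf' _ _ (by simp), hf' _ _ (by simp), hf' _ _ (by simp),
      hf' _ _ (by simp)]
    exact h.noSession j (by simpa [Function.update_of_ne hji] using hj)
  · rw [hf' (num 7) _ (by simp), hf' (num 8) _ (by simp), hf' (num 6) _ (by simp),
      hf' (num 9) _ (by simp)]
    obtain ⟨rfl, rfl⟩ | ⟨hji, hs'⟩ := hsome j s' hs'
    · refine ⟨?_, ?_, ?_, ?_⟩
      · simpa using hdata
      · rw [hphase]
        exact ⟨h7, h8⟩
      · rw [h6, he]
        rfl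
      · rw [h9, he']
        rfl
    · rw [hf' _ _ (by simp [hji]), hne hji]
      exact h.session j s' hs'
  · obtain ⟨rfl, rfl⟩ | ⟨hji, hs'⟩ := hsome j s' hs'
    · simp only [Function.update_self, Option.some.injEq] at hj
      obtain ⟨h1, h2, h3⟩ := hspecial hj
      exact ⟨h1, h2, h3, fun B Y k hp => by simp [hphase] at hp⟩
    · rw [hne hji] at hj
      obtain ⟨h1, h2, h3, h4⟩ := h.special j s' hs' hj
      refine ⟨h1, h2, by rw [hfm _ (by simp [h3]), h3], fun B Y k hp => ?_⟩
      obtain ⟨h5, h6, h7, d', h8⟩ := h4 B Y k hp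
      exact ⟨h5, h6, h7, d', h8.mono hfm⟩
  · have hcκ : c ≠ C.κ := by simpa using hb i
    rw [hf2 hcκ]
    refine h.owner fun j hj => hb j ?_
    by_cases hji : j = i
    · rw [hji, hbi] at hj
      simp at hj
    · rw [hne hji, hj]
  · by_cases hj : j = i
    · subst hj
      simp
    · rw [hne hj]
      simpa [Function.update_of_ne hj] using h.recorded j
  · by_cases hji : j = i <;> by_cases hji' : j' = i
    · rw [hji, hji']
    · subst hji
      simp only [Function.update_self, Option.some.injEq] at hj
      exact absurd ((hne hji').symm.trans hj') (hc hj _)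
    · subst hji'
      simp only [Function.update_self, Option.some.injEq] at hj'
      exact absurd ((hne hji).symm.trans hj) (hc hj' _)
    · exact h.unique j j' ((hne hji).symm.trans hj) ((hne hji').symm.trans hj')
  · have := h.testedSpecial j hj
    rw [hne]
    · exact this
    · rintro rfl
      rw [hbi] at this
      simp at this
  · obtain ⟨rfl, rfl⟩ | ⟨hji, hs'⟩ := hsome j s' hs'
    · exact ⟨hsmall, by simp [hphase]⟩
    · exact h.small j s' hs'

theorem setTested (h : Rel S n C birth st f) {i : ℕ} (ht : st.tested = none)
    (hi : birth i = some C.κ) : Rel S n C birth { st with tested := some i }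
      (Function.update f (num 3) (cons (num i) (num 0))) := by
  have hm := update_mono (v := cons (num i) (num 0)) (show f (num 3) = num 0 by
    rw [h.tested, ht]; rfl)
  refine ⟨by simpa using h.hash, fun d => ?_, by simpa using h.player, by simpa using h.noSession,
    by simpa using h.session, by simp, by simpa using h.alive,
    fun i s hs hi => ?_, by simpa using h.owner, h.recorded, h.unique, ?_, h.small,
    by simpa using h.keySmall⟩
  · obtain h' | ⟨h1, h2⟩ := h.key d
    · exact .inl (by simpa using h')
    · exact .inr ⟨h1, h2.mono hm⟩
  · obtain ⟨h1, h2, h3, h4⟩ := h.special i s hs hi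
    refine ⟨h1, h2, by simpa using h3, fun B Y k hp => ?_⟩
    obtain ⟨h5, h6, h7, d', h8⟩ := h4 B Y k hp
    exact ⟨h5, h6, h7, d', h8.mono hm⟩
  · rintro j ⟨⟩
    exact hi

end Rel

/-! ### Elementary steps of the simulator -/

theorem lookup_cons_eq (s k v : Data) :
    lookup (cons (cons k v) s) = Function.update (lookup s) k v := by
  funext k'
  rw [lookup_cons]
  by_cases h : k = k'
  · subst h
    simp
  · rw [if_neg h, Function.update_of_ne (Ne.symm h)]

namespace Sim

theorem look_bind (k : Data) (G : Data → Sim Data) (s : Data) :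
    (look k >>= G) s = G (lookup s k) s := PMF.pure_bind _ _

theorem pure_bind_apply (a : Data) (G : Data → Sim Data) (s : Data) :
    ((pure a : Sim Data) >>= G) s = G a s := PMF.pure_bind _ _

theorem add_bind {m : ℕ} {k v s : Data} (h : lookup s k = num 0) (h' : k.size + v.size ≤ m)
    (G : Data → Sim Data) : (add m k v >>= G) s = G (num 0) (cons (cons k v) s) :=
  (PMF.pure_bind _ _).trans (by simp only [if_pos h, if_pos h'])

theorem draw_bind (r : ℕ) (G : Data → Sim Data) (s : Data) :
    (draw r >>= G) s = (uniformUpTo r).bind fun v => G (num v) s := by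
  change ((((uniformUpTo r).map num).map fun v => (v, s))).bind _ = _
  rw [PMF.bind_map, PMF.bind_map]
  rfl

theorem oracle_hit {m r : ℕ} {tag d s : Data} {v : Data}
    (h : lookup s (cons tag d) = cons v (num 0)) : oracle m tag r d s = PMF.pure (v, s) := by
  unfold oracle
  rw [look_bind, h, if_neg (by simp)]
  rfl

theorem oracle_miss {m r : ℕ} {tag d s : Data} (h : lookup s (cons tag d) = num 0)
    (hm : tag.size + d.size + Nat.size r + 4 ≤ m) :
    oracle m tag r d s = (uniformUpTo r).map fun v =>
      (num v, cons (cons (cons tag d) (cons (num v) (num 0))) s) := by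
  unfold oracle
  rw [look_bind, if_pos h, draw_bind, PMF.map]
  refine bind_congr_support _ fun v hv => ?_
  have hv := Nat.size_le_size (mem_support_uniformUpTo.1 hv)
  rw [add_bind h (by simp only [Data.size, Nat.size_zero]; omega)]
  rfl

theorem bind_apply (p : Sim Data) (G : Data → Sim Data) (s : Data) :
    (p >>= G) s = (p s).bind fun r => G r.1 r.2 := rfl

theorem ifValid_none {m : ℕ} (h : S.decode n m = none) (p : Sim Data) :
    ifValid S n (num m) p = refuse := by
  unfold ifValid
  by_cases h1 : S.memD n (num m) = num 1
  · rw [if_pos h1]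
    obtain ⟨a, ha⟩ := Params.memD_eq_one.1 h1
    by_cases h2 : num m = S.powD n (S.elem n (S.g n)) 0
    · rw [if_pos h2]
    · exfalso
      rw [Params.powD_elem, pow_zero, ha, Params.elem_inj] at h2
      unfold Params.decode at h
      rw [dif_pos ⟨a, by simpa [Params.elem] using ha.symm, h2⟩] at h
      simp at h
  · rw [if_neg h1]

theorem ifValid_some {m : ℕ} {X : S.G n} (h : S.decode n m = some X) :
    num m = S.elem n X ∧ ∀ p : Sim Data, ifValid S n (num m) p = p := by
  unfold Params.decode at h
  split at h
  · rename_i h'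
    obtain ⟨h1, h2⟩ := h'.choose_spec
    rw [Option.some.inj h] at h1 h2
    have h3 : num m = S.elem n X := by rw [Params.elem, h1]
    refine ⟨h3, fun p => ?_⟩
    rw [ifValid, h3, if_pos (Params.memD_eq_one.2 ⟨X, rfl⟩), Params.powD_elem, pow_zero, if_neg]
    rwa [Params.elem_inj]
  · simp at h

end Sim

/-! ### Corresponding steps -/

namespace Coupled

variable {C : Plan} {birth : ℕ → Option ℕ} {st : GameState (S.G n)} {s : Data} {l : ℕ}
  {R : Data × GameState (S.G n) → Data × Data → Prop}

theorem game_get {F : GameState (S.G n) → S.Game n Data} {ν : PMF (Data × Data)}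
    (h : Coupled R (F st st) ν) : Coupled R ((get >>= F) st) ν := by
  rwa [get_bind]

theorem sim_look {μ : PMF (Data × GameState (S.G n))} {k : Data} {G : Data → Sim Data}
    (h : Coupled R μ (G (lookup s k) s)) : Coupled R μ ((Sim.look k >>= G) s) := by
  rwa [Sim.look_bind]

theorem sim_add {μ : PMF (Data × GameState (S.G n))} {m : ℕ} {k v : Data} {G : Data → Sim Data}
    (h : lookup s k = num 0) (h' : k.size + v.size ≤ m)
    (H : Coupled R μ (G (num 0) (cons (cons k v) s))) :
    Coupled R μ ((Sim.add m k v >>= G) s) := by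
  rwa [Sim.add_bind h h']

theorem game_setSession {i : ℕ} {w : Session (S.G n)} {F : PUnit → S.Game n Data}
    {ν : PMF (Data × Data)}
    (h : Coupled R (F ⟨⟩ { st with sessions := Function.update st.sessions i (some w) }) ν) :
    Coupled R ((S.setSession n i w >>= F) st) ν := by
  rwa [setSession_bind]

theorem game_setPlayer {A : ℕ} {P : Player (S.G n)} {F : PUnit → S.Game n Data}
    {ν : PMF (Data × Data)}
    (h : Coupled R (F ⟨⟩ { st with players := Function.update st.players A (some P) }) ν) :
    Coupled R ((S.setPlayer n A P >>= F) st) ν := by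
  rwa [setPlayer_bind]

/-- The value of `h` at the same point; new values are equally distributed. -/
theorem hash (h : Rel S n C birth st (lookup s)) (hw : C.Wide S n l) {d : Data}
    (hd : d.size ≤ 3 * (C.idSize + l) + 10) {F : ℕ → S.Game n Data} {G : Data → Sim Data}
    (H : ∀ v st' s', Rel S n C birth st' (lookup s') → TableExt st st' → st'.hTable d = some v →
      Coupled R (F v st') (G (num v) s')) :
    Coupled R ((S.h n d >>= F) st) ((Sim.hash n C.limit d >>= G) s) := by
  rw [Game.bind_apply, Sim.bind_apply]
  unfold Params.h Sim.hash
  have h1 := h.hash d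
  cases hT : st.hTable d with
  | some v =>
    rw [hT] at h1
    rw [Sim.oracle_hit h1, PMF.pure_bind, PMF.pure_bind]
    exact H v st s h (.refl _) hT
  | none =>
    rw [hT] at h1
    have hsize : Nat.size (2 ^ n - 1) ≤ n := Nat.size_le.2 (by have := Nat.two_pow_pos n; omega)
    have hlim := hw.limit
    have hsec := hw.security
    rw [Sim.oracle_miss h1 (by simp only [Data.size, Nat.size_zero]; omega), PMF.bind_map,
      PMF.bind_map]
    refine bind (R := Eq) (refl fun _ _ => rfl) ?_
    rintro v _ rfl
    refine H v _ _ ?_ ?_ (by simp)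
    · rw [lookup_cons_eq]
      exact h.setHash hT v
    · refine ⟨fun d' v' h' => ?_, fun _ _ h' => h', rfl, rfl, rfl⟩
      have : d' ≠ d := by rintro rfl; simp [hT] at h'
      simpa [Function.update_of_ne this] using h'

/-- The value of `H_K` at the same point. If this is the point of the special session, the
simulation turns bad. -/
theorem keyHash (h : Rel S n C birth st (lookup s)) (hw : C.Wide S n l) {d : Data}
    (hd : d.size ≤ 3 * (C.idSize + l) + 10) {F : ℕ → S.Game n Data} {G : Data → Sim Data}
    (hR : ∀ a b, Bad S n C.pr C.x b.2 → R a b)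
    (hG : ∀ w, (G w).Tame (S.q n) C.limit (hashZero S n) 20)
    (H : ∀ v st' s', Rel S n C birth st' (lookup s') → TableExt st st' → v < 2 ^ S.keyLen n →
      Coupled R (F v st') (G (num v) s')) :
    Coupled R ((S.hKFrom n (S.keyDist n) d >>= F) st) ((Sim.keyHash S n C.limit d >>= G) s) := by
  have hsize : Nat.size (2 ^ S.keyLen n - 1) ≤ S.keyLen n :=
    Nat.size_le.2 (by have := Nat.two_pow_pos (S.keyLen n); omega)
  have hlim := hw.limit
  have hkey := hw.keyLen
  have hfit : (num 1).size + d.size + Nat.size (2 ^ S.keyLen n - 1) + 4 ≤ C.limit := by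
    simp only [Data.size, Nat.size_one]
    omega
  rw [Game.bind_apply, Sim.bind_apply]
  unfold Sim.keyHash
  obtain h1 | ⟨h1, h2⟩ := h.key d
  · unfold Params.hKFrom
    cases hT : st.keyTable d with
    | some v =>
      rw [hT] at h1
      rw [Sim.oracle_hit h1, PMF.pure_bind, PMF.pure_bind]
      exact H v st s h (.refl _) (h.keySmall d v h1)
    | none =>
      rw [hT] at h1
      rw [Sim.oracle_miss h1 hfit, PMF.bind_map, PMF.bind_map]
      refine bind (R := fun v v' => v = v' ∧ v ≤ 2 ^ S.keyLen n - 1)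
        (refl fun v hv => ⟨rfl, mem_support_uniformUpTo.1 hv⟩) ?_
      rintro v _ ⟨rfl, hv⟩
      have hv : v < 2 ^ S.keyLen n := by have := Nat.two_pow_pos (S.keyLen n); omega
      refine H v _ _ ?_ ?_ hv
      · rw [lookup_cons_eq]
        exact h.setKey h1 hv
      · refine ⟨fun _ _ h' => h', fun d' v' h' => ?_, rfl, rfl, rfl⟩
        have : d' ≠ d := by rintro rfl; simp [hT] at h'
        simpa [Function.update_of_ne this] using h'
  · refine of_forall fun a _ b hb => hR a b ?_
    obtain ⟨r, hr, hb⟩ := (PMF.mem_support_bind_iff _ _ _).1 hb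
    refine Bad.mono ((hG r.1 r.2).1 b hb).2 ?_
    have hext := ((Sim.Tame.keyHash (S := S) (n := n) (m := C.limit) (q := S.q n)
      (δ := hashZero S n) (j := 0) d s).1 r hr).2
    refine ⟨d, h2.mono hext, ?_⟩
    by_cases h0 : lookup s (cons (num 1) d) = num 0
    · rw [Sim.oracle_miss h0 hfit] at hr
      obtain ⟨v, -, rfl⟩ := (PMF.mem_support_map_iff _ _ _).1 hr
      simp [lookup_cons]
    · rwa [hext _ h0]

theorem cd (h : Rel S n C birth st (lookup s)) (hw : C.Wide S n l) {A : ℕ} {Y : S.G n}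
    (hA : (num A).size ≤ C.idSize) {F : ℕ → S.Game n Data} {G : Data → Sim Data}
    (H : ∀ v st' s', Rel S n C birth st' (lookup s') → TableExt st st' → CDVal S n C.pr st' A Y v →
      Coupled R (F v st') (G (num v) s')) :
    Coupled R ((S.cd n C.pr A Y >>= F) st)
      ((Sim.cd n C.pr C.limit (num A) (S.elem n Y) >>= G) s) := by
  have hY := hw.elem Y
  have h0 : (num 0).size = 1 := rfl
  obtain ⟨pr, hpr⟩ : ∃ pr, pr = C.pr := ⟨_, rfl⟩
  rw [← hpr] at H ⊢
  cases pr with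
  | oake =>
    exact hash (d := tuple [num A, S.elem n Y]) h hw (by
      simp only [tuple, size_cons]
      omega) H
  | soake =>
    change Coupled R ((Pure.pure 1 >>= F : S.Game n Data) st)
      ((Pure.pure (num 1) >>= G : Sim Data) s)
    rw [Sim.pure_bind_apply, Game.pure_bind_apply]
    exact H 1 st s h (.refl _) rfl

theorem e (h : Rel S n C birth st (lookup s)) (hw : C.Wide S n l) {A B : ℕ} {X Y : S.G n}
    (hA : (num A).size ≤ C.idSize) (hB : (num B).size ≤ C.idSize) {F : ℕ → S.Game n Data}
    {G : Data → Sim Data}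
    (H : ∀ v st' s', Rel S n C birth st' (lookup s') → TableExt st st' →
      st'.hTable (eArg S n C.pr A B X Y) = some v → Coupled R (F v st') (G (num v) s')) :
    Coupled R ((S.e n C.pr A B X Y >>= F) st)
      ((Sim.e n C.pr C.limit (num A) (num B) (S.elem n X) (S.elem n Y) >>= G) s) := by
  have hX := hw.elem X
  have hY := hw.elem Y
  have h0 : (num 0).size = 1 := rfl
  obtain ⟨pr, hpr⟩ : ∃ pr, pr = C.pr := ⟨_, rfl⟩
  rw [← hpr] at H ⊢
  cases pr with
  | oake =>
    exact hash (d := tuple [S.elem n X, S.elem n Y]) h hw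
      (by simp only [tuple, size_cons]; omega) H
  | soake =>
    exact hash (d := tuple [num A, num B, S.elem n X, S.elem n Y]) h hw
      (by simp only [tuple, size_cons]; omega) H

theorem responderKey (h : Rel S n C birth st (lookup s)) (hw : C.Wide S n l) {A B b y : ℕ}
    {pkA X : S.G n} (hA : (num A).size ≤ C.idSize) (hB : (num B).size ≤ C.idSize)
    {F : ℕ → S.Game n Data} {G : Data → Sim Data} (hR : ∀ a b, Bad S n C.pr C.x b.2 → R a b)
    (hG : ∀ w, (G w).Tame (S.q n) C.limit (hashZero S n) 20)
    (H : ∀ v st' s', Rel S n C birth st' (lookup s') → TableExt st st' → v < 2 ^ S.keyLen n →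
      Coupled R (F v st') (G (num v) s')) :
    Coupled R ((S.responderKeyFrom n (S.keyDist n) C.pr A B b y pkA X >>= F) st)
      ((Sim.responderKey S n C.pr C.limit (num A) (num B) (num b) (num y) (S.elem n (S.g n ^ y))
        (S.elem n pkA) (S.elem n X) >>= G) s) := by
  unfold Params.responderKeyFrom Sim.responderKey
  simp only [bind_assoc]
  refine cd h hw hA fun c st1 s1 h1 e1 _ => cd h1 hw hB fun d st2 s2 h2 e2 _ =>
    e h2 hw hA hB fun e st3 s3 h3 e3 _ => ?_
  simp only [toNat_num, Params.powD_elem, Params.mulD_elem]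
  have := hw.elem (pkA ^ (c * y) * X ^ (d * b + e * y))
  exact keyHash h3 hw (by omega) hR hG fun v st4 s4 h4 e4 =>
    H v st4 s4 h4 (e1.trans (e2.trans (e3.trans e4)))

theorem initiatorKey (h : Rel S n C birth st (lookup s)) (hw : C.Wide S n l) {A B a x : ℕ}
    {pkB Y : S.G n} (hA : (num A).size ≤ C.idSize) (hB : (num B).size ≤ C.idSize)
    {F : ℕ → S.Game n Data} {G : Data → Sim Data} (hR : ∀ a b, Bad S n C.pr C.x b.2 → R a b)
    (hG : ∀ w, (G w).Tame (S.q n) C.limit (hashZero S n) 20)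
    (H : ∀ v st' s', Rel S n C birth st' (lookup s') → TableExt st st' → v < 2 ^ S.keyLen n →
      Coupled R (F v st') (G (num v) s')) :
    Coupled R ((S.initiatorKeyFrom n (S.keyDist n) C.pr A B a x pkB Y >>= F) st)
      ((Sim.initiatorKey S n C.pr C.limit (num A) (num B) (num a) (num x) (S.elem n (S.g n ^ x))
        (S.elem n pkB) (S.elem n Y) >>= G) s) := by
  unfold Params.initiatorKeyFrom Sim.initiatorKey
  simp only [bind_assoc]
  refine cd h hw hA fun c st1 s1 h1 e1 _ => cd h1 hw hB fun d st2 s2 h2 e2 _ =>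
    e h2 hw hA hB fun e st3 s3 h3 e3 _ => ?_
  simp only [toNat_num, Params.powD_elem, Params.mulD_elem]
  have := hw.elem (pkB ^ (d * x) * Y ^ (c * a + e * x))
  exact keyHash h3 hw (by omega) hR hG fun v st4 s4 h4 e4 =>
    H v st4 s4 h4 (e1.trans (e2.trans (e3.trans e4)))

theorem _root_.OAKE.CDVal.entry {c A : ℕ} {Y : S.G n} {f : Data → Data}
    (h : Rel S n C birth st f) (hc : CDVal S n C.pr st A Y c) : CDEntry S n C.pr f A Y c := by
  revert hc
  unfold CDVal CDEntry
  cases C.pr with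
  | oake =>
    intro hc
    exact (h.hash _).trans (by rw [hc]; rfl)
  | soake => exact fun hc => hc

theorem _root_.OAKE.CDVal.unique {pr : Protocol} {c d A : ℕ} {Y : S.G n}
    (hc : CDVal S n pr st A Y c) (hd : CDVal S n pr st A Y d) : c = d := by
  cases pr
  · exact Option.some.inj ((show _ = _ from hc).symm.trans hd)
  · exact Eq.trans hc (Eq.symm hd)

/-- The key of the special session `(A, A, X, X)` is not computed by the simulator. Either the
simulation is bad, or the key is a new random value in the experiment. -/
theorem reflectedKey (h : Rel S n C birth st (lookup s)) (hw : C.Wide S n l) {A a : ℕ}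
    (hA : (num A).size ≤ C.idSize) (hspent : ¬ SpentAt C.κ birth st)
    (howner : ∃ i w, st.sessions i = some w ∧ birth i = some C.κ ∧ w.owner = A)
    (hsk : ∃ P, st.players A = some P ∧ P.sk = some a)
    {z : ℕ → ℕ → ℕ → Data}
    (hz : ∀ c e, z c c e = S.elem n (S.g n ^ (2 * (c * a) * C.x + e * (C.x * C.x))))
    {kd : PMF ℕ} (hkd : C.β = true → kd = PMF.pure C.k)
    {F : ℕ → S.Game n Data} {G : Data → Sim Data} (hR : ∀ a b, Bad S n C.pr C.x b.2 → R a b)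
    (hG : ∀ w, (G w).Tame (S.q n) C.limit (hashZero S n) 20)
    (H : ∀ k st' s' w Z, Rel S n C birth st' (lookup s') → TableExt st st' →
      Target S n C.pr C.x (lookup s') Z → (C.β = true → k = C.k) →
      Coupled R (F k { st' with keyTable := Function.update st'.keyTable Z (some k) }) (G w s')) :
    Coupled R (((do
        let c ← S.cd n C.pr A (S.g n ^ C.x)
        let d ← S.cd n C.pr A (S.g n ^ C.x)
        let e ← S.e n C.pr A A (S.g n ^ C.x) (S.g n ^ C.x)
        S.hKFrom n kd (z c d e)) >>= F) st)
      ((Sim.reflectedHash n C.pr C.limit (num A) (S.elem n (S.g n ^ C.x)) >>= G) s) := by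
  unfold Sim.reflectedHash
  simp only [bind_assoc]
  refine cd h hw hA fun c st1 s1 h1 e1 hc => cd h1 hw hA fun d st2 s2 h2 e2 hd =>
    e h2 hw hA hA fun e st3 s3 h3 e3 he => ?_
  obtain rfl : c = d := CDVal.unique (hc.mono e2) hd
  have e13 := e1.trans (e2.trans e3)
  have hspent3 : ¬ SpentAt C.κ birth st3 := by
    rintro ⟨i, w, B, Y, k, h1, h2, h3⟩
    exact hspent ⟨i, w, B, Y, k, h1, by rw [← e13.sessions]; exact h2, h3⟩
  have hT : Target S n C.pr C.x (lookup s3) (z c c e) := by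
    obtain ⟨i, w, hw1, hw2, rfl⟩ := howner
    obtain ⟨P, hP1, hP2⟩ := hsk
    rw [← e13.sessions] at hw1
    rw [← e13.players] at hP1
    have hP := h3.player w.owner
    rw [hP1] at hP
    exact ⟨w.owner, a, c, e, _, (h3.special i w hw1 hw2).2.2.1, hP.1.trans (by rw [hP2]; rfl),
      CDVal.entry h3 ((hc.mono e2).mono e3), (h3.hash _).trans (by rw [he]; rfl), hz c e⟩
  rw [Game.bind_apply]
  unfold Params.hKFrom
  obtain h4 | h4 := h3.key (z c c e)
  · cases hk : st3.keyTable (z c c e) with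
    -- `H_K` was asked for the key before
    | some v =>
      refine of_forall fun a _ b hb => hR a b (Bad.mono ((hG _ _).1 b hb).2 ⟨_, hT, ?_⟩)
      rw [h4, hk]
      simp
    -- the key is drawn in the experiment, without a counterpart in the simulation
    | none =>
      rw [PMF.bind_map]
      refine bind_left fun k hk => H k st3 s3 _ _ h3 e13 hT fun hβ => ?_
      rw [hkd hβ] at hk
      simpa using hk
  · exact absurd h4.1 hspent3

end Coupled

end OAKE

end

noncomputable section

namespace OAKE

open Data Game

variable {S : Params} {n : ℕ}

/-! ### Corresponding reactions -/

/-- What a reaction of the experiment in the state `t` and the corresponding reaction of the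
simulator lead to: equal replies and corresponding states, or `H_K` was asked for the key of the
special session, or the simulator has given up. -/
def Out (S : Params) (n : ℕ) (C : Plan) (t : Tracked (S.G n)) (r : Data × GameState (S.G n))
    (r' : Data × Data) : Prop :=
  (r.1 = r'.1 ∧ Rel S n C (t.next r.2).birth r.2 (lookup r'.2)) ∨ Bad S n C.pr C.x r'.2 ∨
    Doomed C.κ t.birth r.2 ∧ lookup r'.2 (num 4) ≠ num 0

theorem Tracked.next_birth_eq {t : Tracked (S.G n)} {st : GameState (S.G n)}
    (h : ∀ i, t.base.sessions i = none ↔ t.birth i = none)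
    (h' : ∀ i, st.sessions i = none ↔ t.birth i = none) : (t.next st).birth = t.birth := by
  funext i
  simp only [Tracked.next]
  rw [if_neg]
  rintro ⟨h1, h2⟩
  exact h2 ((h' i).2 ((h i).1 h1))

/-- In the experiment, the value of `H_K` for the special session may be set without a counterpart
in the store. -/
theorem Rel.setHidden {C : Plan} {birth : ℕ → Option ℕ} {st : GameState (S.G n)} {f : Data → Data}
    (h : Rel S n C birth st f) (hs : SpentAt C.κ birth st) {Z : Data}
    (hZ : Target S n C.pr C.x f Z) (k : ℕ) :
    Rel S n C birth { st with keyTable := Function.update st.keyTable Z (some k) } f := by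
  refine ⟨h.hash, fun d => ?_, h.player, h.noSession, h.session, h.tested, h.alive, h.special,
    h.owner, h.recorded, h.unique, h.testedSpecial, h.small, h.keySmall⟩
  by_cases hd : d = Z
  · subst hd
    exact .inr ⟨hs, hZ⟩
  · exact (h.key d).imp (fun h' => by simpa [Function.update_of_ne hd] using h') fun h' => h'

theorem SessionView.special {p : Prop} {w : Session (S.G n)} {d a r e e' : Data}
    (h : SessionView S n p w d a r e e') (hp : p) :
    d = cons (num w.owner) (cons (S.elem n w.component) (num 0)) :=
  h.data.elim (fun h => h.2) fun h => absurd hp h.1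

theorem SessionView.ordinary {p : Prop} {w : Session (S.G n)} {d a r e e' : Data}
    (h : SessionView S n p w d a r e e') (hp : ¬ p) :
    d = cons (num w.owner) (cons (S.elem n w.component) (cons (num w.exponent) (num 0))) :=
  h.data.elim (fun h => absurd h.1 hp) fun h => h.2

theorem Sim.add_bind_of_ne {m : ℕ} {k v s : Data} (h : lookup s k ≠ num 0)
    (G : Data → Sim Data) : (Sim.add m k v >>= G) s = G (num 0) s :=
  (PMF.pure_bind _ _).trans (by simp only [if_neg h])

theorem flag_ne {b : Bool} (h : flag b ≠ num 0) : b = true := by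
  cases b
  · exact absurd rfl h
  · rfl

namespace Coupled

variable {C : Plan} {t : Tracked (S.G n)} {s : Data} {l : ℕ} {ed : PMF ℕ} {kd : ℕ → PMF ℕ}
  {td : PMF ℕ} {β : Bool} {R : Data × GameState (S.G n) → Data × Data → Prop}
  {st : GameState (S.G n)} {birth : ℕ → Option ℕ}

theorem accept {s' : Data} (h : Rel S n C t.birth t.base (lookup s))
    (h' : Rel S n C t.birth st (lookup s')) {d d' : Data} (hd : d = d') :
    Coupled (Out S n C t) (S.accept n d st) (Sim.accept d' s') := by
  refine pure (.inl ⟨by rw [hd], ?_⟩)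
  dsimp only
  rw [Tracked.next_birth_eq h.recorded h'.recorded]
  exact h'

theorem refuse (h : Rel S n C t.birth t.base (lookup s)) :
    Coupled (Out S n C t) (S.refuse n t.base) (Sim.refuse s) := by
  refine pure (.inl ⟨rfl, ?_⟩)
  dsimp only
  rw [Tracked.next_birth_eq h.recorded h.recorded]
  exact h

/-- The simulator may give up when the special session is exposed, or incompatible with the form of
the test session, or not the test session. -/
theorem die (h : Rel S n C t.birth t.base (lookup s)) (hw : C.Wide S n l) {m : S.Game n Data}
    (hm : Reach t.base m fun _ st' => Doomed C.κ t.birth st') :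
    Coupled (Out S n C t) (m t.base) (Sim.die C.limit s) := by
  have := hw.limit
  unfold Sim.die
  refine sim_add h.alive (by simp [Data.size]; have := show Nat.size 4 = 3 from rfl; omega) ?_
  refine of_forall fun a ha b hb => .inr (.inr ⟨hm a ha, ?_⟩)
  rw [(PMF.mem_support_pure_iff _ _).1 hb]
  simp

theorem exponent {F : ℕ → S.Game n Data} {G : Data → Sim Data}
    (H : ∀ a, Nat.size a ≤ Nat.size (S.q n) → Coupled R (F a st) (G (num a) s)) :
    Coupled R ((S.draw n (S.exponent n) >>= F) st) ((Sim.exponent S n >>= G) s) := by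
  rw [Game.draw_bind, Params.exponent, PMF.bind_map]
  unfold Sim.exponent
  rw [bind_assoc, Sim.draw_bind]
  refine bind (R := fun i j => i = j ∧ i ≤ S.q n - 2)
    (refl fun i hi => ⟨rfl, mem_support_uniformUpTo.1 hi⟩) ?_
  rintro i _ ⟨rfl, hi⟩
  have := (S.prime n).two_le
  rw [Sim.pure_bind_apply]
  exact H (i + 1) (Nat.size_le_size (by omega))

/-- The simulator sets up honest players as the experiment does, and knows their secret keys. -/
theorem newPlayer (h : Rel S n C t.birth t.base (lookup s)) (hw : C.Wide S n l) {A : ℕ}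
    (hA : (num A).size ≤ C.idSize) : Coupled (Out S n C t)
      (S.answerFrom n ed kd td C.pr β (.newPlayer A) t.base)
      (Sim.newPlayer S n C.limit (num A) s) := by
  have hv := h.player A
  unfold Params.answerFrom Params.answer Sim.newPlayer
  refine game_get (sim_look ?_)
  cases hP : t.base.players A with
  | some P =>
    rw [hP] at hv
    rw [if_neg (by simp [hv.1])]
    exact refuse h
  | none =>
    rw [hP] at hv
    rw [if_pos hv.1]
    refine exponent fun a ha => ?_
    have hlim := hw.limit
    have hord := hw.order
    have hel := hw.elem (S.g n ^ a)
    have h2 : Nat.size 2 = 2 := rfl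
    refine sim_add hv.1 ?_ (game_setPlayer ?_)
    · simp only [toNat_num, Params.powD_elem, Data.size] at hA hel ⊢
      simp only [Nat.size_zero, h2]
      omega
    refine accept h ?_ (by simp)
    rw [lookup_cons_eq]
    refine h.setPlayer (fun k h1 h2 => Function.update_of_ne h1 _ _)
      (fun k hk _ => update_mono hv.1 k hk) ⟨by simp, ?_⟩
    simp [hv.2]

theorem register (h : Rel S n C t.birth t.base (lookup s)) (hw : C.Wide S n l) {A m : ℕ}
    (hA : (num A).size ≤ C.idSize) : Coupled (Out S n C t)
      (S.answerFrom n ed kd td C.pr β (.register A m) t.base)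
      (Sim.register S n C.limit (num A) (num m) s) := by
  have hv := h.player A
  unfold Params.answerFrom Params.answer Sim.register
  refine game_get (sim_look ?_)
  cases hP : t.base.players A with
  | some P =>
    rw [hP] at hv
    rw [if_neg (by simp [hv.1])]
    exact refuse h
  | none =>
    rw [hP] at hv
    rw [if_pos hv.1]
    cases hX : S.decode n m with
    | none =>
      rw [Sim.ifValid_none hX]
      exact refuse h
    | some X =>
      obtain ⟨hm, hV⟩ := Sim.ifValid_some hX
      rw [hV, hm]
      have hlim := hw.limit
      have hel := hw.elem X
      have h2 : Nat.size 2 = 2 := rfl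
      have h5 : Nat.size 5 = 3 := rfl
      refine sim_add hv.1 ?_ (sim_add ?_ ?_ (game_setPlayer ?_))
      · simp only [Data.size] at hA hel ⊢
        simp only [Nat.size_zero, h2]
        omega
      · simpa using hv.2
      · simp only [Data.size] at hA hel ⊢
        simp only [Nat.size_one, h5]
        omega
      refine accept h ?_ rfl
      rw [lookup_cons_eq, lookup_cons_eq]
      refine h.setPlayer (fun k h1 h2 => by simp [Function.update_of_ne, h1, h2])
        (fun k hk h5 => ?_) ⟨by simp, by simp⟩
      rw [Function.update_of_ne h5]
      exact update_mono hv.1 k hk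

theorem corrupt (h : Rel S n C t.birth t.base (lookup s)) (hw : C.Wide S n l) {A : ℕ}
    (hA : (num A).size ≤ C.idSize) : Coupled (Out S n C t)
      (S.answerFrom n ed kd td C.pr β (.corrupt A) t.base)
      (Sim.corrupt C.limit (num A) s) := by
  have hv := h.player A
  unfold Params.answerFrom Params.answer Sim.corrupt
  refine game_get (sim_look ?_)
  cases hP : t.base.players A with
  | none =>
    rw [hP] at hv
    rw [if_pos (by simp [hv.1])]
    exact refuse h
  | some P =>
    rw [hP] at hv
    obtain ⟨P, _ | a, cor⟩ := P
    · rw [if_pos (by simp [hv.1])]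
      exact refuse h
    · rw [if_neg (by simp [hv.1])]
      have hlim := hw.limit
      have h5 : Nat.size 5 = 3 := rfl
      refine game_setPlayer ?_
      cases cor with
      | true =>
        rw [Sim.add_bind_of_ne (by simp [hv.2])]
        refine accept h ?_ (by simp [hv.1])
        exact h.setPlayer (fun _ _ _ => rfl) (fun _ _ _ => rfl) hv
      | false =>
        refine sim_add hv.2 ?_ ?_
        · simp only [Data.size] at hA ⊢
          simp only [Nat.size_one, h5]
          omega
        refine accept h ?_ (by simp [hv.1])
        rw [lookup_cons_eq]
        exact h.setPlayer (fun k _ h2 => Function.update_of_ne h2 _ _)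
          (fun k _ h5 => Function.update_of_ne h5 _ _) ⟨by simpa using hv.1, by simp⟩

theorem hashQuery (h : Rel S n C t.birth t.base (lookup s)) (hw : C.Wide S n l) {d : Data}
    (hd : d.size ≤ C.idSize) : Coupled (Out S n C t)
      (S.answerFrom n ed kd td C.pr β (.hash d) t.base)
      ((Sim.hash n C.limit d >>= fun v => Sim.accept v) s) :=
  hash h hw (by omega) fun _ _ _ h' _ _ => accept h h' rfl

theorem keyHashQuery (h : Rel S n C t.birth t.base (lookup s)) (hw : C.Wide S n l) {d : Data}
    (hd : d.size ≤ C.idSize) : Coupled (Out S n C t)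
      (S.answerFrom n ed kd td C.pr β (.keyHash d) t.base)
      ((Sim.keyHash S n C.limit d >>= fun v => Sim.accept v) s) :=
  keyHash h hw (by omega) (fun _ _ hb => .inr (.inl hb)) (fun _ => .pure _)
    fun _ _ _ h' _ _ => accept h h' rfl

theorem initiate (h : Rel S n C t.birth t.base (lookup s)) (hw : C.Wide S n l) {i B : ℕ}
    (hi : (num i).size ≤ C.idSize) (hB : (num B).size ≤ C.idSize) : Coupled (Out S n C t)
      (S.answerFrom n ed kd td C.pr β (.initiate i B) t.base)
      (Sim.initiate C.limit (num i) (num B) s) := by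
  have hv := h.player B
  unfold Params.answerFrom Params.answer Sim.initiate
  refine game_get (game_get (sim_look ?_))
  cases hs : t.base.sessions i with
  | none =>
    rw [if_pos (h.noSession i hs).1]
    exact refuse h
  | some w =>
    have hw' := h.session i w hs
    have hd : lookup s (cons (num 3) (num i)) ≠ num 0 ∧
        (lookup s (cons (num 3) (num i))).right.left = S.elem n w.component := by
      obtain h' | h' := hw'.data <;> simp [h'.2]
    rw [if_neg hd.1, hd.2]
    refine sim_look ?_
    cases hP : t.base.players B with
    | none =>
      rw [hP] at hv
      rw [if_pos hv.1]
      exact refuse h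
    | some P =>
      rw [hP] at hv
      rw [if_neg (by simp [hv.1])]
      refine sim_look ?_
      have hp := hw'.phase
      dsimp only
      cases hph : w.phase with
      | opened A =>
        rw [hph] at hp
        rw [if_neg (by simp [hp.1])]
        exact refuse h
      | complete A Y k =>
        rw [hph] at hp
        rw [if_neg (by simp [hp.1])]
        exact refuse h
      | precomputed =>
        rw [hph] at hp
        rw [if_pos hp.1]
        have hlim := hw.limit
        have h7 : Nat.size 7 = 3 := rfl
        refine sim_add hp.1 ?_ (game_setSession ?_)
        · simp only [Data.size] at hi hB ⊢
          simp only [Nat.size_zero, h7]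
          omega
        refine accept h ?_ rfl
        rw [lookup_cons_eq]
        refine h.setSession hs (fun k hk => Function.update_of_ne (hk 7 (by simp)) _ _)
          (by simp [hph]) ⟨?_, ?_, ?_, ?_⟩ rfl rfl rfl (by simp) ?_
        · simpa using hw'.data
        · simpa [PhaseView] using hp.2
        · simpa using hw'.stateExposed
        · simpa using hw'.keyExposed
        · rintro _ ⟨⟩
          exact hB

/-- The session created by query `κ` gets the DH-component `g ^ x` in both cases, without an entry
for the exponent. For other sessions the exponents have the same distribution. -/
theorem precompute (h : Rel S n C t.birth t.base (lookup s)) (hw : C.Wide S n l)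
    (hrec : t.Recorded) (hed : ed = if t.count = C.κ then PMF.pure C.x else S.exponent n)
    {i A : ℕ} (hi : (num i).size ≤ C.idSize) (hA : (num A).size ≤ C.idSize) : Coupled (Out S n C t)
      (S.answerFrom n ed kd td C.pr β (.precompute i A) t.base)
      (Sim.precompute S n C.limit (S.elem n (S.g n ^ C.x)) (num (C.κ + 1 - t.count)) (num i)
        (num A) s) := by
  have hv := h.player A
  have hlim := hw.limit
  have hord := hw.order
  have h0 : Nat.size 0 = 0 := rfl
  have h2 : Nat.size 2 = 2 := rfl
  have h3 : Nat.size 3 = 2 := rfl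
  unfold Params.answerFrom Sim.precompute
  refine game_get (game_get (sim_look ?_))
  cases hs : t.base.sessions i with
  | some w =>
    have hd : lookup s (cons (num 3) (num i)) ≠ num 0 := by
      obtain h' | h' := (h.session i w hs).data <;> simp [h'.2]
    rw [if_neg hd]
    exact refuse h
  | none =>
    obtain ⟨hn, -⟩ := h.noSession i hs
    rw [if_pos hn]
    refine sim_look ?_
    have hb : ∀ w, (t.next { t.base with
        sessions := Function.update t.base.sessions i (some w) }).birth =
          Function.update t.birth i (some t.count) := by
      intro w
      funext j
      simp only [Tracked.next]
      by_cases hj : j = i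
      · subst hj
        simp [hs]
      · simp only [Function.update_of_ne hj, ne_eq, and_not_self, if_false]
    have hfresh : t.count = C.κ → ∀ j, t.birth j ≠ some C.κ := fun hc j hj => by
      have := hrec.2 j _ hj
      omega
    cases hP : t.base.players A with
    | none =>
      rw [hP] at hv
      rw [if_pos (by simp [hv.1])]
      exact refuse h
    | some P =>
      rw [hP] at hv
      obtain ⟨P, _ | a, cor⟩ := P
      · rw [if_pos (by simp [hv.1])]
        exact refuse h
      · rw [if_neg (by simp [hv.1])]
        dsimp only
        by_cases hc : t.count = C.κ
        -- the special session
        · rw [if_pos (by rw [hc]; simp), hed, if_pos hc, Game.draw_bind, PMF.pure_bind]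
          have hel := hw.elem (S.g n ^ C.x)
          refine sim_add (h.owner (hfresh hc)) ?_ (sim_add ?_ ?_ (game_setSession ?_))
          · simp only [Data.size] at hA ⊢
            omega
          · simpa using hn
          · simp only [Data.size] at hA hi hel ⊢
            omega
          refine pure (.inl ⟨rfl, ?_⟩)
          dsimp only
          rw [hb, lookup_cons_eq, lookup_cons_eq]
          refine h.newSession hs hfresh (fun k h1 h2 => ?_) (.inl ⟨hc, by simp⟩) rfl rfl rfl
            (fun _ => ⟨rfl, rfl, by simp⟩) hA
          rw [Function.update_of_ne h1, Function.update_of_ne]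
          exact fun hk => h2 hk hc
        · rw [if_neg (by simp only [num.injEq]; omega), hed, if_neg hc]
          refine exponent fun x hx => ?_
          have hel := hw.elem (S.g n ^ x)
          refine sim_add hn ?_ (game_setSession ?_)
          · simp only [Data.size, toNat_num, Params.powD_elem] at hA hi hel ⊢
            omega
          refine pure (.inl ⟨by simp, ?_⟩)
          dsimp only
          rw [hb, lookup_cons_eq]
          refine h.newSession hs hfresh (fun k h1 _ => Function.update_of_ne h1 _ _)
            (.inr ⟨hc, by simp⟩) rfl rfl rfl (fun h => absurd h hc) hA

/-- State-reveal query against a session that is not complete, with respect to the peer `D`. -/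
theorem revealState_peer (h : Rel S n C t.birth t.base (lookup s)) (hw : C.Wide S n l) {i D : ℕ}
    (hi : (num i).size ≤ C.idSize) (hDs : (num D).size ≤ C.idSize) {w : Session (S.G n)}
    (hs : t.base.sessions i = some w) : Coupled (Out S n C t)
      (((do
        match (← get).players D with
        | none => S.refuse n
        | some P =>
            let d ← S.cd n C.pr D w.component
            S.setSession n i { w with stateExposed := true }
            S.accept n (tuple [S.elem n w.component, num w.exponent,
              S.elem n (P.pk ^ (d * w.exponent))])) : S.Game n Data) t.base)
      ((do
        let d := lookup s (cons (num 3) (num i))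
        let P ← Sim.look (cons (num 2) (num D))
        if P = num 0 then Sim.refuse
        else if d.right.right = num 0 then Sim.die C.limit
        else do
          let v ← Sim.cd n C.pr C.limit (num D) d.right.left
          let _ ← Sim.add C.limit (cons (num 6) (num i)) (num 1)
          Sim.accept (cons d.right.left (cons d.right.right.left
            (cons (S.powD n P.left (v.toNat * d.right.right.left.toNat)) (num 0))))) s) := by
  have hw' := h.session i w hs
  have hv := h.player D
  refine game_get (sim_look ?_)
  cases hP : t.base.players D with
  | none =>
    rw [hP] at hv
    rw [if_pos hv.1]
    exact refuse h
  | some P =>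
    rw [hP] at hv
    rw [if_neg (by simp [hv.1])]
    dsimp only
    by_cases hb : t.birth i = some C.κ
    -- the special session is exposed
    · rw [if_pos (by simp [hw'.special hb])]
      refine die h hw (.bind (.cd fun v st' hst _ => .setSession (.accept ?_)))
      exact .inl ⟨i, { w with stateExposed := true }, hb, fun j hj => h.unique j i hj hb,
        by simp, .inl rfl⟩
    · have hdata := hw'.ordinary hb
      rw [if_neg (by simp [hdata]), hdata, hv.1]
      simp only [left_cons, right_cons]
      refine cd h hw hDs fun v st' s' h' hst _ => game_setSession ?_
      have hs' : st'.sessions i = some w := by rw [hst.sessions, hs]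
      have hw2 := h'.session i w hs'
      have hlim := hw.limit
      have h6 : Nat.size 6 = 3 := rfl
      cases hex : w.stateExposed with
      | true =>
        rw [Sim.add_bind_of_ne (by simp [hw2.stateExposed, hex])]
        refine accept h ?_ (by simp [tuple])
        refine h'.setSession hs' (fun _ _ => rfl) (fun _ _ _ hk => hk)
          ⟨hw2.data, hw2.phase, by simp [hw2.stateExposed, hex], hw2.keyExposed⟩ rfl rfl rfl
          (fun hb' => absurd hb' hb) (h.small i w hs).2
      | false =>
        refine sim_add (by simp [hw2.stateExposed, hex]) ?_ ?_
        · simp only [Data.size] at hi ⊢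
          simp only [Nat.size_one, h6]
          omega
        refine accept h ?_ (by simp [tuple])
        rw [lookup_cons_eq]
        refine h'.setSession hs' (fun k hk => Function.update_of_ne (hk 6 (by simp)) _ _)
          (fun _ _ _ hk => hk) ⟨hw2.data, by simpa using hw2.phase, by simp,
            by simpa using hw2.keyExposed⟩ rfl rfl rfl
          (fun hb' => absurd hb' hb) (h.small i w hs).2

theorem revealState (h : Rel S n C t.birth t.base (lookup s)) (hw : C.Wide S n l) {i B : ℕ}
    (hi : (num i).size ≤ C.idSize) (hB : (num B).size ≤ C.idSize) : Coupled (Out S n C t)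
      (S.answerFrom n ed kd td C.pr β (.revealState i B) t.base)
      (Sim.revealState S n C.pr C.limit (num i) (num B) s) := by
  unfold Params.answerFrom Params.answer Sim.revealState
  refine game_get (sim_look ?_)
  cases hs : t.base.sessions i with
  | none =>
    rw [if_pos (h.noSession i hs).1]
    exact refuse h
  | some w =>
    have hw' := h.session i w hs
    have hd : lookup s (cons (num 3) (num i)) ≠ num 0 := by
      obtain h' | h' := hw'.data <;> simp [h'.2]
    rw [if_neg hd]
    refine sim_look ?_
    have hp := hw'.phase
    dsimp only
    cases hph : w.phase with
    | precomputed =>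
      rw [hph] at hp
      rw [if_pos hp.2]
      refine sim_look ?_
      rw [if_pos hp.1, Sim.pure_bind_apply]
      have haux := revealState_peer h hw hi hB hs
      rw [hph] at haux
      exact haux
    | opened A =>
      rw [hph] at hp
      rw [if_pos hp.2]
      refine sim_look ?_
      rw [if_neg (by simp [hp.1]), Sim.pure_bind_apply, hp.1, left_cons]
      have haux := revealState_peer h hw hi ((h.small i w hs).2 A hph) hs
      rw [hph] at haux
      exact haux
    | complete A Y k =>
      rw [hph] at hp
      have hr : lookup s (cons (num 8) (num i)) ≠ num 0 := by
        obtain h' | h' := hp.2 <;> simp [h'.2]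
      rw [if_neg hr]
      exact refuse h

/-- Session-key query. Keys of ordinary sessions are in the store; a query against the special
session exposes it, and the simulator gives up. -/
theorem revealKey (h : Rel S n C t.birth t.base (lookup s)) (hw : C.Wide S n l) {i : ℕ}
    (hi : (num i).size ≤ C.idSize) : Coupled (Out S n C t)
      (S.answerFrom n ed kd td C.pr β (.revealKey i) t.base)
      (Sim.revealKey C.limit (num i) s) := by
  unfold Params.answerFrom Params.answer Sim.revealKey
  refine game_get (sim_look ?_)
  cases hs : t.base.sessions i with
  | none =>
    rw [if_pos (h.noSession i hs).2.2.1]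
    exact refuse h
  | some w =>
    have hw' := h.session i w hs
    have hp := hw'.phase
    dsimp only
    unfold Session.key
    cases hph : w.phase with
    | precomputed =>
      rw [hph] at hp
      rw [if_pos hp.2]
      exact refuse h
    | opened A =>
      rw [hph] at hp
      rw [if_pos hp.2]
      exact refuse h
    | complete A Y k =>
      rw [hph] at hp
      dsimp only
      by_cases hb : t.birth i = some C.κ
      -- the special session is exposed
      · have hr := (hp.2.resolve_right fun h => h.1 hb).2
        rw [if_neg (by simp [hr]), if_pos (by simp [hr])]
        refine die h hw (.setSession (.accept ?_))
        exact .inl ⟨i, { w with keyExposed := true }, hb, fun j hj => h.unique j i hj hb,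
          by simp [hph], .inr (.inl rfl)⟩
      · have hr := (hp.2.resolve_left fun h => hb h.1).2
        rw [if_neg (by simp [hr]), if_neg (by simp [hr]), hr]
        refine game_setSession ?_
        have hlim := hw.limit
        have h9 : Nat.size 9 = 4 := rfl
        cases hex : w.keyExposed with
        | true =>
          rw [Sim.add_bind_of_ne (by simp [hw'.keyExposed, hex])]
          refine accept h ?_ (by simp)
          refine h.setSession hs (fun _ _ => rfl) (fun _ _ _ hk => hph ▸ hk)
            ⟨hw'.data, hph ▸ hw'.phase, hw'.stateExposed, by simp [hw'.keyExposed, hex]⟩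
            rfl rfl rfl (fun hb' => absurd hb' hb) (fun B hB => by simp at hB)
        | false =>
          refine sim_add (by simp [hw'.keyExposed, hex]) ?_ ?_
          · simp only [Data.size] at hi ⊢
            simp only [Nat.size_one, h9]
            omega
          refine accept h ?_ (by simp)
          rw [lookup_cons_eq]
          refine h.setSession hs (fun k hk => Function.update_of_ne (hk 9 (by simp)) _ _)
            (fun _ _ _ hk => hph ▸ hk) ⟨hw'.data, by simpa [hph] using hw'.phase,
              by simpa using hw'.stateExposed, by simp⟩ rfl rfl rfl
            (fun hb' => absurd hb' hb) (fun B hB => by simp at hB)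

/-- If the special session is tested, then the reply is `k` for both values of the challenge bit: it
is the planned session key or the planned random key. -/
theorem test (h : Rel S n C t.birth t.base (lookup s)) (hw : C.Wide S n l)
    (htd : C.β = false → td = PMF.pure C.k) {i : ℕ}
    (hi : (num i).size ≤ C.idSize) : Coupled (Out S n C t)
      (S.answerFrom n ed kd td C.pr C.β (.test i) t.base)
      (Sim.test C.limit (num C.k) (num i) s) := by
  unfold Params.answerFrom Sim.test
  refine game_get (game_get (sim_look ?_))
  have ht := h.tested
  cases hT : t.base.tested with
  | some j =>
    rw [hT] at ht
    rw [if_neg (by simp [ht])]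
    exact refuse h
  | none =>
    rw [hT, entry_none] at ht
    rw [if_pos ht]
    refine sim_look (sim_look (sim_look ?_))
    cases hs : t.base.sessions i with
    | none =>
      rw [if_pos (h.noSession i hs).2.2.1]
      exact refuse h
    | some w =>
      have hw' := h.session i w hs
      have hp := hw'.phase
      dsimp only
      cases hph : w.phase with
      | precomputed =>
        rw [hph] at hp
        rw [if_pos hp.2, Session.key, hph]
        exact refuse h
      | opened A =>
        rw [hph] at hp
        rw [if_pos hp.2, Session.key, hph]
        exact refuse h
      | complete A Y k =>
        rw [hph] at hp
        have hkey : w.key = some k := by rw [Session.key, hph]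
        have hrefl : w.Reflected ↔ w.owner = A ∧ w.component = Y := by
          unfold Session.Reflected Session.ident
          rw [hph]
          simp only [Option.some.injEq, Prod.mk.injEq]
          constructor
          · rintro ⟨A', X', rfl, rfl, rfl, rfl⟩
            exact ⟨rfl, rfl⟩
          · rintro ⟨rfl, rfl⟩
            exact ⟨_, _, rfl, rfl, rfl, rfl⟩
        have hr : lookup s (cons (num 8) (num i)) ≠ num 0 ∧
            (lookup s (cons (num 8) (num i))).left = S.elem n Y := by
          obtain h' | h' := hp.2 <;> simp [h'.2]
        have hd : (lookup s (cons (num 3) (num i))).left = num w.owner ∧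
            (lookup s (cons (num 3) (num i))).right.left = S.elem n w.component := by
          obtain h' | h' := hw'.data <;> simp [h'.2]
        rw [if_neg hr.1, hkey, hr.2, hd.1, hd.2, hp.1]
        dsimp only
        by_cases hR : w.Reflected
        · rw [if_pos hR, if_pos (by simp [(hrefl.1 hR).1]), if_pos (by rw [(hrefl.1 hR).2])]
          by_cases hb : t.birth i = some C.κ
          · rw [if_pos (by simp [hw'.special hb])]
            have hlim := hw.limit
            have h3 : Nat.size 3 = 2 := rfl
            have h0 : Nat.size 0 = 0 := rfl
            refine sim_add ht ?_ ?_
            · simp only [Data.size] at hi ⊢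
              omega
            rw [modify_bind, Game.draw_bind]
            have hk : ∀ k' ∈ td.support, (if C.β = true then k else k') = C.k := by
              intro k' hk'
              cases hβ : C.β with
              | true => simp [((h.special i w hs hb).2.2.2 A Y k hph).2.2.1 hβ]
              | false =>
                rw [htd hβ] at hk'
                simpa using hk'
            refine bind_left fun k' hk' => accept h ?_ (by rw [hk k' hk'])
            rw [lookup_cons_eq]
            exact h.setTested hT hb
          -- some other session is tested, and there is no second test query
          · rw [if_neg (by simp [hw'.ordinary hb])]
            refine die h hw (.modify (.bind (.draw fun k' => .accept ?_)))
            cases hc : t.birth i with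
            | none =>
              rw [(h.recorded i).2 hc] at hs
              simp at hs
            | some c => exact .inr ⟨i, c, rfl, hc, fun h => hb (h ▸ hc)⟩
        · rw [if_neg hR]
          by_cases h1 : w.owner = A
          · rw [if_pos (by simp [h1]), if_neg fun h2 => hR (hrefl.2 ⟨h1, by simpa using h2⟩)]
            exact refuse h
          · rw [if_neg (by simpa using h1)]
            exact refuse h

end Coupled

end OAKE

end

noncomputable section

namespace OAKE

open Data Game

variable {S : Params} {n : ℕ}

namespace Coupled

variable {C : Plan} {t : Tracked (S.G n)} {s : Data} {l : ℕ} {ed : PMF ℕ} {kd : ℕ → PMF ℕ}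
  {td : PMF ℕ} {β : Bool}

theorem not_spentAt (h : Rel S n C t.birth t.base (lookup s)) {i : ℕ} {w : Session (S.G n)}
    (hs : t.base.sessions i = some w) (hb : t.birth i = some C.κ)
    (hw : ∀ B Y k, w.phase ≠ .complete B Y k) : ¬ SpentAt C.κ t.birth t.base := by
  rintro ⟨j, w', B, Y, k, h1, h2, h3⟩
  obtain rfl := h.unique i j hb h1
  rw [hs] at h2
  obtain rfl := Option.some.inj h2
  exact hw _ _ _ h3

/-- The relation after the special session has been completed. -/
theorem _root_.OAKE.Rel.completeSpecial {birth : ℕ → Option ℕ} {st : GameState (S.G n)} {s' : Data}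
    (h : Rel S n C birth st (lookup s)) {i : ℕ} {w : Session (S.G n)}
    (hs : st.sessions i = some w) (hb : birth i = some C.κ)
    (hw : w.phase = .precomputed ∨ w.phase = .opened w.owner) {Z : Data}
    (hZ : Target S n C.pr C.x (lookup s) Z)
    {k : ℕ} (hk : C.β = true → k = C.k)
    (hf : ∀ k, (∀ j ∈ [6, 7, 8, 9], k ≠ cons (num j) (num i)) → lookup s' k = lookup s k)
    (h6 : lookup s' (cons (num 6) (num i)) = lookup s (cons (num 6) (num i)))
    (h7 : lookup s' (cons (num 7) (num i)) = cons (num w.owner) (num 0))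
    (h8 : lookup s' (cons (num 8) (num i)) = cons (S.elem n (S.g n ^ C.x)) (num 0))
    (h9 : lookup s' (cons (num 9) (num i)) = lookup s (cons (num 9) (num i))) :
    Rel S n C birth { st with
      keyTable := Function.update st.keyTable Z (some k),
      sessions := Function.update st.sessions i
        (some { w with phase := .complete w.owner (S.g n ^ C.x) k }) } (lookup s') := by
  have hw' := h.session i w hs
  have hcompl : ∀ B Y k, w.phase ≠ .complete B Y k := by
    intro B Y k hph
    rw [hph] at hw
    simp at hw
  have h1 : Rel S n C birth { st with
      sessions := Function.update st.sessions i
        (some { w with phase := .complete w.owner (S.g n ^ C.x) k }) } (lookup s') := by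
    refine h.setSession hs hf (fun B Y k' hp => absurd hp (hcompl B Y k')) ⟨hw'.data, ?_, ?_, ?_⟩
      rfl rfl rfl (fun _ B Y k' hp => ?_) (fun B hp => by simp at hp)
    · exact ⟨h7, .inl ⟨hb, h8⟩⟩
    · rw [h6]
      exact hw'.stateExposed
    · rw [h9]
      exact hw'.keyExposed
    · simp only [Phase.complete.injEq] at hp
      obtain ⟨rfl, rfl, rfl⟩ := hp
      exact ⟨rfl, rfl, hk, Z, hZ⟩
  refine h1.setHidden ⟨i, _, _, _, _, hb, by simp; rfl, rfl⟩ (hZ.mono fun k' hk' => ?_) k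
  have h3 : ∀ j ∈ [6, 7, 8, 9], lookup s (cons (num j) (num i)) ≠ num 0 →
      lookup s' (cons (num j) (num i)) = lookup s (cons (num j) (num i)) := by
    have hp := hw'.phase
    intro j hj hne
    simp only [List.mem_cons, List.not_mem_nil, or_false] at hj
    obtain rfl | rfl | rfl | rfl := hj
    · exact h6
    · obtain hph | hph := hw
      · rw [hph] at hp
        exact absurd hp.1 hne
      · rw [hph] at hp
        rw [h7, hp.1]
    · obtain hph | hph := hw <;>
      · rw [hph] at hp
        exact absurd hp.2 hne
    · exact h9
  by_cases hj : ∃ j ∈ [6, 7, 8, 9], k' = cons (num j) (num i)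
  · obtain ⟨j, hj, rfl⟩ := hj
    exact h3 j hj hk'
  · exact hf k' fun j hj' he => hj ⟨j, hj', he⟩

/-- Activation as responder. An ordinary session gets its key from the simulator as in the
experiment. For the special session, the key is missing if the session has the form `(A, A, X, X)`,
and the simulator gives up otherwise. -/
theorem respond (h : Rel S n C t.birth t.base (lookup s)) (hw : C.Wide S n l)
    (hinv : Inv S n C.pr t.base) (hkd : ∀ i, t.birth i ≠ some C.κ → kd i = S.keyDist n)
    (hkd' : ∀ i, t.birth i = some C.κ → ¬ SpentAt C.κ t.birth t.base → C.β = true →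
      kd i = PMF.pure C.k)
    {i B m : ℕ} (hi : (num i).size ≤ C.idSize) (hB : (num B).size ≤ C.idSize) :
    Coupled (Out S n C t)
      (S.answerFrom n ed kd td C.pr β (.respond i B m) t.base)
      (Sim.respond S n C.pr C.limit (S.elem n (S.g n ^ C.x)) (num i) (num B) (num m) s) := by
  have hlim := hw.limit
  have h0 : Nat.size 0 = 0 := rfl
  have h7 : Nat.size 7 = 3 := rfl
  have h8 : Nat.size 8 = 4 := rfl
  have hv := h.player B
  unfold Params.answerFrom Sim.respond
  refine game_get (game_get (sim_look ?_))
  cases hs : t.base.sessions i with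
  | none =>
    rw [if_pos (h.noSession i hs).1]
    exact refuse h
  | some w =>
    have hw' := h.session i w hs
    have hd : lookup s (cons (num 3) (num i)) ≠ num 0 := by
      obtain h' | h' := hw'.data <;> simp [h'.2]
    rw [if_neg hd]
    refine sim_look ?_
    cases hP : t.base.players B with
    | none =>
      rw [hP] at hv
      rw [if_pos hv.1]
      exact refuse h
    | some P =>
      rw [hP] at hv
      rw [if_neg (by simp [hv.1])]
      cases hX : S.decode n m with
      | none =>
        rw [Sim.ifValid_none hX]
        exact refuse h
      | some X =>
        obtain ⟨hm, hV⟩ := Sim.ifValid_some hX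
        rw [hV, hm]
        have hel := hw.elem X
        dsimp only
        refine game_get (sim_look ?_)
        have hp := hw'.phase
        cases hph : w.phase with
        | opened A =>
          rw [hph] at hp
          rw [if_neg (by simp [hp.1])]
          exact refuse h
        | complete A Y k =>
          rw [hph] at hp
          rw [if_neg (by simp [hp.1])]
          exact refuse h
        | precomputed =>
          rw [hph] at hp
          rw [if_pos hp.1]
          refine sim_look ?_
          have hdl : (lookup s (cons (num 3) (num i))).left = num w.owner := by
            obtain h' | h' := hw'.data <;> simp [h'.2]
          rw [hdl]
          have hvo := h.player w.owner
          have hwo := (h.small i w hs).1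
          cases hO : t.base.players w.owner with
          | none =>
            rw [hO] at hvo
            rw [if_pos (by simp [hvo.1])]
            exact refuse h
          | some Q =>
            rw [hO] at hvo
            obtain ⟨Q, _ | b, cor⟩ := Q
            · rw [if_pos (by simp [hvo.1])]
              exact refuse h
            rw [if_neg (by simp [hvo.1])]
            dsimp only
            by_cases hb : t.birth i = some C.κ
            · have hdata := hw'.special hb
              rw [if_pos (by simp [hdata])]
              have hdie : ¬ (B = w.owner ∧ X = w.component) → Coupled (Out S n C t)
                  ((S.responderKeyFrom n (kd i) C.pr B w.owner b w.exponent P.pk X >>= fun k =>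
                    S.setSession n i { w with phase := .complete B X k } >>= fun _ =>
                      S.accept n (S.elem n w.component)) t.base) (Sim.die C.limit s) := by
                intro hne
                refine die h hw (.bind (.responderKeyFrom fun k st' _ _ _ hst _ _ _ _ =>
                  .setSession (.accept ?_)))
                exact .inl ⟨i, { w with phase := .complete B X k }, hb,
                  fun j hj => h.unique j i hj hb, by simp, .inr (.inr ⟨_, _, _, rfl, hne⟩)⟩
              obtain ⟨hx, hcomp, -⟩ := h.special i w hs hb
              by_cases h1 : w.owner = B
              · rw [if_pos (by rw [h1])]
                by_cases h2 : X = S.g n ^ C.x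
                -- the session has the form `(A, A, X, X)`, and its key stays hidden
                · rw [if_pos (by rw [h2])]
                  subst h1 h2
                  rw [hP] at hO
                  obtain rfl := Option.some.inj hO
                  have hpk := hinv.pk _ _ _ hP rfl
                  have hspent := not_spentAt h hs hb (by simp [hph])
                  dsimp only at hpk ⊢
                  subst hpk
                  have hkey : S.responderKeyFrom n (kd i) C.pr w.owner w.owner b w.exponent
                      (S.g n ^ b) (S.g n ^ C.x) = S.responderKeyFrom n (kd i) C.pr w.owner w.owner b
                      C.x (S.g n ^ b) (S.g n ^ C.x) := by rw [hx]
                  rw [hkey]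
                  refine reflectedKey (R := Out S n C t) h hw hwo hspent ⟨i, w, hs, hb, rfl⟩
                    ⟨_, hP, rfl⟩ (z := fun c d e => S.elem n ((S.g n ^ b) ^ (c * C.x) *
                      (S.g n ^ C.x) ^ (d * b + e * C.x))) (fun c e => ?_)
                    (hkd' i hb hspent) (fun _ _ hb => .inr (.inl hb)) (fun _ => .mono (.bind
                      (.add (by simp) _) fun _ => .bind (.add (by simp) _) fun _ =>
                        .pure (j := 0) _) (by omega)) fun k st' s' _ Z h' hst hZ hk => ?_
                  · rw [← pow_mul, ← pow_mul, ← pow_add]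
                    congr 2
                    ring
                  · rw [← hst.sessions] at hs
                    have hp' := (h'.session i w hs).phase
                    rw [hph] at hp'
                    refine sim_add hp'.1 ?_ (sim_add (by simpa using hp'.2) ?_ (game_setSession ?_))
                    · simp only [Data.size] at hi hB ⊢
                      omega
                    · simp only [Data.size] at hi hel ⊢
                      omega
                    refine accept h (h'.completeSpecial hs hb (.inl hph) hZ hk (fun k' hk' => ?_)
                      ?_ ?_ ?_ ?_) (by simp [hdata])
                    · rw [lookup_cons_eq, lookup_cons_eq,
                        Function.update_of_ne (hk' 8 (by simp)),
                        Function.update_of_ne (hk' 7 (by simp))]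
                    all_goals simp
                -- the special session cannot become a test session
                · rw [if_neg (by simpa using h2)]
                  exact hdie fun h' => h2 (h'.2.trans hcomp)
              · rw [if_neg (by simpa using h1)]
                exact hdie fun h' => h1 h'.1.symm
            -- the simulator knows the exponent and computes the key
            · have hdata := hw'.ordinary hb
              have hcomp := hinv.component i w hs
              rw [if_neg (by simp [hdata]), hdata, hkd i hb, hv.1, hvo.1, hcomp]
              simp only [left_cons, right_cons, entry_some]
              refine responderKey h hw hB hwo (fun _ _ hb => .inr (.inl hb)) (fun _ => .mono (.bind
                (.add (by simp) _) fun _ => .bind (.add (by simp) _) fun _ => .pure (j := 0) _)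
                (by omega)) fun k st' s' h' hst hk => ?_
              have hk := Nat.size_le.2 hk
              have hkl := hw.keyLen
              rw [← hst.sessions] at hs
              have hw2 := h'.session i w hs
              have hp' := hw2.phase
              rw [hph] at hp'
              refine sim_add hp'.1 ?_ (sim_add (by simpa using hp'.2) ?_ (game_setSession ?_))
              · simp only [Data.size] at hi hB ⊢
                omega
              · simp only [Data.size] at hi hel ⊢
                omega
              refine accept h ?_ rfl
              rw [lookup_cons_eq, lookup_cons_eq]
              refine h'.setSession hs (fun k' hk' => ?_) (by simp [hph])
                ⟨by simpa only [← hcomp] using hw2.data, ⟨by simp, .inr ⟨hb, by simp⟩⟩,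
                  by simpa using hw2.stateExposed, by simpa using hw2.keyExposed⟩
                rfl rfl hcomp.symm (fun hb' => absurd hb' hb) (fun B hB => by simp at hB)
              rw [Function.update_of_ne (hk' 8 (by simp)), Function.update_of_ne (hk' 7 (by simp))]

/-- Completion as initiator, with the same three cases as for responders. -/
theorem complete (h : Rel S n C t.birth t.base (lookup s)) (hw : C.Wide S n l)
    (hinv : Inv S n C.pr t.base) (hkd : ∀ i, t.birth i ≠ some C.κ → kd i = S.keyDist n)
    (hkd' : ∀ i, t.birth i = some C.κ → ¬ SpentAt C.κ t.birth t.base → C.β = true →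
      kd i = PMF.pure C.k)
    {i m : ℕ} (hi : (num i).size ≤ C.idSize) :
    Coupled (Out S n C t)
      (S.answerFrom n ed kd td C.pr β (.complete i m) t.base)
      (Sim.complete S n C.pr C.limit (S.elem n (S.g n ^ C.x)) (num i) (num m) s) := by
  have hlim := hw.limit
  have h0 : Nat.size 0 = 0 := rfl
  have h8 : Nat.size 8 = 4 := rfl
  unfold Params.answerFrom Sim.complete
  refine game_get (sim_look ?_)
  cases hs : t.base.sessions i with
  | none =>
    rw [if_pos (h.noSession i hs).1]
    exact refuse h
  | some w =>
    have hw' := h.session i w hs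
    have hd : lookup s (cons (num 3) (num i)) ≠ num 0 := by
      obtain h' | h' := hw'.data <;> simp [h'.2]
    rw [if_neg hd]
    cases hX : S.decode n m with
    | none =>
      rw [Sim.ifValid_none hX]
      exact refuse h
    | some X =>
      obtain ⟨hm, hV⟩ := Sim.ifValid_some hX
      rw [hV, hm]
      have hel := hw.elem X
      dsimp only
      refine sim_look ?_
      have hp := hw'.phase
      cases hph : w.phase with
      | precomputed =>
        rw [hph] at hp
        rw [if_pos hp.1]
        exact refuse h
      | complete A Y k =>
        rw [hph] at hp
        have hr : lookup s (cons (num 8) (num i)) ≠ num 0 := by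
          obtain h' | h' := hp.2 <;> simp [h'.2]
        rw [if_neg (by simp [hp.1])]
        refine sim_look ?_
        rw [if_neg hr]
        exact refuse h
      | opened B =>
        rw [hph] at hp
        have hB := (h.small i w hs).2 B hph
        have hv := h.player B
        rw [if_neg (by simp [hp.1])]
        refine sim_look ?_
        rw [if_pos hp.2, hp.1, left_cons]
        dsimp only
        refine game_get (game_get (sim_look ?_))
        cases hP : t.base.players B with
        | none =>
          rw [hP] at hv
          rw [if_pos hv.1]
          exact refuse h
        | some P =>
          rw [hP] at hv
          rw [if_neg (by simp [hv.1])]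
          refine sim_look ?_
          have hdl : (lookup s (cons (num 3) (num i))).left = num w.owner := by
            obtain h' | h' := hw'.data <;> simp [h'.2]
          rw [hdl]
          have hvo := h.player w.owner
          have hwo := (h.small i w hs).1
          cases hO : t.base.players w.owner with
          | none =>
            rw [hO] at hvo
            rw [if_pos (by simp [hvo.1])]
            exact refuse h
          | some Q =>
            rw [hO] at hvo
            obtain ⟨Q, _ | b, cor⟩ := Q
            · rw [if_pos (by simp [hvo.1])]
              exact refuse h
            rw [if_neg (by simp [hvo.1])]
            dsimp only
            by_cases hb : t.birth i = some C.κ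
            · have hdata := hw'.special hb
              rw [if_pos (by simp [hdata])]
              have hdie : ¬ (B = w.owner ∧ X = w.component) → Coupled (Out S n C t)
                  ((S.initiatorKeyFrom n (kd i) C.pr w.owner B b w.exponent P.pk X >>= fun k =>
                    S.setSession n i { w with phase := .complete B X k } >>= fun _ =>
                      S.accept n (num 0)) t.base) (Sim.die C.limit s) := by
                intro hne
                refine die h hw (.bind (.initiatorKeyFrom fun k st' _ _ _ hst _ _ _ _ =>
                  .setSession (.accept ?_)))
                exact .inl ⟨i, { w with phase := .complete B X k }, hb,
                  fun j hj => h.unique j i hj hb, by simp, .inr (.inr ⟨_, _, _, rfl, hne⟩)⟩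
              obtain ⟨hx, hcomp, -⟩ := h.special i w hs hb
              by_cases h1 : w.owner = B
              · rw [if_pos (by rw [h1])]
                by_cases h2 : X = S.g n ^ C.x
                -- the session has the form `(A, A, X, X)`, and its key stays hidden
                · rw [if_pos (by rw [h2])]
                  subst h1 h2
                  rw [hP] at hO
                  obtain rfl := Option.some.inj hO
                  have hpk := hinv.pk _ _ _ hP rfl
                  have hspent := not_spentAt h hs hb (by simp [hph])
                  dsimp only at hpk ⊢
                  subst hpk
                  have hkey : S.initiatorKeyFrom n (kd i) C.pr w.owner w.owner b w.exponent
                      (S.g n ^ b) (S.g n ^ C.x) = S.initiatorKeyFrom n (kd i) C.pr w.owner w.owner b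
                      C.x (S.g n ^ b) (S.g n ^ C.x) := by rw [hx]
                  rw [hkey]
                  refine reflectedKey (R := Out S n C t) h hw hwo hspent ⟨i, w, hs, hb, rfl⟩
                    ⟨_, hP, rfl⟩ (z := fun c d e => S.elem n ((S.g n ^ b) ^ (d * C.x) *
                      (S.g n ^ C.x) ^ (c * b + e * C.x))) (fun c e => ?_)
                    (hkd' i hb hspent) (fun _ _ hb => .inr (.inl hb)) (fun _ => .mono (.bind
                      (.add (by simp) _) fun _ => .pure (j := 0) _)
                      (by omega)) fun k st' s' _ Z h' hst hZ hk => ?_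
                  · rw [← pow_mul, ← pow_mul, ← pow_add]
                    congr 2
                    ring
                  · rw [← hst.sessions] at hs
                    have hp' := (h'.session i w hs).phase
                    rw [hph] at hp'
                    refine sim_add hp'.2 ?_ (game_setSession ?_)
                    · simp only [Data.size] at hi hel ⊢
                      omega
                    refine accept h (h'.completeSpecial hs hb (.inr hph) hZ hk (fun k' hk' => ?_)
                      ?_ ?_ ?_ ?_) rfl
                    · rw [lookup_cons_eq, Function.update_of_ne (hk' 8 (by simp))]
                    all_goals simp [hp'.1]
                -- the special session cannot become a test session
                · rw [if_neg (by simpa using h2)]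
                  exact hdie fun h' => h2 (h'.2.trans hcomp)
              · rw [if_neg (by simpa using h1)]
                exact hdie fun h' => h1 h'.1.symm
            -- the simulator knows the exponent and computes the key
            · have hdata := hw'.ordinary hb
              have hcomp := hinv.component i w hs
              rw [if_neg (by simp [hdata]), hdata, hkd i hb, hv.1, hvo.1, hcomp]
              simp only [left_cons, right_cons, entry_some]
              refine initiatorKey h hw hwo hB (fun _ _ hb => .inr (.inl hb)) (fun _ => .mono (.bind
                (.add (by simp) _) fun _ => .pure (j := 0) _)
                (by omega)) fun k st' s' h' hst hk => ?_
              have hk := Nat.size_le.2 hk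
              have hkl := hw.keyLen
              rw [← hst.sessions] at hs
              have hw2 := h'.session i w hs
              have hp' := hw2.phase
              rw [hph] at hp'
              refine sim_add hp'.2 ?_ (game_setSession ?_)
              · simp only [Data.size] at hi hel ⊢
                omega
              refine accept h ?_ rfl
              rw [lookup_cons_eq]
              refine h'.setSession hs (fun k' hk' => Function.update_of_ne (hk' 8 (by simp)) _ _)
                (by simp [hph])
                ⟨by simpa only [← hcomp] using hw2.data, ⟨by simp [hp'.1], .inr ⟨hb, by simp⟩⟩,
                  by simpa using hw2.stateExposed, by simpa using hw2.keyExposed⟩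
                rfl rfl hcomp.symm (fun hb' => absurd hb' hb) (fun B hB => by simp at hB)

/-- The simulator reacts like the experiment. The query that creates the special session is the one
with `t.count = κ`, for which the countdown `κ + 1 - t.count` of the simulator is `1`. -/
theorem answer (h : Rel S n C t.birth t.base (lookup s)) (hw : C.Wide S n l)
    (hrec : t.Recorded) (hinv : Inv S n C.pr t.base) {d : Data} (hd : d.size ≤ C.idSize) :
    Coupled (fun r r' => Out S n C t (r.1, r.2.base) r' ∧ r.2 = t.next r.2.base)
      (S.planned n C.κ C.pr C.β C.x C.k d t)
      (Sim.answer S n C.pr C.limit (S.elem n (S.g n ^ C.x)) (num C.k)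
        (num (C.κ + 1 - t.count)) d s) := by
  have hkd : ∀ i, t.birth i ≠ some C.κ →
      S.keySource n C.κ (if C.β then PMF.pure C.k else S.keyDist n) t i = S.keyDist n :=
    fun i hi => if_neg fun h => hi h.1
  have hkd' : ∀ i, t.birth i = some C.κ → ¬ SpentAt C.κ t.birth t.base → C.β = true →
      S.keySource n C.κ (if C.β then PMF.pure C.k else S.keyDist n) t i = PMF.pure C.k :=
    fun i hi hs hβ => (if_pos ⟨hi, hs⟩).trans (if_pos hβ)
  have htd : C.β = false → (if C.β then S.keyDist n else PMF.pure C.k) = PMF.pure C.k :=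
    fun hβ => by rw [hβ, if_neg (by simp)]
  unfold Params.planned Params.tracked
  cases hq : Query.ofData d with
  | none =>
    have hne : ∀ d', Query.ofData d' ≠ none → d ≠ d' := by
      rintro d' hd' rfl
      exact hd' hq
    unfold Sim.answer
    iterate 12 rw [if_neg (hne _ (by simp [Query.ofData]))]
    apply pure
    refine ⟨.inl ⟨rfl, ?_⟩, rfl⟩
    change Rel S n C (t.next t.base).birth t.base _
    rw [Tracked.next_birth_eq h.recorded h.recorded]
    exact h
  | some Q =>
    dsimp only
    suffices H : Coupled (Out S n C t) (S.answerFrom n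
        (if t.count = C.κ then PMF.pure C.x else S.exponent n)
        (S.keySource n C.κ (if C.β then PMF.pure C.k else S.keyDist n) t)
        (if C.β then S.keyDist n else PMF.pure C.k) C.pr C.β Q t.base)
        (Sim.answer S n C.pr C.limit (S.elem n (S.g n ^ C.x)) (num C.k)
          (num (C.κ + 1 - t.count)) d s) by
      have := map (f := fun r : Data × GameState (S.G n) => (r.1, t.next r.2))
        (g := id) (R := fun r r' => Out S n C t (r.1, r.2.base) r' ∧
          r.2 = t.next r.2.base) (H.mono fun a b hab => ⟨hab, rfl⟩)
      rwa [PMF.map_id] at this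
    unfold Query.ofData at hq
    split at hq
    all_goals cases hq
    · rename_i d
      have hans : Sim.answer S n C.pr C.limit (S.elem n (S.g n ^ C.x)) (num C.k)
          (num (C.κ + 1 - t.count)) (cons (num 0) d) =
          (Sim.hash n C.limit d >>= fun v => Sim.accept v) := if_pos rfl
      rw [size_cons] at hd
      rw [hans]
      exact hashQuery h hw (by omega)
    all_goals
      unfold Sim.answer
      simp only [size_cons] at hd
      simp only [right_cons, left_cons, toNat_num, eq_self, cons.injEq, num.injEq, if_true,
        true_and, OfNat.ofNat_ne_zero, OfNat.ofNat_ne_one, Nat.reduceEqDiff,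
        false_and, if_false, one_ne_zero]
    · refine keyHashQuery h hw ?_
      omega
    · exact newPlayer h hw (by omega)
    · exact register h hw (by omega)
    · exact corrupt h hw (by omega)
    · exact precompute h hw hrec rfl (by omega) (by omega)
    · exact revealState h hw (by omega) (by omega)
    · exact revealKey h hw (by omega)
    · exact initiate h hw (by omega) (by omega)
    · exact respond h hw hinv hkd hkd' (by omega) (by omega)
    · exact complete h hw hinv hkd hkd' (by omega)
    · exact test h hw htd (by omega)

end Coupled

end OAKE

end

noncomputable section

namespace OAKE

open Data Game

variable {S : Params} {n : ℕ}

/-! ### Corresponding runs -/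

theorem Doomed.next {κ : ℕ} {t : Tracked (S.G n)} {st : GameState (S.G n)} (hrec : t.Recorded)
    (h : ∀ i, t.base.sessions i = none ↔ t.birth i = none) (hd : Doomed κ t.birth st) :
    Doomed κ (t.next st).birth st := by
  have hb : ∀ i c, t.birth i = some c → (t.next st).birth i = some c := by
    intro i c hi
    simp only [Tracked.next]
    rw [if_neg, hi]
    rintro ⟨h1, -⟩
    rw [(h i).1 h1] at hi
    simp at hi
  obtain ⟨i, s, h1, hu, h2⟩ | ⟨i, κ', h1, h2, h3⟩ := hd
  · refine .inl ⟨i, s, hb _ _ h1, fun j hj => hu j ?_, h2⟩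
    simp only [Tracked.next] at hj
    split_ifs at hj
    · simp only [Option.some.injEq] at hj
      have := hrec.2 i κ h1
      omega
    · exact hj
  · exact .inr ⟨i, κ', h1, hb _ _ h2, h3⟩

theorem Doomed.evolves {κ : ℕ} {birth : ℕ → Option ℕ} {st st' : GameState (S.G n)}
    (h : Evolves st st') (hd : Doomed κ birth st) : Doomed κ birth st' := by
  obtain ⟨i, s, h1, hu, h2, h3⟩ | ⟨i, κ', h1, h2⟩ := hd
  · obtain ⟨s', hs', hev⟩ := h.sessions i s h2
    refine .inl ⟨i, s', h1, hu, hs', h3.imp hev.stateExposed fun h3 => h3.imp hev.keyExposed ?_⟩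
    rintro ⟨B, Y, k, h4, h5⟩
    exact ⟨B, Y, k, hev.complete _ _ _ h4, by rwa [hev.owner, hev.component]⟩
  · exact .inr ⟨i, κ', h.tested i h1, h2⟩

theorem Tracked.next_none_iff {t : Tracked (S.G n)} {st : GameState (S.G n)}
    (h : ∀ i, t.base.sessions i = none ↔ t.birth i = none) (hst : Evolves t.base st) (i : ℕ) :
    (t.next st).base.sessions i = none ↔ (t.next st).birth i = none := by
  simp only [Tracked.next]
  by_cases hi : t.base.sessions i = none
  · by_cases hi' : st.sessions i = none
    · simp [hi', (h i).1 hi]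
    · simp [hi, hi']
  · obtain ⟨s, hs⟩ := Option.ne_none_iff_exists'.1 hi
    obtain ⟨s', hs', -⟩ := hst.sessions i s hs
    simp [hi, hs', ← h i]

/-- The relation between the experiment and the simulator as long as they agree. -/
def Sync (S : Params) (n : ℕ) (C : Plan) (t : Tracked (S.G n)) (z : Data) : Prop :=
  ∃ s, z = cons (S.elem n (S.g n ^ C.x)) (cons (num C.k) (cons (num (C.κ + 1 - t.count)) s)) ∧
    Rel S n C t.birth t.base (lookup s) ∧ t.Recorded ∧ Inv S n C.pr t.base

/-- The store in a state of the simulator. -/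
def store (z : Data) : Data := z.right.right.right

/-- The relation between the experiment and the simulator when they need not agree any more. -/
def Broken (S : Params) (n : ℕ) (C : Plan) (t : Tracked (S.G n)) (z : Data) : Prop :=
  Bad S n C.pr C.x (store z) ∨
    (t.Recorded ∧ Inv S n C.pr t.base ∧ (∀ i, t.base.sessions i = none ↔ t.birth i = none) ∧
      Doomed C.κ t.birth t.base ∧ lookup (store z) (num 4) ≠ num 0)

theorem Sim.env_extends {pr : Protocol} {m : ℕ} {d z : Data} :
    ∀ r ∈ (env S n pr m d z).support, ∀ k, lookup (store z) k ≠ num 0 →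
      lookup (store r.2) k = lookup (store z) k := by
  intro r hr
  obtain ⟨t, ht, rfl⟩ := (PMF.mem_support_map_iff _ _ _).1 hr
  exact ((Tame.answer (S := S) (n := n) (pr := pr) (m := m) z.left z.right.left
    z.right.right.left d z.right.right.right).1 t ht).2

theorem Sync.init (C : Plan) : Sync S n C (.init (S.G n))
    (cons (S.elem n (S.g n ^ C.x)) (cons (num C.k) (cons (num (C.κ + 1)) (num 0)))) := by
  refine ⟨num 0, rfl, ?_, ⟨?_, ?_⟩, .init _⟩
  · constructor <;> simp [Tracked.init, GameState.init, PlayerView]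
  · simp [Tracked.init, GameState.init]
  · simp [Tracked.init]

/-- A run of the adversary in the experiment, and the same run in the simulation. -/
theorem Coupled.attack {C : Plan} {l : ℕ} (hw : C.Wide S n l) (c : Code) (x : Data) {b : ℕ}
    (hb : b ≤ C.idSize) : Coupled (fun r r' => (r.1 = r'.1 ∧ Sync S n C r.2 r'.2) ∨
        Broken S n C r.2 r'.2)
      ((c.eval x b).run (S.planned n C.κ C.pr C.β C.x C.k) (.init (S.G n)))
      ((c.eval x b).run (Sim.env S n C.pr C.limit)
        (cons (S.elem n (S.g n ^ C.x)) (cons (num C.k) (cons (num (C.κ + 1)) (num 0))))) := by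
  refine Coupled.run ?_ ?_ ?_ (Code.budget_lt c x b) hb (Sync.init C)
  · rintro d hd t z ⟨s, rfl, hrel, hrec, hinv⟩
    have h := Coupled.map (f := id) (g := fun r : Data × Data => (r.1,
      cons (S.elem n (S.g n ^ C.x)) (cons (num C.k) (cons (num (C.κ + 1 - t.count - 1)) r.2))))
      (R := fun r r' => (r.1 = r'.1 ∧ Sync S n C r.2 r'.2) ∨ Broken S n C r.2 r'.2)
      (μ := S.planned n C.κ C.pr C.β C.x C.k d t) (ν := Sim.answer S n C.pr C.limit
        (S.elem n (S.g n ^ C.x)) (num C.k) (num (C.κ + 1 - t.count)) d s) ?_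
    · rwa [PMF.map_id] at h
    have hsup : ∀ r ∈ (S.planned n C.κ C.pr C.β C.x C.k d t).support,
        Inv S n C.pr r.2.base ∧ Evolves t.base r.2.base ∧ r.2.Recorded := fun r hr =>
      ⟨(tracked_evolves d hinv r hr).1, (tracked_evolves d hinv r hr).2.1,
        (tracked_recorded d hrec r hr).1⟩
    obtain ⟨ρ, h1, h2, h3⟩ := Coupled.answer hrel hw hrec hinv hd
    refine ⟨ρ, h1, h2, fun p hp => ?_⟩
    obtain ⟨hout, hnext⟩ := h3 p hp
    obtain ⟨hi, hev, hr⟩ := hsup p.1 (by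
      rw [← h1]
      exact (PMF.mem_support_map_iff _ _ _).2 ⟨p, hp, rfl⟩)
    obtain ⟨h4, h5⟩ | h4 | ⟨h4, h5⟩ := hout
    · refine .inl ⟨h4, p.2.2, ?_, ?_, hr, hi⟩
      · dsimp only [id]
        rw [hnext, Nat.sub_sub]
        rfl
      · dsimp only [id]
        rw [hnext]
        exact h5
    · exact .inr (.inl h4)
    · refine .inr (.inr ⟨hr, hi, ?_, ?_, h5⟩)
      · dsimp only [id]
        rw [hnext]
        exact Tracked.next_none_iff hrel.recorded hev
      · dsimp only [id]
        rw [hnext]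
        exact h4.next hrec hrel.recorded
  · rintro d t z (h | ⟨hrec, hinv, hnone, hd, hz⟩) r hr
    · exact .inl h
    · obtain ⟨h1, h2, h3⟩ := tracked_evolves d hinv r hr
      refine .inr ⟨(tracked_recorded d hrec r hr).1, h1, ?_, ?_, hz⟩
      · rw [h3]
        exact Tracked.next_none_iff hnone h2
      · rw [h3]
        exact (hd.evolves h2).next hrec hnone
  · rintro d t z (h | ⟨hrec, hinv, hnone, hd, hz⟩) r hr
    · exact .inl (h.mono (Sim.env_extends r hr))
    · exact .inr ⟨hrec, hinv, hnone, hd, by rwa [Sim.env_extends r hr _ hz]⟩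

/-! ### Unexposed test sessions in the simulation -/

/-- Two sessions with the same view have the same owner, identifier and exposure, whatever their
DH-exponents and keys are. -/
theorem SessionView.agree {p p' : Prop} {w w' : Session (S.G n)} {d a r e e' : Data}
    (h : SessionView S n p w d a r e e') (h' : SessionView S n p' w' d a r e e') :
    w.owner = w'.owner ∧ w.ident = w'.ident ∧ w.stateExposed = w'.stateExposed ∧
      w.keyExposed = w'.keyExposed := by
  have hflag : ∀ b b', flag b = flag b' → b = b' := by
    rintro (_ | _) (_ | _) h <;> simp at h ⊢
  have hd : w.owner = w'.owner ∧ w.component = w'.component := by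
    obtain ⟨-, h1⟩ | ⟨-, h1⟩ := h.data <;> obtain ⟨-, h2⟩ | ⟨-, h2⟩ := h'.data <;>
    · rw [h1] at h2
      simp only [cons.injEq, num.injEq, Params.elem_inj] at h2
      exact ⟨h2.1, h2.2.1⟩
  refine ⟨hd.1, ?_, hflag _ _ (h.stateExposed.symm.trans h'.stateExposed),
    hflag _ _ (h.keyExposed.symm.trans h'.keyExposed)⟩
  have h1 := h.phase
  have h2 := h'.phase
  unfold Session.ident
  rw [← hd.1, ← hd.2]
  cases hp : w.phase <;> cases hp' : w'.phase <;> rw [hp] at h1 <;> rw [hp'] at h2 <;> try rfl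
  · obtain h3 | h3 := h2.2 <;> simp [h1.2] at h3
  · obtain h3 | h3 := h2.2 <;> simp [h1.2] at h3
  · obtain h3 | h3 := h1.2 <;> simp [h2.2] at h3
  · obtain h3 | h3 := h1.2 <;> simp [h2.2] at h3
  · have h3 := h1.1.symm.trans h2.1
    simp only [cons.injEq, num.injEq, and_true] at h3
    have h4 : ∀ {q : Prop} {Y : S.G n} {k : ℕ}, ((q ∧ r = cons (S.elem n Y) (num 0)) ∨
        ¬ q ∧ r = cons (S.elem n Y) (cons (num k) (num 0))) → r.left = S.elem n Y := by
      rintro q Y k (⟨-, rfl⟩ | ⟨-, rfl⟩) <;> rfl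
    have h5 := (h4 h1.2).symm.trans (h4 h2.2)
    rw [Params.elem_inj] at h5
    rw [h3, h5]

/-- Whether the test session is unexposed can be read off the store. Hence two experiments coupled
with the same simulation agree on it. -/
theorem Rel.fresh {C C' : Plan} {birth birth' : ℕ → Option ℕ} {st st' : GameState (S.G n)}
    {f : Data → Data} (h : Rel S n C birth st f) (h' : Rel S n C' birth' st' f)
    (hst : st.Fresh) : st'.Fresh := by
  have hs : ∀ {C C' : Plan} {birth birth' : ℕ → Option ℕ} {st st' : GameState (S.G n)},
      Rel S n C birth st f → Rel S n C' birth' st' f → ∀ i w, st.sessions i = some w →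
      ∃ w', st'.sessions i = some w' ∧ w.owner = w'.owner ∧ w.ident = w'.ident ∧
        w.stateExposed = w'.stateExposed ∧ w.keyExposed = w'.keyExposed := by
    intro C C' birth birth' st st' h h' i w hw
    have hv := h.session i w hw
    cases hw' : st'.sessions i with
    | none =>
      have := (h'.noSession i hw').1
      obtain h3 | h3 := hv.data <;> simp [this] at h3
    | some w' => exact ⟨w', rfl, hv.agree (h'.session i w' hw')⟩
  have hc : ∀ A, st'.Corrupted A → st.Corrupted A := by
    rintro A ⟨P', hP', hcor⟩
    have h1 := h.player A
    have h2 := h'.player A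
    rw [hP'] at h2
    cases hP : st.players A with
    | none =>
      rw [hP] at h1
      have := h1.1.symm.trans h2.1
      simp at this
    | some P =>
      rw [hP] at h1
      refine ⟨P, hP, flag_ne ?_⟩
      rw [← h1.2, h2.2, hcor]
      simp
  have hhit : ∀ w w' : Session (S.G n), w.owner = w'.owner → w.ident = w'.ident →
      w.stateExposed = w'.stateExposed → w.keyExposed = w'.keyExposed → st'.Hit w' → st.Hit w := by
    rintro w w' h1 h2 h3 h4 (h5 | h5 | h5 | ⟨A, B, X, Y, h5, h6⟩)
    · exact .inl (h3.trans h5)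
    · exact .inr (.inl (h4.trans h5))
    · exact .inr (.inr (.inl (hc _ (by rwa [h1]))))
    · exact .inr (.inr (.inr ⟨A, B, X, Y, h2.trans h5, hc _ h6⟩))
  obtain ⟨i, w, hi, hw, h1, h2⟩ := hst
  obtain ⟨w', hw', ho, hid, he, he'⟩ := hs h h' i w hw
  refine ⟨i, w', ?_, hw', fun hh => h1 (hhit w w' ho hid he he' hh), fun j v' hv' hm hh => ?_⟩
  · have := h.tested.symm.trans h'.tested
    rw [hi] at this
    cases ht : st'.tested with
    | none => simp [ht] at this
    | some j => simpa [ht] using this.symm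
  · obtain ⟨v, hv, ho1, hid1, he1, he1'⟩ := hs h' h j v' hv'
    refine h2 j v hv ?_ (hhit v v' ho1.symm hid1.symm he1.symm he1'.symm hh)
    obtain ⟨A, B, X, Y, h3, h4⟩ := hm
    exact ⟨A, B, X, Y, hid.trans h3, hid1.symm.trans h4⟩

/-- This justifies that the simulator gives up: the special session will not be an unexposed test
session. -/
theorem Doomed.not_fresh {κ : ℕ} {t : Tracked (S.G n)} (hd : Doomed κ t.birth t.base)
    {pr : Protocol} (hinv : Inv S n pr t.base)
    (h : t.base.Fresh) : ¬ t.TestedAt κ := by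
  rintro ⟨j, hj, hjκ⟩
  obtain ⟨i, s, h1, hu, h2, h3⟩ | ⟨i, κ', h1, h2, h3⟩ := hd
  · obtain rfl := hu j hjκ
    obtain ⟨j', w, hj', hw, hhit, -⟩ := h
    rw [hj] at hj'
    obtain rfl := Option.some.inj hj'
    rw [h2] at hw
    obtain rfl := Option.some.inj hw
    obtain h3 | h3 | ⟨B, Y, k, h4, h5⟩ := h3
    · exact hhit (.inl h3)
    · exact hhit (.inr (.inl h3))
    · obtain ⟨w, hw, A, X, hA⟩ := hinv.tested _ hj
      rw [h2] at hw
      obtain rfl := Option.some.inj hw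
      unfold Session.ident at hA
      rw [h4] at hA
      simp only [Option.some.injEq, Prod.mk.injEq] at hA
      exact h5 ⟨hA.2.1.trans hA.1.symm, hA.2.2.2.trans hA.2.2.1.symm⟩
  · rw [hj] at h1
    obtain rfl := Option.some.inj h1
    rw [hjκ] at h2
    exact h3 (Option.some.inj h2).symm

end OAKE

end

noncomputable section

namespace OAKE

open Data Game

variable {S : Params} {n : ℕ}

/-! ### Replacing the test key -/

theorem toOuterMeasure_le_one {α : Type} (μ : PMF α) (A : Set α) : μ.toOuterMeasure A ≤ 1 :=
  (PMF.toOuterMeasure_apply _ _).trans_le ((ENNReal.tsum_le_tsum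
    fun y => Set.indicator_le_self' (by simp) y).trans μ.tsum_coe.le)

theorem toOuterMeasure_bind_le_add {α β γ : Type} {μ : PMF α} {f f' : α → PMF β} {g : α → PMF γ}
    {A : Set β} {B : Set γ} {C : ENNReal} (h : ∀ a, (f a).toOuterMeasure A ≤
      (f' a).toOuterMeasure A + C * (g a).toOuterMeasure B) :
    (μ.bind f).toOuterMeasure A ≤
      (μ.bind f').toOuterMeasure A + C * (μ.bind g).toOuterMeasure B := by
  rw [PMF.toOuterMeasure_bind_apply, PMF.toOuterMeasure_bind_apply, PMF.toOuterMeasure_bind_apply,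
    ← ENNReal.tsum_mul_left, ← ENNReal.tsum_add]
  refine ENNReal.tsum_le_tsum fun a => ?_
  calc μ a * (f a).toOuterMeasure A
      ≤ μ a * ((f' a).toOuterMeasure A + C * (g a).toOuterMeasure B) := by gcongr; exact h a
    _ = _ := by ring

namespace Params

variable (S n)

/-- The simulated experiment, in which the session created by query `κ` has DH-component `U`. -/
def simRun (pr : Protocol) (m : ℕ) (c : Code) (y : Data) (b κ : ℕ) (U : S.G n) (k : ℕ) :
    PMF (Option (Data × ℕ) × Data) :=
  (c.eval y b).run (Sim.env S n pr m)
    (cons (S.elem n U) (cons (num k) (cons (num (κ + 1)) (num 0))))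

/-- The simulated experiment with a random special session; the result is the DH-exponent of that
session and the final state of the simulator. -/
def simGame (pr : Protocol) (m : ℕ) (c : Code) (y : Data) (b κ : ℕ) : PMF (ℕ × Data) :=
  (S.exponent n).bind fun x => (S.keyDist n).bind fun k =>
    (S.simRun n pr m c y b κ (S.g n ^ x) k).map fun r => (x, r.2)

/-- In the simulated experiment, `H_K` is asked for the key of the special session. -/
def BadEvent (pr : Protocol) : Set (ℕ × Data) := {p | Bad S n pr p.1 (store p.2)}

/-- The experiment, with record of session creation. -/
def trackedRun (pr : Protocol) (c : Code) (y : Data) (b : ℕ) (β : Bool) :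
    PMF (Option (Data × ℕ) × Tracked (S.G n)) :=
  (c.eval y b).run (S.tracked n 0 (S.exponent n) (S.keyDist n) (S.keyDist n) pr β)
    (.init (S.G n))

end Params

/-- There is an unexposed test session, created by query `κ`, and the adversary's output is in
`E`. -/
def FreshAt (S : Params) (n κ : ℕ) (E : Set (Option (Data × ℕ))) :
    Set (Option (Data × ℕ) × Tracked (S.G n)) :=
  {r | r.1 ∈ E ∧ r.2.base.Fresh ∧ r.2.TestedAt κ}

/-- Whether the test query is answered by the session key or by a random key makes a difference
only if the value of `H_K` for the special session is asked for: up to that event, both experiments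
are coupled with the same simulation. -/
theorem planned_freshAt_le {pr : Protocol} {κ x k m b l : ℕ}
    (hw : Plan.Wide S n ⟨pr, κ, x, k, true, b, m⟩ l) (β β' : Bool) (c : Code) (y : Data)
    (E : Set (Option (Data × ℕ))) :
    ((c.eval y b).run (S.planned n κ pr β x k) (.init (S.G n))).toOuterMeasure (FreshAt S n κ E) ≤
      ((c.eval y b).run (S.planned n κ pr β' x k) (.init (S.G n))).toOuterMeasure
        (FreshAt S n κ E) +
      2 * ((S.simRun n pr m c y b κ (S.g n ^ x) k).map fun r => (x, r.2)).toOuterMeasure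
        (S.BadEvent n pr) := by
  have hw' : ∀ β, Plan.Wide S n ⟨pr, κ, x, k, β, b, m⟩ l := fun β =>
    ⟨hw.elem, hw.order, hw.keyLen, hw.security, hw.limit⟩
  have h1 := Coupled.attack (hw' β) c y le_rfl
  have h2 := (Coupled.attack (hw' β') c y le_rfl).swap
  rw [PMF.toOuterMeasure_map_apply]
  -- the event that the simulation represents an experiment with unexposed test session
  let V : Set (Option (Data × ℕ) × Data) := {r | r.1 ∈ E ∧
    ∃ t : Tracked (S.G n), Sync S n ⟨pr, κ, x, k, β, b, m⟩ t r.2 ∧ t.base.Fresh}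
  let N : Set (Option (Data × ℕ) × Data) := {r | Bad S n pr x (store r.2)}
  have h3 := h1.toOuterMeasure_le (A := FreshAt S n κ E) (B := V) (C := N) (by
    rintro a a' (⟨he, hs⟩ | hbad | ⟨-, hinv, -, hd, -⟩) ⟨hE, hf, ht⟩
    · exact .inl ⟨he ▸ hE, _, hs, hf⟩
    · exact .inr hbad
    · exact absurd ht (hd.not_fresh hinv hf))
  have h4 := h2.toOuterMeasure_le (A := V \ N) (B := FreshAt S n κ E) (C := ∅) (by
    rintro a a' hR ⟨⟨hE, t, ⟨s, hz, hrel, -, -⟩, hf⟩, hN⟩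
    have hst : store a.2 = s := by rw [hz]; rfl
    obtain ⟨he, s', hz', hrel', -⟩ | hbad | ⟨-, -, -, -, h5⟩ := hR
    · obtain rfl : s' = s := by rw [← hst, hz']; rfl
      have hf' := hrel.fresh hrel' hf
      obtain ⟨i, w, hi, -⟩ := id hf'
      exact .inl ⟨he ▸ hE, hf', i, hi, hrel'.testedSpecial i hi⟩
    · exact absurd hbad hN
    · rw [hst] at h5
      exact absurd hrel.alive h5)
  rw [MeasureTheory.measure_empty, add_zero] at h4
  have h5 : (S.simRun n pr m c y b κ (S.g n ^ x) k).toOuterMeasure V ≤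
      (S.simRun n pr m c y b κ (S.g n ^ x) k).toOuterMeasure (V \ N) +
      (S.simRun n pr m c y b κ (S.g n ^ x) k).toOuterMeasure N :=
    (MeasureTheory.measure_mono (by
      intro r hr
      by_cases h : r ∈ N
      · exact .inr h
      · exact .inl ⟨hr, h⟩)).trans (MeasureTheory.measure_union_le _ _)
  refine h3.trans ?_
  rw [two_mul, ← add_assoc]
  exact add_le_add (h5.trans (add_le_add h4 le_rfl)) le_rfl

/-- The bounds of `Plan.Wide`, which do not depend on the special session. -/
def WideBound (S : Params) (n b m : ℕ) : Prop :=
  ∃ l, ∀ (pr : Protocol) (κ x k : ℕ) (β : Bool), Plan.Wide S n ⟨pr, κ, x, k, β, b, m⟩ l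

/-- The recorded run does not depend on `κ`, as the sources of random values for the session created
by query `κ` are the ordinary ones. So a `κ` may be chosen, and its session planned, afterwards. -/
theorem trackedRun_eq (κ : ℕ) (pr : Protocol) (c : Code) (y : Data) (b : ℕ) (β : Bool) :
    S.trackedRun n pr c y b β = (S.exponent n).bind fun x => (S.keyDist n).bind fun k =>
      (c.eval y b).run (S.planned n κ pr β x k) (.init (S.G n)) := by
  rw [← run_tracked_eq_planned κ pr β _ (Inv.init pr)]
  have h : ∀ κ, S.keySource n κ (S.keyDist n) = fun _ _ => S.keyDist n :=
    fun κ => funext fun t => funext fun i => ite_self _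
  unfold Params.trackedRun Params.tracked
  simp only [ite_self, h]

/-- The bound of `planned_freshAt_le`, averaged over the planned values. -/
theorem trackedRun_freshAt_le {b m : ℕ} (hw : WideBound S n b m) (κ : ℕ) (pr : Protocol)
    (β β' : Bool) (c : Code) (y : Data) (E : Set (Option (Data × ℕ))) :
    (S.trackedRun n pr c y b β).toOuterMeasure (FreshAt S n κ E) ≤
      (S.trackedRun n pr c y b β').toOuterMeasure (FreshAt S n κ E) +
      2 * (S.simGame n pr m c y b κ).toOuterMeasure (S.BadEvent n pr) := by
  rw [trackedRun_eq κ, trackedRun_eq κ]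
  obtain ⟨l, hw⟩ := hw
  exact toOuterMeasure_bind_le_add fun x => toOuterMeasure_bind_le_add fun k =>
    planned_freshAt_le (hw _ _ _ _ _) _ _ _ _ _

theorem Tracked.TestedAt.unique {κ κ' : ℕ} {t : Tracked (S.G n)} (h : t.TestedAt κ)
    (h' : t.TestedAt κ') : κ = κ' := by
  obtain ⟨i, h1, h2⟩ := h
  obtain ⟨j, h3, h4⟩ := h'
  rw [h1] at h3
  obtain rfl := Option.some.inj h3
  rw [h2] at h4
  exact Option.some.inj h4

theorem trackedRun_spec {pr : Protocol} {c : Code} {y : Data} {b : ℕ} {β : Bool} :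
    ∀ r ∈ (S.trackedRun n pr c y b β).support, Inv S n pr r.2.base ∧ r.2.Recorded ∧
      r.2.count ≤ b := by
  intro r hr
  have h := (Code.budget_lt c y b).run
    (fun a (t : Tracked (S.G n)) => (Inv S n pr t.base ∧ t.Recorded) ∧ t.count + a ≤ b)
    (fun a a' t h ha => ⟨h.1, by have := h.2; omega⟩) (fun a d t h ha u hu => ⟨trivial, ?_⟩)
    ⟨⟨Inv.init pr, by simp [Tracked.init, GameState.init], by simp [Tracked.init]⟩,
      by simp [Tracked.init]⟩ hr
  · exact ⟨h.1.1.1, h.1.1.2, by have := h.1.2; omega⟩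
  · obtain ⟨h1, h2⟩ := tracked_recorded d h.1.2 u hu
    exact ⟨⟨(tracked_evolves d h.1.1 u hu).1, h1⟩, by have := h.2; omega⟩

/-- The test session was created by exactly one query, and the number of queries is at most the
running time `b`. -/
theorem trackedRun_fresh_eq (pr : Protocol) (β : Bool) (c : Code) (y : Data) (b : ℕ)
    (E : Set (Option (Data × ℕ))) :
    (S.trackedRun n pr c y b β).toOuterMeasure {r | r.1 ∈ E ∧ r.2.base.Fresh} =
      ∑ κ ∈ Finset.range b, (S.trackedRun n pr c y b β).toOuterMeasure (FreshAt S n κ E) := by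
  classical
  simp only [PMF.toOuterMeasure_apply]
  rw [← Summable.tsum_finsetSum fun _ _ => ENNReal.summable]
  refine tsum_congr fun r => ?_
  by_cases hr : r ∈ (S.trackedRun n pr c y b β).support
  · obtain ⟨hinv, hrec, hb⟩ := trackedRun_spec r hr
    by_cases hE : r ∈ {r : Option (Data × ℕ) × Tracked (S.G n) | r.1 ∈ E ∧ r.2.base.Fresh}
    · obtain ⟨i, w, hi, hw, -⟩ := id hE.2
      obtain ⟨κ, hκ⟩ := hrec.1 i w hw
      rw [Set.indicator_of_mem hE, Finset.sum_eq_single κ, Set.indicator_of_mem]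
      · exact ⟨hE.1, hE.2, i, hi, hκ⟩
      · exact fun κ' _ hne => Set.indicator_of_notMem
          (fun h => hne (Tracked.TestedAt.unique h.2.2 ⟨i, hi, hκ⟩)) _
      · exact fun h => absurd (Finset.mem_range.2 ((hrec.2 i κ hκ).trans_le hb)) h
    · rw [Set.indicator_of_notMem hE, Finset.sum_eq_zero]
      exact fun κ _ => Set.indicator_of_notMem (fun h => hE ⟨h.1, h.2.1⟩) _
  · rw [PMF.mem_support_iff, not_not] at hr
    simp [Set.indicator_apply, hr]

theorem attack_eq (pr : Protocol) (A : PPT) (β : Bool) : S.attack n pr A β =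
    (S.trackedRun n pr A.code (S.pub n) (A.time.eval n) β).map
      fun r => (r.1.map Prod.fst, r.2.base) := by
  have h := Comp.run_map (env' := S.challenger n pr β) (fun t : Tracked (S.G n) => t.base)
    (fun d t => tracked_map_base 0 pr β d t) (A.start n (S.pub n)) (.init (S.G n))
  unfold Params.attack
  rw [show GameState.init (S.G n) = (Tracked.init (S.G n)).base from rfl, ← h, PMF.map_comp]
  rfl

/-- The probability of an outcome with unexposed test session hardly depends on the challenge
bit. -/
theorem attack_fresh_le (pr : Protocol) (A : PPT) (β β' : Bool) {m : ℕ}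
    (hw : WideBound S n (A.time.eval n) m) (E : Set (Option Data)) :
    (S.attack n pr A β).toOuterMeasure {r | r.1 ∈ E ∧ r.2.Fresh} ≤
      (S.attack n pr A β').toOuterMeasure {r | r.1 ∈ E ∧ r.2.Fresh} +
      2 * ∑ κ ∈ Finset.range (A.time.eval n),
        (S.simGame n pr m A.code (S.pub n) (A.time.eval n) κ).toOuterMeasure
          (S.BadEvent n pr) := by
  rw [attack_eq, attack_eq, PMF.toOuterMeasure_map_apply, PMF.toOuterMeasure_map_apply]
  change (S.trackedRun n pr A.code (S.pub n) (A.time.eval n) β).toOuterMeasure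
    {r | r.1 ∈ Option.map Prod.fst ⁻¹' E ∧ r.2.base.Fresh} ≤
    (S.trackedRun n pr A.code (S.pub n) (A.time.eval n) β').toOuterMeasure
    {r | r.1 ∈ Option.map Prod.fst ⁻¹' E ∧ r.2.base.Fresh} + _
  rw [trackedRun_fresh_eq, trackedRun_fresh_eq, Finset.mul_sum, ← Finset.sum_add_distrib]
  exact Finset.sum_le_sum fun κ _ => trackedRun_freshAt_le hw κ pr β β' _ _ _

/-! ### The advantage of the adversary -/

theorem attack_inv {pr : Protocol} {A : PPT} {β : Bool} :
    ∀ r ∈ (S.attack n pr A β).support, Inv S n pr r.2 := by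
  rw [attack_eq]
  intro r hr
  obtain ⟨u, hu, rfl⟩ := (PMF.mem_support_map_iff _ _ _).1 hr
  exact (trackedRun_spec u hu).1

theorem prob_mismatch (pr : Protocol) (A : PPT) :
    prob (S.experiment n pr A) {r | r.2.2.Mismatch} = 0 := by
  unfold prob
  rw [(PMF.toOuterMeasure_apply_eq_zero_iff _ _).2, ENNReal.toReal_zero]
  rw [Set.disjoint_left]
  intro r hr hm
  obtain ⟨β, -, hr⟩ := (PMF.mem_support_bind_iff _ _ _).1 hr
  obtain ⟨u, hu, rfl⟩ := (PMF.mem_support_map_iff _ _ _).1 hr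
  exact (attack_inv u hu).not_mismatch hm

/-- The four probabilities come in two differences, each of which compares the two values of the
challenge bit for the same set of outputs. Runs decided by the fair coin contribute to `1 / 2`
only. -/
theorem prob_guess (pr : Protocol) (A : PPT) :
    prob (S.guess n pr A) {true} = 1 / 2 + 1 / 4 *
      ((prob (S.attack n pr A true) {r | r.1 ∈ ({some (num 1)} : Set _) ∧ r.2.Fresh} -
        prob (S.attack n pr A false) {r | r.1 ∈ ({some (num 1)} : Set _) ∧ r.2.Fresh}) +
      (prob (S.attack n pr A false) {r | r.1 ∈ ({some (num 1)}ᶜ : Set _) ∧ r.2.Fresh} -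
        prob (S.attack n pr A true) {r | r.1 ∈ ({some (num 1)}ᶜ : Set _) ∧ r.2.Fresh})) := by
  classical
  let f : Bool × Option Data × GameState (S.G n) → PMF Bool := fun r =>
    if r.2.2.Fresh then PMF.pure (decide (r.2.1 = some (num 1)) == r.1)
    else PMF.uniformOfFintype Bool
  let a : Bool → Bool → ENNReal := fun β γ => (S.attack n pr A β).toOuterMeasure
    {r | (decide (r.1 = some (num 1)) == γ) = true ∧ r.2.Fresh}
  let z : Bool → ENNReal := fun β => (S.attack n pr A β).toOuterMeasure {r | ¬ r.2.Fresh}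
  have h1 : ∀ β, a β true + a β false + z β = 1 := by
    intro β
    rw [← (S.attack n pr A β).tsum_coe]
    simp only [a, z, PMF.toOuterMeasure_apply, ← ENNReal.tsum_add]
    refine tsum_congr fun r => ?_
    by_cases h : r.2.Fresh <;> by_cases h' : r.1 = some (num 1) <;>
      simp [h, h']
  have h2 : ∀ β, ((S.attack n pr A β).bind fun r => f (β, r)).toOuterMeasure {true} =
      a β β + z β * 2⁻¹ := by
    intro β
    rw [PMF.toOuterMeasure_bind_apply]
    simp only [a, z, PMF.toOuterMeasure_apply, ← ENNReal.tsum_mul_right, ← ENNReal.tsum_add]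
    refine tsum_congr fun r => ?_
    by_cases h : r.2.Fresh <;> by_cases h' : (decide (r.1 = some (num 1)) = β) <;>
      simp [Set.indicator_apply, h, h', f]
  have h3 : (S.guess n pr A).toOuterMeasure {true} =
      2⁻¹ * (a true true + z true * 2⁻¹) + 2⁻¹ * (a false false + z false * 2⁻¹) := by
    have : S.guess n pr A = (PMF.uniformOfFintype Bool).bind fun β =>
        (S.attack n pr A β).bind fun r => f (β, r) := by
      unfold Params.guess Params.experiment
      simp only [PMF.bind_bind, PMF.bind_map]
      rfl
    rw [this, PMF.toOuterMeasure_bind_apply, tsum_bool, h2, h2]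
    simp [add_comm]
  have ha : ∀ β γ, a β γ ≠ ⊤ := fun β γ =>
    ((toOuterMeasure_le_one _ _).trans_lt ENNReal.one_lt_top).ne
  have hz : ∀ β, z β ≠ ⊤ := fun β => ((toOuterMeasure_le_one _ _).trans_lt ENNReal.one_lt_top).ne
  have h4 : ∀ β, (a β true).toReal + (a β false).toReal + (z β).toReal = 1 := fun β => by
    rw [← ENNReal.toReal_add (ha _ _) (ha _ _),
      ← ENNReal.toReal_add (ENNReal.add_ne_top.2 ⟨ha _ _, ha _ _⟩) (hz _), h1, ENNReal.toReal_one]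
  have h5 : prob (S.guess n pr A) {true} = 2⁻¹ * ((a true true).toReal + (z true).toReal * 2⁻¹) +
      2⁻¹ * ((a false false).toReal + (z false).toReal * 2⁻¹) := by
    have hzz : ∀ β, z β * 2⁻¹ ≠ ⊤ := fun β => ENNReal.mul_ne_top (hz β) (by simp)
    have hzs : ∀ β, 2⁻¹ * (a β β + z β * 2⁻¹) ≠ ⊤ := fun β =>
      ENNReal.mul_ne_top (by simp) (ENNReal.add_ne_top.2 ⟨ha _ _, hzz _⟩)
    rw [prob, h3, ENNReal.toReal_add (hzs true) (hzs false)]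
    simp only [ENNReal.toReal_mul, ENNReal.toReal_add (ha _ _) (hzz _), ENNReal.toReal_inv,
      ENNReal.toReal_ofNat]
  have h6 : ∀ β, prob (S.attack n pr A β) {r | r.1 ∈ ({some (num 1)} : Set _) ∧ r.2.Fresh} =
      (a β true).toReal := fun β => by simp [prob, a]
  have h7 : ∀ β, prob (S.attack n pr A β) {r | r.1 ∈ ({some (num 1)}ᶜ : Set _) ∧ r.2.Fresh} =
      (a β false).toReal := fun β => by simp [prob, a]
  rw [h5, h6, h6, h7, h7]
  linarith [h4 true, h4 false]

/-- The advantage is at most the probability that in the simulated experiment, with a special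
session that is created by a random query, `H_K` is asked for the key of that session. -/
theorem advantage_le (pr : Protocol) (A : PPT) {m : ℕ} (hw : WideBound S n (A.time.eval n) m) :
    |prob (S.guess n pr A) {true} - 1 / 2| ≤ ∑ κ ∈ Finset.range (A.time.eval n),
      prob (S.simGame n pr m A.code (S.pub n) (A.time.eval n) κ) (S.BadEvent n pr) := by
  have hfin : ∀ {α : Type} (μ : PMF α) (B : Set α), μ.toOuterMeasure B ≠ ⊤ := fun μ B =>
    ((toOuterMeasure_le_one _ _).trans_lt ENNReal.one_lt_top).ne
  have h : ∀ β β' (E : Set (Option Data)),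
      prob (S.attack n pr A β) {r | r.1 ∈ E ∧ r.2.Fresh} -
        prob (S.attack n pr A β') {r | r.1 ∈ E ∧ r.2.Fresh} ≤
      2 * ∑ κ ∈ Finset.range (A.time.eval n),
        prob (S.simGame n pr m A.code (S.pub n) (A.time.eval n) κ) (S.BadEvent n pr) := by
    intro β β' E
    have h1 := attack_fresh_le pr A β β' hw E
    have h2 : (2 * ∑ κ ∈ Finset.range (A.time.eval n),
        (S.simGame n pr m A.code (S.pub n) (A.time.eval n) κ).toOuterMeasure
          (S.BadEvent n pr)) ≠ ⊤ :=
      ENNReal.mul_ne_top (by simp) (ENNReal.sum_ne_top.2 fun _ _ => hfin _ _)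
    have h3 := ENNReal.toReal_mono (ENNReal.add_ne_top.2 ⟨hfin _ _, h2⟩) h1
    rw [ENNReal.toReal_add (hfin _ _) h2, ENNReal.toReal_mul,
      ENNReal.toReal_sum fun _ _ => hfin _ _, ENNReal.toReal_ofNat] at h3
    unfold prob
    linarith
  rw [prob_guess, abs_le]
  constructor <;>
    linarith [h true false {some (num 1)}, h false true {some (num 1)},
      h true false {some (num 1)}ᶜ, h false true {some (num 1)}ᶜ]

end OAKE

end

noncomputable section

namespace OAKE

open Data Game

variable {S : Params} {n : ℕ}

/-! ### Values of the oracle that are divisible by the group order -/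

/-- A union bound over the queries, the number of which is at most the time limit. -/
theorem Comp.Budget.run_event_le {σ : Type} {env : Data → StateT σ PMF Data} {A : Set σ}
    {δ : ENNReal} (henv : ∀ d s, s ∉ A → (env d s).toOuterMeasure {r | r.2 ∈ A} ≤ δ)
    {m : Comp (Data × ℕ)} {b : ℕ} {post : Data × ℕ → Prop}
    (h : m.Budget (fun _ => True) post b) {s : σ} (hs : s ∉ A) :
    (m.run env s).toOuterMeasure {r | r.2 ∈ A} ≤ b * δ := by
  have h0 : ∀ (a : Option (Data × ℕ)) (s : σ), s ∉ A →
      (PMF.pure (a, s)).toOuterMeasure {r | r.2 ∈ A} = 0 := fun a s hs => by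
    rw [PMF.toOuterMeasure_pure_apply, if_neg (by exact hs)]
  induction m generalizing b s with
  | ret a => simp [Comp.run, h0 _ _ hs]
  | timeout => simp [Comp.run, h0 _ _ hs]
  | rnd m k ih =>
    have := toOuterMeasure_bind_le (μ := uniformUpTo m) (f := fun i => (k i).run env s) (A := ∅)
      (B := {r | r.2 ∈ A}) (a := 0) (b := b * δ) (by simp)
      fun i hi _ => ih i (h i (mem_support_uniformUpTo.1 hi)) hs
    rwa [zero_add] at this
  | query d k ih =>
    have hb : 1 ≤ b := by have := h.1; omega
    refine (toOuterMeasure_bind_le (henv d s hs) fun r _ hr =>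
      ih r.1 ((h.2 r.1 trivial).mono (b' := b - 1) (by omega) fun _ h => h) hr).trans_eq ?_
    obtain ⟨b, rfl⟩ := Nat.exists_eq_succ_of_ne_zero (Nat.one_le_iff_ne_zero.1 hb)
    simp only [Nat.succ_sub_one, Nat.cast_succ]
    ring

/-- Each query costs time, and the reaction to it consists of at most `20` elementary steps of the
simulator. -/
theorem simRun_degenerate_le (pr : Protocol) (m : ℕ) (c : Code) (y : Data) (b κ : ℕ) (U : S.G n)
    (k : ℕ) : (S.simRun n pr m c y b κ U k).toOuterMeasure {r | Degenerate (S.q n) (store r.2)} ≤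
      b * (20 * hashZero S n) := by
  refine (Code.budget_lt c y b).run_event_le (A := {z | Degenerate (S.q n) (store z)})
    (fun d z hz => ?_) (by simp [store, Degenerate])
  unfold Sim.env
  rw [PMF.toOuterMeasure_map_apply]
  exact (Sim.Tame.answer (S := S) (n := n) (pr := pr) (m := m) z.left z.right.left
    z.right.right.left d z.right.right.right).2 hz

theorem uniformUpTo_apply {m i : ℕ} (hi : i ≤ m) : uniformUpTo m i = (m + 1 : ENNReal)⁻¹ := by
  refine (PMF.uniformOfFinset_apply_of_mem ⟨0, by simp⟩
    (by simpa [Nat.lt_succ_iff] using hi)).trans ?_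
  simp

theorem uniformUpTo_tsum (m : ℕ) (f : ℕ → ENNReal) :
    ∑' i, uniformUpTo m i * f i = (m + 1 : ENNReal)⁻¹ * ∑ i ∈ Finset.range (m + 1), f i := by
  rw [tsum_eq_sum (s := Finset.range (m + 1)), Finset.mul_sum]
  · exact Finset.sum_congr rfl fun i hi => by
      rw [uniformUpTo_apply (Nat.lt_succ_iff.1 (Finset.mem_range.1 hi))]
  · intro i hi
    have : uniformUpTo m i = 0 := by
      rw [PMF.apply_eq_zero_iff, mem_support_uniformUpTo]
      simpa using hi
    rw [this, zero_mul]

/-- At most `2 ^ n / q + 1` of the numbers below `2 ^ n` are divisible by `q`. -/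
theorem hashZero_le (S : Params) (n : ℕ) : hashZero S n ≤ (S.q n : ENNReal)⁻¹ + (2 ^ n)⁻¹ := by
  classical
  have hN : 2 ^ n - 1 + 1 = 2 ^ n := Nat.sub_add_cancel Nat.one_le_two_pow
  have hcard : ((Finset.range (2 ^ n)).filter fun v => S.q n ∣ v).card ≤ 2 ^ n / S.q n + 1 := by
    rw [← Finset.card_range (2 ^ n / S.q n + 1)]
    refine Finset.card_le_card_of_injOn (fun v => v / S.q n) (fun v hv => ?_) fun v hv w hw h => ?_
    · simp only [Finset.coe_filter, Finset.mem_range, Set.mem_ofPred_eq] at hv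
      simpa [Nat.lt_succ_iff] using Nat.div_le_div_right hv.1.le
    · simp only [Finset.coe_filter, Set.mem_ofPred_eq] at hv hw
      rw [← Nat.div_mul_cancel hv.2, ← Nat.div_mul_cancel hw.2]
      exact congrArg (· * S.q n) h
  have h1 : hashZero S n = (2 ^ n : ENNReal)⁻¹ *
      ((Finset.range (2 ^ n)).filter fun v => S.q n ∣ v).card := by
    refine (PMF.toOuterMeasure_uniformOfFinset_apply ⟨0, by simp⟩ _).trans ?_
    rw [hN, Finset.card_range, ENNReal.div_eq_inv_mul]
    simp
  have h2 : ((2 ^ n / S.q n : ℕ) : ENNReal) ≤ 2 ^ n * (S.q n : ENNReal)⁻¹ := by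
    rw [← ENNReal.div_eq_inv_mul.trans (mul_comm _ _), ENNReal.le_div_iff_mul_le
      (.inl (by simpa using (S.q_pos n).ne')) (.inl (by simp))]
    exact_mod_cast Nat.div_mul_le_self _ _
  have h3 : (2 ^ n : ENNReal)⁻¹ * 2 ^ n = 1 := ENNReal.inv_mul_cancel (by simp) (by simp)
  calc hashZero S n ≤ (2 ^ n : ENNReal)⁻¹ * ((2 ^ n / S.q n : ℕ) + 1) := by
        rw [h1]
        gcongr
        exact_mod_cast hcard
    _ ≤ (2 ^ n : ENNReal)⁻¹ * (2 ^ n * (S.q n : ENNReal)⁻¹ + 1) := by gcongr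
    _ = (S.q n : ENNReal)⁻¹ + (2 ^ n)⁻¹ := by rw [mul_add, ← mul_assoc, h3, one_mul, mul_one]

/-! ### Extracting the square -/

/-- The key of the entry number `j` of a store. -/
def entryKey (s : Data) (j : ℕ) : Data := (Data.right^[j] s).left.left

theorem exists_entryKey {s k : Data} (h : lookup s k ≠ num 0) : ∃ j ≤ s.size, entryKey s j = k := by
  induction s with
  | num m => simp at h
  | cons p s _ ih =>
    rw [lookup] at h
    split_ifs at h with hp
    · exact ⟨0, Nat.zero_le _, hp⟩
    · obtain ⟨j, hj, hk⟩ := ih h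
      exact ⟨j + 1, by simp only [Data.size]; omega, hk⟩

/-- The argument of `h` for the value `c` of the special session with owner `A` and DH-component
`U`. -/
def cArg (A U : Data) : Data := cons (num 0) (tuple [A, U])

/-- The argument of `h` for the value `e` of the special session. -/
def reflectedArg (pr : Protocol) (A U : Data) : Data :=
  match pr with
  | .oake => cons (num 0) (tuple [U, U])
  | .soake => cons (num 0) (tuple [A, A, U, U])

/-- The value `c` of the special session. -/
def cValue (pr : Protocol) (s A U : Data) : ℕ :=
  match pr with
  | .oake => (lookup s (cArg A U)).left.toNat
  | .soake => 1

/-- Given the argument `Z = U ^ (2 c a) * g ^ (e u²)` of `H_K` in the special session, where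
`U = g ^ u`, this is `g ^ (u²)`; the numbers `a`, `c` and `e` are taken from the store `s`. -/
def extract (S : Params) (n : ℕ) (pr : Protocol) (U s Z : Data) : Data :=
  S.powD n (S.mulD n Z (S.powD n U ((S.q n - 1) * (2 *
    (cValue pr s (lookup s (num 2)).left U *
      (lookup s (cons (num 2) (lookup s (num 2)).left)).right.left.toNat)))))
    (S.invN n (lookup s (reflectedArg pr (lookup s (num 2)).left U)).left.toNat)

theorem extract_eq {pr : Protocol} {x : ℕ} {s d : Data} (hq : 3 ≤ S.q n)
    (hs : ¬ Degenerate (S.q n) s) (h : Target S n pr x (lookup s) d) :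
    extract S n pr (S.elem n (S.g n ^ x)) s d = S.elem n (S.g n ^ (x * x)) := by
  obtain ⟨A, a, c, e, p, h1, h2, h3, h4, rfl⟩ := h
  have hc : cValue pr s (num A) (S.elem n (S.g n ^ x)) = c := by
    cases pr
    · simp only [CDEntry] at h3
      simp [cValue, cArg, h3]
    · exact h3.symm
  have he : (lookup s (reflectedArg pr (num A) (S.elem n (S.g n ^ x)))).left.toNat = e := by
    cases pr <;> simp only [eArg] at h4 <;> simp [reflectedArg, h4]
  have hqe : ¬ S.q n ∣ e := fun hd => hs ⟨_, _, h4, hd⟩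
  unfold extract
  simp only [h1, left_cons, h2, right_cons, toNat_num, hc, he, Params.powD_elem,
    Params.mulD_elem, Params.elem_inj]
  rw [← pow_mul, ← pow_add, ← pow_mul]
  refine Params.pow_eq_pow_of_cast _ ?_
  have hinv := Params.invN_mul hq hqe
  obtain ⟨r, hr⟩ : ∃ r, S.q n = r + 1 := ⟨S.q n - 1, by omega⟩
  have hr' : (r : ZMod (S.q n)) = -1 := by
    have : ((r + 1 : ℕ) : ZMod (S.q n)) = 0 := by rw [← hr]; simp
    push_cast at this
    exact eq_neg_of_add_eq_zero_left this
  have hr1 : S.q n - 1 = r := by omega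
  rw [hr1]
  push_cast at hinv ⊢
  rw [hr']
  linear_combination (x * x : ZMod (S.q n)) * hinv

/-- The number of an entry that belongs to the special session is found by guessing. -/
theorem Bad.exists_extract {pr : Protocol} {x : ℕ} {s : Data} (hq : 3 ≤ S.q n)
    (hs : ¬ Degenerate (S.q n) s) (h : Bad S n pr x s) : ∃ j ≤ s.size,
      extract S n pr (S.elem n (S.g n ^ x)) s (entryKey s j).right =
        S.elem n (S.g n ^ (x * x)) := by
  obtain ⟨d, hd, h⟩ := h
  obtain ⟨j, hj, hk⟩ := exists_entryKey h
  exact ⟨j, hj, by rw [hk, right_cons, extract_eq hq hs hd]⟩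

theorem EffD.extract (hS : S.Efficient) (pr : Protocol) {U s Z : ℕ → Data → Data} (hU : EffD S U)
    (hs : EffD S s) (hZ : EffD S Z) :
    EffD S fun n z => OAKE.extract S n pr (U n z) (s n z) (Z n z) := by
  have hA : EffD S fun n z => (OAKE.lookup (s n z) (num 2)).left := (hs.lookup (EffD.const _)).left
  have hc : EffN S fun n z => cValue pr (s n z) (OAKE.lookup (s n z) (num 2)).left (U n z) := by
    cases pr
    · exact EffN.toNat (hs.lookup ((EffD.const _).cons
        (hA.cons (hU.cons (EffD.const _))))).left
    · exact EffN.const 1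
  have he : EffD S fun n z => reflectedArg pr (OAKE.lookup (s n z) (num 2)).left (U n z) := by
    cases pr
    · exact (EffD.const _).cons (hU.cons (hU.cons (EffD.const _)))
    · exact (EffD.const _).cons (hA.cons (hA.cons (hU.cons (hU.cons (EffD.const _)))))
  exact EffD.powD hS (EffD.mulD hS hZ (EffD.powD hS hU
    ((EffN.order.sub (EffN.const 1)).mul ((EffN.const 2).mul (hc.mul
      (EffN.toNat (hs.lookup ((EffD.const _).cons hA)).right.left))))))
    (EffN.invN hS (EffN.toNat (hs.lookup he).left))

end OAKE

end

noncomputable section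

namespace OAKE

open Data Game Filter

variable {S : Params} {n : ℕ}

/-! ### Negligible functions -/

namespace Negligible

theorem of_le {f g : ℕ → ℝ} (hg : Negligible g) (h : ∀ᶠ n in atTop, |f n| ≤ g n) : Negligible f :=
  Asymptotics.SuperpolynomialDecay.trans_eventually_abs_le hg (h.mono fun n hn => by
    simpa using hn.trans (le_abs_self _))

theorem poly_mul {f : ℕ → ℝ} (hf : Negligible f) (P : Polynomial ℕ) :
    Negligible fun n => ((P.eval n : ℕ) : ℝ) * f n := by
  have := Asymptotics.SuperpolynomialDecay.polynomial_mul hf (P.map (Nat.castRingHom ℝ))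
  simp only [Polynomial.eval_natCast_map, Nat.coe_castRingHom, Nat.cast_id] at this
  exact this

theorem sqrt {f : ℕ → ℝ} (hf : Negligible f) : Negligible fun n => √(f n) := by
  intro k
  have h := (Real.continuous_sqrt.tendsto 0).comp (hf (2 * k))
  rw [Real.sqrt_zero] at h
  refine h.congr fun n => ?_
  simp only [Function.comp_apply]
  rw [Real.sqrt_mul (by positivity), mul_comm 2 k, pow_mul, Real.sqrt_sq (by positivity)]

theorem two_pow_inv : Negligible fun n => (2 ^ n)⁻¹ := by
  intro k
  simpa [div_eq_mul_inv] using tendsto_pow_const_div_const_pow_of_one_lt k (r := (2 : ℝ)) (by simp)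

end Negligible

/-! ### Consequences of the CDH assumption -/

/-- The probability that the random function `f` maps `(g ^ x, g ^ y)` to `g ^ (x * y)`. -/
def dhProb (S : Params) (n : ℕ) (f : Data → PMF Data) : ENNReal :=
  (S.q n : ENNReal)⁻¹ * ∑ x ∈ Finset.range (S.q n), (S.q n : ENNReal)⁻¹ *
    ∑ y ∈ Finset.range (S.q n), f (tuple [S.elem n (S.g n ^ x), S.elem n (S.g n ^ y)])
      (S.elem n (S.g n ^ (x * y)))

/-- The CDH assumption for efficient functions. The inputs have polynomially bounded size, so a time
limit that depends on the security parameter only is sufficient. -/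
theorem Params.CDH.negligible_dhProb (hS : S.Efficient) (hCDH : S.CDH) {f : ℕ → Data → PMF Data}
    (hf : Eff S f) : Negligible fun n => (dhProb S n (f n)).toReal := by
  obtain ⟨c, P, hc⟩ := hf
  obtain ⟨L, hL⟩ := hS.exists_bound
  have h := hCDH ⟨c, P.comp (4 * L + 4)⟩
  refine (congrArg Negligible (funext fun n => ?_)).mp h
  unfold prob
  congr 1
  have hq : S.q n - 1 + 1 = S.q n := Nat.sub_add_cancel (S.q_pos n)
  have hq' : ((S.q n - 1 : ℕ) : ENNReal) + 1 = S.q n := by exact_mod_cast hq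
  unfold Params.cdhExperiment dhProb
  rw [PMF.toOuterMeasure_bind_apply, uniformUpTo_tsum, hq, hq']
  refine congrArg _ (Finset.sum_congr rfl fun x _ => ?_)
  rw [PMF.toOuterMeasure_bind_apply, uniformUpTo_tsum, hq, hq']
  refine congrArg _ (Finset.sum_congr rfl fun y _ => ?_)
  set z := tuple [S.elem n (S.g n ^ x), S.elem n (S.g n ^ y)] with hz
  have hlen : S.len n z ≤ (4 * L + 4).eval n := by
    have h1 := (hL n).1 (S.g n ^ x)
    have h2 := (hL n).1 (S.g n ^ y)
    have h3 := (hL n).2.2.2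
    simp only [Params.len, hz, tuple, Data.size, Nat.size_zero, Polynomial.eval_add,
      Polynomial.eval_mul, Polynomial.eval_ofNat]
    omega
  obtain ⟨ν, h1, h2, -⟩ := ((hc n z).mono (poly_mono P hlen)).1 0
  have h3 : PPT.start ⟨c, P.comp (4 * L + 4)⟩ n
      (tuple [S.pub n, S.elem n (S.g n ^ x), S.elem n (S.g n ^ y)]) =
      c.eval (cons (S.pub n) z) (P.eval ((4 * L + 4).eval n) + 0) := by
    simp only [PPT.start, Polynomial.eval_comp, add_zero]
    rfl
  rw [h3, Comp.run_noEnv, h1, ← PMF.toOuterMeasure_apply_singleton, ← h2]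
  simp only [PMF.map_comp, PMF.toOuterMeasure_map_apply]
  congr 1
  ext ⟨v, b⟩
  simp

theorem negligible_inv_order (hS : S.Efficient) (hCDH : S.CDH) :
    Negligible fun n => ((S.q n : ℝ))⁻¹ := by
  -- the output `1` is correct if `x = 0`
  have hf : EffD S fun n _ => S.elem n (1 : S.G n) := by
    have := EffD.powD hS (EffD.generator (S := S)) EffN.order
    simpa only [Params.powD_elem, Params.pow_q] using this
  refine (hCDH.negligible_dhProb hS hf).of_le (Eventually.of_forall fun n => ?_)
  have hq : (S.q n : ENNReal) ≠ 0 := by exact_mod_cast (S.q_pos n).ne'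
  have hq' : (S.q n : ENNReal) ≠ ⊤ := by simp
  have h1 : (S.q n : ENNReal)⁻¹ ≤ dhProb S n fun _ => PMF.pure (S.elem n (1 : S.G n)) := by
    unfold dhProb
    refine le_mul_of_one_le_right' ((le_of_eq ?_).trans (Finset.single_le_sum
      (fun _ _ => zero_le) (Finset.mem_range.2 (S.q_pos n))))
    simp [ENNReal.inv_mul_cancel hq hq']
  have h2 : dhProb S n (fun _ => PMF.pure (S.elem n (1 : S.G n))) ≠ ⊤ := by
    unfold dhProb
    refine ENNReal.mul_ne_top (by simp [hq]) (ENNReal.sum_ne_top.2 fun _ _ =>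
      ENNReal.mul_ne_top (by simp [hq]) (ENNReal.sum_ne_top.2 fun _ _ => PMF.apply_ne_top _ _))
  rw [abs_of_nonneg (by positivity)]
  have := ENNReal.toReal_mono h2 h1
  simpa using this

theorem eventually_three_le_order (hS : S.Efficient) (hCDH : S.CDH) : ∀ᶠ n in atTop, 3 ≤ S.q n := by
  have h := negligible_inv_order hS hCDH 0
  simp only [pow_zero, one_mul] at h
  filter_upwards [h.eventually (gt_mem_nhds (by norm_num : (0 : ℝ) < 1 / 2))] with n hn
  by_contra hq
  have h2 := (S.prime n).two_le
  obtain h3 : S.q n = 2 := by omega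
  rw [h3] at hn
  norm_num at hn

/-! ### The square Diffie-Hellman problem -/

/-- A discrete logarithm to the base `g`. -/
def Params.dlog (S : Params) (n : ℕ) (U : S.G n) : ℕ := (S.exists_pow n U).choose

theorem Params.g_pow_dlog (U : S.G n) : S.g n ^ S.dlog n U = U :=
  (S.exists_pow n U).choose_spec.symm

/-- The probability that the random function `f` maps `U = g ^ u` to `g ^ (u²)`. -/
def squareProb (S : Params) (n : ℕ) (f : Data → PMF Data) (U : S.G n) : ENNReal :=
  f (S.elem n U) (S.elem n (S.g n ^ (S.dlog n U * S.dlog n U)))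

theorem squareProb_pow (f : Data → PMF Data) (x : ℕ) : squareProb S n f (S.g n ^ x) =
    f (S.elem n (S.g n ^ x)) (S.elem n (S.g n ^ (x * x))) := by
  have h := Params.g_pow_eq_iff.1 (Params.g_pow_dlog (S.g n ^ x))
  unfold squareProb
  rw [Params.pow_eq_pow_of_cast (i := S.dlog n (S.g n ^ x) * S.dlog n (S.g n ^ x)) (j := x * x)
    (S.g n) (by push_cast; rw [h])]

instance (n : ℕ) : Finite (S.G n) :=
  Nat.finite_of_card_ne_zero (by rw [S.card]; exact (S.q_pos n).ne')

instance (n : ℕ) : Fintype (S.G n) := Fintype.ofFinite _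

theorem sum_range_order (F : S.G n → ENNReal) :
    ∑ x ∈ Finset.range (S.q n), F (S.g n ^ x) = ∑ U, F U := by
  refine Finset.sum_nbij (fun x => S.g n ^ x) (by simp) ?_ ?_ fun _ _ => rfl
  · intro x hx y hy h
    have := Params.g_pow_eq_iff.1 h
    rw [ZMod.natCast_eq_natCast_iff'] at this
    rwa [Nat.mod_eq_of_lt (by simpa using hx), Nat.mod_eq_of_lt (by simpa using hy)] at this
  · intro U _
    refine ⟨S.dlog n U % S.q n, by simpa using Nat.mod_lt _ (S.q_pos n), ?_⟩
    refine (Params.pow_eq_pow_of_cast _ ?_).trans (Params.g_pow_dlog U)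
    simp

/-- For odd group order, `X * Y` and `X / Y` are independent and uniformly distributed. -/
theorem sum_mul_div (hq : 3 ≤ S.q n) (F : S.G n → ENNReal) :
    ∑ X, ∑ Y, F (X * Y) * F (X * Y⁻¹) = (∑ U, F U) ^ 2 := by
  have hinj : Function.Injective fun p : S.G n × S.G n => (p.1 * p.2, p.1 * p.2⁻¹) := by
    rintro ⟨X, Y⟩ ⟨X', Y'⟩ h
    simp only [Prod.mk.injEq] at h
    have h2 : X ^ 2 = X' ^ 2 := by
      calc X ^ 2 = (X * Y) * (X * Y⁻¹) := by rw [mul_mul_mul_comm, mul_inv_cancel, mul_one, sq]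
        _ = (X' * Y') * (X' * Y'⁻¹) := by rw [h.1, h.2]
        _ = X' ^ 2 := by rw [mul_mul_mul_comm, mul_inv_cancel, mul_one, sq]
    have hcop : (Nat.card (S.G n)).Coprime 2 := by
      rw [S.card, Nat.coprime_primes (S.prime n) Nat.prime_two]
      omega
    obtain rfl : X = X' := (powCoprime hcop).injective h2
    simpa using h.1
  rw [sq, Finset.sum_mul_sum, ← Fintype.sum_prod_type', ← Fintype.sum_prod_type']
  exact Fintype.sum_bijective _ (Finite.injective_iff_bijective.1 hinj) _ _ fun _ => rfl

/-- Diffie-Hellman values from squares: `g ^ (x y)` is the fourth root of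
`g ^ ((x + y)²) / g ^ ((x - y)²)`. Inverses are powers with exponent `q - 1`, and `(q + 1) / 2` is
the inverse of `2` modulo `q`. -/
def fromSquares (S : Params) (f : ℕ → Data → PMF Data) (n : ℕ) (z : Data) : PMF Data :=
  (f n (S.mulD n z.left z.right.left)).bind fun v =>
    (f n (S.mulD n z.left (S.powD n z.right.left (S.q n - 1)))).map fun w =>
      S.powD n (S.mulD n v (S.powD n w (S.q n - 1))) ((S.q n + 1) / 2 * ((S.q n + 1) / 2))

theorem Eff.fromSquares {f : ℕ → Data → PMF Data} (hf : Eff S f) (hS : S.Efficient) :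
    Eff S (fromSquares S f) := by
  have hz : EffD S fun _ z => z := Eff.id
  have hq1 : EffN S fun n _ => S.q n - 1 := EffN.order.sub (EffN.const 1)
  have hr : EffN S fun n _ => (S.q n + 1) / 2 :=
    (EffN.order.add (EffN.const 1)).div (EffN.const 2)
  refine Eff.bind (hf.comp (EffD.mulD hS hz.left hz.right.left)) ?_
  refine Eff.map (f := fun n z => f n (S.mulD n z.right.left (S.powD n z.right.right.left
      (S.q n - 1)))) (g := fun n z w => S.powD n (S.mulD n z.left
        (S.powD n w (S.q n - 1))) ((S.q n + 1) / 2 * ((S.q n + 1) / 2)))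
    (hf.comp (EffD.mulD hS hz.right.left (EffD.powD hS hz.right.right.left hq1))) ?_
  exact EffD.powD hS (EffD.mulD hS hz.right.left (EffD.powD hS hz.left hq1)) (hr.mul hr)

theorem mul_le_fromSquares (hq : 3 ≤ S.q n) (f : ℕ → Data → PMF Data) (x y : ℕ) :
    squareProb S n (f n) (S.g n ^ x * S.g n ^ y) *
      squareProb S n (f n) (S.g n ^ x * (S.g n ^ y)⁻¹) ≤
    fromSquares S f n (tuple [S.elem n (S.g n ^ x), S.elem n (S.g n ^ y)])
      (S.elem n (S.g n ^ (x * y))) := by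
  obtain ⟨h, hh⟩ : ∃ h, S.q n + 1 = 2 * h := by
    obtain hodd | hodd := (S.prime n).eq_two_or_odd'
    · omega
    · obtain ⟨k, hk⟩ := hodd
      exact ⟨k + 1, by omega⟩
  have hdiv : (S.q n + 1) / 2 = h := by omega
  obtain ⟨r, hr⟩ : ∃ r, S.q n = r + 1 := ⟨S.q n - 1, by omega⟩
  have hr1 : S.q n - 1 = r := by omega
  have hr' : (r : ZMod (S.q n)) = -1 := by
    have : ((r + 1 : ℕ) : ZMod (S.q n)) = 0 := by rw [← hr]; simp
    push_cast at this
    exact eq_neg_of_add_eq_zero_left this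
  have hh' : (2 * h : ZMod (S.q n)) = 1 := by
    have : ((2 * h : ℕ) : ZMod (S.q n)) = ((S.q n + 1 : ℕ) : ZMod (S.q n)) := by rw [hh]
    simpa using this
  have hinv : S.g n ^ x * (S.g n ^ y)⁻¹ = S.g n ^ (x + y * r) := by
    rw [pow_add, pow_mul]
    congr 1
    refine inv_eq_of_mul_eq_one_right ?_
    rw [← pow_succ', ← hr, Params.pow_q]
  rw [hinv, ← pow_add, squareProb_pow, squareProb_pow]
  unfold fromSquares
  simp only [tuple, left_cons, right_cons, Params.powD_elem, Params.mulD_elem, hr1, hdiv]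
  rw [← pow_mul, ← pow_add, ← pow_add, PMF.bind_apply]
  refine le_trans ?_ (ENNReal.le_tsum (S.elem n (S.g n ^ ((x + y) * (x + y)))))
  gcongr
  rw [PMF.map_apply]
  refine le_trans ?_ (ENNReal.le_tsum (S.elem n (S.g n ^ ((x + y * r) * (x + y * r)))))
  rw [if_pos]
  simp only [Params.powD_elem, Params.mulD_elem, Params.elem_inj]
  rw [← pow_mul, ← pow_add, ← pow_mul]
  refine Params.pow_eq_pow_of_cast _ ?_
  push_cast
  rw [hr']
  linear_combination (-(x * y) * (2 * h + 1) : ZMod (S.q n)) * hh'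

/-- Squares of random group elements are hard to compute. -/
theorem Params.CDH.negligible_squareProb (hS : S.Efficient) (hCDH : S.CDH)
    {f : ℕ → Data → PMF Data} (hf : Eff S f) :
    Negligible fun n => ((S.q n : ENNReal)⁻¹ * ∑ U, squareProb S n (f n) U).toReal := by
  refine ((hCDH.negligible_dhProb hS (hf.fromSquares hS)).sqrt).of_le ?_
  filter_upwards [eventually_three_le_order hS hCDH] with n hq
  rw [abs_of_nonneg ENNReal.toReal_nonneg]
  refine Real.le_sqrt_of_sq_le ?_
  rw [← ENNReal.toReal_pow]
  have hq0 : (S.q n : ENNReal) ≠ 0 := by exact_mod_cast (S.q_pos n).ne'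
  refine ENNReal.toReal_mono ?_ ?_
  · refine ENNReal.mul_ne_top (by simp [hq0]) (ENNReal.sum_ne_top.2 fun _ _ =>
      ENNReal.mul_ne_top (by simp [hq0]) (ENNReal.sum_ne_top.2 fun _ _ => PMF.apply_ne_top _ _))
  · rw [mul_pow, ← sum_mul_div hq, dhProb, sq, mul_assoc, Finset.mul_sum]
    rw [← sum_range_order]
    gcongr with x _
    rw [← sum_range_order]
    gcongr with y _
    exact mul_le_fromSquares hq f x y

end OAKE

end

noncomputable section

namespace OAKE

open Data Game Filter

variable {S : Params} {n : ℕ}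

/-! ### The reduction -/

/-- The algorithm that tries to find `g ^ (u²)` for a given `U = g ^ u`: it runs the adversary in
the simulated experiment, where `U` is the DH-component of a session chosen at random, and picks an
`H_K`-query from the final store at random. -/
def squareSolver (S : Params) (pr : Protocol) (m T M : ℕ → ℕ) (c : Code) (n : ℕ) (z : Data) :
    PMF Data :=
  ((uniformUpTo (T n)).map num).bind fun κ => ((S.keyDist n).map num).bind fun k =>
    (simulate (Sim.env S n pr (m n)) (T n) c.eval (cons (S.pub n) (cons (num (T n))
      (cons z (cons k (cons (num (κ.toNat + 1)) (num 0))))))).bind fun w =>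
        ((uniformUpTo (M n)).map num).map fun j => extract S n pr z (store w.right.right)
          (entryKey (store w.right.right) (min j.toNat (M n))).right

theorem Eff.squareSolver (hS : S.Efficient) (pr : Protocol) (m T M : Polynomial ℕ) (c : Code) :
    Eff S (squareSolver S pr (m.eval ·) (T.eval ·) (M.eval ·) c) := by
  have hz : EffD S fun _ z => z := Eff.id
  have hp : ∀ P : Polynomial ℕ, EffN S fun n _ => P.eval n := fun P =>
    EffN.polynomial P EffN.security
  obtain ⟨L, hL⟩ := hS.exists_bound
  have hlen : ∀ n z, n ≤ S.len n z := fun n z => Nat.le_add_right _ _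
  have hk : EffN S fun n _ => 2 ^ S.keyLen n - 1 :=
    (EffN.two_pow EffN.keyLen L fun n z => by
      have h1 := (hL n).2.2.1
      have h2 := poly_mono L (hlen n z)
      omega).sub (EffN.const 1)
  refine Eff.bind (Eff.uniform (hp T)) (Eff.bind (Eff.uniform hk) (Eff.bind (Eff.comp
    (Eff.simulate (Eff.sim_env hS pr (hp m)) (20 * (m + 2) + 10)
      (fun n d s r hr => by simpa using Sim.env_size_le n pr (m.eval n) d s r hr) T c)
    (EffD.pub.cons ((EffM.num (hp T)).cons (hz.right.right.cons (hz.left.cons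
      ((EffM.num ((EffN.toNat hz.right.left).add (EffN.const 1))).cons (EffD.const _)))))))
    (Eff.map (Eff.uniform (hp M)) ?_)))
  have hs : EffD S fun _ z => store z.right.left.right.right :=
    hz.right.left.right.right.right.right.right
  exact EffD.extract hS pr hz.right.right.right.right hs (EffD.tails hs
    (EffN.min (EffN.toNat hz.left) (hp M)) M fun n z =>
      (min_le_right _ _).trans (poly_mono M (hlen n z))).left.left.right

/-- The adversary asks for the key of the special session, and all values of `h` are invertible
modulo the group order. -/
def GoodEvent (S : Params) (n : ℕ) (pr : Protocol) : Set (ℕ × Data) :=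
  {p | Bad S n pr p.1 (store p.2) ∧ ¬ Degenerate (S.q n) (store p.2)}

theorem size_le_of_mem_simRun {pr : Protocol} {m l M : ℕ} {c : Code} {y : Data} {b κ : ℕ}
    {U : S.G n} {k : ℕ} (hU : (S.elem n U).size ≤ l) (hkey : S.keyLen n + 1 ≤ l) (hκ : κ ≤ b)
    (hk : k ≤ 2 ^ S.keyLen n - 1) (hM : 2 * l + b + 6 + b * (20 * (m + 2) + 10) ≤ M) :
    ∀ r ∈ (S.simRun n pr m c y b κ U k).support, (store r.2).size ≤ M := by
  intro r hr
  have h := (Code.budget_lt c y b).run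
    (fun a z => z.size + a * (20 * (m + 2) + 10) ≤ M)
    (fun a a' z h ha => by
      have := Nat.mul_le_mul_right (20 * (m + 2) + 10) ha
      omega)
    (fun a d z h ha u hu => ⟨trivial, ?_⟩) ?_ hr
  · have h1 := h.1
    have h2 := right_size_le r.2
    have h3 := right_size_le r.2.right
    have h4 := right_size_le r.2.right.right
    unfold store
    omega
  · have h1 := Sim.env_size_le n pr m d z u hu
    have h2 : (a - (1 + d.size) + 1) * (20 * (m + 2) + 10) ≤ a * (20 * (m + 2) + 10) :=
      Nat.mul_le_mul_right _ (by omega)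
    rw [Nat.succ_mul] at h2
    omega
  · have h1 : Nat.size k ≤ S.keyLen n := Nat.size_le.2 (by
      have := Nat.two_pow_pos (S.keyLen n)
      omega)
    have h2 : Nat.size (κ + 1) ≤ κ + 1 := Nat.size_le.2 Nat.lt_two_pow_self
    simp only [Data.size, Nat.size_zero]
    omega

theorem inv_le_uniform_map {M j : ℕ} (hj : j ≤ M) {F : ℕ → Data} {W : Data} (h : F j = W) :
    (M + 1 : ENNReal)⁻¹ ≤ ((uniformUpTo M).map F) W := by
  rw [PMF.map_apply]
  refine le_trans ?_ (ENNReal.le_tsum j)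
  rw [if_pos h.symm, uniformUpTo_apply hj]

/-- The solver succeeds if it guesses the number `κ` and the entry of the final store that belongs
to the critical query; the two factors are the probabilities of these guesses. -/
theorem le_squareSolver {pr : Protocol} {m T M : ℕ → ℕ} {c : Code} {l x : ℕ} (hq : 3 ≤ S.q n)
    (hU : ∀ U, (S.elem n U).size ≤ l) (hkey : S.keyLen n + 1 ≤ l)
    (hM : 2 * l + T n + 6 + T n * (20 * (m n + 2) + 10) ≤ M n) :
    (T n + 1 : ENNReal)⁻¹ * ((M n + 1 : ENNReal)⁻¹ * ∑ κ ∈ Finset.range (T n),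
      ((S.keyDist n).bind fun k => (S.simRun n pr (m n) c (S.pub n) (T n) κ (S.g n ^ x) k).map
        fun r => (x, r.2)).toOuterMeasure (GoodEvent S n pr)) ≤
      squareProb S n (squareSolver S pr m T M c n) (S.g n ^ x) := by
  rw [squareProb_pow]
  unfold squareSolver
  rw [PMF.bind_map, PMF.bind_apply, uniformUpTo_tsum]
  gcongr
  rw [Finset.mul_sum]
  refine le_trans (Finset.sum_le_sum fun κ hκ => ?_)
    (Finset.sum_le_sum_of_subset (Finset.range_subset_range.2 (Nat.le_succ _)))
  have hκ' := (Finset.mem_range.1 hκ).le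
  rw [Function.comp_apply, PMF.bind_map, PMF.toOuterMeasure_bind_apply, PMF.bind_apply,
    ← ENNReal.tsum_mul_left]
  refine ENNReal.tsum_le_tsum fun k => ?_
  by_cases hk : k ∈ (S.keyDist n).support
  swap
  · rw [PMF.mem_support_iff, not_not] at hk
    simp [hk]
  rw [mul_left_comm]
  gcongr
  simp only [Function.comp_apply, simulate, left_cons, right_cons, toNat_num, min_self]
  rw [PMF.bind_map, PMF.bind_apply, PMF.toOuterMeasure_map_apply, PMF.toOuterMeasure_apply,
    ← ENNReal.tsum_mul_left]
  refine ENNReal.tsum_le_tsum fun r => ?_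
  by_cases hr : r ∈ (S.simRun n pr (m n) c (S.pub n) (T n) κ (S.g n ^ x) k).support
  swap
  · rw [PMF.mem_support_iff, not_not] at hr
    rw [Set.indicator_apply_eq_zero.2 fun _ => hr, mul_zero]
    exact zero_le
  by_cases hgood : r ∈ (fun r : Option (Data × ℕ) × Data => (x, r.2)) ⁻¹' GoodEvent S n pr
  swap
  · rw [Set.indicator_of_notMem hgood, mul_zero]
    exact zero_le
  rw [Set.indicator_of_mem hgood, mul_comm]
  refine mul_le_mul' le_rfl ?_
  have hst : (collapse r).right.right = r.2 := by
    obtain ⟨_ | ⟨y, b⟩, z⟩ := r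
    · rfl
    · simp only [collapse]
      split_ifs <;> rfl
  have hsize := size_le_of_mem_simRun (hU _) hkey hκ' (mem_support_uniformUpTo.1 hk) hM r hr
  obtain ⟨j, hj, hW⟩ := hgood.1.exists_extract hq hgood.2
  rw [Function.comp_apply, hst, PMF.map_comp]
  refine inv_le_uniform_map (hj.trans hsize) ?_
  simp only [Function.comp_apply, toNat_num, min_eq_left (hj.trans hsize)]
  exact hW

theorem toOuterMeasure_bind_le_const {α β : Type} {μ : PMF α} {f : α → PMF β} {B : Set β}
    {b : ENNReal} (h : ∀ x, (f x).toOuterMeasure B ≤ b) : (μ.bind f).toOuterMeasure B ≤ b := by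
  have := toOuterMeasure_bind_le (μ := μ) (A := ∅) (a := 0) (by simp) fun x _ _ => h x
  rwa [zero_add] at this

/-- The critical query can be used unless some value of `h` is divisible by the group order. -/
theorem simGame_badEvent_le (pr : Protocol) (m : ℕ) (c : Code) (y : Data) (b κ : ℕ) :
    (S.simGame n pr m c y b κ).toOuterMeasure (S.BadEvent n pr) ≤
      (S.simGame n pr m c y b κ).toOuterMeasure (GoodEvent S n pr) +
        b * (20 * hashZero S n) := by
  have h : (S.simGame n pr m c y b κ).toOuterMeasure {p | Degenerate (S.q n) (store p.2)} ≤
      b * (20 * hashZero S n) := by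
    refine toOuterMeasure_bind_le_const fun x => toOuterMeasure_bind_le_const fun k => ?_
    rw [PMF.toOuterMeasure_map_apply]
    exact simRun_degenerate_le pr m c y b κ _ k
  refine le_trans ((MeasureTheory.measure_mono fun p hp => ?_).trans
    (MeasureTheory.measure_union_le _ _)) (add_le_add le_rfl h)
  by_cases hd : Degenerate (S.q n) (store p.2)
  · exact .inr hd
  · exact .inl ⟨hp, hd⟩

/-- Exponents are drawn from `{1, …, q - 1}`; compared with `{0, …, q - 1}`, this at most doubles
probabilities. -/
theorem exponent_tsum_le (hq : 3 ≤ S.q n) (φ : ℕ → ENNReal) : ∑' x, S.exponent n x * φ x ≤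
    2 * ((S.q n : ENNReal)⁻¹ * ∑ x ∈ Finset.range (S.q n), φ x) := by
  have h1 : ∑' x, S.exponent n x * φ x = ∑' i, uniformUpTo (S.q n - 2) i * φ (i + 1) := by
    simp only [Params.exponent, PMF.map_apply, ← ENNReal.tsum_mul_right]
    rw [ENNReal.tsum_comm]
    refine tsum_congr fun i => ?_
    rw [tsum_eq_single (i + 1) fun x hx => by simp [hx]]
    simp
  obtain ⟨r, hr⟩ : ∃ r, S.q n = r + 2 := ⟨S.q n - 2, by omega⟩
  rw [h1, uniformUpTo_tsum, hr, Nat.add_sub_cancel, Finset.sum_range_succ' _ (r + 1), ← mul_assoc]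
  refine mul_le_mul' ?_ le_self_add
  have h2 : ((r + 2 : ℕ) : ENNReal) * ((r + 2 : ℕ) : ENNReal)⁻¹ = 1 :=
    ENNReal.mul_inv_cancel (by simp) (by simp)
  have h3 : (r + 1 : ENNReal)⁻¹ * (r + 1) = 1 := ENNReal.inv_mul_cancel (by simp) (by simp)
  calc (r + 1 : ENNReal)⁻¹ = (r + 1 : ENNReal)⁻¹ * (((r + 2 : ℕ) : ENNReal) *
        ((r + 2 : ℕ) : ENNReal)⁻¹) := by rw [h2, mul_one]
    _ ≤ (r + 1 : ENNReal)⁻¹ * ((2 * (r + 1)) * ((r + 2 : ℕ) : ENNReal)⁻¹) := by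
        gcongr
        exact_mod_cast (by omega : r + 2 ≤ 2 * (r + 1))
    _ = ((r + 1 : ENNReal)⁻¹ * (r + 1)) * (2 * ((r + 2 : ℕ) : ENNReal)⁻¹) := by ring
    _ = _ := by rw [h3, one_mul]

/-- The total probability of the critical queries, in terms of the success of the solver. -/
theorem sum_simGame_le {pr : Protocol} {m T M : ℕ → ℕ} {c : Code} {l : ℕ} (hq : 3 ≤ S.q n)
    (hU : ∀ U, (S.elem n U).size ≤ l) (hkey : S.keyLen n + 1 ≤ l)
    (hM : 2 * l + T n + 6 + T n * (20 * (m n + 2) + 10) ≤ M n) :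
    ∑ κ ∈ Finset.range (T n), (S.simGame n pr (m n) c (S.pub n) (T n) κ).toOuterMeasure
        (S.BadEvent n pr) ≤
      T n * (T n * (20 * hashZero S n)) + ((T n + 1) * (M n + 1) * 2) *
        ((S.q n : ENNReal)⁻¹ * ∑ U, squareProb S n (squareSolver S pr m T M c n) U) := by
  have hT : (T n + 1 : ENNReal) * (T n + 1 : ENNReal)⁻¹ = 1 :=
    ENNReal.mul_inv_cancel (by simp) (by simp)
  have hM' : (M n + 1 : ENNReal) * (M n + 1 : ENNReal)⁻¹ = 1 :=
    ENNReal.mul_inv_cancel (by simp) (by simp)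
  refine (Finset.sum_le_sum fun κ _ => simGame_badEvent_le pr (m n) c (S.pub n) (T n) κ).trans ?_
  rw [Finset.sum_add_distrib, Finset.sum_const, Finset.card_range, nsmul_eq_mul, add_comm]
  gcongr
  simp only [Params.simGame]
  simp only [PMF.toOuterMeasure_bind_apply (S.exponent n)]
  rw [← Summable.tsum_finsetSum fun _ _ => ENNReal.summable]
  simp only [← Finset.mul_sum]
  calc _ ≤ ∑' x, S.exponent n x * ((T n + 1) * (M n + 1) *
        squareProb S n (squareSolver S pr m T M c n) (S.g n ^ x)) := by
        refine ENNReal.tsum_le_tsum fun x => mul_le_mul' le_rfl ?_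
        refine le_trans (le_of_eq ?_) (mul_le_mul' le_rfl
          (le_squareSolver (pr := pr) (c := c) (x := x) hq hU hkey hM))
        rw [mul_mul_mul_comm, hT, one_mul, ← mul_assoc, hM', one_mul]
    _ = (T n + 1) * (M n + 1) * ∑' x, S.exponent n x *
        squareProb S n (squareSolver S pr m T M c n) (S.g n ^ x) := by
        rw [← ENNReal.tsum_mul_left]
        exact tsum_congr fun x => mul_left_comm _ _ _
    _ ≤ _ := by
        rw [mul_assoc ((T n + 1 : ENNReal) * (M n + 1)), ← sum_range_order]
        exact mul_le_mul' le_rfl (exponent_tsum_le hq _)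

theorem negligible_advantage (hS : S.Efficient) (hCDH : S.CDH) (pr : Protocol) (A : PPT) :
    Negligible fun n => |prob (S.guess n pr A) {true} - 1 / 2| := by
  obtain ⟨L, hL⟩ := hS.exists_bound
  let T := A.time
  -- `m` satisfies `Plan.Wide.limit`; each query enlarges the simulator's state by at most
  -- `20 * (m + 2) + 10`, so `M` bounds the size of the final store
  let m : Polynomial ℕ := 10 * (T + L) + 50
  let M : Polynomial ℕ := 2 * L + T + 6 + T * (20 * (m + 2) + 10)
  have hw : ∀ n, WideBound S n (T.eval n) (m.eval n) := fun n =>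
    ⟨L.eval n, fun _ _ _ _ _ => ⟨(hL n).1, (hL n).2.1, (hL n).2.2.1, (hL n).2.2.2.2, by simp [m]⟩⟩
  have hsq := hCDH.negligible_squareProb hS (Eff.squareSolver hS pr m T M A.code)
  have hsum := Asymptotics.SuperpolynomialDecay.add
    (Asymptotics.SuperpolynomialDecay.add
      ((negligible_inv_order hS hCDH).poly_mul (T * (T * 20)))
      (Negligible.two_pow_inv.poly_mul (T * (T * 20))))
    (hsq.poly_mul ((T + 1) * (M + 1) * 2))
  refine Negligible.of_le hsum ?_
  filter_upwards [eventually_three_le_order hS hCDH] with n hq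
  rw [abs_abs]
  refine (advantage_le pr A (hw n)).trans ?_
  have hfin : ∀ {α : Type} (μ : PMF α) (B : Set α), μ.toOuterMeasure B ≠ ⊤ := fun μ B =>
    ((toOuterMeasure_le_one _ _).trans_lt ENNReal.one_lt_top).ne
  have hq0 : (S.q n : ENNReal) ≠ 0 := by exact_mod_cast (S.q_pos n).ne'
  have h1 := sum_simGame_le (m := (m.eval ·)) (T := (T.eval ·)) (M := (M.eval ·)) (pr := pr)
    (c := A.code) hq (hL n).1 (hL n).2.2.1 (by simp [M])
  set F := (S.q n : ENNReal)⁻¹ *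
    ∑ U, squareProb S n (squareSolver S pr (m.eval ·) (T.eval ·) (M.eval ·) A.code n) U with hF
  have hF' : F ≠ ⊤ := ENNReal.mul_ne_top (by simp [hq0]) (ENNReal.sum_ne_top.2 fun _ _ =>
    PMF.apply_ne_top _ _)
  have h2 : ∑ κ ∈ Finset.range (T.eval n), (S.simGame n pr (m.eval n) A.code (S.pub n)
      (T.eval n) κ).toOuterMeasure (S.BadEvent n pr) ≤
      ((T * (T * 20)).eval n : ℕ) * (S.q n : ENNReal)⁻¹ +
      ((T * (T * 20)).eval n : ℕ) * (2 ^ n)⁻¹ +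
        (((T + 1) * (M + 1) * 2).eval n : ℕ) * F := by
    refine h1.trans (add_le_add ?_ (le_of_eq ?_))
    · calc ((T.eval n : ℕ) : ENNReal) * ((T.eval n : ℕ) * (20 * hashZero S n))
          ≤ (T.eval n : ℕ) * ((T.eval n : ℕ) * (20 * ((S.q n : ENNReal)⁻¹ + (2 ^ n)⁻¹))) := by
            gcongr
            exact hashZero_le S n
        _ = _ := by
            simp only [Polynomial.eval_mul, Polynomial.eval_ofNat]
            push_cast
            ring
    · simp only [Polynomial.eval_mul, Polynomial.eval_add, Polynomial.eval_one,
        Polynomial.eval_ofNat]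
      push_cast
      rfl
  have hi1 : (S.q n : ENNReal)⁻¹ ≠ ⊤ := by simp [hq0]
  have hi2 : ((2 : ENNReal) ^ n)⁻¹ ≠ ⊤ := by simp
  have hn : ∀ (k : ℕ) {a : ENNReal}, a ≠ ⊤ → k * a ≠ ⊤ := fun k a ha =>
    ENNReal.mul_ne_top (by simp) ha
  have h3 := ENNReal.toReal_mono (ENNReal.add_ne_top.2 ⟨ENNReal.add_ne_top.2
    ⟨hn _ hi1, hn _ hi2⟩, hn _ hF'⟩) h2
  rw [ENNReal.toReal_sum fun _ _ => hfin _ _, ENNReal.toReal_add (ENNReal.add_ne_top.2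
    ⟨hn _ hi1, hn _ hi2⟩) (hn _ hF'), ENNReal.toReal_add (hn _ hi1) (hn _ hi2)] at h3
  simp only [ENNReal.toReal_mul, ENNReal.toReal_natCast, ENNReal.toReal_inv, ENNReal.toReal_pow,
    ENNReal.toReal_ofNat] at h3
  exact h3

theorem skSecure (hS : S.Efficient) (hCDH : S.CDH) (pr : Protocol) : S.SKSecure pr := fun A =>
  ⟨Negligible.of_le (negligible_inv_order hS hCDH) (Eventually.of_forall fun n => by
    rw [prob_mismatch, abs_zero]
    positivity), negligible_advantage hS hCDH pr A⟩

end OAKE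

end

theorem mainTheorem5 (S : OAKE.Params) (hS : S.Efficient) (hCDH : S.CDH) :
    S.SKSecure OAKE.Protocol.oake ∧ S.SKSecure OAKE.Protocol.soake :=
  ⟨OAKE.skSecure hS hCDH .oake, OAKE.skSecure hS hCDH .soake⟩
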